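/- Fix a field $\mathbb{K}$ of characteristic $0$, a finite set $X$ and an integer $m\ge 0$. All spaces below are $\mathbb{K}$-linear, spanned by finite diagrams with oriented trivalent vertices, graded by half the number of vertices, and completed with respect to this grading. * $\mathcal{A}(\uparrow_X)$ is spanned by diagrams consisting of upward strands labelled by $X$ and a uni-trivalent graph whose univalent ends (legs) lie at distinct points of the strands (these points count as vertices), modulo the $AS$, $IHX$ and $STU$ relations. * $\mathcal{B}(X)$ is spanned by uni-trivalent graphs whose legs are marked by elements of $X$, modulo $AS$ and $IHX$. The map $\chi:\mathcal{B}(X)\to\mathcal{A}(\uparrow_X)$ sends a diagram to the average of all ways of placing, for every $x\in X$, its $x$-marked legs on the strand $x$. It is an isomorphism (formal PBW theorem), and $\sigma:\mathcal{A}(\uparrow_X)\to\mathcal{B}(X)$ denotes its inverse. * $\mathcal{A}^\circ(\emptyset)$ is spanned by trivalent graphs that may have closed circles (without vertices) as components, modulo $AS$ and $IHX$. The relation $O_m$ says that adding a disjoint closed circle equals multiplication by $-2m$. The relation $P_{m+1}$ says that for any diagram with $2m+2$ free stubs the sum over all $(2m+1)!!$ ways of joining the stubs in pairs is $0$. * $\int^{(m)}:\mathcal{B}(X)\to\mathcal{A}^\circ(\emptyset)/(O_m,P_{m+1})$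 (negative-dimensional formal integration) sends a diagram with exactly $2m$ legs of every mark $x\in X$ to the sum over all ways of joining its legs in pairs of equal marks, and every other diagram to $0$. * The Le–Murakami–Ohtsuki map $j_m:\mathcal{A}(\uparrow_X)\to\mathcal{A}^\circ(\emptyset)$ removes every strand and glues its legs, in their order along the strand, to the legs of $T^m_n$, where $n$ is the number of legs on that strand. Here $T_0=T_1=0$, and for $s\ge 2$ $$T_s=\sum_{\tau\in S_{s-2}}\frac{(-1)^{r(\tau)}}{(s-1)\binom{s-2}{r(\tau)}}\,T_\tau ,$$ where $r(\tau)$ is the number of descents of $\tau$ and $T_\tau$ is the comb-shaped tree with first leg $1$, last leg $s$, and the legs $2,\dots,s-1$ attached in between in the order prescribed by $\tau$. $T^m_n$ is the sum, over all partitions of the $n$ ordered legs into $m$ unordered blocks, of the disjoint union of the elements $T_s$ put on the blocks ($s$ being the size of the block). A joint orientation convention at the vertices of combs and in the $STU$ relation is used. Then $j_m$ is well defined, it lowers degrees by $m|X|$ (vanishing in degrees below $m|X|$), and $$\textstyle\int^{(m)}\circ\,\sigma \;=\; j_m \bmod (O_m,P_{m+1})$$ as maps $\mathcal{A}(\uparrow_X)\to\mathcal{A}^\circ(\emptyset)/(O_m,P_{m+1})$.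 -/

import Mathlib

namespace Jacobi

noncomputable section

/-- The ends of edges available in a uni-trivalent graph with trivalent vertices `V` and univalent
ends `E`: three half-edges at every vertex, and one half-edge at every univalent end. -/
abbrev Flag (V E : Type) : Type := V × Fin 3 ⊕ E

/-- A uni-trivalent graph whose univalent ends are the elements of `E`.  The half-edges at a
trivalent vertex `v` are `(v, 0)`, `(v, 1)`, `(v, 2)`; the vertex is oriented by this cyclic order.
The edges are the two-element orbits of a fixed-point-free involution on the half-edges. -/
structure Graph (E : Type) where
  V : Type
  [fintypeV : Fintype V]
  edge : Flag V E → Flag V E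
  edge_edge : ∀ a, edge (edge a) = a
  edge_ne : ∀ a, edge a ≠ a

attribute [instance] Graph.fintypeV

namespace Graph

variable {E E' : Type}

/-- Reattach the half-edges: what was attached to the half-edge `a` gets attached to `ρ a`. -/
def conj (G : Graph E) (ρ : Equiv.Perm (Flag G.V E)) : Graph E where
  V := G.V
  edge a := ρ (G.edge (ρ.symm a))
  edge_edge a := by simp [G.edge_edge]
  edge_ne a h := G.edge_ne (ρ.symm a) (by rw [Equiv.eq_symm_apply]; exact h)

/-- Rename the univalent ends along a bijection. -/
def relabel (f : E ≃ E') (G : Graph E) : Graph E' where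
  V := G.V
  edge a := Sum.map id f (G.edge (Sum.map id f.symm a))
  edge_edge a := by
    have h : ∀ b : Flag G.V E, Sum.map id f.symm (Sum.map id f b) = b := by
      rintro (b | b) <;> simp
    have h' : ∀ b : Flag G.V E', Sum.map id f (Sum.map id f.symm b) = b := by
      rintro (b | b) <;> simp
    rw [h, G.edge_edge, h']
  edge_ne a h := by
    have h1 : ∀ b : Flag G.V E, Sum.map id f.symm (Sum.map id f b) = b := by
      rintro (b | b) <;> simp
    apply G.edge_ne (Sum.map id f.symm a)
    have h2 := congrArg (Sum.map id f.symm) h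
    rwa [h1] at h2

/-- The inclusion of the half-edges of one summand into those of a disjoint union. -/
def sigmaFlag {ι : Type} {F : ι → Type} (G : ∀ i, Graph (F i)) (i : ι) :
    Flag (G i).V (F i) → Flag (Σ j, (G j).V) (Σ j, F j)
  | Sum.inl (v, k) => Sum.inl (⟨i, v⟩, k)
  | Sum.inr e => Sum.inr ⟨i, e⟩

lemma sigmaFlag_injective {ι : Type} {F : ι → Type} (G : ∀ i, Graph (F i)) (i : ι) :
    Function.Injective (sigmaFlag G i) := by
  rintro (⟨v, k⟩ | e) (⟨v', k'⟩ | e') h <;> simp_all [sigmaFlag]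

/-- The disjoint union of a finite family of graphs. -/
def sigma {ι : Type} [Fintype ι] {F : ι → Type} (G : ∀ i, Graph (F i)) : Graph (Σ i, F i) where
  V := Σ i, (G i).V
  edge
    | Sum.inl (⟨i, v⟩, k) => sigmaFlag G i ((G i).edge (Sum.inl (v, k)))
    | Sum.inr ⟨i, e⟩ => sigmaFlag G i ((G i).edge (Sum.inr e))
  edge_edge a := by
    have key : ∀ (i : ι) (b : Flag (G i).V (F i)),
        (match sigmaFlag G i b with
          | Sum.inl (⟨i, v⟩, k) => sigmaFlag G i ((G i).edge (Sum.inl (v, k)))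
          | Sum.inr ⟨i, e⟩ => sigmaFlag G i ((G i).edge (Sum.inr e)) :
            Flag (Σ j, (G j).V) (Σ j, F j)) = sigmaFlag G i ((G i).edge b) := by
      rintro i (⟨v, k⟩ | e) <;> rfl
    rcases a with ⟨⟨i, v⟩, k⟩ | ⟨i, e⟩
    · exact (key i _).trans (by rw [(G i).edge_edge]; rfl)
    · exact (key i _).trans (by rw [(G i).edge_edge]; rfl)
  edge_ne a := by
    rcases a with ⟨⟨i, v⟩, k⟩ | ⟨i, e⟩
    · intro h
      exact (G i).edge_ne (Sum.inl (v, k)) (sigmaFlag_injective G i h)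
    · intro h
      exact (G i).edge_ne (Sum.inr e) (sigmaFlag_injective G i h)

/-- The inclusion of the half-edges of the first summand into those of a disjoint union. -/
def leftFlag {V W F F' : Type} : Flag V F → Flag (V ⊕ W) (F ⊕ F') :=
  Sum.map (Prod.map Sum.inl id) Sum.inl

/-- The inclusion of the half-edges of the second summand into those of a disjoint union. -/
def rightFlag {V W F F' : Type} : Flag W F' → Flag (V ⊕ W) (F ⊕ F') :=
  Sum.map (Prod.map Sum.inr id) Sum.inr

lemma leftFlag_injective {V W F F' : Type} :
    Function.Injective (leftFlag : Flag V F → Flag (V ⊕ W) (F ⊕ F')) :=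
  (Sum.inl_injective.prodMap Function.injective_id).sumMap Sum.inl_injective

lemma rightFlag_injective {V W F F' : Type} :
    Function.Injective (rightFlag : Flag W F' → Flag (V ⊕ W) (F ⊕ F')) :=
  (Sum.inr_injective.prodMap Function.injective_id).sumMap Sum.inr_injective

/-- The edges of the disjoint union of two graphs. -/
def unionEdge (G : Graph E) (H : Graph E') :
    Flag (G.V ⊕ H.V) (E ⊕ E') → Flag (G.V ⊕ H.V) (E ⊕ E')
  | Sum.inl (Sum.inl v, k) => leftFlag (G.edge (Sum.inl (v, k)))
  | Sum.inl (Sum.inr v, k) => rightFlag (H.edge (Sum.inl (v, k)))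
  | Sum.inr (Sum.inl e) => leftFlag (G.edge (Sum.inr e))
  | Sum.inr (Sum.inr e) => rightFlag (H.edge (Sum.inr e))

lemma unionEdge_left (G : Graph E) (H : Graph E') (a : Flag G.V E) :
    unionEdge G H (leftFlag a) = leftFlag (G.edge a) := by
  rcases a with ⟨v, k⟩ | e <;> rfl

lemma unionEdge_right (G : Graph E) (H : Graph E') (a : Flag H.V E') :
    unionEdge G H (rightFlag a) = rightFlag (H.edge a) := by
  rcases a with ⟨v, k⟩ | e <;> rfl

lemma union_cases {V W F F' : Type} (b : Flag (V ⊕ W) (F ⊕ F')) :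
    (∃ a, b = leftFlag a) ∨ ∃ a, b = rightFlag a := by
  rcases b with ⟨v | v, k⟩ | e | e
  · exact Or.inl ⟨Sum.inl (v, k), rfl⟩
  · exact Or.inr ⟨Sum.inl (v, k), rfl⟩
  · exact Or.inl ⟨Sum.inr e, rfl⟩
  · exact Or.inr ⟨Sum.inr e, rfl⟩

/-- The disjoint union of two graphs. -/
def union (G : Graph E) (H : Graph E') : Graph (E ⊕ E') where
  V := G.V ⊕ H.V
  edge := unionEdge G H
  edge_edge b := by
    rcases union_cases b with ⟨a, rfl⟩ | ⟨a, rfl⟩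
    · rw [unionEdge_left, unionEdge_left, G.edge_edge]
    · rw [unionEdge_right, unionEdge_right, H.edge_edge]
  edge_ne b := by
    rcases union_cases b with ⟨a, rfl⟩ | ⟨a, rfl⟩
    · rw [unionEdge_left]; exact fun h => G.edge_ne a (leftFlag_injective h)
    · rw [unionEdge_right]; exact fun h => H.edge_ne a (rightFlag_injective h)

/-- An identification of two graphs, which may permute the half-edges at every vertex. -/
structure Iso (G : Graph E) (G' : Graph E') where
  ext : E ≃ E'
  vtx : G.V ≃ G'.V
  rot : G.V → Equiv.Perm (Fin 3)
  edge_comm : ∀ a : Flag G.V E,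
    G'.edge (Sum.map (fun w => (vtx w.1, rot w.1 w.2)) ext a) =
      Sum.map (fun w => (vtx w.1, rot w.1 w.2)) ext (G.edge a)

/-- The product of the signs with which the cyclic orders at the vertices are changed. -/
def Iso.sign {G : Graph E} {G' : Graph E'} (φ : Iso G G') : ℤ :=
  ∏ v, ((Equiv.Perm.sign (φ.rot v) : ℤˣ) : ℤ)

open scoped Classical in
/-- The `3`-cycle `(u, 0) → (u, 1) → (v, 1) → (u, 0)` of half-edges. -/
def ihxPerm {V : Type} (E : Type) (u v : V) : Equiv.Perm (Flag V E) :=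
  Equiv.swap (Sum.inl (u, 0)) (Sum.inl (u, 1)) * Equiv.swap (Sum.inl (u, 1)) (Sum.inl (v, 1))

/-- The situation of the `IHX` relation: an edge from the half-edge `(u, 2)` to the half-edge
`(v, 0)` of another vertex.  Reading `(a, b, c)` at a vertex as `⟨[a, b], c⟩`, this part of the
graph is `[[a, b], c]`, with `a, b, c` attached to `(u, 0)`, `(u, 1)`, `(v, 1)`; the other two
terms of the relation arise by cyclic permutation of `a, b, c`. -/
def IsIHX (G : Graph E) (u v : G.V) : Prop :=
  u ≠ v ∧ G.edge (Sum.inl (u, 2)) = Sum.inl (v, 0)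

end Graph

/-! ### The space of marked uni-trivalent diagrams -/

/-- An `X`-marked uni-trivalent diagram. -/
structure BDiag (X : Type) where
  L : Type
  [fintypeL : Fintype L]
  color : L → X
  G : Graph L

attribute [instance] BDiag.fintypeL

/-- The `AS` relations (together with the identification of isomorphic diagrams) and the `IHX`
relations between `X`-marked uni-trivalent diagrams. -/
inductive BRel (𝕜 : Type*) [Field 𝕜] (X : Type) : (BDiag X →₀ 𝕜) → Prop
  | iso (D D' : BDiag X) (φ : Graph.Iso D.G D'.G) (hc : ∀ l, D'.color (φ.ext l) = D.color l) :
      BRel 𝕜 X (Finsupp.single D 1 - Finsupp.single D' (φ.sign : 𝕜))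
  | ihx (D : BDiag X) (u v : D.G.V) (h : D.G.IsIHX u v) :
      BRel 𝕜 X (Finsupp.single D 1
        + Finsupp.single { D with G := D.G.conj (Graph.ihxPerm D.L u v) } 1
        + Finsupp.single { D with G := D.G.conj (Graph.ihxPerm D.L u v ^ 2) } 1)

/-- The (not yet completed) space `𝓑(X)`. -/
abbrev BSpace (𝕜 : Type*) [Field 𝕜] (X : Type) : Type _ :=
  (BDiag X →₀ 𝕜) ⧸ Submodule.span 𝕜 {z | BRel 𝕜 X z}

/-- The class of a diagram in `𝓑(X)`. -/
def BSpace.mk (𝕜 : Type*) [Field 𝕜] {X : Type} (D : BDiag X) : BSpace 𝕜 X :=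
  Submodule.Quotient.mk (Finsupp.single D 1)

/-- The part of degree `d`, where the degree is half the number of vertices (of both kinds). -/
def BDeg (𝕜 : Type*) [Field 𝕜] (X : Type) (d : ℕ) : Submodule 𝕜 (BSpace 𝕜 X) :=
  Submodule.span 𝕜 {z | ∃ D : BDiag X,
    Fintype.card D.G.V + Fintype.card D.L = 2 * d ∧ BSpace.mk 𝕜 D = z}

/-- The completed graded space `𝓑(X)`. -/
abbrev BHat (𝕜 : Type*) [Field 𝕜] (X : Type) : Type _ := ∀ d : ℕ, BDeg 𝕜 X d

/-! ### The space of diagrams on `X`-labelled strands -/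

/-- A diagram on upward strands labelled by `X`: the leg `l` sits on the strand `color l` at the
height `pos l`.  Only the relative heights of legs on the same strand will matter. -/
structure ADiag (X : Type) where
  L : Type
  [fintypeL : Fintype L]
  color : L → X
  pos : L → ℕ
  pos_inj : Function.Injective pos
  G : Graph L

attribute [instance] ADiag.fintypeL

namespace ADiag

variable {X : Type}

/-- `p` and `q` are consecutive legs (in this order) of the same strand. -/
def Consecutive (T : ADiag X) (p q : T.L) : Prop :=
  T.color p = T.color q ∧ T.pos p < T.pos q ∧
    ∀ r, T.color r = T.color p → ¬ (T.pos p < T.pos r ∧ T.pos r < T.pos q)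

open scoped Classical in
/-- Where a half-edge goes when the legs `p` and `q` are joined into a new vertex `none`. -/
def stuFlag {V L : Type} (p q : L) : Flag V L → Flag (Option V) {l : L // l ≠ q}
  | Sum.inl (v, k) => Sum.inl (some v, k)
  | Sum.inr l =>
    if l = p then Sum.inl (none, 0)
    else if hq : l = q then Sum.inl (none, 1)
    else Sum.inr ⟨l, hq⟩

lemma stuFlag_injective {V L : Type} (p q : L) :
    Function.Injective (stuFlag (V := V) p q) := by
  rintro (⟨v, k⟩ | l) (⟨v', k'⟩ | l') h <;> simp only [stuFlag] at h <;> grind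

open scoped Classical in
/-- The edges of the graph in which `p` and `q` are replaced by a single leg, kept at `p`, ending
in a new vertex: its half-edges `0`, `1`, `2` lead to where `p` led, to where `q` led, and to the
new leg. -/
def stuEdge {L : Type} (G : Graph L) (p q : L) (hpq : p ≠ q) :
    Flag (Option G.V) {l : L // l ≠ q} → Flag (Option G.V) {l : L // l ≠ q}
  | Sum.inl (some v, k) => stuFlag p q (G.edge (Sum.inl (v, k)))
  | Sum.inl (none, k) =>
    if k = 0 then stuFlag p q (G.edge (Sum.inr p))
    else if k = 1 then stuFlag p q (G.edge (Sum.inr q))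
    else Sum.inr ⟨p, hpq⟩
  | Sum.inr l =>
    if l.1 = p then Sum.inl (none, 2) else stuFlag p q (G.edge (Sum.inr l.1))

lemma stuEdge_stuFlag {L : Type} (G : Graph L) (p q : L) (hpq : p ≠ q) (a : Flag G.V L) :
    stuEdge G p q hpq (stuFlag p q a) = stuFlag p q (G.edge a) := by
  rcases a with ⟨v, k⟩ | l
  · rfl
  · by_cases hp : l = p
    · subst hp; simp [stuFlag, stuEdge]
    · by_cases hq : l = q
      · subst hq; simp [stuFlag, stuEdge, hp]
      · simp [stuFlag, stuEdge, hp, hq]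

lemma stu_cases {V L : Type} (p q : L) (hpq : p ≠ q) (b : Flag (Option V) {l : L // l ≠ q}) :
    (∃ a, b = stuFlag p q a) ∨ b = Sum.inl (none, 2) ∨ b = Sum.inr ⟨p, hpq⟩ := by
  rcases b with ⟨_ | v, k⟩ | ⟨l, hl⟩
  · fin_cases k
    · exact Or.inl ⟨Sum.inr p, by simp [stuFlag]⟩
    · exact Or.inl ⟨Sum.inr q, by simp [stuFlag, hpq.symm]⟩
    · exact Or.inr (Or.inl rfl)
  · exact Or.inl ⟨Sum.inl (v, k), rfl⟩
  · by_cases hp : l = p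
    · subst hp; exact Or.inr (Or.inr rfl)
    · exact Or.inl ⟨Sum.inr l, by simp [stuFlag, hp, hl]⟩

open scoped Classical in
/-- The diagram `S` of the `STU` relation made from the diagram `T`: the legs `p`, `q` of `T` are
joined in a new vertex, which is connected to the strand by one leg. -/
def stu (T : ADiag X) (p q : T.L) (hpq : p ≠ q) : ADiag X where
  L := {l : T.L // l ≠ q}
  color l := T.color l.1
  pos l := T.pos l.1
  pos_inj := fun _ _ h => Subtype.ext (T.pos_inj h)
  G :=
    { V := Option T.G.V
      edge := stuEdge T.G p q hpq
      edge_edge := fun b => by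
        rcases stu_cases p q hpq b with ⟨a, rfl⟩ | rfl | rfl
        · rw [stuEdge_stuFlag, stuEdge_stuFlag, T.G.edge_edge]
        · simp [stuEdge]
        · simp [stuEdge]
      edge_ne := fun b => by
        rcases stu_cases p q hpq b with ⟨a, rfl⟩ | rfl | rfl
        · rw [stuEdge_stuFlag]
          exact fun h => T.G.edge_ne a (stuFlag_injective p q h)
        · simp [stuEdge]
        · simp [stuEdge] }

end ADiag

open scoped Classical in
/-- The `AS` (with the identification of isomorphic diagrams), `IHX` and `STU` relations between
diagrams on strands. -/
inductive ARel (𝕜 : Type*) [Field 𝕜] (X : Type) : (ADiag X →₀ 𝕜) → Prop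
  | iso (D D' : ADiag X) (φ : Graph.Iso D.G D'.G) (hc : ∀ l, D'.color (φ.ext l) = D.color l)
      (hp : ∀ l l', D.color l = D.color l' →
        (D'.pos (φ.ext l) < D'.pos (φ.ext l') ↔ D.pos l < D.pos l')) :
      ARel 𝕜 X (Finsupp.single D 1 - Finsupp.single D' (φ.sign : 𝕜))
  | ihx (D : ADiag X) (u v : D.G.V) (h : D.G.IsIHX u v) :
      ARel 𝕜 X (Finsupp.single D 1
        + Finsupp.single { D with G := D.G.conj (Graph.ihxPerm D.L u v) } 1
        + Finsupp.single { D with G := D.G.conj (Graph.ihxPerm D.L u v ^ 2) } 1)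
  | stu (T : ADiag X) (p q : T.L) (hpq : p ≠ q) (h : T.Consecutive p q) :
      ARel 𝕜 X (Finsupp.single (T.stu p q hpq) 1 - (Finsupp.single T 1
        - Finsupp.single { T with G := T.G.conj (Equiv.swap (Sum.inr p) (Sum.inr q)) } 1))

/-- The (not yet completed) space `𝓐(↑_X)`. -/
abbrev ASpace (𝕜 : Type*) [Field 𝕜] (X : Type) : Type _ :=
  (ADiag X →₀ 𝕜) ⧸ Submodule.span 𝕜 {z | ARel 𝕜 X z}

/-- The class of a diagram in `𝓐(↑_X)`. -/
def ASpace.mk (𝕜 : Type*) [Field 𝕜] {X : Type} (D : ADiag X) : ASpace 𝕜 X :=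
  Submodule.Quotient.mk (Finsupp.single D 1)

/-- The part of degree `d`, where the degree is half the number of vertices, including the
vertices on the strands. -/
def ADeg (𝕜 : Type*) [Field 𝕜] (X : Type) (d : ℕ) : Submodule 𝕜 (ASpace 𝕜 X) :=
  Submodule.span 𝕜 {z | ∃ D : ADiag X,
    Fintype.card D.G.V + Fintype.card D.L = 2 * d ∧ ASpace.mk 𝕜 D = z}

/-- The completed graded space `𝓐(↑_X)`. -/
abbrev AHat (𝕜 : Type*) [Field 𝕜] (X : Type) : Type _ := ∀ d : ℕ, ADeg 𝕜 X d

/-! ### The map `σ` -/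

/-- The diagram on strands with the legs placed in the order given by a numbering of all legs. -/
def BDiag.place {X : Type} (D : BDiag X) {n : ℕ} (e : D.L ≃ Fin n) : ADiag X where
  L := D.L
  color := D.color
  pos l := (e l : ℕ)
  pos_inj := fun _ _ h => e.injective (Fin.ext h)
  G := D.G

open scoped Classical in
/-- The average of all ways of placing the legs of a uni-trivalent diagram on the strands.  The
average is taken over all numberings of the set of all legs; each placement on the strands arises
from equally many of them. -/
def chiDiag (𝕜 : Type*) [Field 𝕜] {X : Type} (D : BDiag X) : ASpace 𝕜 X :=
  ((Fintype.card D.L).factorial : 𝕜)⁻¹ • ∑ e : D.L ≃ Fin (Fintype.card D.L),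
    ASpace.mk 𝕜 (D.place e)

lemma ASpace.mk_iso (𝕜 : Type*) [Field 𝕜] {X : Type} (D D' : ADiag X) (φ : Graph.Iso D.G D'.G)
    (hc : ∀ l, D'.color (φ.ext l) = D.color l)
    (hp : ∀ l l', D.color l = D.color l' →
        (D'.pos (φ.ext l) < D'.pos (φ.ext l') ↔ D.pos l < D.pos l')) :
    ASpace.mk 𝕜 D = (φ.sign : 𝕜) • ASpace.mk 𝕜 D' := by
  have h := (Submodule.Quotient.mk_eq_zero (Submodule.span 𝕜 {z | ARel 𝕜 X z})).2
    (Submodule.subset_span (ARel.iso (𝕜 := 𝕜) D D' φ hc hp))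
  rw [Submodule.Quotient.mk_sub, sub_eq_zero] at h
  rw [ASpace.mk, ASpace.mk, h, ← Submodule.Quotient.mk_smul, Finsupp.smul_single]
  simp

lemma ASpace.mk_ihx (𝕜 : Type*) [Field 𝕜] {X : Type} (D : ADiag X) (u v : D.G.V)
    (h : D.G.IsIHX u v) :
    ASpace.mk 𝕜 D + ASpace.mk 𝕜 { D with G := D.G.conj (Graph.ihxPerm D.L u v) }
      + ASpace.mk 𝕜 { D with G := D.G.conj (Graph.ihxPerm D.L u v ^ 2) } = 0 :=
  (Submodule.Quotient.mk_eq_zero (Submodule.span 𝕜 {z | ARel 𝕜 X z})).2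
    (Submodule.subset_span (ARel.ihx (𝕜 := 𝕜) D u v h))

lemma chiDiag_rel (𝕜 : Type*) [Field 𝕜] (X : Type) (z : BDiag X →₀ 𝕜) (hz : BRel 𝕜 X z) :
    Finsupp.linearCombination 𝕜 (chiDiag 𝕜) z = 0 := by
  classical
  cases hz with
  | iso D D' φ hc =>
    rw [map_sub, Finsupp.linearCombination_single, Finsupp.linearCombination_single, one_smul,
      sub_eq_zero]
    have hcard : Fintype.card D.L = Fintype.card D'.L := Fintype.card_congr φ.ext
    have hfac : ((Fintype.card D'.L).factorial : 𝕜) = ((Fintype.card D.L).factorial : 𝕜) := by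
      rw [hcard]
    unfold chiDiag
    rw [smul_comm, hfac]
    congr 1
    rw [Finset.smul_sum]
    refine Fintype.sum_equiv (Equiv.equivCongr φ.ext (finCongr hcard)) _ _ fun e => ?_
    exact ASpace.mk_iso 𝕜 (D.place e) (D'.place (Equiv.equivCongr φ.ext (finCongr hcard) e)) φ hc
      (fun l l' _ => by
        change e (φ.ext.symm (φ.ext l)) < e (φ.ext.symm (φ.ext l')) ↔ e l < e l'
        exact iff_of_eq (congrArg₂ (fun a b => e a < e b) (φ.ext.symm_apply_apply l)
          (φ.ext.symm_apply_apply l')))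
  | ihx D u v h =>
    simp only [map_add, Finsupp.linearCombination_single, one_smul]
    unfold chiDiag
    dsimp only
    rw [← smul_add, ← smul_add, ← Finset.sum_add_distrib, ← Finset.sum_add_distrib]
    rw [Finset.sum_eq_zero, smul_zero]
    intro e _
    exact ASpace.mk_ihx 𝕜 (D.place e) u v h

/-- The symmetrization map `χ : 𝓑(X) → 𝓐(↑_X)`. -/
def chi (𝕜 : Type*) [Field 𝕜] (X : Type) : BSpace 𝕜 X →ₗ[𝕜] ASpace 𝕜 X :=
  Submodule.liftQ _ (Finsupp.linearCombination 𝕜 (chiDiag 𝕜))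
    (Submodule.span_le.2 (fun z hz => chiDiag_rel 𝕜 X z hz))

lemma chi_mk (𝕜 : Type*) [Field 𝕜] {X : Type} (D : BDiag X) :
    chi 𝕜 X (BSpace.mk 𝕜 D) = chiDiag 𝕜 D := by
  simp [chi, BSpace.mk]

lemma chi_deg (𝕜 : Type*) [Field 𝕜] (X : Type) (d : ℕ) :
    ∀ b ∈ BDeg 𝕜 X d, chi 𝕜 X b ∈ ADeg 𝕜 X d := by
  have : BDeg 𝕜 X d ≤ (ADeg 𝕜 X d).comap (chi 𝕜 X) := by
    refine Submodule.span_le.2 ?_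
    rintro _ ⟨D, hD, rfl⟩
    change chi 𝕜 X (BSpace.mk 𝕜 D) ∈ ADeg 𝕜 X d
    rw [chi_mk]
    exact Submodule.smul_mem _ _ (Submodule.sum_mem _ fun e _ =>
      Submodule.subset_span ⟨_, hD, rfl⟩)
  exact this

/-- The symmetrization map on the completed spaces. -/
def chiHat (𝕜 : Type*) [Field 𝕜] (X : Type) : BHat 𝕜 X →ₗ[𝕜] AHat 𝕜 X :=
  LinearMap.pi fun d => ((chi 𝕜 X).restrict (chi_deg 𝕜 X d)).comp (LinearMap.proj d)

/-- The formal PBW map `σ : 𝓐(↑_X) → 𝓑(X)`: the inverse of the symmetrization map, which is a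
bijection (in characteristic zero, for finite `X`). -/
def sigma (𝕜 : Type*) [Field 𝕜] (X : Type) : AHat 𝕜 X → BHat 𝕜 X :=
  Function.invFun (chiHat 𝕜 X)

/-! ### Closed diagrams -/

/-- A pairing of the elements of `L`. -/
abbrev Pairing (L : Type) : Type :=
  {p : L → L // (∀ l, p (p l) = l) ∧ ∀ l, p l ≠ l}

/-- A trivalent graph, possibly with closed circles.  It is presented by a uni-trivalent graph
together with a pairing of its univalent ends, each end being glued to its partner.  The points
where ends are glued are ordinary interior points of the edges, so they do not count as vertices;
a component without vertices is a closed circle. -/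
structure CDiag where
  J : Type
  [fintypeJ : Fintype J]
  glue : Pairing J
  G : Graph J

attribute [instance] CDiag.fintypeJ

/-- The disjoint union of two pairings. -/
def Pairing.sum {L L' : Type} (p : Pairing L) (p' : Pairing L') : Pairing (L ⊕ L') :=
  ⟨Sum.map p.1 p'.1, by
    constructor
    · rintro (l | l) <;> simp [p.2.1, p'.2.1]
    · rintro (l | l)
      · simpa using p.2.2 l
      · simpa using p'.2.2 l⟩

/-- The pairing of the two elements of `Bool`. -/
def Pairing.bool : Pairing Bool := ⟨Bool.not, by decide⟩

namespace CDiag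

open scoped Classical in
/-- The edges after the edge of the half-edge `a` has been cut into two pieces, whose new ends are
`false` (on the side of `a`) and `true`. -/
def cutEdge {J : Type} (G : Graph J) (a : Flag G.V J) :
    Flag G.V (J ⊕ Bool) → Flag G.V (J ⊕ Bool)
  | Sum.inl w => if Sum.inl w = a then Sum.inr (Sum.inr false)
      else if Sum.inl w = G.edge a then Sum.inr (Sum.inr true)
      else Sum.map id Sum.inl (G.edge (Sum.inl w))
  | Sum.inr (Sum.inl j) => if Sum.inr j = a then Sum.inr (Sum.inr false)
      else if Sum.inr j = G.edge a then Sum.inr (Sum.inr true)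
      else Sum.map id Sum.inl (G.edge (Sum.inr j))
  | Sum.inr (Sum.inr false) => Sum.map id Sum.inl a
  | Sum.inr (Sum.inr true) => Sum.map id Sum.inl (G.edge a)

lemma cutEdge_map {J : Type} (G : Graph J) (a c : Flag G.V J) [Decidable (c = a)]
    [Decidable (c = G.edge a)] :
    cutEdge G a (Sum.map id Sum.inl c) = if c = a then Sum.inr (Sum.inr false)
      else if c = G.edge a then Sum.inr (Sum.inr true)
      else Sum.map id Sum.inl (G.edge c) := by
  rcases c with w | j <;> simp only [cutEdge, Sum.map_inl, Sum.map_inr, id] <;> congr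

lemma map_inl_injective {V J : Type} :
    Function.Injective (Sum.map id Sum.inl : Flag V J → Flag V (J ⊕ Bool)) :=
  Function.injective_id.sumMap Sum.inl_injective

lemma cut_cases {V J : Type} (b : Flag V (J ⊕ Bool)) :
    (∃ c : Flag V J, b = Sum.map id Sum.inl c) ∨
      b = Sum.inr (Sum.inr false) ∨ b = Sum.inr (Sum.inr true) := by
  rcases b with w | j | (_ | _)
  · exact Or.inl ⟨Sum.inl w, rfl⟩
  · exact Or.inl ⟨Sum.inr j, rfl⟩
  · exact Or.inr (Or.inl rfl)
  · exact Or.inr (Or.inr rfl)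

/-- The same diagram with one more marked interior point on the edge of the half-edge `a`: this
edge is cut into two pieces, whose new ends are glued. -/
def subdivide (D : CDiag) (a : Flag D.G.V D.J) : CDiag where
  J := D.J ⊕ Bool
  glue := D.glue.sum Pairing.bool
  G :=
    { V := D.G.V
      edge := cutEdge D.G a
      edge_edge := fun b => by
        classical
        have hne := D.G.edge_ne a
        have hee := D.G.edge_edge
        rcases cut_cases b with ⟨c, rfl⟩ | rfl | rfl
        · rw [cutEdge_map]
          by_cases h1 : c = a
          · simp [h1, cutEdge]
          · by_cases h2 : c = D.G.edge a
            · simp [h2, hne, cutEdge]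
            · have h3 : D.G.edge c ≠ a := fun h => h2 (by rw [← h, hee])
              have h4 : D.G.edge c ≠ D.G.edge a := fun h => h1 (by rw [← hee c, h, hee])
              rw [if_neg h1, if_neg h2, cutEdge_map, if_neg h3, if_neg h4, hee]
        · change cutEdge D.G a (Sum.map id Sum.inl a) = _
          rw [cutEdge_map, if_pos rfl]
        · change cutEdge D.G a (Sum.map id Sum.inl (D.G.edge a)) = _
          rw [cutEdge_map, if_neg hne, if_pos rfl]
      edge_ne := fun b => by
        classical
        rcases cut_cases b with ⟨c, rfl⟩ | rfl | rfl
        · rw [cutEdge_map]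
          split_ifs
          · rcases c with c | c <;> simp
          · rcases c with c | c <;> simp
          · exact fun h => D.G.edge_ne c (map_inl_injective h)
        · change Sum.map id Sum.inl a ≠ _
          rcases a with a | a <;> simp
        · change Sum.map id Sum.inl (D.G.edge a) ≠ _
          rcases D.G.edge a with a | a <;> simp }

/-- The disjoint union of a diagram with a closed circle: one edge whose two ends are glued. -/
def addCircle (D : CDiag) : CDiag where
  J := D.J ⊕ Bool
  glue := D.glue.sum Pairing.bool
  G :=
    { V := D.G.V
      edge
        | Sum.inl w => Sum.map id Sum.inl (D.G.edge (Sum.inl w))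
        | Sum.inr (Sum.inl j) => Sum.map id Sum.inl (D.G.edge (Sum.inr j))
        | Sum.inr (Sum.inr b) => Sum.inr (Sum.inr (!b))
      edge_edge := by
        have key : ∀ c : Flag D.G.V D.J,
            (match (Sum.map id Sum.inl c : Flag D.G.V (D.J ⊕ Bool)) with
              | Sum.inl w => Sum.map id Sum.inl (D.G.edge (Sum.inl w))
              | Sum.inr (Sum.inl j) => Sum.map id Sum.inl (D.G.edge (Sum.inr j))
              | Sum.inr (Sum.inr b) => Sum.inr (Sum.inr (!b)) :
                Flag D.G.V (D.J ⊕ Bool)) = Sum.map id Sum.inl (D.G.edge c) := by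
          rintro (c | c) <;> rfl
        rintro (w | j | b)
        · exact (key _).trans (by rw [D.G.edge_edge]; rfl)
        · exact (key _).trans (by rw [D.G.edge_edge]; rfl)
        · simp
      edge_ne := by
        rintro (w | j | b) h
        · exact D.G.edge_ne (Sum.inl w) (map_inl_injective h)
        · exact D.G.edge_ne (Sum.inr j) (map_inl_injective h)
        · simp at h }

end CDiag

/-- The relations of `𝓐°(∅)`: `AS` (with the identification of isomorphic diagrams), the
irrelevance of marked interior points of edges, and `IHX`. -/
inductive CRel (𝕜 : Type*) [Field 𝕜] : (CDiag →₀ 𝕜) → Prop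
  | iso (D D' : CDiag) (φ : Graph.Iso D.G D'.G)
      (hg : ∀ j, D'.glue.1 (φ.ext j) = φ.ext (D.glue.1 j)) :
      CRel 𝕜 (Finsupp.single D 1 - Finsupp.single D' (φ.sign : 𝕜))
  | subdivide (D : CDiag) (a : Flag D.G.V D.J) :
      CRel 𝕜 (Finsupp.single (D.subdivide a) 1 - Finsupp.single D 1)
  | ihx (D : CDiag) (u v : D.G.V) (h : D.G.IsIHX u v) :
      CRel 𝕜 (Finsupp.single D 1
        + Finsupp.single { D with G := D.G.conj (Graph.ihxPerm D.J u v) } 1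
        + Finsupp.single { D with G := D.G.conj (Graph.ihxPerm D.J u v ^ 2) } 1)

/-- The (not yet completed) space `𝓐°(∅)`. -/
abbrev CSpace (𝕜 : Type*) [Field 𝕜] : Type _ :=
  (CDiag →₀ 𝕜) ⧸ Submodule.span 𝕜 {z | CRel 𝕜 z}

/-- The class of a diagram in `𝓐°(∅)`. -/
def CSpace.mk (𝕜 : Type*) [Field 𝕜] (D : CDiag) : CSpace 𝕜 :=
  Submodule.Quotient.mk (Finsupp.single D 1)

/-- The part of degree `d`, where the degree is half the number of vertices. -/
def CDeg (𝕜 : Type*) [Field 𝕜] (d : ℕ) : Submodule 𝕜 (CSpace 𝕜) :=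
  Submodule.span 𝕜 {z | ∃ D : CDiag, Fintype.card D.G.V = 2 * d ∧ CSpace.mk 𝕜 D = z}

/-- The completed graded space `𝓐°(∅)`. -/
abbrev CHat (𝕜 : Type*) [Field 𝕜] : Type _ := ∀ d : ℕ, CDeg 𝕜 d

open scoped Classical in
/-- The relations `O_m` (a closed circle equals `-2m`) and `P_{m+1}` (the sum over all ways of
pairing up `2m+2` stubs of a diagram is zero). -/
inductive OPRel (𝕜 : Type*) [Field 𝕜] (m : ℕ) : CSpace 𝕜 → Prop
  | circle (D : CDiag) :
      OPRel 𝕜 m (CSpace.mk 𝕜 D.addCircle - (-2 * (m : 𝕜)) • CSpace.mk 𝕜 D)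
  | pairings (J : Type) [Fintype J] (g : Pairing J) (G : Graph (J ⊕ Fin (2 * m + 2))) :
      OPRel 𝕜 m (∑ p : Pairing (Fin (2 * m + 2)),
        CSpace.mk 𝕜 { J := J ⊕ Fin (2 * m + 2), glue := g.sum p, G := G })

/-- The (not yet completed) space `𝓐°(∅) / (O_m, P_{m+1})`. -/
abbrev QSpace (𝕜 : Type*) [Field 𝕜] (m : ℕ) : Type _ :=
  CSpace 𝕜 ⧸ Submodule.span 𝕜 {z | OPRel 𝕜 m z}

/-- The projection `𝓐°(∅) → 𝓐°(∅) / (O_m, P_{m+1})`. -/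
def proj (𝕜 : Type*) [Field 𝕜] (m : ℕ) : CSpace 𝕜 →ₗ[𝕜] QSpace 𝕜 m :=
  Submodule.mkQ _

/-- The part of degree `d`. -/
def QDeg (𝕜 : Type*) [Field 𝕜] (m d : ℕ) : Submodule 𝕜 (QSpace 𝕜 m) :=
  (CDeg 𝕜 d).map (proj 𝕜 m)

/-- The completed graded space `𝓐°(∅) / (O_m, P_{m+1})`. -/
abbrev QHat (𝕜 : Type*) [Field 𝕜] (m : ℕ) : Type _ := ∀ d : ℕ, QDeg 𝕜 m d

/-- The projection `𝓐°(∅) → 𝓐°(∅) / (O_m, P_{m+1})` of the completed spaces. -/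
def projHat (𝕜 : Type*) [Field 𝕜] (m : ℕ) : CHat 𝕜 →ₗ[𝕜] QHat 𝕜 m :=
  LinearMap.pi fun d => ((proj 𝕜 m).restrict
    (fun _ h => Submodule.mem_map_of_mem h : ∀ c ∈ CDeg 𝕜 d, proj 𝕜 m c ∈ QDeg 𝕜 m d)).comp
      (LinearMap.proj d)

/-! ### Negative-dimensional formal integration -/

/-- The closed diagram obtained by gluing the legs of a diagram in pairs. -/
def BDiag.close {X : Type} (D : BDiag X) (p : Pairing D.L) : CDiag where
  J := D.L
  glue := p
  G := D.G

open scoped Classical in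
/-- The sum over all ways of gluing the legs of a diagram in pairs of equal colour, if there are
exactly `2m` legs of every colour, and zero otherwise. -/
def intDiag (𝕜 : Type*) [Field 𝕜] {X : Type} (m : ℕ) (D : BDiag X) : CSpace 𝕜 :=
  if ∀ x, Fintype.card {l // D.color l = x} = 2 * m then
    ∑ p : {p : Pairing D.L // ∀ l, D.color (p.1 l) = D.color l},
      CSpace.mk 𝕜 (D.close p.1)
  else 0

lemma CSpace.mk_iso (𝕜 : Type*) [Field 𝕜] (D D' : CDiag) (φ : Graph.Iso D.G D'.G)
    (hg : ∀ j, D'.glue.1 (φ.ext j) = φ.ext (D.glue.1 j)) :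
    CSpace.mk 𝕜 D = (φ.sign : 𝕜) • CSpace.mk 𝕜 D' := by
  have h := (Submodule.Quotient.mk_eq_zero (Submodule.span 𝕜 {z | CRel 𝕜 z})).2
    (Submodule.subset_span (CRel.iso (𝕜 := 𝕜) D D' φ hg))
  rw [Submodule.Quotient.mk_sub, sub_eq_zero] at h
  rw [CSpace.mk, CSpace.mk, h, ← Submodule.Quotient.mk_smul, Finsupp.smul_single]
  simp

lemma CSpace.mk_ihx (𝕜 : Type*) [Field 𝕜] (D : CDiag) (u v : D.G.V) (h : D.G.IsIHX u v) :
    CSpace.mk 𝕜 D + CSpace.mk 𝕜 { D with G := D.G.conj (Graph.ihxPerm D.J u v) }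
      + CSpace.mk 𝕜 { D with G := D.G.conj (Graph.ihxPerm D.J u v ^ 2) } = 0 :=
  (Submodule.Quotient.mk_eq_zero (Submodule.span 𝕜 {z | CRel 𝕜 z})).2
    (Submodule.subset_span (CRel.ihx (𝕜 := 𝕜) D u v h))

/-- Transport of colour-preserving pairings along a colour-preserving bijection. -/
def pairingCongr {X L L' : Type} (c : L → X) (c' : L' → X) (f : L ≃ L')
    (hf : ∀ l, c' (f l) = c l) :
    {p : Pairing L // ∀ l, c (p.1 l) = c l} ≃ {p : Pairing L' // ∀ l, c' (p.1 l) = c' l} where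
  toFun p := ⟨⟨fun l => f (p.1.1 (f.symm l)),
    ⟨fun l => by simp [p.1.2.1], fun l h => p.1.2.2 (f.symm l) (by
      rw [Equiv.eq_symm_apply]; exact h)⟩⟩,
    fun l => by
      change c' (f (p.1.1 (f.symm l))) = c' l
      rw [hf, p.2, ← hf, Equiv.apply_symm_apply]⟩
  invFun p := ⟨⟨fun l => f.symm (p.1.1 (f l)),
    ⟨fun l => by simp [p.1.2.1], fun l h => p.1.2.2 (f l) (by
      rw [← Equiv.symm_apply_eq]; exact h)⟩⟩,
    fun l => by
      change c (f.symm (p.1.1 (f l))) = c l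
      rw [← hf, Equiv.apply_symm_apply, p.2, hf]⟩
  left_inv p := by
    apply Subtype.ext; apply Subtype.ext; funext l; simp
  right_inv p := by
    apply Subtype.ext; apply Subtype.ext; funext l; simp

lemma intDiag_rel (𝕜 : Type*) [Field 𝕜] (X : Type) (m : ℕ) (z : BDiag X →₀ 𝕜)
    (hz : BRel 𝕜 X z) : Finsupp.linearCombination 𝕜 (intDiag 𝕜 m) z = 0 := by
  classical
  cases hz with
  | iso D D' φ hc =>
    rw [map_sub, Finsupp.linearCombination_single, Finsupp.linearCombination_single, one_smul,
      sub_eq_zero]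
    have hcard : ∀ x, Fintype.card {l // D.color l = x} = Fintype.card {l // D'.color l = x} :=
      fun x => Fintype.card_congr (φ.ext.subtypeEquiv fun l => by rw [hc])
    unfold intDiag
    by_cases h : ∀ x, Fintype.card {l // D.color l = x} = 2 * m
    · have h' : ∀ x, Fintype.card {l // D'.color l = x} = 2 * m := fun x => by rw [← hcard, h]
      rw [if_pos h, if_pos h', Finset.smul_sum]
      refine Fintype.sum_equiv (pairingCongr D.color D'.color φ.ext hc) _ _ fun p => ?_
      exact CSpace.mk_iso 𝕜 (D.close p.1)
        (D'.close (pairingCongr D.color D'.color φ.ext hc p).1) φ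
        (fun j => by
          change φ.ext (p.1.1 (φ.ext.symm (φ.ext j))) = φ.ext (p.1.1 j)
          exact congrArg (fun i => φ.ext (p.1.1 i)) (φ.ext.symm_apply_apply j))
    · have h' : ¬ ∀ x, Fintype.card {l // D'.color l = x} = 2 * m := fun h' =>
        h fun x => by rw [hcard, h']
      rw [if_neg h, if_neg h', smul_zero]
  | ihx D u v h =>
    simp only [map_add, Finsupp.linearCombination_single, one_smul]
    unfold intDiag
    dsimp only
    split_ifs with hm
    · rw [← Finset.sum_add_distrib, ← Finset.sum_add_distrib]
      refine Finset.sum_eq_zero fun p _ => ?_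
      exact CSpace.mk_ihx 𝕜 (D.close p.1) u v h
    · simp

/-- Negative-dimensional formal integration `∫^{(m)} : 𝓑(X) → 𝓐°(∅) / (O_m, P_{m+1})`, before
completion. -/
def integral (𝕜 : Type*) [Field 𝕜] (X : Type) (m : ℕ) : BSpace 𝕜 X →ₗ[𝕜] QSpace 𝕜 m :=
  (proj 𝕜 m).comp (Submodule.liftQ _ (Finsupp.linearCombination 𝕜 (intDiag 𝕜 m))
    (Submodule.span_le.2 (fun z hz => intDiag_rel 𝕜 X m z hz)))

lemma integral_mk (𝕜 : Type*) [Field 𝕜] {X : Type} (m : ℕ) (D : BDiag X) :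
    integral 𝕜 X m (BSpace.mk 𝕜 D) = proj 𝕜 m (intDiag 𝕜 m D) := by
  simp [integral, BSpace.mk]

lemma integral_deg (𝕜 : Type*) [Field 𝕜] (X : Type) [Fintype X] (m d : ℕ) :
    ∀ b ∈ BDeg 𝕜 X (d + m * Fintype.card X), integral 𝕜 X m b ∈ QDeg 𝕜 m d := by
  classical
  have : BDeg 𝕜 X (d + m * Fintype.card X) ≤ (QDeg 𝕜 m d).comap (integral 𝕜 X m) := by
    refine Submodule.span_le.2 ?_
    rintro _ ⟨D, hD, rfl⟩
    change integral 𝕜 X m (BSpace.mk 𝕜 D) ∈ QDeg 𝕜 m d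
    rw [integral_mk]
    refine Submodule.mem_map_of_mem ?_
    unfold intDiag
    split_ifs with h
    · have hL : Fintype.card D.L = Fintype.card X * (2 * m) := by
        rw [← Fintype.card_congr (Equiv.sigmaFiberEquiv D.color), Fintype.card_sigma]
        simp [h]
      refine Submodule.sum_mem _ fun p _ => Submodule.subset_span ⟨_, ?_, rfl⟩
      change Fintype.card D.G.V = 2 * d
      rw [hL] at hD
      linarith
    · exact Submodule.zero_mem _
  exact this

/-- Negative-dimensional formal integration `∫^{(m)} : 𝓑(X) → 𝓐°(∅) / (O_m, P_{m+1})` on the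
completed spaces.  It lowers the degree by `m |X|`, and vanishes in degrees below `m |X|`. -/
def integralHat (𝕜 : Type*) [Field 𝕜] (X : Type) [Fintype X] (m : ℕ) :
    BHat 𝕜 X →ₗ[𝕜] QHat 𝕜 m :=
  LinearMap.pi fun d => ((integral 𝕜 X m).restrict (integral_deg 𝕜 X m d)).comp
    (LinearMap.proj (d + m * Fintype.card X))

/-! ### The map `j_m` -/

/-- The half-edges of a comb that point to the right: the leg `0`, and one at every vertex. -/
def combRight (n : ℕ) : Fin (n + 1) → Flag (Fin n) (Fin (n + 2)) :=
  Fin.cases (Sum.inr 0) (fun i => Sum.inl (i, 2))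

/-- The half-edges of a comb that point to the left: one at every vertex, and the last leg. -/
def combLeft (n : ℕ) : Fin (n + 1) → Flag (Fin n) (Fin (n + 2)) :=
  Fin.lastCases (Sum.inr (Fin.last (n + 1))) (fun i => Sum.inl (i, 0))

/-- The edges of a comb with legs `0, …, n + 1`. -/
def combEdge (n : ℕ) : Flag (Fin n) (Fin (n + 2)) → Flag (Fin n) (Fin (n + 2))
  | Sum.inl (i, k) =>
    if k = 0 then combRight n i.castSucc
    else if k = 1 then Sum.inr i.succ.castSucc
    else combLeft n i.succ
  | Sum.inr j =>
    Fin.cases (motive := fun _ => Flag (Fin n) (Fin (n + 2))) (combLeft n 0)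
      (fun j' => Fin.lastCases (motive := fun _ => Flag (Fin n) (Fin (n + 2)))
        (combRight n (Fin.last n)) (fun i => Sum.inl (i, 1)) j') j

lemma combEdge_right (n : ℕ) (i : Fin (n + 1)) : combEdge n (combRight n i) = combLeft n i := by
  induction i using Fin.cases with
  | zero => simp [combRight, combEdge]
  | succ i => simp [combRight, combEdge]

lemma combEdge_left (n : ℕ) (i : Fin (n + 1)) : combEdge n (combLeft n i) = combRight n i := by
  induction i using Fin.lastCases with
  | last =>
    have : Fin.last (n + 1) = (Fin.last n).succ := rfl
    simp only [combLeft, Fin.lastCases_last, combEdge]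
    rw [this, Fin.cases_succ, Fin.lastCases_last]
  | cast i => simp [combLeft, combEdge]

lemma combEdge_leg (n : ℕ) (i : Fin n) :
    combEdge n (Sum.inr i.succ.castSucc) = Sum.inl (i, 1) := by
  have : (i.succ.castSucc : Fin (n + 2)) = i.castSucc.succ := rfl
  simp only [combEdge]
  rw [this, Fin.cases_succ, Fin.lastCases_castSucc]

lemma comb_cases (n : ℕ) (a : Flag (Fin n) (Fin (n + 2))) :
    (∃ i, a = combRight n i) ∨ (∃ i, a = combLeft n i) ∨
      (∃ i : Fin n, a = Sum.inl (i, 1)) ∨ ∃ i : Fin n, a = Sum.inr i.succ.castSucc := by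
  rcases a with ⟨i, k⟩ | j
  · fin_cases k
    · exact Or.inr (Or.inl ⟨i.castSucc, by simp [combLeft]⟩)
    · exact Or.inr (Or.inr (Or.inl ⟨i, rfl⟩))
    · exact Or.inl ⟨i.succ, by simp [combRight]⟩
  · induction j using Fin.cases with
    | zero => exact Or.inl ⟨0, by simp [combRight]⟩
    | succ j =>
      induction j using Fin.lastCases with
      | last => exact Or.inr (Or.inl ⟨Fin.last n, by simp [combLeft]⟩)
      | cast i => exact Or.inr (Or.inr (Or.inr ⟨i, rfl⟩))

lemma combRight_ne_left (n : ℕ) (i j : Fin (n + 1)) : combRight n i ≠ combLeft n j := by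
  induction i using Fin.cases with
  | zero =>
    induction j using Fin.lastCases with
    | last => simp [combRight, combLeft, Fin.ext_iff]
    | cast j => simp [combRight, combLeft]
  | succ i =>
    induction j using Fin.lastCases with
    | last => simp [combRight, combLeft]
    | cast j => simp [combRight, combLeft]

/-- The comb with legs `0, 1, …, n + 1`: the vertices `0, …, n - 1` lie on a line from the leg `0`
to the leg `n + 1`, and the leg `i + 1` is attached to the vertex `i`.  With `(a, b, c)` at a vertex
read as `⟨[a, b], c⟩`, this is `⟨[…[[0, 1], 2], …, n], n + 1⟩`; for `n = 0` it is a strut. -/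
def comb (n : ℕ) : Graph (Fin (n + 2)) where
  V := Fin n
  edge := combEdge n
  edge_edge a := by
    rcases comb_cases n a with ⟨i, rfl⟩ | ⟨i, rfl⟩ | ⟨i, rfl⟩ | ⟨i, rfl⟩
    · rw [combEdge_right, combEdge_left]
    · rw [combEdge_left, combEdge_right]
    · exact combEdge_leg n i
    · rw [combEdge_leg]; rfl
  edge_ne a := by
    rcases comb_cases n a with ⟨i, rfl⟩ | ⟨i, rfl⟩ | ⟨i, rfl⟩ | ⟨i, rfl⟩
    · rw [combEdge_right]; exact (combRight_ne_left n i i).symm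
    · rw [combEdge_left]; exact combRight_ne_left n i i
    · simp [combEdge]
    · rw [combEdge_leg]; simp

/-- The number of descents of a word. -/
def descents {n : ℕ} (e : Equiv.Perm (Fin (n + 2))) : ℕ :=
  Fintype.card {k : Fin (n + 1) // e k.succ < e k.castSucc}

open scoped Classical in
/-- The linear combination of trees `T_s` with legs `0, …, s - 1`: it is zero for `s = 0, 1`, and
for `s = n + 2` it is the sum over all ways `τ` of permuting the legs `1, …, n` of the comb, with
coefficients `(-1)^r / ((n + 1) * (n choose r))`, where `r` is the number of descents of `τ`. -/
def treeSum (𝕜 : Type*) [Field 𝕜] : (s : ℕ) → (Graph (Fin s) →₀ 𝕜)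
  | 0 => 0
  | 1 => 0
  | n + 2 => ∑ e : {e : Equiv.Perm (Fin (n + 2)) // e 0 = 0 ∧ e (Fin.last _) = Fin.last _},
      Finsupp.single ((comb n).relabel e.1)
        ((-1) ^ descents e.1 / (((n : 𝕜) + 1) * (n.choose (descents e.1) : 𝕜)))

open scoped Classical in
/-- The disjoint union of linear combinations of graphs, extended multilinearly. -/
def unionSum {𝕜 : Type*} [Field 𝕜] {ι : Type} [Fintype ι] {F : ι → Type}
    (u : ∀ i, Graph (F i) →₀ 𝕜) : Graph (Σ i, F i) →₀ 𝕜 :=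
  ∑ g ∈ Fintype.piFinset (fun i => (u i).support),
    Finsupp.single (Graph.sigma g) (∏ i, u i (g i))

/-- The increasing enumeration of a finite set whose order is given by heights. -/
def enumerate (B : Type) [Fintype B] (pos : B → ℕ) (h : Function.Injective pos) :
    Fin (Fintype.card B) ≃ B :=
  letI := LinearOrder.lift' pos h
  (Fintype.orderIsoFinOfCardEq B rfl).toEquiv

open scoped Classical in
/-- The linear combination of forests `T^m` with legs in the ordered set `B`: the sum, over all
ways of distributing the legs to `m` unordered blocks, of the disjoint union of the trees
`T_s` put on the blocks in increasing order. -/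
def forestSum (𝕜 : Type*) [Field 𝕜] (m : ℕ) (B : Type) [Fintype B] (pos : B → ℕ)
    (h : Function.Injective pos) : Graph B →₀ 𝕜 :=
  (m.factorial : 𝕜)⁻¹ • ∑ f : B → Fin m,
    (unionSum (fun b : Fin m =>
      (treeSum 𝕜 (Fintype.card {l // f l = b})).mapDomain
        (Graph.relabel (enumerate {l // f l = b} (fun l => pos l.1)
          (h.comp Subtype.val_injective))))).mapDomain
      (Graph.relabel (Equiv.sigmaFiberEquiv f))

/-- Glue two graphs with the same set of ends along their ends. -/
def glueGraphs {L : Type} [Fintype L] (G H : Graph L) : CDiag where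
  J := L ⊕ L
  glue := ⟨Sum.swap, ⟨fun j => by simp, by rintro (j | j) <;> simp⟩⟩
  G := G.union H

open scoped Classical in
/-- The value of `j_m` on a diagram: for every strand `x`, the strand is removed and its legs are
glued in their order to the legs of `T^m`. -/
def jDiag (𝕜 : Type*) [Field 𝕜] {X : Type} [Fintype X] (m : ℕ) (D : ADiag X) : CSpace 𝕜 :=
  Finsupp.linearCombination 𝕜 (fun H : Graph D.L => CSpace.mk 𝕜 (glueGraphs D.G H))
    ((unionSum (fun x : X => forestSum 𝕜 m {l // D.color l = x} (fun l => D.pos l.1)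
      (D.pos_inj.comp Subtype.val_injective))).mapDomain
        (Graph.relabel (Equiv.sigmaFiberEquiv D.color)))

end

end Jacobi

/-! Everything is expressed through a gluing pairing. The space of marked diagrams is a commutative
algebra under disjoint union, and `gl` glues two diagrams with distinct marks at equal marks. Giving
every leg of a strand diagram its own mark, `jDiag_eq` writes $j_m$ as the pairing of the underlying
graph with a sum of products of block trees `blockTree`: one summand for every map of the legs to
`Fin m`, one factor for every pair of a strand and a block, all multiplied by $(m!)^{-|X|}$ because
the blocks are unordered. A block tree is a combination of combs, that is, of iterated brackets
indexed by words.

The substance of well-definedness is STU. Splitting a leg on one side of the pairing is adjoint to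
joining two legs on the other (`gl_split`), so the letters of a comb can be removed one by one as
joining operators, and IHX becomes the Jacobi identity `joinOp_jacobi`. Suppose that $p$ and $q$ are
neighbours in a block. If neither is the first or the last leg, only words with $p$ and $q$ adjacent
notice their exchange. Each exchange produces a bracket, and `treeCoeff_sub` says that the
coefficients subtract to those of the tree with one leg fewer.

If $p$ is the first leg, the two trees have different first letters. Apart from its last letter, the
tree has the coefficients of the first Eulerian idempotent, and these vanish on proper shuffles
(`shuffleSum_eulerCoeff`): $\binom{k+\mathrm{asc}(w)}{|w|}$ counts the occurrences of $w$ in $k$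
copies of the ordered alphabet, is multiplicative under shuffles and polynomial in $k$ without
constant term, and the coefficient in question is its linear term. Hence the first letter can be
changed freely (`sum_gl_combWord_head`). The case of the last leg follows by reflection. Together
this is `gl_blockTree_exchange`. Summing over all distributions of the legs gives `jDiag_stu`:
distributions that separate $p$ from $q$ cancel, the others are distributions of the legs of the
joined diagram.

For the comparison with the integral, $j_m$ is applied to a symmetrized diagram. Averaging over the
orders of the legs makes the coefficient of a comb symmetric in the letters of a block, whereas a
comb with at least three legs is antisymmetric in its first two letters, so such blocks contribute
nothing (`sum_forest_eq_zero`). Blocks with fewer than two legs give zero by definition. What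
remains are blocks of two legs, that is, struts, and gluing struts closes the legs in pairs
(`gl_struts`). Every pairing arises from $(m!)^{|X|}$ distributions, which cancels the normalization
(`jMap_chiDiag`). The equality $j_m\circ\chi=\int^{(m)}$ therefore holds on each diagram before the
quotient is taken.

Finally `chi_surjective`, an induction on the number of legs by STU, makes $\sigma$ a right inverse
of $\chi$, and $\int^{(m)}\sigma a = j_m\chi\sigma a = j_m a$. -/

namespace Jacobi

noncomputable section

/-! ### Identifications of graphs and their signs -/

namespace Graph

variable {E E' : Type}

/-- An identification of graphs that preserves the numbering of the half-edges at the vertices. -/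
def Iso.ofEquiv {G : Graph E} {G' : Graph E'} (ext : E ≃ E') (vtx : G.V ≃ G'.V)
    (h : ∀ a, G'.edge (Sum.map (Prod.map vtx id) ext a) =
      Sum.map (Prod.map vtx id) ext (G.edge a)) : Iso G G' where
  ext := ext
  vtx := vtx
  rot _ := 1
  edge_comm := h

@[simp] lemma Iso.sign_ofEquiv {G : Graph E} {G' : Graph E'} (ext : E ≃ E') (vtx : G.V ≃ G'.V)
    (h) : (Iso.ofEquiv (G := G) (G' := G') ext vtx h).sign = 1 := by
  simp [Iso.sign, Iso.ofEquiv]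

/-- The identification of a graph with its relabelling. -/
def Iso.relabel (f : E ≃ E') (G : Graph E) : Iso G (G.relabel f) :=
  Iso.ofEquiv f (Equiv.refl _) fun a => by
    have h : ∀ b : Flag G.V E, Sum.map id f.symm (Sum.map (Prod.map id id) f b) = b := by
      rintro (b | b) <;> simp
    change Sum.map id f (G.edge (Sum.map id f.symm (Sum.map (Prod.map id id) f a))) = _
    rw [h]
    rcases G.edge a with b | b <;> rfl

/-- The product of the numbers `ε v` and `ε' w` over the vertices of a disjoint union. -/
def Iso.union {F F' : Type} {G : Graph E} {G' : Graph E'} {H : Graph F} {H' : Graph F'}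
    (φ : Iso G G') (ψ : Iso H H') : Iso (G.union H) (G'.union H') where
  ext := Equiv.sumCongr φ.ext ψ.ext
  vtx := Equiv.sumCongr φ.vtx ψ.vtx
  rot := Sum.elim φ.rot ψ.rot
  edge_comm a := by
    rcases union_cases a with ⟨a, rfl⟩ | ⟨a, rfl⟩
    · have key : ∀ b : Flag G.V E, Sum.map (fun w : (G.V ⊕ H.V) × Fin 3 =>
          (Equiv.sumCongr φ.vtx ψ.vtx w.1, Sum.elim φ.rot ψ.rot w.1 w.2))
          (Equiv.sumCongr φ.ext ψ.ext) (leftFlag b) =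
            leftFlag (Sum.map (fun w => (φ.vtx w.1, φ.rot w.1 w.2)) φ.ext b) := by
        rintro (⟨v, k⟩ | b) <;> rfl
      change unionEdge G' H' _ = Sum.map _ _ (unionEdge G H _)
      rw [unionEdge_left]
      erw [key, key]
      rw [unionEdge_left, φ.edge_comm]
    · have key : ∀ b : Flag H.V F, Sum.map (fun w : (G.V ⊕ H.V) × Fin 3 =>
          (Equiv.sumCongr φ.vtx ψ.vtx w.1, Sum.elim φ.rot ψ.rot w.1 w.2))
          (Equiv.sumCongr φ.ext ψ.ext) (rightFlag b) =
            rightFlag (Sum.map (fun w => (ψ.vtx w.1, ψ.rot w.1 w.2)) ψ.ext b) := by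
        rintro (⟨v, k⟩ | b) <;> rfl
      change unionEdge G' H' _ = Sum.map _ _ (unionEdge G H _)
      rw [unionEdge_right]
      erw [key, key]
      rw [unionEdge_right, ψ.edge_comm]

lemma Iso.sign_union {F F' : Type} {G : Graph E} {G' : Graph E'} {H : Graph F} {H' : Graph F'}
    (φ : Iso G G') (ψ : Iso H H') : (φ.union ψ).sign = φ.sign * ψ.sign := by
  simp only [Iso.sign, Iso.union]
  exact Fintype.prod_sum_type _

/-- The identity of a graph. -/
def Iso.refl (G : Graph E) : Iso G G :=
  Iso.ofEquiv (Equiv.refl _) (Equiv.refl _) fun a => by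
    have : ∀ b : Flag G.V E, Sum.map (Prod.map (Equiv.refl _) id) (Equiv.refl _) b = b := by
      rintro (⟨v, k⟩ | b) <;> rfl
    rw [this, this]

@[simp] lemma Iso.sign_refl (G : Graph E) : (Iso.refl G).sign = 1 := Iso.sign_ofEquiv _ _ _

end Graph

lemma BSpace.mk_iso (𝕜 : Type*) [Field 𝕜] {X : Type} (D D' : BDiag X)
    (φ : Graph.Iso D.G D'.G) (hc : ∀ l, D'.color (φ.ext l) = D.color l) :
    BSpace.mk 𝕜 D = (φ.sign : 𝕜) • BSpace.mk 𝕜 D' := by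
  have h := (Submodule.Quotient.mk_eq_zero (Submodule.span 𝕜 {z | BRel 𝕜 X z})).2
    (Submodule.subset_span (BRel.iso (𝕜 := 𝕜) D D' φ hc))
  rw [Submodule.Quotient.mk_sub, sub_eq_zero] at h
  rw [BSpace.mk, BSpace.mk, h, ← Submodule.Quotient.mk_smul, Finsupp.smul_single]
  simp

lemma BSpace.mk_equiv (𝕜 : Type*) [Field 𝕜] {X : Type} (D D' : BDiag X)
    (ext : D.L ≃ D'.L) (vtx : D.G.V ≃ D'.G.V)
    (h : ∀ a, D'.G.edge (Sum.map (Prod.map vtx id) ext a) =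
      Sum.map (Prod.map vtx id) ext (D.G.edge a))
    (hc : ∀ l, D'.color (ext l) = D.color l) :
    BSpace.mk 𝕜 D = BSpace.mk 𝕜 D' := by
  rw [BSpace.mk_iso 𝕜 D D' (Graph.Iso.ofEquiv ext vtx h) hc]
  simp

lemma BSpace.mk_ihx (𝕜 : Type*) [Field 𝕜] {X : Type} (D : BDiag X) (u v : D.G.V)
    (h : D.G.IsIHX u v) :
    BSpace.mk 𝕜 D + BSpace.mk 𝕜 { D with G := D.G.conj (Graph.ihxPerm D.L u v) }
      + BSpace.mk 𝕜 { D with G := D.G.conj (Graph.ihxPerm D.L u v ^ 2) } = 0 :=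
  (Submodule.Quotient.mk_eq_zero (Submodule.span 𝕜 {z | BRel 𝕜 X z})).2
    (Submodule.subset_span (BRel.ihx (𝕜 := 𝕜) D u v h))

lemma CSpace.mk_equiv (𝕜 : Type*) [Field 𝕜] (D D' : CDiag)
    (ext : D.J ≃ D'.J) (vtx : D.G.V ≃ D'.G.V)
    (h : ∀ a, D'.G.edge (Sum.map (Prod.map vtx id) ext a) =
      Sum.map (Prod.map vtx id) ext (D.G.edge a))
    (hg : ∀ j, D'.glue.1 (ext j) = ext (D.glue.1 j)) :
    CSpace.mk 𝕜 D = CSpace.mk 𝕜 D' := by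
  rw [CSpace.mk_iso 𝕜 D D' (Graph.Iso.ofEquiv ext vtx h) hg]
  simp

lemma CSpace.mk_subdivide (𝕜 : Type*) [Field 𝕜] (D : CDiag) (a : Flag D.G.V D.J) :
    CSpace.mk 𝕜 (D.subdivide a) = CSpace.mk 𝕜 D := by
  have h := (Submodule.Quotient.mk_eq_zero (Submodule.span 𝕜 {z | CRel 𝕜 z})).2
    (Submodule.subset_span (CRel.subdivide (𝕜 := 𝕜) D a))
  rwa [Submodule.Quotient.mk_sub, sub_eq_zero] at h

/-! ### Removing marked interior points of edges -/

/-- The inclusion of the half-edges of a graph from which some univalent ends were removed. -/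
def subFlag {V J : Type} (P : J → Prop) : Flag V {j // P j} → Flag V J := Sum.map id Subtype.val

lemma subFlag_injective {V J : Type} (P : J → Prop) :
    Function.Injective (subFlag (V := V) P) :=
  Function.injective_id.sumMap Subtype.val_injective

/-- A half-edge that is not one of the removed univalent ends. -/
def lowerFlag {V J : Type} (P : J → Prop) (x : Flag V J) (h : ∀ j, x = Sum.inr j → P j) :
    Flag V {j // P j} :=
  match x, h with
  | Sum.inl w, _ => Sum.inl w
  | Sum.inr j, h => Sum.inr ⟨j, h j rfl⟩

lemma subFlag_lowerFlag {V J : Type} (P : J → Prop) (x : Flag V J) (h) :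
    subFlag P (lowerFlag P x h) = x := by
  rcases x with w | j <;> rfl

lemma subFlag_ne {V J : Type} (P : J → Prop) (x : Flag V {j // P j}) (j : J) (hj : ¬ P j) :
    subFlag P x ≠ Sum.inr j := by
  rcases x with w | ⟨i, hi⟩
  · simp [subFlag]
  · simp only [subFlag, Sum.map_inr, ne_eq, Sum.inr.injEq]
    rintro rfl; exact hj hi

namespace CDiag

/-- Leaving from the half-edge `a`, one follows an edge, and goes on at the partner of its end as
long as this end lies in `R`; finally one arrives at `b`. -/
inductive Run (D : CDiag) (R : D.J → Prop) : Flag D.G.V D.J → Flag D.G.V D.J → Prop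
  | done {a b : Flag D.G.V D.J} : D.G.edge a = b → (∀ r, b = Sum.inr r → ¬ R r) → Run D R a b
  | step {a b : Flag D.G.V D.J} {r : D.J} : D.G.edge a = Sum.inr r → R r →
      Run D R (Sum.inr (D.glue.1 r)) b → Run D R a b

open scoped Classical in
/-- The edges after removal of the glued pair formed by `a` and its partner. -/
def contractEdge (D : CDiag) (a : D.J) (x : Flag D.G.V D.J) : Flag D.G.V D.J :=
  if D.G.edge x = Sum.inr a then D.G.edge (Sum.inr (D.glue.1 a))
  else if D.G.edge x = Sum.inr (D.glue.1 a) then D.G.edge (Sum.inr a)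
  else D.G.edge x

/-- A glued pair can be erased unless its two ends also bound a common edge, in which case it is the
only marked point of a closed circle. `ha` excludes this; otherwise the merged edge avoids both
erased ends. -/
lemma contractEdge_ne (D : CDiag) (a : D.J)
    (ha : D.G.edge (Sum.inr a) ≠ Sum.inr (D.glue.1 a)) (x : Flag D.G.V D.J) (j : D.J)
    (h : D.contractEdge a x = Sum.inr j) : j ≠ a ∧ j ≠ D.glue.1 a := by
  have e1 := D.G.edge_edge
  have e2 := D.G.edge_ne
  have e3 := D.glue.2.2 a
  have h1 := e1 (Sum.inr a)
  have h2 := e1 (Sum.inr (D.glue.1 a))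
  have h3 := e2 (Sum.inr a)
  have h4 := e2 (Sum.inr (D.glue.1 a))
  unfold contractEdge at h
  constructor
  · rintro rfl; split_ifs at h <;> simp_all
  · rintro rfl; split_ifs at h <;> simp_all

lemma contractEdge_contractEdge (D : CDiag) (a : D.J)
    (_ha : D.G.edge (Sum.inr a) ≠ Sum.inr (D.glue.1 a)) (x : Flag D.G.V D.J)
    (h1 : x ≠ Sum.inr a) (h2 : x ≠ Sum.inr (D.glue.1 a)) :
    D.contractEdge a (D.contractEdge a x) = x := by
  have e1 := D.G.edge_edge
  have f1 := e1 x
  have f2 := e1 (Sum.inr a)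
  have f3 := e1 (Sum.inr (D.glue.1 a))
  have f4 := D.G.edge_ne (Sum.inr a)
  have f5 := D.G.edge_ne (Sum.inr (D.glue.1 a))
  unfold contractEdge
  by_cases g1 : D.G.edge x = Sum.inr a
  · have : D.G.edge (Sum.inr a) = x := by rw [← g1, f1]
    rw [if_pos g1, f3]
    rw [if_neg (by simpa using D.glue.2.2 a), if_pos rfl, this]
  · by_cases g2 : D.G.edge x = Sum.inr (D.glue.1 a)
    · have : D.G.edge (Sum.inr (D.glue.1 a)) = x := by rw [← g2, f1]
      rw [if_neg g1, if_pos g2, f2, if_pos rfl, this]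
    · rw [if_neg g1, if_neg g2, f1, if_neg h1, if_neg h2]

/-- The diagram from which the glued pair formed by `a` and its partner was removed. -/
abbrev contract (D : CDiag) (a : D.J) (ha : D.G.edge (Sum.inr a) ≠ Sum.inr (D.glue.1 a)) :
    CDiag where
  J := {j // j ≠ a ∧ j ≠ D.glue.1 a}
  fintypeJ := by classical exact inferInstance
  glue := ⟨fun j => ⟨D.glue.1 j.1,
      fun h => j.2.2 (by rw [← D.glue.2.1 j.1, h]),
      fun h => j.2.1 (by rw [← D.glue.2.1 j.1, h, D.glue.2.1])⟩,
    fun j => Subtype.ext (D.glue.2.1 j.1),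
    fun j h => D.glue.2.2 j.1 (congrArg Subtype.val h)⟩
  G :=
    { V := D.G.V
      edge := fun x => lowerFlag _ (D.contractEdge a (subFlag _ x))
        (D.contractEdge_ne a ha _)
      edge_edge := fun x => by
        apply subFlag_injective
        rw [subFlag_lowerFlag, subFlag_lowerFlag, contractEdge_contractEdge D a ha]
        · exact subFlag_ne _ _ _ (by simp)
        · exact subFlag_ne _ _ _ (by simp)
      edge_ne := fun x h => by
        have h' := congrArg (subFlag _) h
        rw [subFlag_lowerFlag] at h'
        have n1 := subFlag_ne _ x a (by simp)
        have n2 := subFlag_ne _ x (D.glue.1 a) (by simp)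
        have e2 := D.G.edge_ne (subFlag _ x)
        have e1 := D.G.edge_edge
        unfold contractEdge at h'
        split_ifs at h' with g1 g2
        · rw [← h', e1] at g1
          exact D.glue.2.2 a (Sum.inr_injective g1)
        · rw [← h', e1] at g2
          exact D.glue.2.2 a (Sum.inr_injective g2).symm
        · exact e2 h' }

lemma subFlag_contract_edge (D : CDiag) (a : D.J) (ha) (x) :
    subFlag _ ((D.contract a ha).G.edge x) = D.contractEdge a (subFlag _ x) :=
  subFlag_lowerFlag _ _ _

open scoped Classical in
/-- The univalent ends of a diagram are those of the contracted diagram and the removed ones. -/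
def contractEquiv (D : CDiag) (a : D.J) : {j // j ≠ a ∧ j ≠ D.glue.1 a} ⊕ Bool ≃ D.J where
  toFun := Sum.elim Subtype.val (fun b => if b then D.glue.1 a else a)
  invFun j := if h1 : j = a then Sum.inr false else if h2 : j = D.glue.1 a then Sum.inr true
    else Sum.inl ⟨j, h1, h2⟩
  left_inv := by
    have := D.glue.2.2 a
    rintro (⟨j, h1, h2⟩ | (_ | _)) <;> simp_all
  right_inv j := by
    have := D.glue.2.2 a
    dsimp only
    split_ifs with h1 h2 <;> simp_all

/-- Cutting the merged edge at the half-edge to which `a` led recreates `a` and its partner as the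
two new ends, so `D` is a subdivision of the contracted diagram up to an identification that rotates
no vertex. -/
lemma mk_contract (𝕜 : Type*) [Field 𝕜] (D : CDiag) (a : D.J) (ha) :
    CSpace.mk 𝕜 (D.contract a ha) = CSpace.mk 𝕜 D := by
  classical
  have ea : ∀ j, D.G.edge (Sum.inr a) = Sum.inr j → j ≠ a ∧ j ≠ D.glue.1 a := by
    intro j hj
    constructor
    · rintro rfl; exact D.G.edge_ne _ hj
    · rintro rfl; exact ha hj
  set a0 : Flag D.G.V {j // j ≠ a ∧ j ≠ D.glue.1 a} :=
    lowerFlag _ (D.G.edge (Sum.inr a)) ea with ha0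
  have sa0 : subFlag _ a0 = D.G.edge (Sum.inr a) := subFlag_lowerFlag _ _ _
  have sea0 : subFlag _ ((D.contract a ha).G.edge a0) = D.G.edge (Sum.inr (D.glue.1 a)) := by
    refine (subFlag_contract_edge D a ha a0).trans ?_
    rw [sa0, contractEdge, D.G.edge_edge, if_pos rfl]
  rw [← CSpace.mk_subdivide 𝕜 (D.contract a ha) a0]
  have key : ∀ c : Flag D.G.V {j // j ≠ a ∧ j ≠ D.glue.1 a},
      Sum.map (Prod.map (Equiv.refl D.G.V) id) (D.contractEquiv a) (Sum.map id Sum.inl c) =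
        subFlag _ c := by
    rintro (⟨v, k⟩ | c) <;> simp [subFlag, contractEquiv]
  have main : ∀ b : Flag D.G.V ({j // j ≠ a ∧ j ≠ D.glue.1 a} ⊕ Bool),
      D.G.edge (Sum.map (Prod.map (Equiv.refl D.G.V) id) (D.contractEquiv a) b) =
        Sum.map (Prod.map (Equiv.refl D.G.V) id) (D.contractEquiv a)
          (cutEdge (D.contract a ha).G a0 b) := by
    intro b
    rcases cut_cases b with ⟨c, rfl⟩ | rfl | rfl
    · refine Eq.trans ?_ (congrArg (Sum.map (Prod.map (Equiv.refl D.G.V) id) (D.contractEquiv a))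
        (cutEdge_map (D.contract a ha).G a0 c)).symm
      refine (congrArg D.G.edge (key c)).trans ?_
      have hc := subFlag_contract_edge D a ha c
      by_cases h1 : c = a0
      · rw [if_pos h1]
        rw [h1, sa0, D.G.edge_edge]; simp [contractEquiv]
      · rw [if_neg h1]
        have h1' : D.G.edge (subFlag _ c) ≠ Sum.inr a := fun h => h1 <| by
          apply subFlag_injective
          rw [sa0, ← h, D.G.edge_edge]
        by_cases h2 : c = (D.contract a ha).G.edge a0
        · rw [if_pos h2]
          rw [h2, sea0, D.G.edge_edge]; simp [contractEquiv]
        · rw [if_neg h2]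
          have h2' : D.G.edge (subFlag _ c) ≠ Sum.inr (D.glue.1 a) := fun h => h2 <| by
            apply subFlag_injective
            rw [sea0, ← h, D.G.edge_edge]
          refine Eq.trans ?_ (key _).symm
          rw [hc, contractEdge, if_neg h1', if_neg h2']
    · change D.G.edge (Sum.inr (D.contractEquiv a (Sum.inr false))) =
        Sum.map _ _ (Sum.map id Sum.inl a0)
      rw [key, sa0]; simp [contractEquiv]
    · change D.G.edge (Sum.inr (D.contractEquiv a (Sum.inr true))) =
        Sum.map (Prod.map (Equiv.refl D.G.V) id) (D.contractEquiv a)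
          (Sum.map id Sum.inl ((D.contract a ha).G.edge a0))
      refine Eq.trans ?_ (key _).symm
      rw [sea0]; simp [contractEquiv]
  refine CSpace.mk_equiv 𝕜 ((D.contract a ha).subdivide a0) D (D.contractEquiv a)
    (Equiv.refl _) main (fun j => ?_)
  rcases j with j | (_ | _)
  · rfl
  · rfl
  · exact D.glue.2.1 a

/-- Such a walk goes round a closed circle: from `r` it reaches the partner of `r` and continues at
`r` again, whereas a `Run` is finite. -/
lemma Run.not_short {D : CDiag} {R : D.J → Prop} {r : D.J} (_hr : R r)
    (hr' : R (D.glue.1 r)) (h : D.G.edge (Sum.inr r) = Sum.inr (D.glue.1 r))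
    {x b : Flag D.G.V D.J} (hx : x = Sum.inr r) : ¬ Run D R x b := by
  intro hrun
  induction hrun with
  | done h1 h2 =>
    subst hx
    rw [h] at h1
    exact h2 _ h1.symm hr'
  | step h1 h2 _ ih =>
    subst hx
    rw [h] at h1
    apply ih
    rw [← Sum.inr_injective h1, D.glue.2.1]

/-- A run loses its visits to the erased pair and is otherwise unchanged. The starting point is
described only by where the contracted edge leads, because the run may have to be continued from an
erased end, which has no counterpart in the contracted diagram. -/
lemma Run.contract {D : CDiag} {R : D.J → Prop} {a : D.J} {ha}
    (hr : R a) (hr' : R (D.glue.1 a)) {x y : Flag D.G.V D.J} (h : Run D R x y) :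
    ∀ x1 y1, subFlag _ ((D.contract a ha).G.edge x1) = D.contractEdge a x → subFlag _ y1 = y →
      Run (D.contract a ha) (fun j => R j.1) x1 y1 := by
  induction h with
  | @done x y h1 h2 =>
    intro x1 y1 hx hy
    have n1 : y ≠ Sum.inr a := fun h => h2 _ h hr
    have n2 : y ≠ Sum.inr (D.glue.1 a) := fun h => h2 _ h hr'
    rw [contractEdge, h1, if_neg n1, if_neg n2] at hx
    refine Run.done (subFlag_injective _ (hx.trans hy.symm)) ?_
    rintro r rfl
    exact h2 _ hy.symm
  | @step x y r h1 h2 _ ih =>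
    intro x1 y1 hx hy
    by_cases c1 : r = a
    · apply ih x1 y1 _ hy
      rw [hx, contractEdge, h1, if_pos (by rw [c1]), contractEdge, c1]
      have : D.G.edge (Sum.inr (D.glue.1 a)) ≠ Sum.inr a := fun h => ha (by
        rw [← h, D.G.edge_edge])
      rw [if_neg this, if_neg (D.G.edge_ne _)]
    · by_cases c2 : r = D.glue.1 a
      · apply ih x1 y1 _ hy
        rw [hx, contractEdge, h1, if_neg (by rw [c2]; simpa using D.glue.2.2 a),
          if_pos (by rw [c2]), contractEdge, c2, D.glue.2.1,
          if_neg (D.G.edge_ne _), if_neg ha]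
      · have hx' := hx
        rw [contractEdge, h1, if_neg (by simpa using c1), if_neg (by simpa using c2)] at hx'
        have : (D.contract a ha).G.edge x1 = Sum.inr ⟨r, c1, c2⟩ :=
          subFlag_injective _ hx'
        refine Run.step this h2 (ih _ _ ?_ hy)
        rw [subFlag_contract_edge]
        rfl

/-- If all univalent ends of `D` that are not univalent ends of `D'` are interior points of edges
of `D'`, then `D` and `D'` present the same trivalent graph. -/
theorem mk_eq_of_run (𝕜 : Type*) [Field 𝕜] (D D' : CDiag) (vtx : D'.G.V ≃ D.G.V)
    (f : D'.J → D.J) (hf : Function.Injective f)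
    (hglue : ∀ j, D.glue.1 (f j) = f (D'.glue.1 j))
    (R : D.J → Prop) (hR : ∀ j, R j ↔ j ∉ Set.range f)
    (hrun : ∀ x, Run D R (Sum.map (Prod.map vtx id) f x)
      (Sum.map (Prod.map vtx id) f (D'.G.edge x)))
    (hfin : ∀ r, R r → ∃ b, Run D R (Sum.inr r) b) :
    CSpace.mk 𝕜 D = CSpace.mk 𝕜 D' := by
  classical
  -- Induction on the number of glued ends of `D`: the superfluous pairs are contracted one at a
  -- time. `hfin` ensures that no contraction destroys a closed circle.
  induction hn : Fintype.card D.J using Nat.strong_induction_on generalizing D with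
  | _ n ih =>
  by_cases hsurj : ∃ r, R r
  · obtain ⟨a, hra⟩ := hsurj
    have hra' : R (D.glue.1 a) := by
      rw [hR] at hra ⊢
      rintro ⟨j, hj⟩
      exact hra ⟨D'.glue.1 j, by rw [← hglue, hj, D.glue.2.1]⟩
    have ha : D.G.edge (Sum.inr a) ≠ Sum.inr (D.glue.1 a) := fun h => by
      obtain ⟨b, hb⟩ := hfin a hra
      exact Run.not_short hra hra' h rfl hb
    rw [← mk_contract 𝕜 D a ha]
    have hfa : ∀ j, f j ≠ a ∧ f j ≠ D.glue.1 a := fun j =>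
      ⟨fun h => (hR a).1 hra ⟨j, h⟩, fun h => (hR _).1 hra' ⟨j, h⟩⟩
    let f1 : D'.J → (D.contract a ha).J := fun j => ⟨f j, hfa j⟩
    have hsub : ∀ x : Flag D'.G.V D'.J,
        subFlag _ (Sum.map (Prod.map vtx id) f1 x) = Sum.map (Prod.map vtx id) f x := by
      rintro (⟨v, k⟩ | j) <;> rfl
    refine ih _ ?_ (D.contract a ha) vtx f1 (fun i j h => hf (congrArg Subtype.val h))
      (fun j => Subtype.ext (hglue j)) (fun j => R j.1) (fun j => ?_) (fun x => ?_)
      (fun r hr => ?_) rfl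
    · rw [← hn]
      have : Fintype.card (D.contract a ha).J < Fintype.card D.J := by
        have := Fintype.card_congr (D.contractEquiv a)
        rw [Fintype.card_sum, Fintype.card_bool] at this
        have h3 : Fintype.card (D.contract a ha).J =
          Fintype.card {j // j ≠ a ∧ j ≠ D.glue.1 a} := Fintype.card_congr (Equiv.refl _)
        omega
      exact this
    · rw [hR, not_iff_not]
      constructor
      · rintro ⟨i, hi⟩; exact ⟨i, Subtype.ext hi⟩
      · rintro ⟨i, hi⟩; exact ⟨i, congrArg Subtype.val hi⟩
    · refine (hrun x).contract hra hra' _ _ ?_ (hsub _)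
      exact (subFlag_contract_edge D a ha _).trans (congrArg _ (hsub x))
    · obtain ⟨b, hb⟩ := hfin r.1 hr
      have hb' : ∀ j, b = Sum.inr j → ¬ R j := by
        clear hfin
        generalize hx : (Sum.inr r.1 : Flag D.G.V D.J) = x at hb
        clear hx
        induction hb with
        | done _ h => exact h
        | step _ _ _ ih => exact ih
      refine ⟨lowerFlag _ b (fun j hj => ⟨?_, ?_⟩), hb.contract hra hra' _ _ ?_
        (subFlag_lowerFlag _ _ _)⟩
      · rintro rfl; exact hb' _ hj hra
      · rintro rfl; exact hb' _ hj hra'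
      · rw [subFlag_contract_edge]; rfl
  -- Nothing is superfluous any more: `f` is a bijection, every run consists of a single edge, and
  -- the two diagrams are isomorphic.
  · push Not at hsurj
    have hbij : Function.Bijective f := ⟨hf, fun j => by
      by_contra h; exact hsurj j ((hR j).2 h)⟩
    symm
    refine CSpace.mk_equiv 𝕜 D' D (Equiv.ofBijective f hbij) vtx (fun x => ?_) hglue
    have := hrun x
    rcases this with ⟨h, _⟩ | ⟨_, h, _⟩
    · exact h
    · exact absurd h (hsurj _)

end CDiag

end

end Jacobi

namespace Jacobi

noncomputable section

/-! ### Compatibility of the IHX moves with disjoint unions -/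

lemma flag_map_id {V E : Type} (b : Flag V E) :
    Sum.map (Prod.map (Equiv.refl V) id) (Equiv.refl E) b = b := by
  rcases b with ⟨v, k⟩ | b <;> rfl

namespace Graph

lemma mk_congr {E V : Type} [Fintype V] {e e' : Flag V E → Flag V E} (h : ∀ a, e a = e' a)
    (h1) (h2) (h1') (h2') : (⟨V, e, h1, h2⟩ : Graph E) = ⟨V, e', h1', h2'⟩ := by
  obtain rfl : e = e' := funext h
  rfl

lemma swap_leftFlag {V W E F : Type} (i1 : DecidableEq (Flag V E))
    (i2 : DecidableEq (Flag (V ⊕ W) (E ⊕ F))) (x y z : Flag V E) :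
    @Equiv.swap _ i2 (leftFlag x) (leftFlag y) (leftFlag z) = leftFlag (@Equiv.swap _ i1 x y z) :=
  @Function.Injective.swap_apply _ _ i1 i2 _ leftFlag_injective x y z

lemma ihxPerm_leftFlag {V W E F : Type} (u v : V) (a : Flag V E) :
    ihxPerm (E ⊕ F) (Sum.inl u : V ⊕ W) (Sum.inl v) (leftFlag a) =
      leftFlag (ihxPerm E u v a) := by
  classical
  exact (congrArg _ (swap_leftFlag inferInstance _ (Sum.inl (u, 1)) (Sum.inl (v, 1)) a)).trans
    (swap_leftFlag inferInstance _ (Sum.inl (u, 0)) (Sum.inl (u, 1)) _)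

lemma swap_apply_of_ne {α : Type} (i : DecidableEq α) {x y a : α} (h : a ≠ x) (h' : a ≠ y) :
    @Equiv.swap _ i x y a = a := Equiv.swap_apply_of_ne_of_ne h h'

lemma ihxPerm_of_ne {V E : Type} (u v : V) (a : Flag V E) (h0 : a ≠ Sum.inl (u, 0))
    (h1 : a ≠ Sum.inl (u, 1)) (h2 : a ≠ Sum.inl (v, 1)) : ihxPerm E u v a = a := by
  unfold ihxPerm
  rw [Equiv.Perm.mul_apply, swap_apply_of_ne _ h1 h2, swap_apply_of_ne _ h0 h1]

lemma ihxPerm_rightFlag {V W E F : Type} (u v : V) (a : Flag W F) :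
    ihxPerm (E ⊕ F) (Sum.inl u : V ⊕ W) (Sum.inl v) (rightFlag a) = rightFlag a := by
  have h : ∀ (w : V) (k : Fin 3),
      (rightFlag a : Flag (V ⊕ W) (E ⊕ F)) ≠ Sum.inl (Sum.inl w, k) := by
    rcases a with ⟨v, k⟩ | e <;> simp [rightFlag]
  exact ihxPerm_of_ne _ _ _ (h _ _) (h _ _) (h _ _)

lemma ihxPerm_sq_leftFlag {V W E F : Type} (u v : V) (a : Flag V E) :
    (ihxPerm (E ⊕ F) (Sum.inl u : V ⊕ W) (Sum.inl v) ^ 2) (leftFlag a) =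
      leftFlag ((ihxPerm E u v ^ 2) a) := by
  rw [pow_two, pow_two, Equiv.Perm.mul_apply, ihxPerm_leftFlag, ihxPerm_leftFlag,
    Equiv.Perm.mul_apply]

lemma ihxPerm_sq_rightFlag {V W E F : Type} (u v : V) (a : Flag W F) :
    (ihxPerm (E ⊕ F) (Sum.inl u : V ⊕ W) (Sum.inl v) ^ 2) (rightFlag a) = rightFlag a := by
  rw [pow_two, Equiv.Perm.mul_apply, ihxPerm_rightFlag, ihxPerm_rightFlag]

/-- An equality of graphs and not merely an isomorphism, so that the three terms of an IHX relation
can be rewritten inside any diagram without a sign. -/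
lemma conj_union {E F : Type} (G : Graph E) (H : Graph F) (ρ : Equiv.Perm (Flag G.V E))
    (ρ' : Equiv.Perm (Flag (G.V ⊕ H.V) (E ⊕ F))) (hl : ∀ a, ρ' (leftFlag a) = leftFlag (ρ a))
    (hr : ∀ a, ρ' (rightFlag a) = rightFlag a) :
    (G.union H).conj ρ' = (G.conj ρ).union H := by
  refine mk_congr (fun a => ?_) _ _ _ _
  change ρ' (unionEdge G H (ρ'.symm a)) = unionEdge (G.conj ρ) H a
  rcases union_cases a with ⟨a, rfl⟩ | ⟨a, rfl⟩
  · have : ρ'.symm (leftFlag a) = leftFlag (ρ.symm a) := by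
      rw [Equiv.symm_apply_eq, hl, Equiv.apply_symm_apply]
    rw [this, unionEdge_left, hl]
    exact (unionEdge_left (G.conj ρ) H a).symm
  · have : ρ'.symm (rightFlag a) = rightFlag a := by
      rw [Equiv.symm_apply_eq, hr]
    rw [this, unionEdge_right, hr]
    exact (unionEdge_right (G.conj ρ) H a).symm

lemma IsIHX.union {E F : Type} {G : Graph E} (H : Graph F) {u v : G.V} (h : G.IsIHX u v) :
    (G.union H).IsIHX (Sum.inl u) (Sum.inl v) := by
  refine ⟨fun h' => h.1 (Sum.inl_injective h'), ?_⟩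
  change unionEdge G H (leftFlag (Sum.inl (u, 2))) = _
  rw [unionEdge_left, h.2]
  rfl

lemma conj_ihx_union {E F : Type} (G : Graph E) (H : Graph F) (u v : G.V) :
    (G.union H).conj (ihxPerm (E ⊕ F) (Sum.inl u) (Sum.inl v)) =
      (G.conj (ihxPerm E u v)).union H :=
  conj_union G H _ _ (ihxPerm_leftFlag u v) (ihxPerm_rightFlag u v)

lemma conj_ihx_sq_union {E F : Type} (G : Graph E) (H : Graph F) (u v : G.V) :
    (G.union H).conj (ihxPerm (E ⊕ F) (Sum.inl u) (Sum.inl v) ^ 2) =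
      (G.conj (ihxPerm E u v ^ 2)).union H :=
  conj_union G H _ _ (ihxPerm_sq_leftFlag u v) (ihxPerm_sq_rightFlag u v)

end Graph

/-! ### The algebra of marked diagrams -/

variable {𝕜 : Type*} [Field 𝕜] {X Y Z : Type}

/-- Linear maps on the space of marked diagrams. -/
def BSpace.lift {M : Type*} [AddCommGroup M] [Module 𝕜 M] (f : BDiag X → M)
    (hiso : ∀ (D D' : BDiag X) (φ : Graph.Iso D.G D'.G),
      (∀ l, D'.color (φ.ext l) = D.color l) → f D = (φ.sign : 𝕜) • f D')
    (hihx : ∀ (D : BDiag X) (u v : D.G.V), D.G.IsIHX u v →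
      f D + f { D with G := D.G.conj (Graph.ihxPerm D.L u v) }
        + f { D with G := D.G.conj (Graph.ihxPerm D.L u v ^ 2) } = 0) :
    BSpace 𝕜 X →ₗ[𝕜] M :=
  Submodule.liftQ _ (Finsupp.linearCombination 𝕜 f) (Submodule.span_le.2 (by
    intro z hz
    change Finsupp.linearCombination 𝕜 f z = 0
    cases hz with
    | iso D D' φ hc =>
      rw [map_sub, Finsupp.linearCombination_single, Finsupp.linearCombination_single, one_smul,
        sub_eq_zero]
      exact hiso D D' φ hc
    | ihx D u v h =>
      simp only [map_add, Finsupp.linearCombination_single, one_smul]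
      exact hihx D u v h))

@[simp] lemma BSpace.lift_mk {M : Type*} [AddCommGroup M] [Module 𝕜 M] (f : BDiag X → M) (h1) (h2)
    (D : BDiag X) : BSpace.lift (𝕜 := 𝕜) f h1 h2 (BSpace.mk 𝕜 D) = f D := by
  simp [BSpace.lift, BSpace.mk]

lemma BSpace.hom_ext {M : Type*} [AddCommGroup M] [Module 𝕜 M] {f g : BSpace 𝕜 X →ₗ[𝕜] M}
    (h : ∀ D, f (BSpace.mk 𝕜 D) = g (BSpace.mk 𝕜 D)) : f = g := by
  apply Submodule.linearMap_qext
  apply Finsupp.lhom_ext'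
  intro D
  apply LinearMap.ext_ring
  exact h D

lemma BSpace.induction {p : BSpace 𝕜 X → Prop} (hmk : ∀ D, p (BSpace.mk 𝕜 D))
    (hadd : ∀ a b, p a → p b → p (a + b)) (hsmul : ∀ (c : 𝕜) a, p a → p (c • a))
    (hzero : p 0) (a : BSpace 𝕜 X) : p a := by
  obtain ⟨z, rfl⟩ := Submodule.Quotient.mk_surjective _ a
  induction z using Finsupp.induction_linear with
  | zero => exact hzero
  | add f g hf hg => exact hadd _ _ hf hg
  | single D c =>
    have : Finsupp.single D c = c • Finsupp.single D (1 : 𝕜) := by simp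
    rw [this]
    exact hsmul c _ (hmk D)

/-- The disjoint union of two marked diagrams. -/

abbrev BDiag.union (D D' : BDiag X) : BDiag X where
  L := D.L ⊕ D'.L
  color := Sum.elim D.color D'.color
  G := D.G.union D'.G

lemma BDiag.mk_union_comm (D D' : BDiag X) :
    BSpace.mk 𝕜 (D.union D') = BSpace.mk 𝕜 (D'.union D) := by
  refine BSpace.mk_equiv 𝕜 _ _ (Equiv.sumComm _ _) (Equiv.sumComm _ _) ?_ ?_
  · intro a
    rcases Graph.union_cases a with ⟨a, rfl⟩ | ⟨a, rfl⟩
    · have key : ∀ b : Flag D.G.V D.L, Sum.map (Prod.map (Equiv.sumComm D.G.V D'.G.V) id)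
          (Equiv.sumComm D.L D'.L) (Graph.leftFlag b) = Graph.rightFlag b := by
        rintro (⟨v, k⟩ | b) <;> rfl
      refine (congrArg (Graph.unionEdge D'.G D.G) (key a)).trans ?_
      rw [Graph.unionEdge_right, ← key, ← Graph.unionEdge_left]
      rfl
    · have key : ∀ b : Flag D'.G.V D'.L, Sum.map (Prod.map (Equiv.sumComm D.G.V D'.G.V) id)
          (Equiv.sumComm D.L D'.L) (Graph.rightFlag b) = Graph.leftFlag b := by
        rintro (⟨v, k⟩ | b) <;> rfl
      refine (congrArg (Graph.unionEdge D'.G D.G) (key a)).trans ?_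
      rw [Graph.unionEdge_left, ← key, ← Graph.unionEdge_right]
      rfl
  · rintro (l | l) <;> rfl

/-- Stated for bare edge maps, known only by their values on the half-edges of the summands; these
values determine a nested union completely. -/
lemma Graph.union_assoc_edge {V V' V'' L L' L'' : Type} {e : Flag V L → Flag V L}
    {e' : Flag V' L' → Flag V' L'} {e'' : Flag V'' L'' → Flag V'' L''}
    {u : Flag (V ⊕ V') (L ⊕ L') → Flag (V ⊕ V') (L ⊕ L')}
    {u' : Flag (V' ⊕ V'') (L' ⊕ L'') → Flag (V' ⊕ V'') (L' ⊕ L'')}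
    {w : Flag ((V ⊕ V') ⊕ V'') ((L ⊕ L') ⊕ L'') → Flag ((V ⊕ V') ⊕ V'') ((L ⊕ L') ⊕ L'')}
    {w' : Flag (V ⊕ V' ⊕ V'') (L ⊕ L' ⊕ L'') → Flag (V ⊕ V' ⊕ V'') (L ⊕ L' ⊕ L'')}
    (ul : ∀ a, u (leftFlag a) = leftFlag (e a)) (ur : ∀ a, u (rightFlag a) = rightFlag (e' a))
    (ul' : ∀ a, u' (leftFlag a) = leftFlag (e' a))
    (ur' : ∀ a, u' (rightFlag a) = rightFlag (e'' a))
    (wl : ∀ a, w (leftFlag a) = leftFlag (u a)) (wr : ∀ a, w (rightFlag a) = rightFlag (e'' a))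
    (wl' : ∀ a, w' (leftFlag a) = leftFlag (e a))
    (wr' : ∀ a, w' (rightFlag a) = rightFlag (u' a)) (a) :
    w' (Sum.map (Prod.map (Equiv.sumAssoc V V' V'') id) (Equiv.sumAssoc L L' L'') a) =
      Sum.map (Prod.map (Equiv.sumAssoc V V' V'') id) (Equiv.sumAssoc L L' L'') (w a) := by
  have k1 : ∀ b : Flag V L, Sum.map (Prod.map (Equiv.sumAssoc V V' V'') id)
      (Equiv.sumAssoc L L' L'') (leftFlag (leftFlag b)) = leftFlag b := by
    rintro (⟨v, k⟩ | b) <;> rfl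
  have k2 : ∀ b : Flag V' L', Sum.map (Prod.map (Equiv.sumAssoc V V' V'') id)
      (Equiv.sumAssoc L L' L'') (leftFlag (rightFlag b)) = rightFlag (leftFlag b) := by
    rintro (⟨v, k⟩ | b) <;> rfl
  have k3 : ∀ b : Flag V'' L'', Sum.map (Prod.map (Equiv.sumAssoc V V' V'') id)
      (Equiv.sumAssoc L L' L'') (rightFlag b) = rightFlag (rightFlag b) := by
    rintro (⟨v, k⟩ | b) <;> rfl
  rcases union_cases a with ⟨a, rfl⟩ | ⟨a, rfl⟩
  · rcases union_cases a with ⟨a, rfl⟩ | ⟨a, rfl⟩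
    · rw [k1, wl, ul, wl', k1]
    · rw [k2, wl, ur, wr', ul', k2]
  · rw [k3, wr, wr', ur', k3]

lemma BDiag.mk_union_assoc (D D' D'' : BDiag X) :
    BSpace.mk 𝕜 ((D.union D').union D'') = BSpace.mk 𝕜 (D.union (D'.union D'')) := by
  refine BSpace.mk_equiv 𝕜 _ _ (Equiv.sumAssoc _ _ _) (Equiv.sumAssoc _ _ _) ?_ ?_
  · exact Graph.union_assoc_edge (Graph.unionEdge_left D.G D'.G) (Graph.unionEdge_right D.G D'.G)
      (Graph.unionEdge_left D'.G D''.G) (Graph.unionEdge_right D'.G D''.G)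
      (Graph.unionEdge_left (D.G.union D'.G) D''.G) (Graph.unionEdge_right (D.G.union D'.G) D''.G)
      (Graph.unionEdge_left D.G (D'.G.union D''.G)) (Graph.unionEdge_right D.G (D'.G.union D''.G))
  · rintro ((l | l) | l) <;> rfl

/-- The empty diagram. -/
abbrev BDiag.empty (X : Type) : BDiag X where
  L := Empty
  color := Empty.elim
  G :=
    { V := Empty
      edge := fun a => a
      edge_edge := fun _ => rfl
      edge_ne := by rintro (⟨v, k⟩ | e); exacts [v.elim, e.elim] }

lemma BDiag.mk_empty_union (D : BDiag X) :
    BSpace.mk 𝕜 ((BDiag.empty X).union D) = BSpace.mk 𝕜 D := by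
  refine BSpace.mk_equiv 𝕜 _ _ (Equiv.emptySum _ _) (Equiv.emptySum _ _) ?_ ?_
  · intro a
    have k2 : ∀ b : Flag D.G.V D.L, Sum.map (Prod.map (Equiv.emptySum Empty D.G.V) id)
          (Equiv.emptySum Empty D.L) (Graph.rightFlag b) = b := by
      rintro (⟨v, k⟩ | b) <;> rfl
    rcases Graph.union_cases a with ⟨a, rfl⟩ | ⟨a, rfl⟩
    · rcases a with ⟨v, k⟩ | e
      exacts [v.elim, e.elim]
    · refine (congrArg D.G.edge (k2 a)).trans ?_
      rw [← k2 (D.G.edge a), ← Graph.unionEdge_right (BDiag.empty X).G D.G]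
      rfl
  · rintro (l | l)
    · exact l.elim
    · rfl

lemma BSpace.mk_ihx_union (D D' : BDiag X) (u v : D.G.V) (h : D.G.IsIHX u v) :
    BSpace.mk 𝕜 (D.union D')
      + BSpace.mk 𝕜 (BDiag.union { D with G := D.G.conj (Graph.ihxPerm D.L u v) } D')
      + BSpace.mk 𝕜 (BDiag.union { D with G := D.G.conj (Graph.ihxPerm D.L u v ^ 2) } D') = 0 :=
  let f : Graph (D.L ⊕ D'.L) → BSpace 𝕜 X := fun G =>
    BSpace.mk 𝕜 { L := D.L ⊕ D'.L, color := Sum.elim D.color D'.color, G := G }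
  (congrArg₂ (fun a b => f (D.G.union D'.G) + a + b)
    (congrArg f (Graph.conj_ihx_union D.G D'.G u v)).symm
    (congrArg f (Graph.conj_ihx_sq_union D.G D'.G u v)).symm).trans
  (BSpace.mk_ihx 𝕜 (D.union D') (Sum.inl u) (Sum.inl v) (h.union D'.G))

/-- The product with a diagram given by disjoint union. -/
def BSpace.mulLeft (𝕜 : Type*) [Field 𝕜] (D : BDiag X) : BSpace 𝕜 X →ₗ[𝕜] BSpace 𝕜 X :=
  BSpace.lift (fun D' => BSpace.mk 𝕜 (D'.union D))
    (fun D1 D2 φ hc => by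
      have := BSpace.mk_iso 𝕜 (D1.union D) (D2.union D) (φ.union (Graph.Iso.refl D.G)) (by
        rintro (l | l)
        · exact hc l
        · rfl)
      rwa [Graph.Iso.sign_union, Graph.Iso.sign_refl, mul_one] at this)
    (fun D1 u v h => BSpace.mk_ihx_union D1 D u v h)

/-- The product on the space of marked diagrams given by disjoint union. -/
def BSpace.mulMap (𝕜 : Type*) [Field 𝕜] (X : Type) :
    BSpace 𝕜 X →ₗ[𝕜] BSpace 𝕜 X →ₗ[𝕜] BSpace 𝕜 X :=
  BSpace.lift (fun D => BSpace.mulLeft 𝕜 D)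
    (fun D1 D2 φ hc => by
      apply BSpace.hom_ext
      intro D
      rw [LinearMap.smul_apply, BSpace.mulLeft, BSpace.mulLeft, BSpace.lift_mk, BSpace.lift_mk,
        BDiag.mk_union_comm, BDiag.mk_union_comm D]
      have := BSpace.mk_iso 𝕜 (D1.union D) (D2.union D) (φ.union (Graph.Iso.refl D.G)) (by
        rintro (l | l)
        · exact hc l
        · rfl)
      rwa [Graph.Iso.sign_union, Graph.Iso.sign_refl, mul_one] at this)
    (fun D1 u v h => by
      apply BSpace.hom_ext
      intro D
      simp only [LinearMap.add_apply, BSpace.mulLeft, BSpace.lift_mk]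
      rw [BDiag.mk_union_comm, BDiag.mk_union_comm D, BDiag.mk_union_comm D]
      exact BSpace.mk_ihx_union D1 D u v h)

lemma BSpace.mulMap_mk (D D' : BDiag X) :
    BSpace.mulMap 𝕜 X (BSpace.mk 𝕜 D) (BSpace.mk 𝕜 D') = BSpace.mk 𝕜 (D.union D') := by
  rw [BSpace.mulMap, BSpace.lift_mk, BSpace.mulLeft, BSpace.lift_mk, BDiag.mk_union_comm]

lemma BSpace.mulMap_comm (a b : BSpace 𝕜 X) :
    BSpace.mulMap 𝕜 X a b = BSpace.mulMap 𝕜 X b a := by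
  suffices h : BSpace.mulMap 𝕜 X = (BSpace.mulMap 𝕜 X).flip from
    congrArg (fun f => f a b) h
  apply BSpace.hom_ext
  intro D
  apply BSpace.hom_ext
  intro D'
  rw [LinearMap.flip_apply, BSpace.mulMap_mk, BSpace.mulMap_mk, BDiag.mk_union_comm]

lemma BSpace.mulMap_assoc (a b c : BSpace 𝕜 X) :
    BSpace.mulMap 𝕜 X (BSpace.mulMap 𝕜 X a b) c =
      BSpace.mulMap 𝕜 X a (BSpace.mulMap 𝕜 X b c) := by
  induction a using BSpace.induction with
  | hmk D =>
    induction b using BSpace.induction with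
    | hmk D' =>
      induction c using BSpace.induction with
      | hmk D'' => simp only [BSpace.mulMap_mk, BDiag.mk_union_assoc]
      | hadd a b ha hb => simp only [map_add, ha, hb]
      | hsmul c a ha => simp only [map_smul, ha]
      | hzero => simp only [map_zero]
    | hadd a b ha hb => simp only [map_add, LinearMap.add_apply, ha, hb]
    | hsmul c a ha => simp only [map_smul, LinearMap.smul_apply, ha]
    | hzero => simp only [map_zero, LinearMap.zero_apply]
  | hadd a b ha hb => simp only [map_add, LinearMap.add_apply, ha, hb]
  | hsmul c a ha => simp only [map_smul, LinearMap.smul_apply, ha]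
  | hzero => simp only [map_zero, LinearMap.zero_apply]

lemma BSpace.one_mulMap (a : BSpace 𝕜 X) :
    BSpace.mulMap 𝕜 X (BSpace.mk 𝕜 (BDiag.empty X)) a = a := by
  suffices h : BSpace.mulMap 𝕜 X (BSpace.mk 𝕜 (BDiag.empty X)) = LinearMap.id from
    congrArg (fun f => f a) h
  apply BSpace.hom_ext
  intro D
  rw [BSpace.mulMap_mk, BDiag.mk_empty_union]
  rfl

/-- The product is disjoint union and the unit is the empty diagram. The ring structure allows
forests to be handled as products of trees, with one tree singled out as a factor. -/
instance : CommRing (BSpace 𝕜 X) :=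
  { (inferInstance : AddCommGroup (BSpace 𝕜 X)) with
    mul := fun a b => BSpace.mulMap 𝕜 X a b
    one := BSpace.mk 𝕜 (BDiag.empty X)
    mul_assoc := BSpace.mulMap_assoc
    mul_comm := BSpace.mulMap_comm
    one_mul := BSpace.one_mulMap
    mul_one := fun a => (BSpace.mulMap_comm _ _).trans (BSpace.one_mulMap a)
    left_distrib := fun a b c => map_add (BSpace.mulMap 𝕜 X a) b c
    right_distrib := fun a b c => by
      change BSpace.mulMap 𝕜 X (a + b) c = BSpace.mulMap 𝕜 X a c + BSpace.mulMap 𝕜 X b c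
      rw [map_add, LinearMap.add_apply]
    zero_mul := fun a => by
      change BSpace.mulMap 𝕜 X 0 a = 0
      rw [map_zero, LinearMap.zero_apply]
    mul_zero := fun a => map_zero (BSpace.mulMap 𝕜 X a) }

lemma BSpace.one_def : (1 : BSpace 𝕜 X) = BSpace.mk 𝕜 (BDiag.empty X) := rfl

instance : Algebra 𝕜 (BSpace 𝕜 X) :=
  Algebra.ofModule
    (fun r a b => by
      change BSpace.mulMap 𝕜 X (r • a) b = r • BSpace.mulMap 𝕜 X a b
      rw [map_smul, LinearMap.smul_apply])
    (fun r a b => map_smul (BSpace.mulMap 𝕜 X a) r b)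

lemma BSpace.mk_mul_mk (D D' : BDiag X) :
    BSpace.mk 𝕜 D * BSpace.mk 𝕜 D' = BSpace.mk 𝕜 (D.union D') := BSpace.mulMap_mk D D'

/-! ### Change of marks -/

/-- Change of marks. -/
abbrev BDiag.recolor (f : X → Y) (D : BDiag X) : BDiag Y where
  L := D.L
  color := f ∘ D.color
  G := D.G

/-- Change of marks. -/
def BSpace.mapLin (𝕜 : Type*) [Field 𝕜] (f : X → Y) : BSpace 𝕜 X →ₗ[𝕜] BSpace 𝕜 Y :=
  BSpace.lift (fun D => BSpace.mk 𝕜 (D.recolor f))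
    (fun D D' φ hc => BSpace.mk_iso 𝕜 (D.recolor f) (D'.recolor f) φ fun l => congrArg f (hc l))
    (fun D u v h => BSpace.mk_ihx 𝕜 (D.recolor f) u v h)

lemma BSpace.mapLin_mk (f : X → Y) (D : BDiag X) :
    BSpace.mapLin 𝕜 f (BSpace.mk 𝕜 D) = BSpace.mk 𝕜 (D.recolor f) := by
  rw [BSpace.mapLin, BSpace.lift_mk]

lemma BSpace.mapLin_one (f : X → Y) : BSpace.mapLin 𝕜 f 1 = 1 := by
  rw [BSpace.one_def, BSpace.one_def, BSpace.mapLin_mk]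
  refine BSpace.mk_equiv 𝕜 _ _ (Equiv.refl _) (Equiv.refl _) (fun a => ?_) (fun l => l.elim)
  rcases a with ⟨v, k⟩ | e
  exacts [v.elim, e.elim]

lemma BSpace.mapLin_mul (f : X → Y) (a b : BSpace 𝕜 X) :
    BSpace.mapLin 𝕜 f (a * b) = BSpace.mapLin 𝕜 f a * BSpace.mapLin 𝕜 f b := by
  suffices h : (BSpace.mulMap 𝕜 X).compr₂ (BSpace.mapLin 𝕜 f) =
      (BSpace.mulMap 𝕜 Y).compl₁₂ (BSpace.mapLin 𝕜 f) (BSpace.mapLin 𝕜 f) from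
    congrArg (fun f => f a b) h
  apply BSpace.hom_ext
  intro D
  apply BSpace.hom_ext
  intro D'
  rw [LinearMap.compr₂_apply, LinearMap.compl₁₂_apply, BSpace.mulMap_mk]
  simp only [BSpace.mapLin_mk, BSpace.mulMap_mk]
  refine BSpace.mk_equiv 𝕜 _ _ (Equiv.refl _) (Equiv.refl _) (fun a => ?_) ?_
  · rw [flag_map_id]
    exact (flag_map_id _).symm
  · rintro (l | l) <;> rfl

/-- Change of marks. -/
def BSpace.map (𝕜 : Type*) [Field 𝕜] (f : X → Y) : BSpace 𝕜 X →ₐ[𝕜] BSpace 𝕜 Y :=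
  AlgHom.ofLinearMap (BSpace.mapLin 𝕜 f) (BSpace.mapLin_one f) (BSpace.mapLin_mul f)

@[simp] lemma BSpace.map_mk (f : X → Y) (D : BDiag X) :
    BSpace.map 𝕜 f (BSpace.mk 𝕜 D) = BSpace.mk 𝕜 (D.recolor f) :=
  BSpace.mapLin_mk f D

end

end Jacobi

namespace Jacobi

noncomputable section

variable {𝕜 : Type*} [Field 𝕜] {X Y Z : Type}

/-! ### Disjoint unions of families as products -/

lemma Graph.sigma_edge {ι : Type} [Fintype ι] {F : ι → Type} (G : ∀ i, Graph (F i)) (i : ι)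
    (a : Flag (G i).V (F i)) :
    (Graph.sigma G).edge (Graph.sigmaFlag G i a) = Graph.sigmaFlag G i ((G i).edge a) := by
  rcases a with ⟨v, k⟩ | e <;> rfl

lemma Graph.sigma_cases {ι : Type} {F : ι → Type} (G : ∀ i, Graph (F i))
    (b : Flag (Σ j, (G j).V) (Σ j, F j)) : ∃ i a, b = Graph.sigmaFlag G i a := by
  rcases b with ⟨⟨i, v⟩, k⟩ | ⟨i, e⟩
  · exact ⟨i, Sum.inl (v, k), rfl⟩
  · exact ⟨i, Sum.inr e, rfl⟩

/-- A family of graphs with marked ends as a marked diagram. -/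
abbrev BDiag.sigma {ι : Type} [Fintype ι] (D : ι → BDiag X) : BDiag X where
  L := Σ i, (D i).L
  color l := (D l.1).color l.2
  G := Graph.sigma fun i => (D i).G

/-- The index set of a family over `Option α` split into two parts. -/
def sigmaOption {α : Type} (F : Option α → Type) : (Σ o, F o) ≃ F none ⊕ Σ a, F (some a) where
  toFun
    | ⟨none, x⟩ => Sum.inl x
    | ⟨some a, x⟩ => Sum.inr ⟨a, x⟩
  invFun := Sum.elim (fun x => ⟨none, x⟩) (fun p => ⟨some p.1, p.2⟩)
  left_inv := by rintro ⟨_ | a, x⟩ <;> rfl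
  right_inv := by rintro (x | ⟨a, x⟩) <;> rfl

/-- The link between the families in the definition of $j_m$ and the algebra. By induction over
finite index types: transport along a bijection, the empty family, and one additional member. -/
lemma BDiag.mk_sigma {ι : Type} [Fintype ι] (D : ι → BDiag X) :
    BSpace.mk 𝕜 (BDiag.sigma D) = ∏ i, BSpace.mk 𝕜 (D i) := by
  refine Fintype.induction_empty_option (P := fun ι _ => ∀ D : ι → BDiag X,
    BSpace.mk 𝕜 (BDiag.sigma D) = ∏ i, BSpace.mk 𝕜 (D i)) ?_ ?_ ?_ ι D
  · intro α β _ e ih D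
    let _ : Fintype α := Fintype.ofEquiv β e.symm
    have h := ih (D ∘ e)
    rw [← Equiv.prod_comp e (fun i => BSpace.mk 𝕜 (D i))]
    refine Eq.trans ?_ h
    symm
    have key : ∀ i (a : Flag (D (e i)).G.V (D (e i)).L),
        Sum.map (Prod.map (Equiv.sigmaCongrLeft (β := fun i => (D i).G.V) e) id)
          (Equiv.sigmaCongrLeft (β := fun i => (D i).L) e)
          (Graph.sigmaFlag (fun i => (D (e i)).G) i a) =
          Graph.sigmaFlag (fun i => (D i).G) (e i) a := by
      rintro i (⟨v, k⟩ | a) <;> rfl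
    refine BSpace.mk_equiv 𝕜 (BDiag.sigma (D ∘ e)) (BDiag.sigma D)
      (Equiv.sigmaCongrLeft (β := fun i => (D i).L) e)
      (Equiv.sigmaCongrLeft (β := fun i => (D i).G.V) e) (fun b => ?_) (fun l => rfl)
    obtain ⟨i, a, rfl⟩ := Graph.sigma_cases (fun i => (D (e i)).G) b
    refine (congrArg (Graph.sigma fun i => (D i).G).edge (key i a)).trans ?_
    refine (Graph.sigma_edge (fun i => (D i).G) (e i) a).trans ?_
    refine (key i _).symm.trans ?_
    exact congrArg _ (Graph.sigma_edge (fun i => (D (e i)).G) i a).symm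
  · intro D
    rw [Fintype.prod_empty, BSpace.one_def]
    refine BSpace.mk_equiv 𝕜 _ _ (Equiv.equivOfIsEmpty _ _)
      (Equiv.equivOfIsEmpty (Σ i : PEmpty, (D i).G.V) Empty)
      (fun a => ?_) (fun l => l.1.elim)
    rcases a with ⟨⟨v, _⟩, _⟩ | ⟨v, _⟩ <;> exact v.elim
  · intro α _ ih D
    rw [Fintype.prod_option, ← ih, BSpace.mk_mul_mk]
    have k1 : ∀ a : Flag (D none).G.V (D none).L,
        Sum.map (Prod.map (sigmaOption fun i => (D i).G.V) id) (sigmaOption fun i => (D i).L)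
          (Graph.sigmaFlag (fun i => (D i).G) none a) = Graph.leftFlag a := by
      rintro (⟨v, k⟩ | a) <;> rfl
    have k2 : ∀ i (a : Flag (D (some i)).G.V (D (some i)).L),
        Sum.map (Prod.map (sigmaOption fun i => (D i).G.V) id) (sigmaOption fun i => (D i).L)
          (Graph.sigmaFlag (fun i => (D i).G) (some i) a) =
        Graph.rightFlag (Graph.sigmaFlag (fun i => (D (some i)).G) i a) := by
      rintro i (⟨v, k⟩ | a) <;> rfl
    refine BSpace.mk_equiv 𝕜 (BDiag.sigma D) ((D none).union (BDiag.sigma fun i => D (some i)))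
      (sigmaOption fun i => (D i).L) (sigmaOption fun i => (D i).G.V) (fun b => ?_) ?_
    · obtain ⟨_ | i, a, rfl⟩ := Graph.sigma_cases (fun i => (D i).G) b
      · refine (congrArg (Graph.unionEdge _ _) (k1 a)).trans ?_
        refine (Graph.unionEdge_left (D none).G (BDiag.sigma fun i => D (some i)).G a).trans ?_
        refine (k1 _).symm.trans ?_
        exact congrArg _ (Graph.sigma_edge (fun i => (D i).G) none a).symm
      · refine (congrArg (Graph.unionEdge _ _) (k2 i a)).trans ?_
        refine (Graph.unionEdge_right (D none).G (BDiag.sigma fun i => D (some i)).G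
          (Graph.sigmaFlag (fun i => (D (some i)).G) i a)).trans ?_
        refine (congrArg Graph.rightFlag
          (Graph.sigma_edge (fun i => (D (some i)).G) i a)).trans ?_
        refine (k2 i _).symm.trans ?_
        exact congrArg _ (Graph.sigma_edge (fun i => (D i).G) (some i) a).symm
    · rintro ⟨_ | i, l⟩ <;> rfl

/-! ### Gluing of marked diagrams -/

/-- Two marked diagrams glued along a bijection of their legs. -/
abbrev glueAlong (D H : BDiag Y) (f : D.L ≃ H.L) : CDiag where
  J := D.L ⊕ H.L
  glue := ⟨Sum.elim (fun l => Sum.inr (f l)) (fun l => Sum.inl (f.symm l)), by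
    rintro (l | l) <;> simp, by rintro (l | l) <;> simp⟩
  G := D.G.union H.G

/-- The bijections of the legs that preserve the marks. -/
abbrev LegMatch (D H : BDiag Y) : Type :=
  {f : D.L ≃ H.L // ∀ l, H.color (f l) = D.color l}

open scoped Classical in
/-- The result of gluing two diagrams, whose legs have different marks, at equal marks. -/
def glDiag (𝕜 : Type*) [Field 𝕜] (D H : BDiag Y) : CSpace 𝕜 :=
  if Function.Injective D.color then
    ∑ f : LegMatch D H, CSpace.mk 𝕜 (glueAlong D H f.1)
  else 0

lemma LegMatch.injective {D H : BDiag Y} (f : LegMatch D H) (h : Function.Injective D.color) :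
    Function.Injective H.color := by
  have : H.color = D.color ∘ f.1.symm := by
    funext l
    rw [Function.comp_apply, ← f.2, Equiv.apply_symm_apply]
  rw [this]
  exact h.comp f.1.symm.injective

/-- Distinct marks force the match, so the sum that defines `glDiag` has at most one term. -/
lemma LegMatch.subsingleton {D H : BDiag Y} (h : Function.Injective D.color) :
    Subsingleton (LegMatch D H) := ⟨fun f g => by
  apply Subtype.ext
  ext l
  apply f.injective h
  rw [f.2, g.2]⟩

lemma glDiag_eq {D H : BDiag Y} (h : Function.Injective D.color) (f : LegMatch D H) :
    glDiag 𝕜 D H = CSpace.mk 𝕜 (glueAlong D H f.1) := by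
  classical
  rw [glDiag, if_pos h]
  have := LegMatch.subsingleton (H := H) h
  exact Fintype.sum_eq_single f (fun g hg => absurd (Subsingleton.elim g f) hg)

lemma glDiag_of_isEmpty {D H : BDiag Y} (h : IsEmpty (LegMatch D H)) : glDiag 𝕜 D H = 0 := by
  classical
  rw [glDiag]
  split_ifs
  · exact Fintype.sum_empty _
  · rfl

lemma glDiag_of_not_injective {D H : BDiag Y} (h : ¬ Function.Injective D.color) :
    glDiag 𝕜 D H = 0 := by
  rw [glDiag, if_neg h]

/-- Symmetry reduces the relations in the second argument of `gl` to those in the first. -/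
lemma glDiag_comm (D H : BDiag Y) : glDiag 𝕜 D H = glDiag 𝕜 H D := by
  by_cases h : Nonempty (LegMatch D H)
  · obtain ⟨f⟩ := h
    let g : LegMatch H D := ⟨f.1.symm, fun l => by rw [← f.2, Equiv.apply_symm_apply]⟩
    by_cases hD : Function.Injective D.color
    · rw [glDiag_eq hD f, glDiag_eq (f.injective hD) g]
      refine CSpace.mk_equiv 𝕜 _ _ (Equiv.sumComm _ _) (Equiv.sumComm _ _) (fun a => ?_) ?_
      · have k1 : ∀ b : Flag D.G.V D.L, Sum.map (Prod.map (Equiv.sumComm D.G.V H.G.V) id)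
            (Equiv.sumComm D.L H.L) (Graph.leftFlag b) = Graph.rightFlag b := by
          rintro (⟨v, k⟩ | b) <;> rfl
        have k2 : ∀ b : Flag H.G.V H.L, Sum.map (Prod.map (Equiv.sumComm D.G.V H.G.V) id)
            (Equiv.sumComm D.L H.L) (Graph.rightFlag b) = Graph.leftFlag b := by
          rintro (⟨v, k⟩ | b) <;> rfl
        rcases Graph.union_cases a with ⟨a, rfl⟩ | ⟨a, rfl⟩
        · refine (congrArg (Graph.unionEdge H.G D.G) (k1 a)).trans ?_
          rw [Graph.unionEdge_right, ← k1, ← Graph.unionEdge_left]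
          rfl
        · refine (congrArg (Graph.unionEdge H.G D.G) (k2 a)).trans ?_
          rw [Graph.unionEdge_left, ← k2, ← Graph.unionEdge_right]
          rfl
      · rintro (l | l) <;> rfl
    · have hH : ¬ Function.Injective H.color := fun h => hD (g.injective h)
      rw [glDiag_of_not_injective hD, glDiag_of_not_injective hH]
  · have h' : IsEmpty (LegMatch H D) := ⟨fun f => h ⟨⟨f.1.symm, fun l => by
      rw [← f.2, Equiv.apply_symm_apply]⟩⟩⟩
    rw [glDiag_of_isEmpty (not_nonempty_iff.1 h), glDiag_of_isEmpty h']

lemma glDiag_iso (D D' H : BDiag Y) (φ : Graph.Iso D.G D'.G)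
    (hc : ∀ l, D'.color (φ.ext l) = D.color l) :
    glDiag 𝕜 D H = (φ.sign : 𝕜) • glDiag 𝕜 D' H := by
  have hinj : Function.Injective D.color ↔ Function.Injective D'.color := by
    have : D.color = D'.color ∘ φ.ext := funext fun l => (hc l).symm
    rw [this, Equiv.injective_comp]
  by_cases hD : Function.Injective D.color
  · by_cases h : Nonempty (LegMatch D H)
    · obtain ⟨f⟩ := h
      let g : LegMatch D' H := ⟨φ.ext.symm.trans f.1, fun l => by
        change H.color (f.1 (φ.ext.symm l)) = _
        rw [f.2, ← hc, Equiv.apply_symm_apply]⟩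
      rw [glDiag_eq hD f, glDiag_eq (hinj.1 hD) g]
      have := CSpace.mk_iso 𝕜 (glueAlong D H f.1) (glueAlong D' H g.1)
        (φ.union (Graph.Iso.refl H.G)) (by
          rintro (l | l)
          · exact congrArg (fun l => Sum.inr (f.1 l)) (φ.ext.symm_apply_apply l)
          · rfl)
      rwa [Graph.Iso.sign_union, Graph.Iso.sign_refl, mul_one] at this
    · have h' : IsEmpty (LegMatch D' H) := ⟨fun f => h ⟨⟨φ.ext.trans f.1, fun l => by
        rw [Equiv.trans_apply, f.2, hc]⟩⟩⟩
      rw [glDiag_of_isEmpty (not_nonempty_iff.1 h), glDiag_of_isEmpty h', smul_zero]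
  · rw [glDiag_of_not_injective hD, glDiag_of_not_injective (fun h => hD (hinj.2 h)), smul_zero]

lemma glDiag_ihx (D H : BDiag Y) (u v : D.G.V) (h : D.G.IsIHX u v) :
    glDiag 𝕜 D H + glDiag 𝕜 { D with G := D.G.conj (Graph.ihxPerm D.L u v) } H
      + glDiag 𝕜 { D with G := D.G.conj (Graph.ihxPerm D.L u v ^ 2) } H = 0 := by
  by_cases hD : Function.Injective D.color
  · by_cases hf : Nonempty (LegMatch D H)
    · obtain ⟨f⟩ := hf
      rw [glDiag_eq hD f, glDiag_eq (D := { D with G := D.G.conj (Graph.ihxPerm D.L u v) }) hD f,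
        glDiag_eq (D := { D with G := D.G.conj (Graph.ihxPerm D.L u v ^ 2) }) hD f]
      let F : Graph (D.L ⊕ H.L) → CSpace 𝕜 := fun G =>
        CSpace.mk 𝕜 { J := D.L ⊕ H.L, glue := (glueAlong D H f.1).glue, G := G }
      exact (congrArg₂ (fun a b => F (D.G.union H.G) + a + b)
        (congrArg F (Graph.conj_ihx_union D.G H.G u v)).symm
        (congrArg F (Graph.conj_ihx_sq_union D.G H.G u v)).symm).trans
        (CSpace.mk_ihx 𝕜 (glueAlong D H f.1) (Sum.inl u) (Sum.inl v) (h.union H.G))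
    · have h' := not_nonempty_iff.1 hf
      rw [glDiag_of_isEmpty h',
        glDiag_of_isEmpty (D := { D with G := D.G.conj (Graph.ihxPerm D.L u v) }) h',
        glDiag_of_isEmpty (D := { D with G := D.G.conj (Graph.ihxPerm D.L u v ^ 2) }) h']
      simp
  · rw [glDiag_of_not_injective hD,
      glDiag_of_not_injective (D := { D with G := D.G.conj (Graph.ihxPerm D.L u v) }) hD,
      glDiag_of_not_injective (D := { D with G := D.G.conj (Graph.ihxPerm D.L u v ^ 2) }) hD]
    simp

/-- The bilinear extension of the gluing of diagrams at equal marks. -/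
def gl (𝕜 : Type*) [Field 𝕜] (Y : Type) : BSpace 𝕜 Y →ₗ[𝕜] BSpace 𝕜 Y →ₗ[𝕜] CSpace 𝕜 :=
  BSpace.lift
    (fun D => BSpace.lift (fun H => glDiag 𝕜 D H)
      (fun H H' φ hc => by
        rw [glDiag_comm, glDiag_comm D]
        exact glDiag_iso H H' D φ hc)
      (fun H u v h => by
        rw [glDiag_comm, glDiag_comm D, glDiag_comm D]
        exact glDiag_ihx H D u v h))
    (fun D D' φ hc => by
      apply BSpace.hom_ext
      intro H
      rw [LinearMap.smul_apply, BSpace.lift_mk, BSpace.lift_mk]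
      exact glDiag_iso D D' H φ hc)
    (fun D u v h => by
      apply BSpace.hom_ext
      intro H
      simp only [LinearMap.add_apply, BSpace.lift_mk]
      exact glDiag_ihx D H u v h)

lemma gl_mk (D H : BDiag Y) : gl 𝕜 Y (BSpace.mk 𝕜 D) (BSpace.mk 𝕜 H) = glDiag 𝕜 D H := by
  rw [gl, BSpace.lift_mk, BSpace.lift_mk]

lemma glDiag_recolor {f : X → Y} (hf : Function.Injective f) (D H : BDiag X) :
    glDiag 𝕜 (D.recolor f) (H.recolor f) = glDiag 𝕜 D H := by
  have hinj : Function.Injective (D.recolor f).color ↔ Function.Injective D.color :=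
    hf.of_comp_iff _
  by_cases hD : Function.Injective D.color
  · by_cases h : Nonempty (LegMatch D H)
    · obtain ⟨g⟩ := h
      rw [glDiag_eq hD g, glDiag_eq (H := H.recolor f) (hinj.2 hD)
        ⟨g.1, fun l => congrArg f (g.2 l)⟩]
    · rw [glDiag_of_isEmpty (not_nonempty_iff.1 h), glDiag_of_isEmpty]
      exact ⟨fun g => h ⟨⟨g.1, fun l => hf (g.2 l)⟩⟩⟩
  · rw [glDiag_of_not_injective hD, glDiag_of_not_injective (fun h => hD (hinj.1 h))]

/-- Only coincidences of marks enter the gluing. Consequently marks may be exchanged on both sides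
at once, and the legs of a joined diagram may keep the marks of the original one. -/
lemma gl_map {f : X → Y} (hf : Function.Injective f) (a b : BSpace 𝕜 X) :
    gl 𝕜 Y (BSpace.map 𝕜 f a) (BSpace.map 𝕜 f b) = gl 𝕜 X a b := by
  induction a using BSpace.induction with
  | hmk D =>
    induction b using BSpace.induction with
    | hmk H => rw [BSpace.map_mk, BSpace.map_mk, gl_mk, gl_mk, glDiag_recolor hf]
    | hadd a b ha hb => simp only [map_add, ha, hb]
    | hsmul c a ha => simp only [map_smul, ha]
    | hzero => simp only [map_zero]
  | hadd a b ha hb => simp only [map_add, LinearMap.add_apply, ha, hb]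
  | hsmul c a ha => simp only [map_smul, LinearMap.smul_apply, ha]
  | hzero => simp only [map_zero, LinearMap.zero_apply]

end

end Jacobi

namespace Jacobi

noncomputable section

variable {𝕜 : Type*} [Field 𝕜] {X Y Z : Type}

/-! ### Joining two legs -/

namespace Graph

lemma swap_map {α β : Type} (i1 : DecidableEq α) (i2 : DecidableEq β) {s : α → β}
    (hs : Function.Injective s) (x y z : α) :
    @Equiv.swap _ i2 (s x) (s y) (s z) = s (@Equiv.swap _ i1 x y z) :=
  @Function.Injective.swap_apply _ _ i1 i2 _ hs x y z

lemma ihxPerm_map {V V' E E' : Type} {s : Flag V E → Flag V' E'} (hs : Function.Injective s)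
    (g : V → V') (hg : ∀ v k, s (Sum.inl (v, k)) = Sum.inl (g v, k)) (u v : V) (a : Flag V E) :
    ihxPerm E' (g u) (g v) (s a) = s (ihxPerm E u v a) := by
  classical
  unfold ihxPerm
  rw [Equiv.Perm.mul_apply, Equiv.Perm.mul_apply, ← hg u 0, ← hg u 1, ← hg v 1,
    swap_map inferInstance _ hs, swap_map inferInstance _ hs]

lemma swap_left_apply {α : Type} (i : DecidableEq α) (x y : α) : @Equiv.swap _ i x y x = y :=
  Equiv.swap_apply_left x y

lemma swap_right_apply {α : Type} (i : DecidableEq α) (x y : α) : @Equiv.swap _ i x y y = x :=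
  Equiv.swap_apply_right x y

lemma ihxPerm_zero {V : Type} (E : Type) {u v : V} :
    ihxPerm E u v (Sum.inl (u, 0)) = Sum.inl (u, 1) := by
  unfold ihxPerm
  rw [Equiv.Perm.mul_apply, swap_apply_of_ne (x := Sum.inl (u, 1)) (y := Sum.inl (v, 1)) _
    (by simp) (by simp), swap_left_apply]

lemma ihxPerm_one {V : Type} (E : Type) {u v : V} (h : u ≠ v) :
    ihxPerm E u v (Sum.inl (u, 1)) = Sum.inl (v, 1) := by
  unfold ihxPerm
  rw [Equiv.Perm.mul_apply, swap_left_apply, swap_apply_of_ne _ (by simp) (by simp [h.symm])]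

lemma ihxPerm_two {V : Type} (E : Type) {u v : V} :
    ihxPerm E u v (Sum.inl (v, 1)) = Sum.inl (u, 0) := by
  unfold ihxPerm
  rw [Equiv.Perm.mul_apply, swap_right_apply, swap_right_apply]

/-- The graph in which the legs `p` and `q` are joined in a new vertex with a new leg, which is
kept at `p`. -/
abbrev join {L : Type} (G : Graph L) (p q : L) (hpq : p ≠ q) : Graph {l : L // l ≠ q} where
  V := Option G.V
  edge := ADiag.stuEdge G p q hpq
  edge_edge := fun b => by
    rcases ADiag.stu_cases p q hpq b with ⟨a, rfl⟩ | rfl | rfl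
    · rw [ADiag.stuEdge_stuFlag, ADiag.stuEdge_stuFlag, G.edge_edge]
    · simp [ADiag.stuEdge]
    · simp [ADiag.stuEdge]
  edge_ne := fun b => by
    rcases ADiag.stu_cases p q hpq b with ⟨a, rfl⟩ | rfl | rfl
    · rw [ADiag.stuEdge_stuFlag]
      exact fun h => G.edge_ne a (ADiag.stuFlag_injective p q h)
    · simp [ADiag.stuEdge]
    · simp [ADiag.stuEdge]

open ADiag (stuFlag stuEdge stu_cases stuEdge_stuFlag stuFlag_injective)

lemma stuFlag_inl {V L : Type} (p q : L) (v : V) (k : Fin 3) :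
    stuFlag p q (Sum.inl (v, k)) = Sum.inl (some v, k) := rfl

lemma stuFlag_fst {V L : Type} (p q : L) :
    stuFlag (V := V) p q (Sum.inr p) = Sum.inl (none, 0) := by simp [stuFlag]

lemma stuFlag_snd {V L : Type} {p q : L} (h : p ≠ q) :
    stuFlag (V := V) p q (Sum.inr q) = Sum.inl (none, 1) := by simp [stuFlag, h.symm]

lemma stuFlag_of_ne {V L : Type} {p q l : L} (h : l ≠ p) (h' : l ≠ q) :
    stuFlag (V := V) p q (Sum.inr l) = Sum.inr ⟨l, h'⟩ := by simp [stuFlag, h, h']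

lemma stuEdge_two {L : Type} (G : Graph L) (p q : L) (hpq : p ≠ q) :
    stuEdge G p q hpq (Sum.inl (none, 2)) = Sum.inr ⟨p, hpq⟩ := by simp [stuEdge]

lemma stuEdge_leg {L : Type} (G : Graph L) (p q : L) (hpq : p ≠ q) :
    stuEdge G p q hpq (Sum.inr ⟨p, hpq⟩) = Sum.inl (none, 2) := by simp [stuEdge]

/-- An identification of graphs is an identification of the graphs with joined legs. -/
def Iso.join {L L' : Type} {G : Graph L} {G' : Graph L'} (φ : Iso G G') (p q : L) (hpq : p ≠ q) :
    Iso (G.join p q hpq) (G'.join (φ.ext p) (φ.ext q) (φ.ext.injective.ne hpq)) where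
  ext := φ.ext.subtypeEquiv fun l => not_congr (φ.ext.injective.eq_iff).symm
  vtx := Equiv.optionCongr φ.vtx
  rot := fun v => v.elim 1 φ.rot
  edge_comm b := by
    have key : ∀ a : Flag G.V L,
        Sum.map (fun w : Option G.V × Fin 3 => (Equiv.optionCongr φ.vtx w.1,
          (w.1.elim 1 φ.rot : Equiv.Perm (Fin 3)) w.2))
          (φ.ext.subtypeEquiv fun l => not_congr (φ.ext.injective.eq_iff).symm)
          (stuFlag p q a) = stuFlag (φ.ext p) (φ.ext q)
            (Sum.map (fun w => (φ.vtx w.1, φ.rot w.1 w.2)) φ.ext a) := by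
      rintro (⟨v, k⟩ | l)
      · rfl
      · by_cases h1 : l = p
        · subst h1; rw [stuFlag_fst]; simp [stuFlag_fst]
        · by_cases h2 : l = q
          · subst h2; rw [stuFlag_snd hpq]; simp [stuFlag_snd (φ.ext.injective.ne hpq)]
          · rw [stuFlag_of_ne h1 h2, Sum.map_inr, Sum.map_inr,
              stuFlag_of_ne (φ.ext.injective.ne h1) (φ.ext.injective.ne h2)]
            rfl
    rcases stu_cases p q hpq b with ⟨a, rfl⟩ | rfl | rfl
    · dsimp only
      rw [key, stuEdge_stuFlag, stuEdge_stuFlag, key, φ.edge_comm]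
    · dsimp only
      rw [stuEdge_two]
      exact stuEdge_two _ _ _ _
    · dsimp only
      rw [stuEdge_leg]
      exact stuEdge_leg _ _ _ _

lemma Iso.sign_join {L L' : Type} {G : Graph L} {G' : Graph L'} (φ : Iso G G') (p q : L)
    (hpq : p ≠ q) : (φ.join p q hpq).sign = φ.sign := by
  simp only [Iso.sign, Iso.join]
  refine (Fintype.prod_option _).trans ?_
  simp

lemma conj_join {L : Type} (G : Graph L) (p q : L) (hpq : p ≠ q)
    (ρ : Equiv.Perm (Flag G.V L)) (ρ' : Equiv.Perm (Flag (Option G.V) {l // l ≠ q}))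
    (h : ∀ a, ρ' (stuFlag p q a) = stuFlag p q (ρ a))
    (h2 : ρ' (Sum.inl (none, 2)) = Sum.inl (none, 2))
    (hp : ρ' (Sum.inr ⟨p, hpq⟩) = Sum.inr ⟨p, hpq⟩) :
    (G.join p q hpq).conj ρ' = (G.conj ρ).join p q hpq := by
  refine mk_congr (fun b => ?_) _ _ _ _
  rcases stu_cases p q hpq b with ⟨a, rfl⟩ | rfl | rfl
  · have : ρ'.symm (stuFlag p q a) = stuFlag p q (ρ.symm a) := by
      rw [Equiv.symm_apply_eq, h, Equiv.apply_symm_apply]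
    refine Eq.trans ?_ (stuEdge_stuFlag (G.conj ρ) p q hpq a).symm
    rw [this]
    exact (congrArg ρ' (stuEdge_stuFlag G p q hpq _)).trans (h _)
  · rw [(Equiv.symm_apply_eq ρ').2 h2.symm]
    refine Eq.trans ?_ (stuEdge_two (G.conj ρ) p q hpq).symm
    exact (congrArg ρ' (stuEdge_two G p q hpq)).trans hp
  · rw [(Equiv.symm_apply_eq ρ').2 hp.symm]
    refine Eq.trans ?_ (stuEdge_leg (G.conj ρ) p q hpq).symm
    exact (congrArg ρ' (stuEdge_leg G p q hpq)).trans h2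

lemma conj_ihx_join {L : Type} (G : Graph L) (p q : L) (hpq : p ≠ q) (u v : G.V) :
    (G.join p q hpq).conj (ihxPerm {l // l ≠ q} (some u) (some v)) =
      (G.conj (ihxPerm L u v)).join p q hpq :=
  conj_join G p q hpq _ _
    (ihxPerm_map (stuFlag_injective p q) some (stuFlag_inl p q) u v)
    (ihxPerm_of_ne _ _ _ (by simp) (by simp) (by simp))
    (ihxPerm_of_ne _ _ _ (by simp) (by simp) (by simp))

lemma perm_sq_apply {α : Type*} (ρ : Equiv.Perm α) (a : α) : (ρ ^ 2) a = ρ (ρ a) := by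
  rw [pow_two, Equiv.Perm.mul_apply]

lemma conj_ihx_sq_join {L : Type} (G : Graph L) (p q : L) (hpq : p ≠ q) (u v : G.V) :
    (G.join p q hpq).conj (ihxPerm {l // l ≠ q} (some u) (some v) ^ 2) =
      (G.conj (ihxPerm L u v ^ 2)).join p q hpq := by
  have h1 : ihxPerm {l // l ≠ q} (some u) (some v) (Sum.inl (none, 2)) = Sum.inl (none, 2) :=
    ihxPerm_of_ne _ _ _ (by simp) (by simp) (by simp)
  have h2 : ihxPerm {l // l ≠ q} (some u) (some v) (Sum.inr ⟨p, hpq⟩) = Sum.inr ⟨p, hpq⟩ :=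
    ihxPerm_of_ne _ _ _ (by simp) (by simp) (by simp)
  refine conj_join G p q hpq _ _ (fun a => ?_) ?_ ?_
  · rw [perm_sq_apply, perm_sq_apply,
      ihxPerm_map (stuFlag_injective p q) some (stuFlag_inl p q) u v,
      ihxPerm_map (stuFlag_injective p q) some (stuFlag_inl p q) u v]
  · rw [perm_sq_apply, h1, h1]
  · rw [perm_sq_apply, h2, h2]

lemma IsIHX.join {L : Type} {G : Graph L} {u v : G.V} (h : G.IsIHX u v) (p q : L)
    (hpq : p ≠ q) : (G.join p q hpq).IsIHX (some u) (some v) := by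
  refine ⟨fun h' => h.1 (Option.some_injective _ h'), ?_⟩
  have := stuEdge_stuFlag G p q hpq (Sum.inl (u, 2))
  rw [h.2] at this
  exact this

end Graph

open scoped Classical in
/-- The marked diagram in which the legs `p` and `q` are joined. -/
abbrev BDiag.join (D : BDiag Y) (p q : D.L) (hpq : p ≠ q) : BDiag Y where
  L := {l : D.L // l ≠ q}
  color l := D.color l.1
  G := D.G.join p q hpq

lemma BDiag.join_injective {D : BDiag Y} (h : Function.Injective D.color) (p q : D.L)
    (hpq : p ≠ q) : Function.Injective (D.join p q hpq).color :=
  h.comp Subtype.val_injective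

open scoped Classical in
/-- The diagram in which the legs with the marks `x` and `y` are joined to a leg with the mark `x`,
if the legs of `D` have different marks. -/
def joinDiag (𝕜 : Type*) [Field 𝕜] (x y : Y) (D : BDiag Y) : BSpace 𝕜 Y :=
  if Function.Injective D.color then
    ∑ r : {r : D.L × D.L // D.color r.1 = x ∧ D.color r.2 = y ∧ r.1 ≠ r.2},
      BSpace.mk 𝕜 (D.join r.1.1 r.1.2 r.2.2.2)
  else 0

lemma joinDiag_of_not_injective {x y : Y} {D : BDiag Y} (h : ¬ Function.Injective D.color) :
    joinDiag 𝕜 x y D = 0 := by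
  rw [joinDiag, if_neg h]

lemma joinDiag_eq {x y : Y} {D : BDiag Y} (h : Function.Injective D.color) (p q : D.L)
    (hpq : p ≠ q) (hp : D.color p = x) (hq : D.color q = y) :
    joinDiag 𝕜 x y D = BSpace.mk 𝕜 (D.join p q hpq) := by
  classical
  rw [joinDiag, if_pos h]
  refine Fintype.sum_eq_single (⟨(p, q), hp, hq, hpq⟩ : {r : D.L × D.L //
    D.color r.1 = x ∧ D.color r.2 = y ∧ r.1 ≠ r.2}) (fun g hg => absurd ?_ hg)
  apply Subtype.ext
  exact Prod.ext (h (g.2.1.trans hp.symm)) (h (g.2.2.1.trans hq.symm))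

lemma joinDiag_of_forall_ne {x y : Y} {D : BDiag Y}
    (h : (∀ l, D.color l ≠ x) ∨ ∀ l, D.color l ≠ y) : joinDiag 𝕜 x y D = 0 := by
  classical
  rw [joinDiag]
  split_ifs
  · have : IsEmpty {r : D.L × D.L // D.color r.1 = x ∧ D.color r.2 = y ∧ r.1 ≠ r.2} :=
      ⟨fun r => h.elim (fun h => h _ r.2.1) (fun h => h _ r.2.2.1)⟩
    exact Fintype.sum_empty _
  · rfl

lemma joinDiag_self {x : Y} {D : BDiag Y} : joinDiag 𝕜 x x D = 0 := by
  classical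
  rw [joinDiag]
  split_ifs with hD
  · have : IsEmpty {r : D.L × D.L // D.color r.1 = x ∧ D.color r.2 = x ∧ r.1 ≠ r.2} :=
      ⟨fun r => r.2.2.2 (hD (r.2.1.trans r.2.2.1.symm))⟩
    exact Fintype.sum_empty _
  · rfl

/-- For diagrams with different marks on their legs, a linear equation between joins may be checked
under the assumption that the marks in question occur. -/
lemma exists_legs_or (D : BDiag Y) (x y : Y) (hxy : x ≠ y) :
    ((∀ l, D.color l ≠ x) ∨ ∀ l, D.color l ≠ y) ∨
      ∃ p q, p ≠ q ∧ D.color p = x ∧ D.color q = y := by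
  by_cases h1 : ∃ p, D.color p = x
  · by_cases h2 : ∃ q, D.color q = y
    · obtain ⟨p, rfl⟩ := h1
      obtain ⟨q, rfl⟩ := h2
      exact Or.inr ⟨p, q, fun h => hxy (congrArg _ h), rfl, rfl⟩
    · push Not at h2
      exact Or.inl (Or.inr h2)
  · push Not at h1
    exact Or.inl (Or.inl h1)

lemma joinDiag_iso (x y : Y) (D D' : BDiag Y) (φ : Graph.Iso D.G D'.G)
    (hc : ∀ l, D'.color (φ.ext l) = D.color l) :
    joinDiag 𝕜 x y D = (φ.sign : 𝕜) • joinDiag 𝕜 x y D' := by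
  have hcol : D.color = D'.color ∘ φ.ext := funext fun l => (hc l).symm
  have hinj : Function.Injective D.color ↔ Function.Injective D'.color := by
    rw [hcol, Equiv.injective_comp]
  by_cases hxy : x = y
  · subst hxy; rw [joinDiag_self, joinDiag_self, smul_zero]
  by_cases hD : Function.Injective D.color
  · rcases exists_legs_or D x y hxy with h | ⟨p, q, hpq, hp, hq⟩
    · have h' : (∀ l, D'.color l ≠ x) ∨ ∀ l, D'.color l ≠ y := by
        refine h.imp (fun h l => ?_) (fun h l => ?_)
        · have := h (φ.ext.symm l)
          rwa [← hc, Equiv.apply_symm_apply] at this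
        · have := h (φ.ext.symm l)
          rwa [← hc, Equiv.apply_symm_apply] at this
      rw [joinDiag_of_forall_ne h, joinDiag_of_forall_ne h', smul_zero]
    · rw [joinDiag_eq hD p q hpq hp hq, joinDiag_eq (hinj.1 hD) (φ.ext p) (φ.ext q)
        (φ.ext.injective.ne hpq) ((hc p).trans hp) ((hc q).trans hq),
        BSpace.mk_iso 𝕜 (D.join p q hpq)
          (D'.join (φ.ext p) (φ.ext q) (φ.ext.injective.ne hpq)) (φ.join p q hpq)
          (fun l => hc l.1),
        Graph.Iso.sign_join]
  · rw [joinDiag_of_not_injective hD, joinDiag_of_not_injective (fun h => hD (hinj.2 h)),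
      smul_zero]

lemma joinDiag_ihx (x y : Y) (D : BDiag Y) (u v : D.G.V) (h : D.G.IsIHX u v) :
    joinDiag 𝕜 x y D + joinDiag 𝕜 x y { D with G := D.G.conj (Graph.ihxPerm D.L u v) }
      + joinDiag 𝕜 x y { D with G := D.G.conj (Graph.ihxPerm D.L u v ^ 2) } = 0 := by
  by_cases hxy : x = y
  · subst hxy; rw [joinDiag_self, joinDiag_self, joinDiag_self, add_zero, add_zero]
  by_cases hD : Function.Injective D.color
  · rcases exists_legs_or D x y hxy with h' | ⟨p, q, hpq, hp, hq⟩
    · rw [joinDiag_of_forall_ne h',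
        joinDiag_of_forall_ne (D := { D with G := D.G.conj (Graph.ihxPerm D.L u v) }) h',
        joinDiag_of_forall_ne (D := { D with G := D.G.conj (Graph.ihxPerm D.L u v ^ 2) }) h',
        add_zero, add_zero]
    · rw [joinDiag_eq hD p q hpq hp hq,
        joinDiag_eq (D := { D with G := D.G.conj (Graph.ihxPerm D.L u v) }) hD p q hpq hp hq,
        joinDiag_eq (D := { D with G := D.G.conj (Graph.ihxPerm D.L u v ^ 2) }) hD p q hpq hp hq]
      let F : Graph {l // l ≠ q} → BSpace 𝕜 Y := fun G =>
        BSpace.mk 𝕜 { (D.join p q hpq) with G := G }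
      exact (congrArg₂ (fun a b => F (D.G.join p q hpq) + a + b)
        (congrArg F (Graph.conj_ihx_join D.G p q hpq u v)).symm
        (congrArg F (Graph.conj_ihx_sq_join D.G p q hpq u v)).symm).trans
        (BSpace.mk_ihx 𝕜 (D.join p q hpq) (some u) (some v) (h.join p q hpq))
  · rw [joinDiag_of_not_injective hD,
      joinDiag_of_not_injective (D := { D with G := D.G.conj (Graph.ihxPerm D.L u v) }) hD,
      joinDiag_of_not_injective (D := { D with G := D.G.conj (Graph.ihxPerm D.L u v ^ 2) }) hD,
      add_zero, add_zero]

/-- The operator that joins the legs with the marks `x` and `y` to a leg with the mark `x`. -/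
def joinOp (𝕜 : Type*) [Field 𝕜] (x y : Y) : Module.End 𝕜 (BSpace 𝕜 Y) :=
  BSpace.lift (joinDiag 𝕜 x y) (joinDiag_iso x y) (joinDiag_ihx x y)

@[simp] lemma joinOp_mk (x y : Y) (D : BDiag Y) :
    joinOp 𝕜 x y (BSpace.mk 𝕜 D) = joinDiag 𝕜 x y D := BSpace.lift_mk _ _ _ _

end

end Jacobi

namespace Jacobi

noncomputable section

variable {𝕜 : Type*} [Field 𝕜] {X Y Z : Type}

/-! ### Graphs with two successive joins -/

namespace Graph

open ADiag (stuFlag stuEdge stu_cases stuEdge_stuFlag stuFlag_injective)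

/-- The half-edges of a graph with two new vertices coming from the original graph. -/
abbrev stuFlag₂ {V L : Type} (p q : L) (r s : {l : L // l ≠ q}) (a : Flag V L) :
    Flag (Option (Option V)) {l : {l : L // l ≠ q} // l ≠ s} := stuFlag r s (stuFlag p q a)

lemma join_join_cases {V L : Type} {p q : L} (hpq : p ≠ q) {r s : {l : L // l ≠ q}} (hrs : r ≠ s)
    (b : Flag (Option (Option V)) {l : {l : L // l ≠ q} // l ≠ s}) :
    (∃ a, b = stuFlag₂ p q r s a) ∨ b = Sum.inl (some none, 2) ∨
      b = stuFlag r s (Sum.inr ⟨p, hpq⟩) ∨ b = Sum.inl (none, 2) ∨ b = Sum.inr ⟨r, hrs⟩ := by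
  rcases stu_cases r s hrs b with ⟨a, rfl⟩ | rfl | rfl
  · rcases stu_cases p q hpq a with ⟨a, rfl⟩ | rfl | rfl
    · exact Or.inl ⟨a, rfl⟩
    · exact Or.inr (Or.inl rfl)
    · exact Or.inr (Or.inr (Or.inl rfl))
  · tauto
  · tauto

lemma join_join_edge {L : Type} (G : Graph L) {p q : L} (hpq : p ≠ q) {r s : {l : L // l ≠ q}}
    (hrs : r ≠ s) (a : Flag G.V L) :
    ((G.join p q hpq).join r s hrs).edge (stuFlag₂ p q r s a) = stuFlag₂ p q r s (G.edge a) := by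
  refine (stuEdge_stuFlag (G.join p q hpq) r s hrs (stuFlag p q a)).trans ?_
  exact congrArg _ (stuEdge_stuFlag G p q hpq a)

lemma join_join_edge_two {L : Type} (G : Graph L) {p q : L} (hpq : p ≠ q)
    {r s : {l : L // l ≠ q}} (hrs : r ≠ s) :
    ((G.join p q hpq).join r s hrs).edge (Sum.inl (some none, 2)) =
      stuFlag r s (Sum.inr ⟨p, hpq⟩) := by
  refine (stuEdge_stuFlag (G.join p q hpq) r s hrs (Sum.inl (none, 2))).trans ?_
  exact congrArg _ (stuEdge_two G p q hpq)

lemma join_join_edge_leg {L : Type} (G : Graph L) {p q : L} (hpq : p ≠ q)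
    {r s : {l : L // l ≠ q}} (hrs : r ≠ s) :
    ((G.join p q hpq).join r s hrs).edge (stuFlag r s (Sum.inr ⟨p, hpq⟩)) =
      Sum.inl (some none, 2) := by
  rw [← join_join_edge_two G hpq hrs, Graph.edge_edge]

/-- A map of half-edges between graphs with two new vertices that is compatible with the inclusions
of the original half-edges is compatible with the edges. -/
lemma join_join_comm {L : Type} (G : Graph L) {p q : L} {hpq : p ≠ q}
    {r s : {l : L // l ≠ q}} {hrs : r ≠ s} {p' q' : L} {hpq' : p' ≠ q'}
    {r' s' : {l : L // l ≠ q'}} {hrs' : r' ≠ s'}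
    (Ψ : Flag (Option (Option G.V)) {l : {l : L // l ≠ q} // l ≠ s} →
      Flag (Option (Option G.V)) {l : {l : L // l ≠ q'} // l ≠ s'})
    (h : ∀ a, Ψ (stuFlag₂ p q r s a) = stuFlag₂ p' q' r' s' a)
    (h1 : ((G.join p' q' hpq').join r' s' hrs').edge (Ψ (Sum.inl (some none, 2))) =
      Ψ (stuFlag r s (Sum.inr ⟨p, hpq⟩)))
    (h2 : ((G.join p' q' hpq').join r' s' hrs').edge (Ψ (Sum.inl (none, 2))) =
      Ψ (Sum.inr ⟨r, hrs⟩)) (b) :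
    ((G.join p' q' hpq').join r' s' hrs').edge (Ψ b) =
      Ψ (((G.join p q hpq).join r s hrs).edge b) := by
  rcases join_join_cases hpq hrs b with ⟨a, rfl⟩ | rfl | rfl | rfl | rfl
  · rw [h, join_join_edge, join_join_edge, h]
  · rw [h1, join_join_edge_two]
  · rw [← h1, Graph.edge_edge, join_join_edge_leg]
  · rw [h2]
    exact congrArg Ψ (stuEdge_two (G.join p q hpq) r s hrs).symm
  · rw [← h2, Graph.edge_edge]
    exact congrArg Ψ (stuEdge_leg (G.join p q hpq) r s hrs).symm

end Graph

/-- Exchange of two conditions on a subtype. -/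
def subtypeSwap {L : Type} {q s : L} (hsq : s ≠ q) (hqs : q ≠ s) :
    {l : {l : L // l ≠ q} // l ≠ ⟨s, hsq⟩} ≃ {l : {l : L // l ≠ s} // l ≠ ⟨q, hqs⟩} where
  toFun l := ⟨⟨l.1.1, fun h => l.2 (Subtype.ext h)⟩, fun h => l.1.2 (congrArg Subtype.val h)⟩
  invFun l := ⟨⟨l.1.1, fun h => l.2 (Subtype.ext h)⟩, fun h => l.1.2 (congrArg Subtype.val h)⟩
  left_inv _ := rfl
  right_inv _ := rfl

open Jacobi.Graph ADiag in
-- Joins at disjoint pairs of legs produce the same graph; only the names of the two new vertices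
-- are exchanged.
lemma BDiag.mk_join_comm (D : BDiag Y) {p q r s : D.L} (hpq : p ≠ q) (hrs : r ≠ s) (hpr : p ≠ r)
    (hps : p ≠ s) (hqr : q ≠ r) (hqs : q ≠ s) :
    BSpace.mk 𝕜 ((D.join p q hpq).join ⟨r, hqr.symm⟩ ⟨s, hqs.symm⟩ (by simpa using hrs)) =
      BSpace.mk 𝕜 ((D.join r s hrs).join ⟨p, hps⟩ ⟨q, hqs⟩ (by simpa using hpq)) := by
  classical
  let σ : Option (Option D.G.V) ≃ Option (Option D.G.V) := Equiv.swap none (some none)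
  have s1 : σ none = some none := Equiv.swap_apply_left _ _
  have s2 : σ (some none) = none := Equiv.swap_apply_right _ _
  have s3 : ∀ v, σ (some (some v)) = some (some v) := fun v =>
    Equiv.swap_apply_of_ne_of_ne (by simp) (by simp)
  refine BSpace.mk_equiv 𝕜 _ _ (subtypeSwap hqs.symm hqs) σ ?_ (fun l => rfl)
  refine Graph.join_join_comm D.G (hpq := hpq) (hpq' := hrs) (hrs := by simpa using hrs)
    (hrs' := by simpa using hpq) (Sum.map (Prod.map σ id) (subtypeSwap hqs.symm hqs)) ?_ ?_ ?_
  · rintro (⟨v, k⟩ | l)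
    · simp [stuFlag₂, stuFlag, s3]
    · by_cases h1 : l = p
      · subst h1; simp [stuFlag₂, stuFlag, hpr, hps, s2]
      by_cases h2 : l = q
      · subst h2; simp [stuFlag₂, stuFlag, hpq.symm, hqr, hqs, s2]
      by_cases h3 : l = r
      · subst h3; simp [stuFlag₂, stuFlag, hpr.symm, hqr.symm, s1]
      by_cases h4 : l = s
      · subst h4; simp [stuFlag₂, stuFlag, hps.symm, hqs.symm, hrs.symm, s1]
      · simp [stuFlag₂, stuFlag, h1, h2, h3, h4, subtypeSwap]
  · simp [stuFlag, s2, hpr, hps, stuEdge, subtypeSwap]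
  · have e : (Sum.map (Prod.map σ id) (subtypeSwap hqs.symm hqs)
        (Sum.inl (none, 2)) : Flag (Option (Option D.G.V)) _) = Sum.inl (some none, 2) := by
      simp [s1]
    rw [e, join_join_edge_two]
    simp [stuFlag, hpr.symm, hqr.symm, subtypeSwap]

open Jacobi.Graph ADiag in
-- The Jacobi identity $[[p,q],r]=[[p,r],q]+[p,[q,r]]$. In the double join on the left an edge leads
-- from half-edge 2 of the inner new vertex to half-edge 0 of the outer one, which is exactly the
-- position required by IHX.
lemma BDiag.mk_join_jacobi (D : BDiag Y) {p q r : D.L} (hpq : p ≠ q) (hpr : p ≠ r)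
    (hqr : q ≠ r) :
    BSpace.mk 𝕜 ((D.join p q hpq).join ⟨p, hpq⟩ ⟨r, hqr.symm⟩ (by simpa using hpr)) =
      BSpace.mk 𝕜 ((D.join p r hpr).join ⟨p, hpr⟩ ⟨q, hqr⟩ (by simpa using hpq)) +
      BSpace.mk 𝕜 ((D.join q r hqr).join ⟨p, hpr⟩ ⟨q, hqr⟩ (by simpa using hpq)) := by
  classical
  set D1 := (D.join p q hpq).join ⟨p, hpq⟩ ⟨r, hqr.symm⟩ (by simpa using hpr) with hD1
  have huv : (some none : Option (Option D.G.V)) ≠ none := by simp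
  have hihx : D1.G.IsIHX (some none) none := by
    refine ⟨huv, ?_⟩
    refine (join_join_edge_two D.G hpq (by simpa using hpr)).trans ?_
    simp [stuFlag]
  set ρ : Equiv.Perm (Flag (Option (Option D.G.V))
    {l : {l : D.L // l ≠ q} // l ≠ ⟨r, hqr.symm⟩}) := ihxPerm _ (some none) none with hρ
  have r0 : ρ (Sum.inl (some none, 0)) = Sum.inl (some none, 1) := ihxPerm_zero _
  have r1 : ρ (Sum.inl (some none, 1)) = Sum.inl (none, 1) := ihxPerm_one _ huv
  have r2 : ρ (Sum.inl (none, 1)) = Sum.inl (some none, 0) := ihxPerm_two _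
  have rn0 : ρ (Sum.inl (none, 0)) = Sum.inl (none, 0) :=
    ihxPerm_of_ne _ _ _ (by simp) (by simp) (by simp)
  have rn2 : ρ (Sum.inl (none, 2)) = Sum.inl (none, 2) :=
    ihxPerm_of_ne _ _ _ (by simp) (by simp) (by simp)
  have rs2 : ρ (Sum.inl (some none, 2)) = Sum.inl (some none, 2) :=
    ihxPerm_of_ne _ _ _ (by simp) (by simp) (by simp)
  have rv : ∀ v k, ρ (Sum.inl (some (some v), k)) = Sum.inl (some (some v), k) := fun v k =>
    ihxPerm_of_ne _ _ _ (by simp) (by simp) (by simp)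
  have rl : ∀ l, ρ (Sum.inr l) = Sum.inr l := fun l =>
    ihxPerm_of_ne _ _ _ (by simp) (by simp) (by simp)
  have sw0 : Equiv.swap (0 : Fin 3) 1 0 = 1 := by decide
  have sw1 : Equiv.swap (0 : Fin 3) 1 1 = 0 := by decide
  have sw2 : Equiv.swap (0 : Fin 3) 1 2 = 2 := by decide
  have hmain := BSpace.mk_ihx 𝕜 D1 (some none) none hihx
  obtain ⟨rt, hrt, hrt'⟩ : ∃ rt : Option (Option D.G.V) → Option (Option D.G.V) →
      Equiv.Perm (Fin 3), (∀ o, rt o o = Equiv.swap 0 1) ∧ ∀ o v, v ≠ o → rt o v = 1 :=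
    ⟨fun o v => if v = o then Equiv.swap 0 1 else 1, fun o => if_pos rfl, fun o v h => if_neg h⟩
  have hsign : ∀ o, (∏ v, ((Equiv.Perm.sign (rt o v) : ℤˣ) : ℤ)) = -1 := by
    intro o
    rw [Fintype.prod_eq_single o (fun v hv => by rw [hrt' _ _ hv]; simp), hrt,
      Equiv.Perm.sign_swap (by decide)]
    rfl
  have main : ∀ (D2 : BDiag Y) (τ : Equiv.Perm (Flag (Option (Option D.G.V))
        {l : {l : D.L // l ≠ q} // l ≠ ⟨r, hqr.symm⟩}))
      (φ : Iso (D1.G.conj τ) D2.G), φ.sign = -1 → (∀ l, D2.color (φ.ext l) = D1.color l) →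
      BSpace.mk 𝕜 { D1 with G := D1.G.conj τ } = - BSpace.mk 𝕜 D2 := by
    intro D2 τ φ hφ hc
    rw [BSpace.mk_iso 𝕜 { D1 with G := D1.G.conj τ } D2 φ hc, hφ]
    simp
  -- The first rotation gives $[[r,p],q]$, which becomes $-[[p,r],q]$ by AS at the inner vertex
  -- `some none`.
  have h2 : BSpace.mk 𝕜 { D1 with G := D1.G.conj ρ } =
      - BSpace.mk 𝕜 ((D.join p r hpr).join ⟨p, hpr⟩ ⟨q, hqr⟩ (by simpa using hpq)) := by
    refine main _ ρ
      { ext := subtypeSwap hqr.symm hqr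
        vtx := Equiv.refl _
        rot := rt (some none)
        edge_comm := ?_ } (hsign (some none)) (fun l => rfl)
    intro a
    obtain ⟨b, rfl⟩ := ρ.surjective a
    have := Graph.join_join_comm D.G (hpq := hpq) (r := ⟨p, hpq⟩) (s := ⟨r, hqr.symm⟩) (r' := ⟨p, hpr⟩)
      (s' := ⟨q, hqr⟩) (hpq' := hpr) (hrs := by simpa using hpr) (hrs' := by simpa using hpq)
      (fun b => Sum.map (fun w : Option (Option D.G.V) × Fin 3 =>
        (w.1, rt (some none) w.1 w.2))
        (subtypeSwap hqr.symm hqr) (ρ b)) ?_ ?_ ?_ b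
    · refine this.trans ?_
      change _ = Sum.map _ _ (ρ (D1.G.edge (ρ.symm (ρ b))))
      rw [Equiv.symm_apply_apply]
      rfl
    · rintro (⟨v, k⟩ | l)
      · simp [stuFlag₂, stuFlag, rv, hrt']
      · by_cases h1 : l = p
        · subst h1; simp [stuFlag₂, stuFlag, r0, hrt, sw1]
        by_cases h2 : l = q
        · subst h2; simp [stuFlag₂, stuFlag, hpq.symm, hqr, r1, hrt']
        by_cases h3 : l = r
        · subst h3; simp [stuFlag₂, stuFlag, hpr.symm, hqr.symm, r2, hrt, sw0]
        · simp [stuFlag₂, stuFlag, h1, h2, h3, subtypeSwap, rl]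
    · simp only [rs2, Sum.map_inl, hrt, sw2, stuFlag_fst, rn0]
      simp [stuEdge, stuFlag, hrt']
    · simp only [rn2, rl]
      simp [stuEdge, subtypeSwap, hrt']
  -- The second rotation gives $[[q,r],p]$, which becomes $-[p,[q,r]]$ by AS at the outer vertex
  -- `none`.
  have h3 : BSpace.mk 𝕜 { D1 with G := D1.G.conj (ρ ^ 2) } =
      - BSpace.mk 𝕜 ((D.join q r hqr).join ⟨p, hpr⟩ ⟨q, hqr⟩ (by simpa using hpq)) := by
    refine main _ (ρ ^ 2)
      { ext := subtypeSwap hqr.symm hqr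
        vtx := Equiv.refl _
        rot := rt none
        edge_comm := ?_ } (hsign none) (fun l => rfl)
    intro a
    obtain ⟨b, rfl⟩ := (ρ ^ 2).surjective a
    have := Graph.join_join_comm D.G (hpq := hpq) (r := ⟨p, hpq⟩) (s := ⟨r, hqr.symm⟩) (r' := ⟨p, hpr⟩)
      (s' := ⟨q, hqr⟩) (hpq' := hqr) (hrs := by simpa using hpr) (hrs' := by simpa using hpq)
      (fun b => Sum.map (fun w : Option (Option D.G.V) × Fin 3 =>
        (w.1, rt none w.1 w.2))
        (subtypeSwap hqr.symm hqr) ((ρ ^ 2) b)) ?_ ?_ ?_ b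
    · refine this.trans ?_
      change _ = Sum.map _ _ ((ρ ^ 2) (D1.G.edge ((ρ ^ 2).symm ((ρ ^ 2) b))))
      rw [Equiv.symm_apply_apply]
      rfl
    · rintro (⟨v, k⟩ | l)
      · simp [stuFlag₂, stuFlag, perm_sq_apply, rv, hrt']
      · by_cases h1 : l = p
        · subst h1; simp [stuFlag₂, stuFlag, hpr, hpq, perm_sq_apply, r0, r1, hrt]
        by_cases h2 : l = q
        · subst h2; simp [stuFlag₂, stuFlag, hpq.symm, perm_sq_apply, r1, r2, hrt']
        by_cases h3 : l = r
        · subst h3; simp [stuFlag₂, stuFlag, hpr.symm, hqr.symm, perm_sq_apply, r2, r0, hrt']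
        · simp [stuFlag₂, stuFlag, h1, h2, h3, subtypeSwap, perm_sq_apply, rl]
    · simp only [perm_sq_apply, rs2, Sum.map_inl, stuFlag_fst, rn0]
      simp [stuEdge, stuFlag, hpq.symm, hrt, hrt', sw0]
    · simp only [perm_sq_apply, rn2, rl]
      simp [stuEdge, subtypeSwap, hrt, sw2]
  have e : BSpace.mk 𝕜 D1 + BSpace.mk 𝕜 { D1 with G := D1.G.conj ρ } +
    BSpace.mk 𝕜 { D1 with G := D1.G.conj (ρ ^ 2) } = 0 := hmain
  rw [h2, h3] at e
  rw [← sub_eq_zero, ← e]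
  abel

/-! ### Relations between the joining operators -/

lemma BDiag.exists_leg_or (D : BDiag Y) (x : Y) : (∀ l, D.color l ≠ x) ∨ ∃ p, D.color p = x := by
  by_cases h : ∃ p, D.color p = x
  · exact Or.inr h
  · push Not at h
    exact Or.inl h

lemma joinOp_joinOp_mk {D : BDiag Y} (h : Function.Injective D.color) {p q r s : D.L}
    {x y z w : Y} (hp : D.color p = x) (hq : D.color q = y) (hr : D.color r = z)
    (hs : D.color s = w) (hpq : p ≠ q) (hrq : r ≠ q) (hsq : s ≠ q) (hrs : r ≠ s) :
    joinOp 𝕜 z w (joinOp 𝕜 x y (BSpace.mk 𝕜 D)) =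
      BSpace.mk 𝕜 ((D.join p q hpq).join ⟨r, hrq⟩ ⟨s, hsq⟩ (by simpa using hrs)) := by
  rw [joinOp_mk, joinDiag_eq h p q hpq hp hq, joinOp_mk]
  exact joinDiag_eq (BDiag.join_injective h p q hpq) ⟨r, hrq⟩ ⟨s, hsq⟩ _ hr hs

lemma joinOp_joinOp_of_forall_ne {D : BDiag Y} {x y z w : Y}
    (h : (∀ l, D.color l ≠ x) ∨ (∀ l, D.color l ≠ y) ∨ (∀ l, D.color l ≠ z) ∨
      ∀ l, D.color l ≠ w) :
    joinOp 𝕜 z w (joinOp 𝕜 x y (BSpace.mk 𝕜 D)) = 0 := by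
  classical
  rw [joinOp_mk]
  by_cases h1 : (∀ l, D.color l ≠ x) ∨ ∀ l, D.color l ≠ y
  · rw [joinDiag_of_forall_ne h1, map_zero]
  · have h2 : (∀ l, D.color l ≠ z) ∨ ∀ l, D.color l ≠ w := by tauto
    rw [joinDiag]
    split_ifs
    · rw [map_sum]
      refine Finset.sum_eq_zero fun r _ => ?_
      rw [joinOp_mk]
      exact joinDiag_of_forall_ne (h2.imp (fun h l => h l.1) (fun h l => h l.1))
    · rw [map_zero]

lemma joinOp_joinOp_of_not_injective {D : BDiag Y} {x y z w : Y}
    (h : ¬ Function.Injective D.color) :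
    joinOp 𝕜 z w (joinOp 𝕜 x y (BSpace.mk 𝕜 D)) = 0 := by
  rw [joinOp_mk, joinDiag_of_not_injective h, map_zero]

/-- Joining `b` and `a` to `x` in the two possible orders differs by joining `[a, b]` to `x`. -/
lemma joinOp_jacobi {x a b : Y} (hxa : x ≠ a) (hxb : x ≠ b) (hab : a ≠ b) (m : BSpace 𝕜 Y) :
    joinOp 𝕜 x b (joinOp 𝕜 x a m) =
      joinOp 𝕜 x a (joinOp 𝕜 x b m) + joinOp 𝕜 x a (joinOp 𝕜 a b m) := by
  induction m using BSpace.induction with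
  | hmk D =>
    by_cases hD : Function.Injective D.color
    · rcases D.exists_leg_or x with h | ⟨p, hp⟩
      · simp only [joinOp_joinOp_of_forall_ne (𝕜 := 𝕜) (D := D) (Or.inl h)]
        rw [joinOp_joinOp_of_forall_ne (Or.inr (Or.inr (Or.inl h))), add_zero]
      rcases D.exists_leg_or a with h | ⟨q, hq⟩
      · rw [joinOp_joinOp_of_forall_ne (Or.inr (Or.inl h)),
          joinOp_joinOp_of_forall_ne (Or.inr (Or.inr (Or.inr h))),
          joinOp_joinOp_of_forall_ne (Or.inl h), add_zero]
      rcases D.exists_leg_or b with h | ⟨r, hr⟩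
      · rw [joinOp_joinOp_of_forall_ne (Or.inr (Or.inr (Or.inr h))),
          joinOp_joinOp_of_forall_ne (Or.inr (Or.inl h)),
          joinOp_joinOp_of_forall_ne (Or.inr (Or.inl h)), add_zero]
      have hpq : p ≠ q := fun h => hxa (by rw [← hp, ← hq, h])
      have hpr : p ≠ r := fun h => hxb (by rw [← hp, ← hr, h])
      have hqr : q ≠ r := fun h => hab (by rw [← hq, ← hr, h])
      rw [joinOp_joinOp_mk hD hp hq hp hr hpq hpq hqr.symm hpr,
        joinOp_joinOp_mk hD hp hr hp hq hpr hpr hqr hpq,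
        joinOp_joinOp_mk hD hq hr hp hq hqr hpr hqr hpq]
      exact BDiag.mk_join_jacobi D hpq hpr hqr
    · simp only [joinOp_joinOp_of_not_injective (𝕜 := 𝕜) hD, add_zero]
  | hzero => simp only [map_zero, add_zero]
  | hadd m m' h h' => simp only [map_add, h, h']; abel
  | hsmul c m h => simp only [map_smul, h, smul_add]

/-- Both sides vanish unless all four marks occur and the marks are distinct; then the legs are
determined and `BDiag.mk_join_comm` applies. -/
lemma joinOp_comm {x y z w : Y} (hxy : x ≠ y) (hxz : x ≠ z) (hxw : x ≠ w) (hyz : y ≠ z)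
    (hyw : y ≠ w) (hzw : z ≠ w) (m : BSpace 𝕜 Y) :
    joinOp 𝕜 z w (joinOp 𝕜 x y m) = joinOp 𝕜 x y (joinOp 𝕜 z w m) := by
  induction m using BSpace.induction with
  | hmk D =>
    by_cases hD : Function.Injective D.color
    · rcases D.exists_leg_or x with h | ⟨p, hp⟩
      · rw [joinOp_joinOp_of_forall_ne (by tauto), joinOp_joinOp_of_forall_ne (by tauto)]
      rcases D.exists_leg_or y with h | ⟨q, hq⟩
      · rw [joinOp_joinOp_of_forall_ne (by tauto), joinOp_joinOp_of_forall_ne (by tauto)]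
      rcases D.exists_leg_or z with h | ⟨r, hr⟩
      · rw [joinOp_joinOp_of_forall_ne (by tauto), joinOp_joinOp_of_forall_ne (by tauto)]
      rcases D.exists_leg_or w with h | ⟨s, hs⟩
      · rw [joinOp_joinOp_of_forall_ne (by tauto), joinOp_joinOp_of_forall_ne (by tauto)]
      have hpq : p ≠ q := by rintro rfl; exact hxy (hp.symm.trans hq)
      have hpr : p ≠ r := by rintro rfl; exact hxz (hp.symm.trans hr)
      have hps : p ≠ s := by rintro rfl; exact hxw (hp.symm.trans hs)
      have hqr : q ≠ r := by rintro rfl; exact hyz (hq.symm.trans hr)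
      have hqs : q ≠ s := by rintro rfl; exact hyw (hq.symm.trans hs)
      have hrs : r ≠ s := by rintro rfl; exact hzw (hr.symm.trans hs)
      rw [joinOp_joinOp_mk hD hp hq hr hs hpq hqr.symm hqs.symm hrs,
        joinOp_joinOp_mk hD hr hs hp hq hrs hps hqs hpq]
      exact BDiag.mk_join_comm D hpq hrs hpr hps hqr hqs
    · simp only [joinOp_joinOp_of_not_injective (𝕜 := 𝕜) hD]
  | hzero => simp only [map_zero]
  | hadd m m' h h' => simp only [map_add, h, h']
  | hsmul c m h => simp only [map_smul, h]

open scoped Classical in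
/-- Joining two legs in the opposite order. -/
def Graph.joinSwap {L : Type} (G : Graph L) (p q : L) (hpq : p ≠ q) :
    Graph.Iso (G.join q p hpq.symm) (G.join p q hpq) where
  ext := (Equiv.swap p q).subtypeEquiv fun l => by
    rw [not_iff_not, Equiv.swap_apply_eq_iff, Equiv.swap_apply_right]
  vtx := Equiv.refl _
  rot := fun v : Option G.V => if v = none then Equiv.swap 0 1 else 1
  edge_comm := by
    have sw0 : Equiv.swap (0 : Fin 3) 1 0 = 1 := by decide
    have sw1 : Equiv.swap (0 : Fin 3) 1 1 = 0 := by decide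
    have sw2 : Equiv.swap (0 : Fin 3) 1 2 = 2 := by decide
    set Ψ : Flag (Option G.V) {l // l ≠ p} → Flag (Option G.V) {l // l ≠ q} :=
      Sum.map (fun w : Option G.V × Fin 3 =>
        (w.1, (if w.1 = none then Equiv.swap 0 1 else 1 : Equiv.Perm (Fin 3)) w.2))
        ((Equiv.swap p q).subtypeEquiv fun l => by
          rw [not_iff_not, Equiv.swap_apply_eq_iff, Equiv.swap_apply_right]) with hΨ
    have h : ∀ a : Flag G.V L, Ψ (ADiag.stuFlag q p a) = ADiag.stuFlag p q a := by
      rintro (⟨v, k⟩ | l)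
      · simp [hΨ, ADiag.stuFlag]
      · by_cases h1 : l = p
        · subst h1; simp [hΨ, ADiag.stuFlag, hpq, sw1]
        by_cases h2 : l = q
        · subst h2; simp [hΨ, ADiag.stuFlag, hpq.symm, sw0]
        · simp [hΨ, ADiag.stuFlag, h1, h2, Equiv.swap_apply_of_ne_of_ne h1 h2]
    have h1 : Ψ (Sum.inl (none, 2)) = Sum.inl (none, 2) := by simp [hΨ, sw2]
    have h2 : Ψ (Sum.inr ⟨q, hpq.symm⟩) = Sum.inr ⟨p, hpq⟩ := by simp [hΨ]
    intro b
    change (G.join p q hpq).edge (Ψ b) = Ψ ((G.join q p hpq.symm).edge b)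
    rcases ADiag.stu_cases q p hpq.symm b with ⟨a, rfl⟩ | rfl | rfl
    · rw [h]
      refine (ADiag.stuEdge_stuFlag G p q hpq a).trans ((h _).symm.trans (congrArg Ψ ?_))
      exact (ADiag.stuEdge_stuFlag G q p hpq.symm a).symm
    · rw [h1]
      refine (Graph.stuEdge_two G p q hpq).trans (h2.symm.trans (congrArg Ψ ?_))
      exact (Graph.stuEdge_two G q p hpq.symm).symm
    · rw [h2]
      refine (Graph.stuEdge_leg G p q hpq).trans (h1.symm.trans (congrArg Ψ ?_))
      exact (Graph.stuEdge_leg G q p hpq.symm).symm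

lemma Graph.sign_joinSwap {L : Type} (G : Graph L) (p q : L) (hpq : p ≠ q) :
    (G.joinSwap p q hpq).sign = -1 := by
  classical
  change (∏ v : Option G.V, ((Equiv.Perm.sign
    (if v = none then Equiv.swap (0 : Fin 3) 1 else 1) : ℤˣ) : ℤ)) = -1
  rw [Fintype.prod_eq_single none (fun v hv => by rw [if_neg hv]; simp), if_pos rfl,
    Equiv.Perm.sign_swap (by decide)]
  rfl

open scoped Classical in
-- The sign is AS at the new vertex. The exchange of marks is needed because the new leg inherits
-- the mark of the first of the two joined legs.
lemma joinOp_swap {x y : Y} (hxy : x ≠ y) (m : BSpace 𝕜 Y) :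
    joinOp 𝕜 y x m = - BSpace.map 𝕜 (Equiv.swap x y) (joinOp 𝕜 x y m) := by
  induction m using BSpace.induction with
  | hmk D =>
    rw [joinOp_mk, joinOp_mk]
    by_cases hD : Function.Injective D.color
    · rcases exists_legs_or D x y hxy with h | ⟨p, q, hpq, hp, hq⟩
      · rw [joinDiag_of_forall_ne h, joinDiag_of_forall_ne h.symm, map_zero, neg_zero]
      · rw [joinDiag_eq hD p q hpq hp hq, joinDiag_eq hD q p hpq.symm hq hp, BSpace.map_mk,
          BSpace.mk_iso 𝕜 (D.join q p hpq.symm) ((D.join p q hpq).recolor (Equiv.swap x y))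
            (D.G.joinSwap p q hpq) ?_, Graph.sign_joinSwap]
        · simp
        · rintro ⟨l, hl⟩
          change Equiv.swap x y (D.color (Equiv.swap p q l)) = D.color l
          by_cases h2 : l = q
          · subst h2; rw [Equiv.swap_apply_right, hp, hq, Equiv.swap_apply_left]
          · rw [Equiv.swap_apply_of_ne_of_ne hl h2, Equiv.swap_apply_of_ne_of_ne]
            · exact fun h => hl (hD (h.trans hp.symm))
            · exact fun h => h2 (hD (h.trans hq.symm))
    · rw [joinDiag_of_not_injective hD, joinDiag_of_not_injective hD, map_zero, neg_zero]
  | hzero => simp only [map_zero, neg_zero]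
  | hadd m m' h h' => simp only [map_add, h, h']; abel
  | hsmul c m h => simp only [map_smul, h, smul_neg]

end

end Jacobi

namespace Jacobi

noncomputable section

variable {𝕜 : Type*} [Field 𝕜] {X Y Z : Type}

/-! ### Splitting a leg, the adjoint operation of joining two legs -/

lemma CDiag.cutEdge_of_ne {J : Type} (G : Graph J) (a c : Flag G.V J) (h1 : c ≠ a)
    (h2 : c ≠ G.edge a) : CDiag.cutEdge G a (Sum.map id Sum.inl c) =
      Sum.map id Sum.inl (G.edge c) := by
  classical rw [CDiag.cutEdge_map, if_neg h1, if_neg h2]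

lemma CDiag.cutEdge_self {J : Type} (G : Graph J) (a : Flag G.V J) :
    CDiag.cutEdge G a (Sum.map id Sum.inl a) = Sum.inr (Sum.inr false) := by
  classical rw [CDiag.cutEdge_map, if_pos rfl]

lemma CDiag.cutEdge_edge {J : Type} (G : Graph J) (a : Flag G.V J) :
    CDiag.cutEdge G a (Sum.map id Sum.inl (G.edge a)) = Sum.inr (Sum.inr true) := by
  classical rw [CDiag.cutEdge_map, if_neg (G.edge_ne a), if_pos rfl]

namespace Graph

lemma leftFlag_ne_rightFlag {V W F F' : Type} (a : Flag V F) (b : Flag W F') :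
    (leftFlag a : Flag (V ⊕ W) (F ⊕ F')) ≠ rightFlag b := by
  rcases a with ⟨v, k⟩ | a <;> rcases b with ⟨w, k'⟩ | b <;> simp [leftFlag, rightFlag]

open scoped Classical in
/-- Where a half-edge goes when the leg `l` is split. -/
def splitFlag {V L : Type} (l : L) : Flag V L → Flag (Option V) (Option L)
  | Sum.inl (v, k) => Sum.inl (some v, k)
  | Sum.inr j => if j = l then Sum.inl (none, 2) else Sum.inr (some j)

lemma splitFlag_self {V L : Type} (l : L) :
    splitFlag l (Sum.inr l : Flag V L) = Sum.inl (none, 2) := by simp [splitFlag]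

lemma splitFlag_of_ne {V L : Type} {l j : L} (h : j ≠ l) :
    splitFlag l (Sum.inr j : Flag V L) = Sum.inr (some j) := by simp [splitFlag, h]

lemma splitFlag_injective {V L : Type} (l : L) :
    Function.Injective (splitFlag (V := V) l) := by
  rintro (⟨v, k⟩ | j) (⟨v', k'⟩ | j') h <;> simp only [splitFlag] at h <;> grind

lemma splitFlag_ne {V L : Type} (l : L) (a : Flag V L) {k : Fin 3} (hk : k ≠ 2) :
    splitFlag l a ≠ Sum.inl (none, k) := by
  rcases a with ⟨v, k'⟩ | j
  · simp [splitFlag]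
  · by_cases h : j = l <;> simp [splitFlag, h, hk.symm]

lemma split_cases {V L : Type} (l : L) (b : Flag (Option V) (Option L)) :
    (∃ a, b = splitFlag l a) ∨ b = Sum.inl (none, 0) ∨ b = Sum.inl (none, 1) ∨
      b = Sum.inr (some l) ∨ b = Sum.inr none := by
  rcases b with ⟨_ | v, k⟩ | _ | j
  · fin_cases k
    · exact Or.inr (Or.inl rfl)
    · exact Or.inr (Or.inr (Or.inl rfl))
    · exact Or.inl ⟨Sum.inr l, (splitFlag_self l).symm⟩
  · exact Or.inl ⟨Sum.inl (v, k), rfl⟩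
  · tauto
  · by_cases h : j = l
    · subst h; tauto
    · exact Or.inl ⟨Sum.inr j, (splitFlag_of_ne h).symm⟩

open scoped Classical in
/-- The edges of the graph in which the leg `l` ends in a new vertex with two legs. -/
def splitEdge {L : Type} (G : Graph L) (l : L) :
    Flag (Option G.V) (Option L) → Flag (Option G.V) (Option L)
  | Sum.inl (some v, k) => splitFlag l (G.edge (Sum.inl (v, k)))
  | Sum.inl (none, k) => if k = 0 then Sum.inr (some l) else if k = 1 then Sum.inr none
      else splitFlag l (G.edge (Sum.inr l))
  | Sum.inr none => Sum.inl (none, 1)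
  | Sum.inr (some j) => if j = l then Sum.inl (none, 0) else splitFlag l (G.edge (Sum.inr j))

lemma splitEdge_splitFlag {L : Type} (G : Graph L) (l : L) (a : Flag G.V L) :
    splitEdge G l (splitFlag l a) = splitFlag l (G.edge a) := by
  rcases a with ⟨v, k⟩ | j
  · rfl
  · by_cases h : j = l
    · subst h; simp [splitFlag, splitEdge]
    · simp [splitFlag, splitEdge, h]

lemma splitEdge_zero {L : Type} (G : Graph L) (l : L) :
    splitEdge G l (Sum.inl (none, 0)) = Sum.inr (some l) := rfl

lemma splitEdge_one {L : Type} (G : Graph L) (l : L) :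
    splitEdge G l (Sum.inl (none, 1)) = Sum.inr none := rfl

lemma splitEdge_some {L : Type} (G : Graph L) (l : L) :
    splitEdge G l (Sum.inr (some l)) = Sum.inl (none, 0) := by simp [splitEdge]

lemma splitEdge_none {L : Type} (G : Graph L) (l : L) :
    splitEdge G l (Sum.inr none) = Sum.inl (none, 1) := rfl

/-- The graph in which the leg `l` ends in a new vertex with two legs. -/
abbrev split {L : Type} (G : Graph L) (l : L) : Graph (Option L) where
  V := Option G.V
  edge := splitEdge G l
  edge_edge b := by
    rcases split_cases l b with ⟨a, rfl⟩ | rfl | rfl | rfl | rfl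
    · rw [splitEdge_splitFlag, splitEdge_splitFlag, G.edge_edge]
    · rw [splitEdge_zero, splitEdge_some]
    · rw [splitEdge_one, splitEdge_none]
    · rw [splitEdge_some, splitEdge_zero]
    · rw [splitEdge_none, splitEdge_one]
  edge_ne b := by
    rcases split_cases l b with ⟨a, rfl⟩ | rfl | rfl | rfl | rfl
    · rw [splitEdge_splitFlag]
      exact fun h => G.edge_ne a (splitFlag_injective l h)
    · simp [splitEdge_zero]
    · simp [splitEdge_one]
    · simp [splitEdge_some]
    · simp [splitEdge_none]

end Graph

/-- The marked diagram in which the leg `l` ends in a new vertex, with one leg that keeps the mark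
and a second leg marked `z`. -/
abbrev BDiag.split (E : BDiag Y) (l : E.L) (z : Y) : BDiag Y where
  L := Option E.L
  color := fun o => o.elim z E.color
  G := E.G.split l

open scoped Classical in
/-- The extension of a bijection of legs to the diagram before joining and the split diagram. -/
def splitMatch {L K : Type} (q : L) (f : {l : L // l ≠ q} ≃ K) : L ≃ Option K :=
  (Equiv.optionSubtypeNe q).symm.trans f.optionCongr

lemma splitMatch_self {L K : Type} (q : L) (f : {l : L // l ≠ q} ≃ K) :
    splitMatch q f q = none := by simp [splitMatch]

lemma splitMatch_of_ne {L K : Type} {q : L} (f : {l : L // l ≠ q} ≃ K) {l : L} (h : l ≠ q) :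
    splitMatch q f l = some (f ⟨l, h⟩) := by
  classical
  rw [splitMatch, Equiv.trans_apply]
  exact (congrArg f.optionCongr (@Equiv.optionSubtypeNe_symm_of_ne _ (_) q l h)).trans rfl

lemma splitMatch_symm_none {L K : Type} (q : L) (f : {l : L // l ≠ q} ≃ K) :
    (splitMatch q f).symm none = q := by
  rw [Equiv.symm_apply_eq, splitMatch_self]

lemma splitMatch_symm_some {L K : Type} (q : L) (f : {l : L // l ≠ q} ≃ K) (k : K) :
    (splitMatch q f).symm (some k) = (f.symm k).1 := by
  rw [Equiv.symm_apply_eq, splitMatch_of_ne f (f.symm k).2, Subtype.coe_eta,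
    Equiv.apply_symm_apply]

open scoped Classical in
/-- The inclusion of the glued ends of a diagram with a join into those of the subdivided diagram
with a split. -/
def joinEnd {L K : Type} (p q : L) (l : K) : {j : L // j ≠ q} ⊕ K → (L ⊕ Option K) ⊕ Bool :=
  Sum.elim (fun j => if j.1 = p then Sum.inr false else Sum.inl (Sum.inl j.1))
    (fun j => if j = l then Sum.inr true else Sum.inl (Sum.inr (some j)))

lemma joinEnd_fst {L K : Type} {p q : L} (l : K) (h : p ≠ q) :
    joinEnd p q l (Sum.inl ⟨p, h⟩) = Sum.inr false := by simp [joinEnd]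

lemma joinEnd_inl {L K : Type} {p q : L} (l : K) {j : L} (h : j ≠ q) (h' : j ≠ p) :
    joinEnd p q l (Sum.inl ⟨j, h⟩) = Sum.inl (Sum.inl j) := by simp [joinEnd, h']

lemma joinEnd_snd {L K : Type} (p q : L) (l : K) :
    joinEnd p q l (Sum.inr l) = Sum.inr true := by simp [joinEnd]

lemma joinEnd_inr {L K : Type} (p q : L) {l j : K} (h : j ≠ l) :
    joinEnd p q l (Sum.inr j) = Sum.inl (Sum.inr (some j)) := by simp [joinEnd, h]

lemma joinEnd_injective {L K : Type} (p q : L) (l : K) :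
    Function.Injective (joinEnd p q l) := by
  rintro (⟨j, hj⟩ | j) (⟨j', hj'⟩ | j') h <;>
    simp only [joinEnd, Sum.elim_inl, Sum.elim_inr] at h <;> split_ifs at h <;> simp_all

/-- The glued ends that only occur in the diagram with a split. -/
def IsSplitEnd {L K : Type} (p q : L) (l : K) (j : (L ⊕ Option K) ⊕ Bool) : Prop :=
  j = Sum.inl (Sum.inl p) ∨ j = Sum.inl (Sum.inl q) ∨ j = Sum.inl (Sum.inr (some l)) ∨
    j = Sum.inl (Sum.inr none)

lemma isSplitEnd_iff {L K : Type} {p q : L} (hpq : p ≠ q) (l : K) (j) :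
    IsSplitEnd p q l j ↔ j ∉ Set.range (joinEnd p q l) := by
  constructor
  · rintro (rfl | rfl | rfl | rfl) ⟨(⟨i, hi⟩ | i), h⟩ <;>
      simp only [joinEnd, Sum.elim_inl, Sum.elim_inr] at h <;> split_ifs at h <;> simp_all
  · intro h
    by_contra h'
    simp only [IsSplitEnd, not_or] at h'
    apply h
    rcases j with (j | (_ | j)) | (_ | _)
    · have h1 : j ≠ p := fun e => h'.1 (by rw [e])
      have h2 : j ≠ q := fun e => h'.2.1 (by rw [e])
      exact ⟨_, joinEnd_inl l h2 h1⟩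
    · exact absurd rfl h'.2.2.2
    · have h1 : j ≠ l := fun e => h'.2.2.1 (by rw [e])
      exact ⟨_, joinEnd_inr p q h1⟩
    · exact ⟨_, joinEnd_fst l hpq⟩
    · exact ⟨_, joinEnd_snd p q l⟩

open Jacobi.Graph ADiag CDiag in
-- Both sides are the same trivalent graph; the line of gluing merely passes across one vertex. With
-- the vertex on the side of `E` its two branches are glued to `p` and `q`; with the vertex on the
-- side of `D` its stem is glued. The comparison is made by `mk_eq_of_run`, the superfluous points
-- being those on the two branches.
lemma mk_glueAlong_split (D E : BDiag Y) (p q : D.L) (hpq : p ≠ q)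
    (f : {l : D.L // l ≠ q} ≃ E.L) (z : Y) :
    CSpace.mk 𝕜 (glueAlong D (E.split (f ⟨p, hpq⟩) z) (splitMatch q f)) =
      CSpace.mk 𝕜 (glueAlong (D.join p q hpq) E f) := by
  classical
  set l := f ⟨p, hpq⟩ with hl
  let lam : Flag D.G.V D.L → Flag (D.G.V ⊕ Option E.G.V) ((D.L ⊕ Option E.L) ⊕ Bool) :=
    fun y => Sum.map id Sum.inl (leftFlag y)
  let rho : Flag (Option E.G.V) (Option E.L) →
      Flag (D.G.V ⊕ Option E.G.V) ((D.L ⊕ Option E.L) ⊕ Bool) :=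
    fun y => Sum.map id Sum.inl (rightFlag y)
  let B := glueAlong D (E.split l z) (splitMatch q f)
  -- The stem of the new vertex. Cutting it supplies the glued pair that the joined diagram has at
  -- its new leg, so that all marked points of the joined diagram occur in the other one.
  let c : Flag (D.G.V ⊕ Option E.G.V) (D.L ⊕ Option E.L) := rightFlag (Sum.inl (none, 2))
  let e : Flag (D.G.V ⊕ Option E.G.V) ((D.L ⊕ Option E.L) ⊕ Bool) →
    Flag (D.G.V ⊕ Option E.G.V) ((D.L ⊕ Option E.L) ⊕ Bool) := (B.subdivide c).G.edge
  have ec : B.G.edge c = rightFlag (splitFlag l (E.G.edge (Sum.inr l))) := by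
    refine (unionEdge_right D.G (E.split l z).G (Sum.inl (none, 2))).trans ?_
    exact congrArg rightFlag ((congrArg (splitEdge E.G l) (splitFlag_self l).symm).trans
      (splitEdge_splitFlag E.G l (Sum.inr l)))
  have e1 : ∀ y, e (lam y) = lam (D.G.edge y) := by
    intro y
    refine (cutEdge_of_ne B.G c (leftFlag y) (leftFlag_ne_rightFlag _ _) (fun h => ?_)).trans ?_
    · exact leftFlag_ne_rightFlag y _ (h.trans ec)
    · exact congrArg _ (unionEdge_left D.G (E.split l z).G y)
  have e2 : ∀ y, rightFlag y ≠ c → rightFlag y ≠ B.G.edge c →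
      e (rho y) = rho (splitEdge E.G l y) := by
    intro y h1 h2
    refine (cutEdge_of_ne B.G c (rightFlag y) h1 h2).trans ?_
    exact congrArg _ (unionEdge_right D.G (E.split l z).G y)
  have e3 : e (rho (Sum.inl (none, 2))) = Sum.inr (Sum.inr false) := cutEdge_self B.G c
  have e4 : e (rho (splitFlag l (E.G.edge (Sum.inr l)))) = Sum.inr (Sum.inr true) :=
    (congrArg (fun a => e (Sum.map id Sum.inl a)) ec.symm).trans (cutEdge_edge B.G c)
  have e5 : e (Sum.inr (Sum.inr false)) = rho (Sum.inl (none, 2)) := rfl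
  have e6 : e (Sum.inr (Sum.inr true)) = rho (splitFlag l (E.G.edge (Sum.inr l))) :=
    congrArg (Sum.map id Sum.inl) ec
  have rinj : Function.Injective (rightFlag : Flag (Option E.G.V) (Option E.L) →
    Flag (D.G.V ⊕ Option E.G.V) (D.L ⊕ Option E.L)) := rightFlag_injective
  have e7 : ∀ y, y ≠ Sum.inr l → y ≠ E.G.edge (Sum.inr l) →
      e (rho (splitFlag l y)) = rho (splitFlag l (E.G.edge y)) := by
    intro y h1 h2
    rw [e2, splitEdge_splitFlag]
    · intro h
      apply h1
      apply splitFlag_injective l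
      rw [splitFlag_self]
      exact rinj h
    · rw [ec]
      exact fun h => h2 (splitFlag_injective l (rinj h))
  have e8 : e (rho (Sum.inl (none, 0))) = rho (Sum.inr (some l)) := by
    refine e2 _ (fun h => by simpa using rinj h) ?_
    rw [ec]
    exact fun h => splitFlag_ne l _ (by decide) (rinj h).symm
  have e9 : e (rho (Sum.inl (none, 1))) = rho (Sum.inr none) := by
    refine e2 _ (fun h => by simpa using rinj h) ?_
    rw [ec]
    exact fun h => splitFlag_ne l _ (by decide) (rinj h).symm
  have ee : ∀ y, e (e y) = y := (B.subdivide c).G.edge_edge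
  have e8' : e (rho (Sum.inr (some l))) = rho (Sum.inl (none, 0)) := by rw [← e8, ee]
  have e9' : e (rho (Sum.inr none)) = rho (Sum.inl (none, 1)) := by rw [← e9, ee]
  let R : (D.L ⊕ Option E.L) ⊕ Bool → Prop := IsSplitEnd p q l
  -- The new vertex belongs to the left summand after joining and to the right summand after
  -- splitting.
  let vtx : Option D.G.V ⊕ E.G.V ≃ D.G.V ⊕ Option E.G.V :=
    { toFun := Sum.elim (fun o => o.elim (Sum.inr none) Sum.inl) (fun v => Sum.inr (some v))
      invFun := Sum.elim (fun v => Sum.inl (some v))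
        (fun o => o.elim (Sum.inl none) (fun v => Sum.inr v))
      left_inv := by rintro ((_ | v) | v) <;> rfl
      right_inv := by rintro (v | (_ | v)) <;> rfl }
  let F : {l : D.L // l ≠ q} ⊕ E.L → (D.L ⊕ Option E.L) ⊕ Bool := joinEnd p q l
  let Φ : Flag (Option D.G.V ⊕ E.G.V) ({l : D.L // l ≠ q} ⊕ E.L) →
    Flag (D.G.V ⊕ Option E.G.V) ((D.L ⊕ Option E.L) ⊕ Bool) := Sum.map (Prod.map vtx id) F
  have P1 : Φ (leftFlag (stuFlag p q (Sum.inr p))) = rho (Sum.inl (none, 0)) := by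
    simp [stuFlag_fst, leftFlag, Φ, vtx, rho, rightFlag]
  have P2 : Φ (leftFlag (stuFlag p q (Sum.inr q))) = rho (Sum.inl (none, 1)) := by
    simp [stuFlag_snd hpq, leftFlag, Φ, vtx, rho, rightFlag]
  have P3 : ∀ y, y ≠ Sum.inr p → y ≠ Sum.inr q → Φ (leftFlag (stuFlag p q y)) = lam y := by
    rintro (⟨v, k⟩ | j) h1 h2
    · rfl
    · have h1' : j ≠ p := fun h => h1 (by rw [h])
      have h2' : j ≠ q := fun h => h2 (by rw [h])
      rw [stuFlag_of_ne h1' h2']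
      exact congrArg Sum.inr (joinEnd_inl l h2' h1')
  have P4 : Φ (leftFlag (Sum.inl (none, 2))) = rho (Sum.inl (none, 2)) := rfl
  have P5 : Φ (leftFlag (Sum.inr ⟨p, hpq⟩)) = Sum.inr (Sum.inr false) :=
    congrArg Sum.inr (joinEnd_fst l hpq)
  have P6 : Φ (rightFlag (Sum.inr l)) = Sum.inr (Sum.inr true) :=
    congrArg Sum.inr (joinEnd_snd p q l)
  have P7 : ∀ y, y ≠ Sum.inr l → Φ (rightFlag y) = rho (splitFlag l y) := by
    rintro (⟨v, k⟩ | j) h1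
    · rfl
    · have h1' : j ≠ l := fun h => h1 (by rw [h])
      rw [splitFlag_of_ne h1']
      exact congrArg Sum.inr (joinEnd_inr p q h1')
  -- A walk that enters `D` at the half-edge `y` stops there, except at `p` or `q`, where it crosses
  -- the glued point to a branch of the new vertex.
  have K : ∀ x y, e x = lam y → Run (B.subdivide c) R x (Φ (leftFlag (stuFlag p q y))) := by
    intro x y hx
    by_cases h1 : y = Sum.inr p
    · subst h1
      rw [P1]
      refine Run.step (r := (Sum.inl (Sum.inl p) : (D.L ⊕ Option E.L) ⊕ Bool)) hx (Or.inl rfl) ?_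
      refine Run.done ?_ (fun r hr => by simp [rho, rightFlag] at hr)
      have : splitMatch q f p = some l := splitMatch_of_ne f hpq
      change e (Sum.inr (Sum.inl (Sum.inr (splitMatch q f p)))) = _
      rw [this]
      exact e8'
    · by_cases h2 : y = Sum.inr q
      · subst h2
        rw [P2]
        refine Run.step (r := (Sum.inl (Sum.inl q) : (D.L ⊕ Option E.L) ⊕ Bool)) hx
          (Or.inr (Or.inl rfl)) ?_
        refine Run.done ?_ (fun r hr => by simp [rho, rightFlag] at hr)
        change e (Sum.inr (Sum.inl (Sum.inr (splitMatch q f q)))) = _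
        rw [splitMatch_self]
        exact e9'
      · rw [P3 y h1 h2]
        refine Run.done hx (fun r hr => ?_)
        rcases y with ⟨v, k⟩ | j
        · simp [lam, leftFlag] at hr
        · have h1' : j ≠ p := fun h => h1 (by rw [h])
          have h2' : j ≠ q := fun h => h2 (by rw [h])
          rw [← (Sum.inr_injective hr : Sum.inl (Sum.inl j) = r)]
          simp [R, IsSplitEnd, h1', h2']
  have sp : (splitMatch q f).symm (some l) = p := by
    rw [splitMatch_symm_some, hl, Equiv.symm_apply_apply]
  have sq : (splitMatch q f).symm none = q := splitMatch_symm_none q f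
  have K8 : Run (B.subdivide c) R (rho (Sum.inl (none, 0)))
      (Φ (leftFlag (stuFlag p q (D.G.edge (Sum.inr p))))) := by
    refine Run.step (r := (Sum.inl (Sum.inr (some l)) : (D.L ⊕ Option E.L) ⊕ Bool)) e8
      (Or.inr (Or.inr (Or.inl rfl))) ?_
    apply K
    change e (Sum.inr (Sum.inl (Sum.inl ((splitMatch q f).symm (some l))))) = _
    rw [sp]
    exact e1 (Sum.inr p)
  have K9 : Run (B.subdivide c) R (rho (Sum.inl (none, 1)))
      (Φ (leftFlag (stuFlag p q (D.G.edge (Sum.inr q))))) := by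
    refine Run.step (r := (Sum.inl (Sum.inr none) : (D.L ⊕ Option E.L) ⊕ Bool)) e9
      (Or.inr (Or.inr (Or.inr rfl))) ?_
    apply K
    change e (Sum.inr (Sum.inl (Sum.inl ((splitMatch q f).symm none)))) = _
    rw [sq]
    exact e1 (Sum.inr q)
  have K7 : ∀ x y, y ≠ Sum.inr l → e x = rho (splitFlag l y) →
      Run (B.subdivide c) R x (rho (splitFlag l y)) := by
    intro x y hy hx
    refine Run.done hx (fun r hr => ?_)
    rcases y with ⟨v, k⟩ | j
    · simp [rho, splitFlag, rightFlag] at hr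
    · have h1' : j ≠ l := fun h => hy (by rw [h])
      rw [splitFlag_of_ne h1'] at hr
      rw [← (Sum.inr_injective hr : Sum.inl (Sum.inr (some j)) = r)]
      simp [R, IsSplitEnd, h1']
  refine (CSpace.mk_subdivide 𝕜 B c).symm.trans ?_
  refine mk_eq_of_run 𝕜 (B.subdivide c) (glueAlong (D.join p q hpq) E f) vtx F ?_ ?_ R ?_ ?_ ?_
  · exact joinEnd_injective p q l
  · rintro (⟨j, hj⟩ | j)
    · by_cases h1 : j = p
      · subst h1
        have a1 : F (Sum.inl ⟨j, hj⟩) = Sum.inr false := joinEnd_fst l hj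
        have a2 : F (Sum.inr (f ⟨j, hj⟩)) = Sum.inr true := joinEnd_snd j q l
        exact (congrArg (B.subdivide c).glue.1 a1).trans a2.symm
      · have h2 : f ⟨j, hj⟩ ≠ l := fun h => h1 (congrArg Subtype.val (f.injective h))
        have a1 : F (Sum.inl ⟨j, hj⟩) = Sum.inl (Sum.inl j) := joinEnd_inl l hj h1
        have a2 : F (Sum.inr (f ⟨j, hj⟩)) = Sum.inl (Sum.inr (some (f ⟨j, hj⟩))) :=
          joinEnd_inr p q h2
        refine (congrArg (B.subdivide c).glue.1 a1).trans (Eq.trans ?_ a2.symm)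
        exact congrArg (fun o => (Sum.inl (Sum.inr o) : (D.L ⊕ Option E.L) ⊕ Bool))
          (splitMatch_of_ne f hj)
    · by_cases h1 : j = l
      · subst h1
        have a1 : F (Sum.inr l) = Sum.inr true := joinEnd_snd p q l
        have a2 : F (Sum.inl (f.symm l)) = Sum.inr false := by
          rw [hl, Equiv.symm_apply_apply]; exact joinEnd_fst _ hpq
        exact (congrArg (B.subdivide c).glue.1 a1).trans a2.symm
      · have h2 : (f.symm j).1 ≠ p := fun h => h1 (by
          exact f.symm_apply_eq.1 (Subtype.ext h : f.symm j = ⟨p, hpq⟩))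
        have a1 : F (Sum.inr j) = Sum.inl (Sum.inr (some j)) := joinEnd_inr p q h1
        have a2 : F (Sum.inl (f.symm j)) = Sum.inl (Sum.inl (f.symm j).1) :=
          joinEnd_inl l (f.symm j).2 h2
        refine (congrArg (B.subdivide c).glue.1 a1).trans (Eq.trans ?_ a2.symm)
        exact congrArg (fun o => (Sum.inl (Sum.inl o) : (D.L ⊕ Option E.L) ⊕ Bool))
          (splitMatch_symm_some q f j)
  · exact isSplitEnd_iff hpq l
  · intro x
    change Run (B.subdivide c) R (Φ x) (Φ ((glueAlong (D.join p q hpq) E f).G.edge x))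
    have lE : ∀ y, (glueAlong (D.join p q hpq) E f).G.edge (leftFlag y) =
      leftFlag ((D.join p q hpq).G.edge y) := unionEdge_left (D.join p q hpq).G E.G
    have rE : ∀ y, (glueAlong (D.join p q hpq) E f).G.edge (rightFlag y) =
      rightFlag (E.G.edge y) := unionEdge_right (D.join p q hpq).G E.G
    rcases union_cases x with ⟨x, rfl⟩ | ⟨y, rfl⟩
    · rw [lE]
      rcases stu_cases p q hpq x with ⟨y, rfl⟩ | rfl | rfl
      · rw [show (D.join p q hpq).G.edge (stuFlag p q y) = stuFlag p q (D.G.edge y) from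
          stuEdge_stuFlag D.G p q hpq y]
        by_cases h1 : y = Sum.inr p
        · subst h1; rw [P1]; exact K8
        by_cases h2 : y = Sum.inr q
        · subst h2; rw [P2]; exact K9
        rw [P3 y h1 h2]
        exact K _ _ (e1 y)
      · rw [show (D.join p q hpq).G.edge (Sum.inl (none, 2)) = Sum.inr ⟨p, hpq⟩ from
          stuEdge_two D.G p q hpq, P4, P5]
        exact Run.done e3 (fun r hr => by cases hr; simp [R, IsSplitEnd])
      · rw [show (D.join p q hpq).G.edge (Sum.inr ⟨p, hpq⟩) = Sum.inl (none, 2) from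
          stuEdge_leg D.G p q hpq, P4, P5]
        exact Run.done e5 (fun r hr => by simp [rho, rightFlag] at hr)
    · rw [rE]
      by_cases h1 : y = Sum.inr l
      · subst h1
        rw [P6, P7 _ (E.G.edge_ne _)]
        exact K7 _ _ (E.G.edge_ne _) e6
      · rw [P7 y h1]
        by_cases h2 : y = E.G.edge (Sum.inr l)
        · subst h2
          rw [E.G.edge_edge, P6]
          exact Run.done e4 (fun r hr => by cases hr; simp [R, IsSplitEnd])
        · have h3 : E.G.edge y ≠ Sum.inr l := fun h => h2 (by rw [← h, E.G.edge_edge])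
          rw [P7 _ h3]
          exact K7 _ _ h3 (e7 y h1 h2)
  · rintro r (rfl | rfl | rfl | rfl)
    · exact ⟨_, K _ _ (e1 (Sum.inr p))⟩
    · exact ⟨_, K _ _ (e1 (Sum.inr q))⟩
    · exact ⟨_, Run.done e8' (fun r hr => by simp [rho, rightFlag] at hr)⟩
    · exact ⟨_, Run.done e9' (fun r hr => by simp [rho, rightFlag] at hr)⟩

/-- Joining legs is adjoint to splitting a leg. -/
lemma gl_split (D E : BDiag Y) (l : E.L) {x z : Y} (hl : E.color l = x) (hxz : x ≠ z) :
    gl 𝕜 Y (BSpace.mk 𝕜 D) (BSpace.mk 𝕜 (E.split l z)) =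
      gl 𝕜 Y (joinOp 𝕜 x z (BSpace.mk 𝕜 D)) (BSpace.mk 𝕜 E) := by
  classical
  rw [gl_mk, joinOp_mk]
  by_cases hD : Function.Injective D.color
  · rcases exists_legs_or D x z hxz with h | ⟨p, q, hpq, hp, hq⟩
    · rw [joinDiag_of_forall_ne h, map_zero, LinearMap.zero_apply]
      refine glDiag_of_isEmpty ⟨fun g => ?_⟩
      have g2 : ∀ o, D.color (g.1.symm o) = (E.split l z).color o := fun o => by
        rw [← g.2, Equiv.apply_symm_apply]
      rcases h with h | h
      · exact h _ ((g2 (some l)).trans hl)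
      · exact h _ (g2 none)
    · rw [joinDiag_eq hD p q hpq hp hq, gl_mk]
      by_cases hm : Nonempty (LegMatch (D.join p q hpq) E)
      · obtain ⟨f⟩ := hm
        have hE := f.injective (BDiag.join_injective hD p q hpq)
        have hlp : l = f.1 ⟨p, hpq⟩ := hE (by rw [f.2, hl]; exact hp.symm)
        subst hlp
        rw [glDiag_eq (BDiag.join_injective hD p q hpq) f,
          glDiag_eq hD ⟨splitMatch q f.1, fun j => ?_⟩]
        · exact mk_glueAlong_split D E p q hpq f.1 z
        · by_cases hj : j = q
          · subst hj; rw [splitMatch_self]; exact hq.symm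
          · rw [splitMatch_of_ne f.1 hj]; exact f.2 ⟨j, hj⟩
      · rw [glDiag_of_isEmpty (not_nonempty_iff.1 hm)]
        refine glDiag_of_isEmpty ⟨fun g => hm ?_⟩
        have hS := g.injective hD
        -- In a match with the split diagram, `q` must meet the additional leg, both being marked
        -- `z`. Removing this pair leaves a match with the joined diagram.
        have gq : g.1 q = none := hS (by rw [g.2, hq]; rfl)
        let e : Option {j // j ≠ q} ≃ Option E.L := (Equiv.optionSubtypeNe q).trans g.1
        have he : ∀ j : {j // j ≠ q}, e (some j) = g.1 j.1 := fun j => rfl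
        refine ⟨⟨Equiv.removeNone e, fun j => ?_⟩⟩
        have hne : e (some j) ≠ none := fun h => by
          rw [he, ← gq] at h
          exact j.2 (g.1.injective h)
        have h1 := Equiv.removeNone_some e (Option.ne_none_iff_exists'.1 hne)
        have h2 := g.2 j.1
        rw [← he, ← h1] at h2
        exact h2
  · rw [joinDiag_of_not_injective hD, map_zero, LinearMap.zero_apply, glDiag_of_not_injective hD]

end

end Jacobi

namespace Jacobi

noncomputable section

variable {𝕜 : Type*} [Field 𝕜] {X Y Z : Type}

/-! ### Combs with marked legs -/

/-- The comb with marked legs. -/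
abbrev BDiag.comb (n : ℕ) (c : Fin (n + 2) → Y) : BDiag Y where
  L := Fin (n + 2)
  color := c
  G := Jacobi.comb n

/-- Every edge of a comb either belongs to the spine, running from a right-pointing to a
left-pointing half-edge, or is a tooth. Since `e` is an involution, one end of each edge suffices.
-/
lemma Graph.comb_comm {n : ℕ} {W E : Type} (e : Flag W E → Flag W E) (he : ∀ a, e (e a) = a)
    (Φ : Flag (Fin n) (Fin (n + 2)) → Flag W E)
    (h1 : ∀ i, e (Φ (combRight n i)) = Φ (combLeft n i))
    (h2 : ∀ i : Fin n, e (Φ (Sum.inl (i, 1))) = Φ (Sum.inr i.succ.castSucc)) (b) :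
    e (Φ b) = Φ (combEdge n b) := by
  rcases comb_cases n b with ⟨i, rfl⟩ | ⟨i, rfl⟩ | ⟨i, rfl⟩ | ⟨i, rfl⟩
  · rw [combEdge_right, h1]
  · rw [combEdge_left, ← h1, he]
  · rw [h2]; rfl
  · rw [combEdge_leg, ← h2, he]

open Jacobi.Graph in
-- The first vertex of a comb carries the legs 0 and 1, the innermost bracket, and removing it
-- leaves a shorter comb. Accordingly `finSuccEquiv' 1` singles out leg 1 as the additional leg of
-- the split.
lemma BDiag.mk_comb_succ (n : ℕ) (x z : Y) (c : Fin (n + 1) → Y) :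
    BSpace.mk 𝕜 (BDiag.comb (n + 1) (Fin.cons x (Fin.cons z c))) =
      BSpace.mk 𝕜 ((BDiag.comb n (Fin.cons x c)).split (0 : Fin (n + 2)) z) := by
  let ext : Fin (n + 3) ≃ Option (Fin (n + 2)) := finSuccEquiv' 1
  have x0 : ext 0 = some 0 := by
    have : (0 : Fin (n + 3)) = (1 : Fin (n + 3)).succAbove 0 := rfl
    rw [this]; exact finSuccEquiv'_succAbove _ _
  have x1 : ext 1 = none := finSuccEquiv'_at _
  have x2 : ∀ i : Fin (n + 1), ext i.succ.succ = some i.succ := fun i => by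
    have : i.succ.succ = (1 : Fin (n + 3)).succAbove i.succ := by
      rw [← Fin.succ_zero_eq_one, Fin.succ_succAbove_succ, Fin.succAbove_zero]
    rw [this]; exact finSuccEquiv'_succAbove _ _
  let vtx : Fin (n + 1) ≃ Option (Fin n) := finSuccEquiv n
  have v0 : vtx 0 = none := finSuccEquiv_zero
  have v1 : ∀ i : Fin n, vtx i.succ = some i := finSuccEquiv_succ
  let S : Flag (Option (Fin n)) (Option (Fin (n + 2))) → Flag (Option (Fin n)) (Option (Fin (n + 2))) :=
    ((Jacobi.comb n).split (0 : Fin (n + 2))).edge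
  let Φ : Flag (Fin (n + 1)) (Fin (n + 3)) → Flag (Option (Fin n)) (Option (Fin (n + 2))) :=
    Sum.map (Prod.map vtx id) ext
  have pl : ∀ i : Fin (n + 1), Φ (combLeft (n + 1) i.succ) = splitFlag 0 (combLeft n i) := by
    intro i
    induction i using Fin.lastCases with
    | last =>
      have : (Fin.last n).succ = Fin.last (n + 1) := rfl
      rw [this, combLeft, combLeft, Fin.lastCases_last, Fin.lastCases_last,
        splitFlag_of_ne (Fin.last_pos.ne')]
      exact congrArg Sum.inr (x2 (Fin.last n))
    | cast j =>
      have : j.castSucc.succ = j.succ.castSucc := rfl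
      rw [this, combLeft, combLeft, Fin.lastCases_castSucc, Fin.lastCases_castSucc]
      simp [Φ, v1, splitFlag]
  have pr : ∀ i : Fin (n + 1), Φ (combRight (n + 1) i.succ) = splitFlag 0 (combRight n i) := by
    intro i
    induction i using Fin.cases with
    | zero =>
      rw [combRight, combRight, Fin.cases_succ, Fin.cases_zero, splitFlag_self]
      exact congrArg (fun o => Sum.inl (o, 2)) v0
    | succ j => simp [combRight, splitFlag, Φ, v1]
  have se : ∀ a : Flag (Fin n) (Fin (n + 2)), S (splitFlag 0 a) = splitFlag 0 (combEdge n a) :=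
    splitEdge_splitFlag (Jacobi.comb n) (0 : Fin (n + 2))
  refine BSpace.mk_equiv 𝕜 _ _ ext vtx ?_ ?_
  · refine comb_comm S ((Jacobi.comb n).split (0 : Fin (n + 2))).edge_edge Φ (fun i => ?_) (fun i => ?_)
    · induction i using Fin.cases with
      | zero =>
        have e1 : Φ (combRight (n + 1) 0) = Sum.inr (some 0) := by simp [combRight, Φ, x0]
        have e2 : Φ (combLeft (n + 1) 0) = Sum.inl (none, 0) := by
          have : (0 : Fin (n + 2)) = (0 : Fin (n + 1)).castSucc := rfl
          rw [this, combLeft, Fin.lastCases_castSucc]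
          simp [Φ, v0]
        rw [e1, e2]
        exact splitEdge_some (Jacobi.comb n) (0 : Fin (n + 2))
      | succ i => rw [pr, se, combEdge_right, pl]
    · induction i using Fin.cases with
      | zero =>
        have e1 : Φ (Sum.inl (0, 1)) = Sum.inl (none, 1) := by simp [Φ, v0]
        have e2 : Φ (Sum.inr (Fin.succ 0).castSucc) = Sum.inr none := congrArg Sum.inr x1
        rw [e1, e2]
        exact splitEdge_one (Jacobi.comb n) (0 : Fin (n + 2))
      | succ j =>
        have e1 : Φ (Sum.inl (j.succ, 1)) = splitFlag 0 (Sum.inl (j, 1)) := by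
          simp [Φ, v1, splitFlag]
        have e2 : Φ (Sum.inr j.succ.succ.castSucc) = splitFlag 0 (Sum.inr j.succ.castSucc) := by
          have : j.succ.castSucc = j.castSucc.succ := rfl
          rw [splitFlag_of_ne (by rw [this]; exact Fin.succ_ne_zero _)]
          exact congrArg Sum.inr (x2 j.castSucc)
        rw [e1, e2, se]
        rfl
  · intro l
    change Option.elim (ext l) z (Fin.cons x c : Fin (n + 2) → Y) =
      (Fin.cons x (Fin.cons z c) : Fin (n + 3) → Y) l
    induction l using Fin.cases with
    | zero => rw [x0]; rfl
    | succ l =>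
      induction l using Fin.cases with
      | zero => exact congrArg (fun o => Option.elim o z (Fin.cons x c : Fin (n + 2) → Y)) x1
      | succ l => rw [x2]; rfl

/-- The reflection of a comb. -/
def combRev (n : ℕ) : Graph.Iso (comb n) (comb n) where
  ext := Fin.revPerm
  vtx := Fin.revPerm (n := n)
  rot _ := Equiv.swap 0 2
  edge_comm := by
    refine Graph.comb_comm (comb n).edge (comb n).edge_edge _ (fun i => ?_) (fun i => ?_)
    · have sw0 : Equiv.swap (0 : Fin 3) 2 0 = 2 := by decide
      have sw2 : Equiv.swap (0 : Fin 3) 2 2 = 0 := by decide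
      have r : ∀ i : Fin (n + 1), Sum.map (fun w : Fin n × Fin 3 =>
          (Fin.revPerm w.1, Equiv.swap (0 : Fin 3) 2 w.2)) Fin.revPerm (combRight n i) =
          combLeft n i.rev := by
        intro i
        induction i using Fin.cases with
        | zero => simp [combRight, combLeft]
        | succ j => simp [combRight, combLeft, sw2, Fin.rev_succ]
      have l : ∀ i : Fin (n + 1), Sum.map (fun w : Fin n × Fin 3 =>
          (Fin.revPerm w.1, Equiv.swap (0 : Fin 3) 2 w.2)) Fin.revPerm (combLeft n i) =
          combRight n i.rev := by
        intro i
        induction i using Fin.lastCases with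
        | last => simp [combRight, combLeft]
        | cast j => simp [combRight, combLeft, sw0, Fin.rev_castSucc]
      exact (congrArg (combEdge n) (r i)).trans ((combEdge_left n _).trans (l i).symm)
    · have sw1 : Equiv.swap (0 : Fin 3) 2 1 = 1 := by decide
      change combEdge n (Sum.inl (i.rev, Equiv.swap (0 : Fin 3) 2 1)) =
        Sum.inr (i.succ.castSucc.rev)
      rw [sw1, Fin.rev_castSucc, Fin.rev_succ]
      rfl

lemma sign_combRev (n : ℕ) : (combRev n).sign = (-1) ^ n := by
  change (∏ _v : Fin n, ((Equiv.Perm.sign (Equiv.swap (0 : Fin 3) 2) : ℤˣ) : ℤ)) = _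
  rw [Equiv.Perm.sign_swap (by decide)]
  simp

lemma BDiag.mk_comb_rev (n : ℕ) (c : Fin (n + 2) → Y) :
    BSpace.mk 𝕜 (BDiag.comb n c) = (-1) ^ n • BSpace.mk 𝕜 (BDiag.comb n (c ∘ Fin.rev)) := by
  rw [BSpace.mk_iso 𝕜 (BDiag.comb n c) (BDiag.comb n (c ∘ Fin.rev)) (combRev n)
    (fun l => congrArg c (Fin.rev_rev l)), sign_combRev]
  rw [← Int.cast_smul_eq_zsmul 𝕜]

/-- Exchange of the two legs of a split leg. -/
def Graph.splitSwap {L : Type} (G : Graph L) (l : L) : Graph.Iso (G.split l) (G.split l) :=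
  letI : DecidableEq (Option L) := Classical.decEq _
  letI : DecidableEq (Option G.V) := Classical.decEq _
  { ext := Equiv.swap (some l) none
    vtx := Equiv.refl _
    rot := fun v => if v = none then Equiv.swap 0 1 else 1
    edge_comm := by
      have sw0 : Equiv.swap (0 : Fin 3) 1 0 = 1 := by decide
      have sw1 : Equiv.swap (0 : Fin 3) 1 1 = 0 := by decide
      have sw2 : Equiv.swap (0 : Fin 3) 1 2 = 2 := by decide
      set Ψ : Flag (Option G.V) (Option L) → Flag (Option G.V) (Option L) :=
        Sum.map (fun w : Option G.V × Fin 3 =>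
          (w.1, (if w.1 = none then Equiv.swap 0 1 else 1 : Equiv.Perm (Fin 3)) w.2))
          (Equiv.swap (some l) none) with hΨ
      have h : ∀ a : Flag G.V L, Ψ (splitFlag l a) = splitFlag l a := by
        rintro (⟨v, k⟩ | j)
        · simp [hΨ, splitFlag]
        · by_cases h1 : j = l
          · subst h1; simp [hΨ, splitFlag, sw2]
          · rw [splitFlag_of_ne h1]
            exact congrArg Sum.inr (Equiv.swap_apply_of_ne_of_ne (by simpa using h1) (by simp))
      have h1 : Ψ (Sum.inl (none, 0)) = Sum.inl (none, 1) := by simp [hΨ, sw0]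
      have h2 : Ψ (Sum.inl (none, 1)) = Sum.inl (none, 0) := by simp [hΨ, sw1]
      have h3 : Ψ (Sum.inr (some l)) = Sum.inr none := by simp [hΨ]
      have h4 : Ψ (Sum.inr none) = Sum.inr (some l) := by simp [hΨ]
      intro b
      change splitEdge G l (Ψ b) = Ψ (splitEdge G l b)
      rcases split_cases l b with ⟨a, rfl⟩ | rfl | rfl | rfl | rfl
      · rw [h, splitEdge_splitFlag, h]
      · rw [h1, splitEdge_one, splitEdge_zero, h3]
      · rw [h2, splitEdge_one, splitEdge_zero, h4]
      · rw [h3, splitEdge_some, splitEdge_none, h1]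
      · rw [h4, splitEdge_some, splitEdge_none, h2] }

lemma Graph.sign_splitSwap {L : Type} (G : Graph L) (l : L) : (G.splitSwap l).sign = -1 := by
  classical
  change (∏ v : Option G.V, ((Equiv.Perm.sign
    (@ite _ (v = none) (Classical.decEq _ v none) (Equiv.swap (0 : Fin 3) 1) 1) : ℤˣ) : ℤ)) = -1
  rw [Fintype.prod_eq_single none (fun v hv => by rw [if_neg hv]; simp), if_pos rfl,
    Equiv.Perm.sign_swap (by decide)]
  rfl

/-- AS at the first vertex, which exists because the comb has at least three legs. -/
lemma BDiag.mk_comb_swap (n : ℕ) (x z : Y) (c : Fin (n + 1) → Y) :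
    BSpace.mk 𝕜 (BDiag.comb (n + 1) (Fin.cons x (Fin.cons z c))) =
      - BSpace.mk 𝕜 (BDiag.comb (n + 1) (Fin.cons z (Fin.cons x c))) := by
  rw [BDiag.mk_comb_succ, BDiag.mk_comb_succ]
  rw [BSpace.mk_iso 𝕜 ((BDiag.comb n (Fin.cons x c)).split (0 : Fin (n + 2)) z)
    ((BDiag.comb n (Fin.cons z c)).split (0 : Fin (n + 2)) x)
    ((Jacobi.comb n).splitSwap (0 : Fin (n + 2))) ?_, Graph.sign_splitSwap]
  · simp
  · intro l
    change Option.elim (@Equiv.swap _ (Classical.decEq _) (some (0 : Fin (n + 2))) none l) x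
      (Fin.cons z c : Fin (n + 2) → Y) = Option.elim l z (Fin.cons x c : Fin (n + 2) → Y)
    rcases l with _ | l
    · rw [Graph.swap_right_apply]; rfl
    · induction l using Fin.cases with
      | zero => rw [Graph.swap_left_apply]; rfl
      | succ l =>
        rw [Graph.swap_apply_of_ne _ (by simp) (by simp)]
        rfl

/-- The class of the comb whose legs are marked by the letters of a word. -/
def combWord (𝕜 : Type*) [Field 𝕜] : List Y → BSpace 𝕜 Y
  | [] => 0
  | [_] => 0
  | a :: b :: w => BSpace.mk 𝕜 (BDiag.comb w.length (a :: b :: w).get)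

lemma combWord_ofFn {n : ℕ} (c : Fin (n + 2) → Y) :
    combWord 𝕜 (List.ofFn c) = BSpace.mk 𝕜 (BDiag.comb n c) := by
  have key : ∀ (w : List Y) (h : w.length = n + 2),
      combWord 𝕜 w = BSpace.mk 𝕜 (BDiag.comb n fun i => w.get (i.cast h.symm)) := by
    intro w h
    match w, h with
    | [], h => simp at h
    | [_], h => simp at h
    | a :: b :: w, h =>
      obtain rfl : w.length = n := by simpa using h
      rfl
  rw [key _ (List.length_ofFn)]
  congr 2
  funext i
  simp only [List.get_eq_getElem, List.getElem_ofFn, Fin.val_cast, Fin.eta]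

lemma exists_ofFn {w : List Y} (h : 2 ≤ w.length) :
    ∃ (n : ℕ) (c : Fin (n + 2) → Y), w = List.ofFn c ∧ w.length = n + 2 := by
  obtain ⟨n, hn⟩ := Nat.exists_eq_add_of_le' h
  exact ⟨n, fun i => w.get (i.cast hn.symm), by
    apply List.ext_get
    · simp [hn]
    · intro i h1 h2
      simp only [List.get_eq_getElem, List.getElem_ofFn, Fin.val_cast], hn⟩

/-- Reflection reverses the orientation of all $n$ vertices; the length is $n+2$, which has the same
parity. -/
lemma combWord_rev {w : List Y} (h : 2 ≤ w.length) :
    combWord 𝕜 w.reverse = (-1) ^ w.length • combWord 𝕜 w := by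
  obtain ⟨n, c, rfl, hn⟩ := exists_ofFn h
  have : (List.ofFn c).reverse = List.ofFn (c ∘ Fin.rev) := by
    apply List.ext_getElem
    · simp
    · intro i h1 h2
      rw [List.getElem_reverse, List.getElem_ofFn, List.getElem_ofFn]
      refine congrArg c (Fin.ext ?_)
      simp only [List.length_reverse, List.length_ofFn, Fin.val_rev] at h1 ⊢
      omega
  rw [this, combWord_ofFn, combWord_ofFn, BDiag.mk_comb_rev, hn, pow_add]
  have : (c ∘ Fin.rev) ∘ Fin.rev = c := by funext i; simp
  rw [this]
  simp

/-- A third letter is indispensable: the comb with two letters is a strut, which is symmetric. -/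
lemma combWord_swap (a b : Y) {w : List Y} (h : w ≠ []) :
    combWord 𝕜 (a :: b :: w) = - combWord 𝕜 (b :: a :: w) := by
  obtain ⟨d, w, rfl⟩ := List.exists_cons_of_ne_nil h
  have e : ∀ a b : Y, a :: b :: d :: w =
      List.ofFn (Fin.cons a (Fin.cons b (d :: w).get) : Fin (w.length + 1 + 2) → Y) := by
    intro a b
    rw [List.ofFn_cons, List.ofFn_cons, List.ofFn_get]
  rw [e a b, e b a, combWord_ofFn, combWord_ofFn, BDiag.mk_comb_swap]

lemma combWord_map (f : X → Y) (w : List X) :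
    BSpace.map 𝕜 f (combWord 𝕜 w) = combWord 𝕜 (w.map f) := by
  match w with
  | [] => simp [combWord]
  | [_] => simp [combWord]
  | a :: b :: w =>
    rw [show a :: b :: w = List.ofFn (a :: b :: w).get from (List.ofFn_get _).symm]
    rw [List.map_ofFn]
    erw [combWord_ofFn, combWord_ofFn, BSpace.map_mk]

open Jacobi.Graph in
-- It lets the adjunction `gl_split` act on one tree in the presence of the other trees of a forest.
lemma BDiag.mk_union_split (H E : BDiag Y) (l : E.L) (z : Y) :
    BSpace.mk 𝕜 (H.union (E.split l z)) = BSpace.mk 𝕜 ((H.union E).split (Sum.inr l) z) := by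
  let ext : H.L ⊕ Option E.L ≃ Option (H.L ⊕ E.L) :=
    { toFun := Sum.elim (fun j => some (Sum.inl j)) (Option.map Sum.inr)
      invFun := fun o => o.elim (Sum.inr none) (Sum.map id some)
      left_inv := by rintro (j | (_ | j)) <;> rfl
      right_inv := by rintro (_ | (j | j)) <;> rfl }
  let vtx : H.G.V ⊕ Option E.G.V ≃ Option (H.G.V ⊕ E.G.V) :=
    { toFun := Sum.elim (fun j => some (Sum.inl j)) (Option.map Sum.inr)
      invFun := fun o => o.elim (Sum.inr none) (Sum.map id some)
      left_inv := by rintro (j | (_ | j)) <;> rfl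
      right_inv := by rintro (_ | (j | j)) <;> rfl }
  let S : Flag (Option (H.G.V ⊕ E.G.V)) (Option (H.L ⊕ E.L)) →
    Flag (Option (H.G.V ⊕ E.G.V)) (Option (H.L ⊕ E.L)) :=
    ((H.union E).G.split (Sum.inr l : H.L ⊕ E.L)).edge
  let U : Flag (H.G.V ⊕ Option E.G.V) (H.L ⊕ Option E.L) →
    Flag (H.G.V ⊕ Option E.G.V) (H.L ⊕ Option E.L) := (H.union (E.split l z)).G.edge
  let Φ : Flag (H.G.V ⊕ Option E.G.V) (H.L ⊕ Option E.L) →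
    Flag (Option (H.G.V ⊕ E.G.V)) (Option (H.L ⊕ E.L)) := Sum.map (Prod.map vtx id) ext
  have se : ∀ a : Flag (H.G.V ⊕ E.G.V) (H.L ⊕ E.L), S (splitFlag (Sum.inr l) a) =
      splitFlag (Sum.inr l) (unionEdge H.G E.G a) :=
    splitEdge_splitFlag (H.union E).G (Sum.inr l : H.L ⊕ E.L)
  have p1 : ∀ a : Flag H.G.V H.L, Φ (leftFlag a) =
      splitFlag (Sum.inr l) (leftFlag a : Flag (H.G.V ⊕ E.G.V) (H.L ⊕ E.L)) := by
    rintro (⟨v, k⟩ | j)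
    · rfl
    · exact (splitFlag_of_ne (l := (Sum.inr l : H.L ⊕ E.L)) (j := Sum.inl j) (by simp)).symm
  have p2 : ∀ a : Flag E.G.V E.L, Φ (rightFlag (splitFlag l a)) =
      splitFlag (Sum.inr l) (rightFlag a : Flag (H.G.V ⊕ E.G.V) (H.L ⊕ E.L)) := by
    rintro (⟨v, k⟩ | j)
    · rfl
    · by_cases hj : j = l
      · subst hj
        rw [splitFlag_self]
        exact (splitFlag_self (Sum.inr j : H.L ⊕ E.L)).symm
      · rw [splitFlag_of_ne hj]
        exact (splitFlag_of_ne (l := (Sum.inr l : H.L ⊕ E.L)) (j := Sum.inr j)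
          (by simpa using hj)).symm
  have ur : ∀ a, U (rightFlag a) =
      rightFlag (splitEdge E.G l a) := unionEdge_right H.G (E.split l z).G
  refine BSpace.mk_equiv 𝕜 _ _ ext vtx (fun b => ?_) ?_
  · change S (Φ b) = Φ (U b)
    rcases union_cases b with ⟨a, rfl⟩ | ⟨a, rfl⟩
    · rw [p1, se, unionEdge_left, ← p1]
      exact congrArg Φ (unionEdge_left H.G (E.split l z).G a).symm
    · rcases split_cases l a with ⟨a, rfl⟩ | rfl | rfl | rfl | rfl
      · rw [p2, se, ur, unionEdge_right, splitEdge_splitFlag, p2]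
      · rw [ur, splitEdge_zero]; rfl
      · rw [ur, splitEdge_one]; rfl
      · rw [ur, splitEdge_some]
        exact splitEdge_some (H.union E).G (Sum.inr l : H.L ⊕ E.L)
      · rw [ur, splitEdge_none]; rfl
  · rintro (j | (_ | j)) <;> rfl

/-- The first letter of a comb can be joined to the second one in the other factor. -/
lemma gl_combWord_cons (m R : BSpace 𝕜 Y) {x z : Y} (hxz : x ≠ z) {w : List Y} (h : w ≠ []) :
    gl 𝕜 Y m (R * combWord 𝕜 (x :: z :: w)) =
      gl 𝕜 Y (joinOp 𝕜 x z m) (R * combWord 𝕜 (x :: w)) := by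
  obtain ⟨d, w, rfl⟩ := List.exists_cons_of_ne_nil h
  have e1 : combWord 𝕜 (x :: z :: d :: w) =
      BSpace.mk 𝕜 ((BDiag.comb w.length (Fin.cons x (d :: w).get)).split
        (0 : Fin (w.length + 2)) z) := by
    rw [← BDiag.mk_comb_succ, ← combWord_ofFn, List.ofFn_cons, List.ofFn_cons, List.ofFn_get]
  have e2 : combWord 𝕜 (x :: d :: w) =
      BSpace.mk 𝕜 (BDiag.comb w.length (Fin.cons x (d :: w).get)) := by
    rw [← combWord_ofFn, List.ofFn_cons, List.ofFn_get]
  rw [e1, e2]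
  induction R using BSpace.induction with
  | hmk H =>
    induction m using BSpace.induction with
    | hmk D =>
      rw [BSpace.mk_mul_mk, BSpace.mk_mul_mk]
      set E := BDiag.comb w.length (Fin.cons x (d :: w).get) with hE
      rw [BDiag.mk_union_split]
      exact gl_split D (H.union E) (Sum.inr (0 : Fin (w.length + 2))) rfl hxz
    | hadd a b ha hb => simp only [map_add, LinearMap.add_apply, ha, hb]
    | hsmul c a ha => simp only [map_smul, LinearMap.smul_apply, ha]
    | hzero => simp only [map_zero, LinearMap.zero_apply]
  | hadd a b ha hb => simp only [add_mul, map_add, ha, hb]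
  | hsmul c a ha => simp only [smul_mul_assoc, map_smul, ha]
  | hzero => simp only [zero_mul, map_zero]

/-! ### Gluing struts -/

open Jacobi.Graph CDiag in
/-- Gluing a union of struts to a diagram joins its legs in pairs. -/
lemma gl_struts (D : BDiag Y) (hD : Function.Injective D.color) {ι : Type} [Fintype ι]
    (p : Pairing D.L) (s : (Σ _ : ι, Fin 2) ≃ D.L) (hs : ∀ b, p.1 (s ⟨b, 0⟩) = s ⟨b, 1⟩) :
    gl 𝕜 Y (BSpace.mk 𝕜 D) (∏ b, BSpace.mk 𝕜 (BDiag.comb 0 fun i => D.color (s ⟨b, i⟩))) =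
      CSpace.mk 𝕜 (D.close p) := by
  have hs' : ∀ b, p.1 (s ⟨b, 1⟩) = s ⟨b, 0⟩ := fun b => by rw [← hs, p.2.1]
  set H : BDiag Y := BDiag.sigma fun b => BDiag.comb 0 fun i => D.color (s ⟨b, i⟩) with hH
  have hm : ∀ l, H.color (s.symm l) = D.color l := fun l =>
    congrArg D.color (s.apply_symm_apply l)
  rw [← BDiag.mk_sigma, gl_mk, glDiag_eq hD ⟨s.symm, hm⟩]
  let B := glueAlong D H s.symm
  let e : Flag (D.G.V ⊕ Σ _ : ι, Fin 0) (D.L ⊕ Σ _ : ι, Fin 2) →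
    Flag (D.G.V ⊕ Σ _ : ι, Fin 0) (D.L ⊕ Σ _ : ι, Fin 2) := B.G.edge
  have e1 : ∀ a, e (leftFlag a) = leftFlag (D.G.edge a) := unionEdge_left D.G H.G
  have e2 : ∀ b, e (Sum.inr (Sum.inr ⟨b, 0⟩)) = Sum.inr (Sum.inr ⟨b, 1⟩) := fun b => rfl
  have e3 : ∀ b, e (Sum.inr (Sum.inr ⟨b, 1⟩)) = Sum.inr (Sum.inr ⟨b, 0⟩) := fun b => rfl
  have g1 : ∀ l, B.glue.1 (Sum.inl l : D.L ⊕ Σ _ : ι, Fin 2) = Sum.inr (s.symm l) := fun l => rfl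
  have g2 : ∀ x, B.glue.1 (Sum.inr x : D.L ⊕ Σ _ : ι, Fin 2) = Sum.inl (s x) := fun l => rfl
  -- A strut passes through two glued points, one at each end. The point at end 1 is kept and plays
  -- the role of the gluing by `p`; the point at end 0 is superfluous and makes up `R` below.
  let F0 : (Σ _ : ι, Fin 2) → D.L ⊕ Σ _ : ι, Fin 2 := fun x =>
    if x.2 = 0 then Sum.inr ⟨x.1, 1⟩ else Sum.inl (s x)
  let F : D.L → D.L ⊕ Σ _ : ι, Fin 2 := fun l => F0 (s.symm l)
  have f0 : ∀ b, F (s ⟨b, 0⟩) = Sum.inr ⟨b, 1⟩ := fun b => by simp [F, F0]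
  have f1 : ∀ b, F (s ⟨b, 1⟩) = Sum.inl (s ⟨b, 1⟩) := fun b => by simp [F, F0]
  have hcase : ∀ l, ∃ b, l = s ⟨b, 0⟩ ∨ l = s ⟨b, 1⟩ := by
    intro l
    obtain ⟨⟨b, i⟩, rfl⟩ := s.surjective l
    refine ⟨b, ?_⟩
    fin_cases i
    · exact Or.inl rfl
    · exact Or.inr rfl
  let R : (D.L ⊕ Σ _ : ι, Fin 2) → Prop := fun j =>
    ∃ b, j = Sum.inl (s ⟨b, 0⟩) ∨ j = Sum.inr ⟨b, 0⟩
  have hempty : IsEmpty (Σ _ : ι, Fin 0) := ⟨fun x => x.2.elim0⟩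
  let vtx : D.G.V ≃ D.G.V ⊕ Σ _ : ι, Fin 0 := (Equiv.sumEmpty _ _).symm
  let Φ : Flag D.G.V D.L → Flag (D.G.V ⊕ Σ _ : ι, Fin 0) (D.L ⊕ Σ _ : ι, Fin 2) :=
    Sum.map (Prod.map vtx id) F
  have nR : ∀ b, ¬ R (Sum.inr ⟨b, 1⟩) := by
    rintro b ⟨b', h | h⟩ <;> simp at h
  have nR' : ∀ b, ¬ R (Sum.inl (s ⟨b, 1⟩)) := by
    rintro b ⟨b', h | h⟩ <;> simp at h
  have K : ∀ x y, e x = leftFlag y → Run B R x (Φ y) := by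
    intro x y hx
    rcases y with ⟨v, k⟩ | l
    · exact Run.done hx (fun r hr => by simp [Φ] at hr)
    · obtain ⟨b, rfl | rfl⟩ := hcase l
      · refine Run.step (r := (Sum.inl (s ⟨b, 0⟩) : D.L ⊕ Σ _ : ι, Fin 2)) hx
          ⟨b, Or.inl rfl⟩ ?_
        rw [show Φ (Sum.inr (s ⟨b, 0⟩)) = Sum.inr (Sum.inr ⟨b, 1⟩) from congrArg Sum.inr (f0 b),
          g1, Equiv.symm_apply_apply]
        exact Run.done (e2 b) (fun r hr => by cases hr; exact nR b)
      · rw [show Φ (Sum.inr (s ⟨b, 1⟩)) = Sum.inr (Sum.inl (s ⟨b, 1⟩)) from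
          congrArg Sum.inr (f1 b)]
        exact Run.done hx (fun r hr => by cases hr; exact nR' b)
  have hF : Function.Injective F := by
    intro l l' h
    obtain ⟨b, rfl | rfl⟩ := hcase l <;> obtain ⟨b', rfl | rfl⟩ := hcase l' <;>
      simp only [f0, f1, Sum.inr.injEq, Sum.inl.injEq, Sigma.mk.injEq, reduceCtorEq] at h
    · rw [h.1]
    · exact h
  have hR : ∀ j, R j ↔ j ∉ Set.range F := by
    intro j
    constructor
    · rintro ⟨b, rfl | rfl⟩ ⟨l, hl⟩ <;> obtain ⟨b', rfl | rfl⟩ := hcase l <;>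
        simp [f0, f1] at hl
    · intro h
      rcases j with l | ⟨b, i⟩
      · obtain ⟨b, rfl | rfl⟩ := hcase l
        · exact ⟨b, Or.inl rfl⟩
        · exact absurd ⟨_, f1 b⟩ h
      · fin_cases i
        · exact ⟨b, Or.inr rfl⟩
        · exact absurd ⟨_, f0 b⟩ h
  have hrun : ∀ x : Flag D.G.V D.L, Run B R (Φ x) (Φ (D.G.edge x)) := by
    rintro (⟨v, k⟩ | l)
    · exact K _ _ (e1 (Sum.inl (v, k)))
    · obtain ⟨b, rfl | rfl⟩ := hcase l
      · rw [show Φ (Sum.inr (s ⟨b, 0⟩)) = Sum.inr (Sum.inr ⟨b, 1⟩) from congrArg Sum.inr (f0 b)]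
        refine Run.step (r := (Sum.inr ⟨b, 0⟩ : D.L ⊕ Σ _ : ι, Fin 2)) (e3 b)
          ⟨b, Or.inr rfl⟩ (K _ _ ?_)
        exact e1 (Sum.inr (s ⟨b, 0⟩))
      · rw [show Φ (Sum.inr (s ⟨b, 1⟩)) = Sum.inr (Sum.inl (s ⟨b, 1⟩)) from
          congrArg Sum.inr (f1 b)]
        exact K _ _ (e1 (Sum.inr (s ⟨b, 1⟩)))
  refine mk_eq_of_run 𝕜 B (D.close p) vtx F hF (fun l => ?_) R hR hrun ?_
  · change B.glue.1 (F l) = F (p.1 l)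
    obtain ⟨b, rfl | rfl⟩ := hcase l
    · rw [hs, f0, f1, g2]
    · rw [hs', f0, f1, g1, Equiv.symm_apply_apply]
  · rintro r ⟨b, rfl | rfl⟩
    · exact ⟨_, K _ _ (e1 (Sum.inr (s ⟨b, 0⟩)))⟩
    · exact ⟨_, Run.done (e2 b) (fun r hr => by cases hr; exact nR b)⟩

end

end Jacobi

namespace Jacobi

noncomputable section

variable {𝕜 : Type*} [Field 𝕜] {X Y Z : Type}

/-! ### Sums over shuffles of words -/

section Shuffle

variable {α β M N : Type*} [AddCommMonoid M] [AddCommMonoid N]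

/-- The sum of the values of `f` on all shuffles of two words. -/
def shuffleSum (f : List α → M) : List α → List α → M
  | [], v => f v
  | u, [] => f u
  | x :: u, y :: v => shuffleSum (fun w => f (x :: w)) u (y :: v) +
      shuffleSum (fun w => f (y :: w)) (x :: u) v
  termination_by u v => u.length + v.length

lemma shuffleSum_nil_left (f : List α → M) (v : List α) : shuffleSum f [] v = f v := by
  rw [shuffleSum]

lemma shuffleSum_nil_right (f : List α → M) (u : List α) : shuffleSum f u [] = f u := by
  cases u <;> simp [shuffleSum]

lemma shuffleSum_cons (f : List α → M) (x y : α) (u v : List α) :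
    shuffleSum f (x :: u) (y :: v) = shuffleSum (fun w => f (x :: w)) u (y :: v) +
      shuffleSum (fun w => f (y :: w)) (x :: u) v := by
  rw [shuffleSum]

lemma shuffleSum_congr {f g : List α → M} (u v : List α)
    (h : ∀ w, w.Perm (u ++ v) → f w = g w) : shuffleSum f u v = shuffleSum g u v := by
  match u, v with
  | [], v => rw [shuffleSum_nil_left, shuffleSum_nil_left, h v (by simp)]
  | x :: u, [] => rw [shuffleSum_nil_right, shuffleSum_nil_right, h (x :: u) (by simp)]
  | x :: u, y :: v =>
    rw [shuffleSum_cons, shuffleSum_cons,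
      shuffleSum_congr (f := fun w => f (x :: w)) (g := fun w => g (x :: w)) u (y :: v)
        (fun w hw => h _ (by simpa using hw)),
      shuffleSum_congr (f := fun w => f (y :: w)) (g := fun w => g (y :: w)) (x :: u) v
        (fun w hw => h _ ?_)]
    refine (hw.cons y).trans ?_
    exact (List.perm_middle (l₁ := x :: u)).symm
  termination_by u.length + v.length

lemma shuffleSum_add (f g : List α → M) (u v : List α) :
    shuffleSum (fun w => f w + g w) u v = shuffleSum f u v + shuffleSum g u v := by
  match u, v with
  | [], v => simp only [shuffleSum_nil_left]
  | x :: u, [] => simp only [shuffleSum_nil_right]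
  | x :: u, y :: v =>
    simp only [shuffleSum_cons]
    rw [shuffleSum_add (fun w => f (x :: w)), shuffleSum_add (fun w => f (y :: w))]
    abel
  termination_by u.length + v.length

lemma shuffleSum_zero (u v : List α) : shuffleSum (fun _ => (0 : M)) u v = 0 := by
  match u, v with
  | [], v => simp only [shuffleSum_nil_left]
  | x :: u, [] => simp only [shuffleSum_nil_right]
  | x :: u, y :: v => rw [shuffleSum_cons, shuffleSum_zero, shuffleSum_zero, add_zero]
  termination_by u.length + v.length

lemma map_shuffleSum (φ : M →+ N) (f : List α → M) (u v : List α) :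
    φ (shuffleSum f u v) = shuffleSum (fun w => φ (f w)) u v := by
  match u, v with
  | [], v => simp only [shuffleSum_nil_left]
  | x :: u, [] => simp only [shuffleSum_nil_right]
  | x :: u, y :: v => rw [shuffleSum_cons, shuffleSum_cons, map_add, map_shuffleSum, map_shuffleSum]
  termination_by u.length + v.length

lemma shuffleSum_map (g : α → β) (f : List β → M) (u v : List α) :
    shuffleSum f (u.map g) (v.map g) = shuffleSum (fun w => f (w.map g)) u v := by
  match u, v with
  | [], v => simp only [shuffleSum_nil_left, List.map_nil]
  | x :: u, [] => simp only [shuffleSum_nil_right, List.map_nil]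
  | x :: u, y :: v =>
    have h1 := shuffleSum_map g (fun w => f (g x :: w)) u (y :: v)
    have h2 := shuffleSum_map g (fun w => f (g y :: w)) (x :: u) v
    simp only [List.map_cons] at h1 h2 ⊢
    rw [shuffleSum_cons, shuffleSum_cons, h1, h2]
    simp only [List.map_cons]
  termination_by u.length + v.length

/-- A function on words that vanishes on shuffles is determined by its values on the words with
a given first letter. -/
lemma shuffleSum_reverse {A : Type*} [AddCommGroup A] (f : List α → A) (p a q : List α) (x : α)
    (hf : ∀ u v, u ≠ [] → v ≠ [] → (u ++ v).Perm (p ++ a ++ x :: q) → shuffleSum f u v = 0)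
    {c : α} {r : List α} (hc : c :: r = p ++ x :: q) :
    shuffleSum (fun w => f (x :: w)) (p.reverse ++ a) q =
      (-1) ^ p.length • shuffleSum (fun w => f (c :: w)) a r := by
  induction p generalizing a c r with
  | nil =>
    obtain ⟨rfl, rfl⟩ : c = x ∧ r = q := by simpa using hc
    simp
  | cons d p ih =>
    obtain ⟨rfl, rfl⟩ : c = d ∧ r = p ++ x :: q := by simpa using hc
    obtain ⟨e, s, hs⟩ := List.exists_cons_of_ne_nil (show p ++ x :: q ≠ [] by simp)
    have h1 := ih (c :: a) (fun u v hu hv h => hf u v hu hv (h.trans (by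
      simp only [List.append_assoc, List.cons_append]
      exact List.perm_middle))) hs.symm
    rw [List.reverse_cons, List.append_assoc, List.singleton_append, h1, List.length_cons,
      pow_succ, mul_neg_one, neg_smul]
    -- The shuffles of `c :: a` and `e :: s` begin with `c` or with `e`. As the total vanishes, the
    -- first letter is traded at the cost of a sign; each step moves one letter of `p` over to `a`.
    have h2 := hf (c :: a) (e :: s) (by simp) (by simp) (by
      rw [← hs]
      simp only [List.append_assoc, List.cons_append]
      refine List.Perm.cons c ?_
      rw [← List.append_assoc, ← List.append_assoc]
      exact List.perm_append_comm.append_right _)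
    rw [shuffleSum_cons] at h2
    rw [hs, eq_neg_of_add_eq_zero_left h2, smul_neg, neg_neg]

end Shuffle

/-! ### Descents and shuffles -/

/-- The number of ascents of a word. -/
def ascents : List ℤ → ℕ
  | [] => 0
  | [_] => 0
  | x :: y :: w => (if x < y then 1 else 0) + ascents (y :: w)

/-- The number of descents of a word. -/
def descentsOf : List ℤ → ℕ
  | [] => 0
  | [_] => 0
  | x :: y :: w => (if y < x then 1 else 0) + descentsOf (y :: w)

lemma ascents_add_descents {w : List ℤ} (hw : w.Nodup) (h : w ≠ []) :
    ascents w + descentsOf w + 1 = w.length := by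
  match w with
  | [] => exact absurd rfl h
  | [_] => rfl
  | x :: y :: w =>
    have ih := ascents_add_descents (w := y :: w) hw.of_cons (by simp)
    have hxy : x ≠ y := fun h => by simp [h] at hw
    simp only [ascents, descentsOf, List.length_cons] at ih ⊢
    rcases lt_or_gt_of_ne hxy with h | h
    · rw [if_pos h, if_neg h.not_gt]; omega
    · rw [if_neg h.not_gt, if_pos h]; omega

lemma ascents_lt {w : List ℤ} (h : w ≠ []) : ascents w < w.length := by
  match w with
  | [] => exact absurd rfl h
  | [_] => simp [ascents]
  | x :: y :: w =>
    have ih := ascents_lt (w := y :: w) (by simp)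
    simp only [ascents, List.length_cons] at ih ⊢
    split_ifs <;> omega

/-- The number of occurrences of `w` as a subsequence of a word. -/
def occurrences : List ℤ → List ℤ → ℕ
  | [], [] => 1
  | [], _ :: _ => 0
  | _ :: A, [] => occurrences A []
  | c :: A, x :: w => occurrences A (x :: w) + if x = c then occurrences A w else 0

lemma occurrences_nil (A : List ℤ) : occurrences A [] = 1 := by
  induction A with
  | nil => rfl
  | cons c A ih => rw [occurrences, ih]

/-- An occurrence of `u` and one of `v` use disjoint positions of `A`, since no letter is common to
both words. Merging the positions gives an occurrence of exactly one shuffle, and every occurrence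
of a shuffle arises in this way. -/
lemma shuffleSum_occurrences (A : List ℤ) (u v : List ℤ) (h : (u ++ v).Nodup) :
    shuffleSum (occurrences A) u v = occurrences A u * occurrences A v := by
  induction A generalizing u v with
  | nil =>
    match u, v with
    | [], v => rw [shuffleSum_nil_left]; simp [occurrences]
    | x :: u, [] => rw [shuffleSum_nil_right]; simp [occurrences]
    | x :: u, y :: v =>
      have : ∀ x : ℤ, (fun w => occurrences [] (x :: w)) = fun _ => 0 := fun x => rfl
      rw [shuffleSum_cons, this, this, shuffleSum_zero, shuffleSum_zero]
      simp [occurrences]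
  | cons c A ih =>
    match u, v with
    | [], v => rw [shuffleSum_nil_left, occurrences_nil, one_mul]
    | x :: u, [] => rw [shuffleSum_nil_right, occurrences_nil, mul_one]
    | x :: u, y :: v =>
      have hxy : x ≠ y := by
        rintro rfl; simp at h
      have e : ∀ x : ℤ, (fun w => occurrences (c :: A) (x :: w)) =
          fun w => occurrences A (x :: w) + if x = c then occurrences A w else 0 := fun x => rfl
      have h1 := ih (x :: u) (y :: v) h
      rw [shuffleSum_cons] at h1
      rw [shuffleSum_cons, e, e, shuffleSum_add, shuffleSum_add, add_add_add_comm, h1]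
      simp only [occurrences]
      by_cases hx : x = c
      · have hy : y ≠ c := fun h => hxy (hx.trans h.symm)
        simp only [if_pos hx, if_neg hy, shuffleSum_zero]
        rw [ih u (y :: v) (by simpa using h.of_cons)]
        ring
      · by_cases hy : y = c
        · simp only [if_neg hx, if_pos hy, shuffleSum_zero]
          rw [ih (x :: u) v (h.sublist (by simp))]
          ring
        · simp only [if_neg hx, if_neg hy, shuffleSum_zero]
          ring

/-- `k` copies of a word. -/
def copies (T : List ℤ) : ℕ → List ℤ
  | 0 => []
  | k + 1 => T ++ copies T k

/-- The binomial coefficient that counts the occurrences of `w` in `k` copies of an ordered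
alphabet. -/
def ascentBinom (k : ℕ) (w : List ℤ) : ℕ := (k + ascents w).choose w.length

/-- Pascal's rule. In terms of occurrences, `x` is either absent from the first copy of the alphabet
or taken from it, and in the latter case `y` may come from the same copy exactly if it is larger. -/
lemma ascentBinom_cons (k : ℕ) (x y : ℤ) (w : List ℤ) :
    ascentBinom (k + 1) (x :: y :: w) = ascentBinom k (x :: y :: w) +
      if x < y then ascentBinom (k + 1) (y :: w) else ascentBinom k (y :: w) := by
  simp only [ascentBinom, ascents, List.length_cons]
  split_ifs
  · rw [show k + 1 + (1 + ascents (y :: w)) = (k + (1 + ascents (y :: w))) + 1 by ring,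
      Nat.choose_succ_succ' _ (w.length + 1), add_comm]
    congr 2; ring
  · rw [show k + 1 + (0 + ascents (y :: w)) = (k + (0 + ascents (y :: w))) + 1 by ring,
      Nat.choose_succ_succ' _ (w.length + 1), add_comm]
    congr 2; ring

/-- Induction over the final segments `T` of the ordered alphabet. A word whose first letter lies
outside `T` cannot begin in `T`. A word that begins with a letter of `T` finds in `T` as much as in
a full copy, since further letters taken from this copy are larger and so belong to `T`. -/
lemma occurrences_append (S : Finset ℤ) (A : List ℤ) (k : ℕ)
    (hA : ∀ w : List ℤ, w.Nodup → (∀ x ∈ w, x ∈ S) → occurrences A w = ascentBinom k w)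
    (T : List ℤ) (hT : T.Pairwise (· < ·)) (hT' : ∀ z ∈ S, (∃ c ∈ T, c ≤ z) → z ∈ T)
    (w : List ℤ) (hw : w.Nodup) (hwS : ∀ x ∈ w, x ∈ S) :
    occurrences (T ++ A) w =
      if ∃ x ∈ w.head?, x ∈ T then ascentBinom (k + 1) w else ascentBinom k w := by
  induction T generalizing w with
  | nil => simpa using hA w hw hwS
  | cons c T ih =>
    rw [List.pairwise_cons] at hT
    have hT1 : ∀ z ∈ S, (∃ c ∈ T, c ≤ z) → z ∈ T := by
      rintro z hz ⟨c', hc', hle⟩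
      have := hT' z hz ⟨c', List.mem_cons_of_mem _ hc', hle⟩
      rcases List.mem_cons.1 this with rfl | h
      · exact absurd (hT.1 c' hc') (not_lt.2 hle)
      · exact h
    match w with
    | [] => simp [occurrences_nil, ascentBinom]
    | [x] =>
      have hx := ih hT.2 hT1 [x] hw hwS
      simp only [List.cons_append, occurrences, occurrences_nil, hx]
      by_cases hxc : x = c
      · have hxT : x ∉ T := fun h => absurd (hT.1 x h) (by simp [hxc])
        simp [hxc, ascentBinom, ascents]
        simp [← hxc, hxT]
      · simp [hxc]
    | x :: y :: w =>
      have hx := ih hT.2 hT1 (x :: y :: w) hw hwS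
      have hy := ih hT.2 hT1 (y :: w) hw.of_cons (fun z hz => hwS z (List.mem_cons_of_mem _ hz))
      have hxy : x ≠ y := fun h => by simp [h] at hw
      simp only [List.cons_append, occurrences, hx, hy, List.head?_cons, Option.mem_some_iff,
        exists_eq_left', List.mem_cons]
      by_cases hxc : x = c
      · have hxT : x ∉ T := fun h => absurd (hT.1 x h) (by simp [hxc])
        have hyT : y ∈ T ↔ x < y := by
          constructor
          · intro h; rw [hxc]; exact hT.1 y h
          · intro h
            have := hT' y (hwS y (by simp)) ⟨c, by simp, hxc ▸ h.le⟩
            rcases List.mem_cons.1 this with h' | h'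
            · exact absurd (hxc.trans h'.symm) hxy
            · exact h'
        rw [if_neg hxT, if_pos hxc, if_pos (Or.inl hxc), ascentBinom_cons k x y w]
        simp only [hyT]
      · simp [hxc]

/-- An occurrence is a weakly increasing choice of copies that is strict at every descent; such
choices are counted by the binomial coefficient. -/
lemma occurrences_copies (S : Finset ℤ) (k : ℕ) (w : List ℤ) (hw : w.Nodup)
    (hwS : ∀ x ∈ w, x ∈ S) : occurrences (copies (S.sort (· ≤ ·)) k) w = ascentBinom k w := by
  induction k generalizing w with
  | zero =>
    match w with
    | [] => simp [occurrences_nil, ascentBinom]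
    | x :: w =>
      have := ascents_lt (w := x :: w) (by simp)
      rw [ascentBinom, Nat.choose_eq_zero_of_lt (by omega)]
      rfl
  | succ k ih =>
    rw [copies, occurrences_append S _ k ih _ (S.sortedLT_sort).pairwise (fun z hz _ => by simpa using hz)
      w hw hwS]
    split_ifs with h
    · rfl
    · match w with
      | [] => simp [ascentBinom]
      | x :: w => exact absurd ⟨x, by simp, by simpa using hwS x (by simp)⟩ h

lemma shuffleSum_ascentBinom (k : ℕ) (u v : List ℤ) (h : (u ++ v).Nodup) :
    shuffleSum (ascentBinom k) u v = ascentBinom k u * ascentBinom k v := by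
  have key : ∀ w : List ℤ, w.Nodup → (∀ x ∈ w, x ∈ (u ++ v).toFinset) → _ :=
    occurrences_copies (u ++ v).toFinset k
  rw [← key u (List.nodup_append.1 h).1 (fun x hx => by simp [hx]),
    ← key v (List.nodup_append.1 h).2.1 (fun x hx => by simp [hx]),
    ← shuffleSum_occurrences _ u v h]
  exact shuffleSum_congr u v fun w hw => (key w (hw.nodup_iff.2 h)
    (fun x hx => by simpa using hw.mem_iff.1 hx)).symm

/-! ### The first Eulerian idempotent -/

/-- The coefficients of the trees. -/
def treeCoeff (𝕜 : Type*) [Field 𝕜] (n d : ℕ) : 𝕜 :=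
  (-1) ^ d / (((n : 𝕜) + 1) * (n.choose d : 𝕜))

/-- Since $\frac1{(n+1)\binom nd}=\int_0^1x^d(1-x)^{n-d}\,dx$, the identity amounts to $(1-x)+x=1$;
here it is derived from the recursions of binomial coefficients. It governs the exchange of two
adjacent letters, which changes the number of descents by one. -/
lemma treeCoeff_sub [CharZero 𝕜] {n d : ℕ} (h : d ≤ n) :
    treeCoeff 𝕜 (n + 1) d - treeCoeff 𝕜 (n + 1) (d + 1) = treeCoeff 𝕜 n d := by
  have h1 : ((n.choose d : ℕ) : 𝕜) ≠ 0 := Nat.cast_ne_zero.2 (Nat.choose_pos h).ne'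
  have h2 : (((n + 1).choose d : ℕ) : 𝕜) ≠ 0 := Nat.cast_ne_zero.2 (Nat.choose_pos (by omega)).ne'
  have h3 : (((n + 1).choose (d + 1) : ℕ) : 𝕜) ≠ 0 :=
    Nat.cast_ne_zero.2 (Nat.choose_pos (by omega)).ne'
  have h4 : (n : 𝕜) + 1 ≠ 0 := by exact_mod_cast Nat.succ_ne_zero n
  have h5 : (n : 𝕜) + 1 + 1 ≠ 0 := by exact_mod_cast Nat.succ_ne_zero (n + 1)
  have e1 : ((n : 𝕜) + 1) * (n.choose d : 𝕜) = ((n + 1).choose (d + 1) : ℕ) * ((d : 𝕜) + 1) := by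
    exact_mod_cast Nat.add_one_mul_choose_eq n d
  have e2 : (((n + 1).choose d : ℕ) : 𝕜) * ((n : 𝕜) + 1 - d) =
      ((n : 𝕜) + 1) * (n.choose d : 𝕜) := by
    have := Nat.choose_mul_succ_eq n d
    have h' : ((n + 1 - d : ℕ) : 𝕜) = (n : 𝕜) + 1 - d := by
      rw [Nat.cast_sub (by omega)]; push_cast; ring
    rw [← h', mul_comm ((n : 𝕜) + 1)]
    exact_mod_cast this.symm
  have h6 : (d : 𝕜) + 1 ≠ 0 := by exact_mod_cast Nat.succ_ne_zero d
  have h7 : (n : 𝕜) + 1 - d ≠ 0 := by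
    intro h; rw [h, mul_zero] at e2
    exact mul_ne_zero h4 h1 e2.symm
  have f1 : (((n + 1).choose (d + 1) : ℕ) : 𝕜) =
      ((n : 𝕜) + 1) * (n.choose d : 𝕜) / ((d : 𝕜) + 1) := by
    rw [e1]; field_simp
  have f2 : (((n + 1).choose d : ℕ) : 𝕜) =
      ((n : 𝕜) + 1) * (n.choose d : 𝕜) / ((n : 𝕜) + 1 - d) := by
    rw [← e2]; field_simp
  rw [treeCoeff, treeCoeff, treeCoeff, f1, f2]
  push_cast
  field_simp
  ring

/-- The coefficient of a word in the first Eulerian idempotent. -/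
def eulerCoeff (𝕜 : Type*) [Field 𝕜] (w : List ℤ) : 𝕜 :=
  treeCoeff 𝕜 (w.length - 1) (descentsOf w)

open Polynomial in
/-- The polynomial in `k` with the values `ascentBinom k w`. -/
def ascentPoly (𝕜 : Type*) [Field 𝕜] (w : List ℤ) : 𝕜[X] :=
  C ((w.length.factorial : 𝕜)⁻¹) *
    (descPochhammer 𝕜 w.length).comp (Polynomial.X + C (ascents w : 𝕜))

open Polynomial in
lemma eval_ascentPoly [CharZero 𝕜] (k : ℕ) (w : List ℤ) :
    (ascentPoly 𝕜 w).eval (k : 𝕜) = ascentBinom k w := by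
  rw [ascentPoly, eval_mul, eval_C, eval_comp, eval_add, eval_X, eval_C, ← Nat.cast_add,
    descPochhammer_eval_eq_descFactorial, ascentBinom, Nat.descFactorial_eq_factorial_mul_choose]
  push_cast
  rw [inv_mul_cancel_left₀]
  exact_mod_cast Nat.factorial_ne_zero _

open Polynomial in
-- With $a$ ascents and $d$ descents the length is $a+d+1$, and the polynomial is
-- $(k+a)\cdots(k+1)\,k\,(k-1)\cdots(k-d)/(a+d+1)!$. Its constant term is zero and its linear
-- coefficient is $(-1)^d\,a!\,d!/(a+d+1)!$.
lemma coeff_ascentPoly [CharZero 𝕜] {w : List ℤ} (hw : w.Nodup) (h : w ≠ []) :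
    (ascentPoly 𝕜 w).coeff 0 = 0 ∧ (ascentPoly 𝕜 w).coeff 1 = eulerCoeff 𝕜 w := by
  have hlen := ascents_add_descents hw h
  set a := ascents w with ha
  set d := descentsOf w with hd
  have hl : w.length = a + (d + 1) := by omega
  set p : 𝕜[X] := (descPochhammer 𝕜 a).comp (Polynomial.X + C (a : 𝕜)) with hp
  set q : 𝕜[X] := (descPochhammer 𝕜 d).comp (Polynomial.X - 1) with hq
  have hprod : (descPochhammer 𝕜 w.length).comp (Polynomial.X + C (a : 𝕜)) = Polynomial.X * (p * q) := by
    rw [hl, ← descPochhammer_mul, mul_comp, comp_assoc]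
    have : (Polynomial.X - (a : 𝕜[X])).comp (Polynomial.X + C (a : 𝕜)) = Polynomial.X := by
      simp
    rw [this, comp_X, descPochhammer_succ_left]
    ring
  have p0 : p.eval 0 = (a.factorial : 𝕜) := by
    rw [hp, eval_comp]
    simp only [eval_add, eval_X, eval_C, zero_add]
    rw [descPochhammer_eval_eq_descFactorial, Nat.descFactorial_self]
  have q0 : q.eval 0 = (-1) ^ d * (d.factorial : 𝕜) := by
    rw [hq, eval_comp]
    simp only [eval_sub, eval_X, eval_one, zero_sub]
    clear_value d
    clear hq q hprod hl hlen hd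
    induction d with
    | zero => simp
    | succ d ih =>
      rw [descPochhammer_succ_eval, ih, Nat.factorial_succ]
      push_cast
      ring
  have hcoe : ascentPoly 𝕜 w = Polynomial.X * (C ((w.length.factorial : 𝕜)⁻¹) * (p * q)) := by
    rw [ascentPoly, ← ha, hprod]; ring
  refine ⟨by rw [hcoe]; simp, ?_⟩
  rw [hcoe, show (1 : ℕ) = 0 + 1 from rfl, coeff_X_mul, coeff_zero_eq_eval_zero, eval_mul,
    eval_mul, eval_C, p0, q0, eulerCoeff, treeCoeff, ← hd]
  have hn : w.length - 1 = a + d := by omega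
  rw [hn, hl]
  have hf : ((a + (d + 1)).factorial : 𝕜) = ((a + d : ℕ) + 1 : 𝕜) * ((a + d).factorial : 𝕜) := by
    rw [← add_assoc, Nat.factorial_succ]; push_cast; ring
  have hc : (((a + d).choose d : ℕ) : 𝕜) * (a.factorial * d.factorial) = (a + d).factorial := by
    have := Nat.add_choose_mul_factorial_mul_factorial a d
    rw [← mul_assoc]
    exact_mod_cast this
  have n1 : (a.factorial : 𝕜) ≠ 0 := by exact_mod_cast Nat.factorial_ne_zero _
  have n2 : (d.factorial : 𝕜) ≠ 0 := by exact_mod_cast Nat.factorial_ne_zero _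
  have n3 : (((a + d).choose d : ℕ) : 𝕜) ≠ 0 :=
    Nat.cast_ne_zero.2 (Nat.choose_pos (by omega)).ne'
  have n4 : ((a + d : ℕ) + 1 : 𝕜) ≠ 0 := Nat.cast_add_one_ne_zero _
  rw [hf, ← hc]
  field_simp

open Polynomial in
-- The ascent polynomials are multiplicative under shuffles, because their values at all natural
-- numbers are. Two factors without constant term have a product without linear term.
lemma shuffleSum_eulerCoeff [CharZero 𝕜] (u v : List ℤ) (h : (u ++ v).Nodup) (hu : u ≠ [])
    (hv : v ≠ []) : shuffleSum (eulerCoeff 𝕜) u v = 0 := by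
  have hpoly : shuffleSum (ascentPoly 𝕜) u v = ascentPoly 𝕜 u * ascentPoly 𝕜 v := by
    refine eq_of_infinite_eval_eq _ _ (Set.Infinite.mono ?_
      (Set.infinite_range_of_injective (Nat.cast_injective (R := 𝕜))))
    rintro _ ⟨k, rfl⟩
    have h1 := map_shuffleSum (evalRingHom (k : 𝕜)).toAddMonoidHom (ascentPoly 𝕜) u v
    have h2 := map_shuffleSum (Nat.castRingHom 𝕜).toAddMonoidHom (ascentBinom k) u v
    rw [shuffleSum_ascentBinom k u v h] at h2
    have h3 : (fun w => (evalRingHom (k : 𝕜)).toAddMonoidHom (ascentPoly 𝕜 w)) =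
        fun w => (Nat.castRingHom 𝕜).toAddMonoidHom (ascentBinom k w) := by
      funext w; exact eval_ascentPoly k w
    rw [h3, ← h2] at h1
    refine h1.trans ?_
    rw [eval_mul, eval_ascentPoly, eval_ascentPoly]
    exact Nat.cast_mul _ _
  have h1 := map_shuffleSum (lcoeff 𝕜 1).toAddMonoidHom (ascentPoly 𝕜) u v
  have hnu := (List.nodup_append.1 h).1
  have hnv := (List.nodup_append.1 h).2.1
  rw [hpoly] at h1
  have h2 : (lcoeff 𝕜 1).toAddMonoidHom (ascentPoly 𝕜 u * ascentPoly 𝕜 v) = 0 := by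
    change (ascentPoly 𝕜 u * ascentPoly 𝕜 v).coeff 1 = 0
    rw [mul_coeff_one, (coeff_ascentPoly hnu hu).1, (coeff_ascentPoly hnv hv).1]
    ring
  rw [h2] at h1
  rw [h1]
  refine shuffleSum_congr u v fun w hw => ?_
  refine (coeff_ascentPoly (𝕜 := 𝕜) (hw.nodup_iff.2 h) ?_).2.symm
  rintro rfl
  simp_all

end

end Jacobi

namespace Jacobi

noncomputable section

variable {𝕜 : Type*} [Field 𝕜] {X Y Z : Type}

/-! ### Words in which every letter of a finite set occurs once -/

section Words

variable {α M : Type*} [AddCommMonoid M]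

/-- The words in which every element of a finite set occurs exactly once. -/
def words (A : Finset α) : Finset (List α) := by
  classical
  exact A.val.lists.toFinset

lemma mem_words {A : Finset α} {w : List α} : w ∈ words A ↔ A.val = ↑w := by
  classical
  rw [words, Multiset.mem_toFinset, Multiset.mem_lists_iff]
  rfl

lemma mem_words_iff {A : Finset α} {w : List α} :
    w ∈ words A ↔ w.Nodup ∧ ∀ x, x ∈ w ↔ x ∈ A := by
  rw [mem_words]
  constructor
  · intro h
    refine ⟨?_, fun x => ?_⟩
    · rw [← Multiset.coe_nodup, ← h]; exact A.nodup
    · rw [← Multiset.mem_coe, ← h]; rfl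
  · rintro ⟨h1, h2⟩
    exact (Multiset.Nodup.ext A.nodup (Multiset.coe_nodup.2 h1)).2 fun x => (h2 x).symm

lemma nodup_of_mem_words {A : Finset α} {w : List α} (h : w ∈ words A) : w.Nodup :=
  (mem_words_iff.1 h).1

lemma mem_of_mem_words {A : Finset α} {w : List α} (h : w ∈ words A) {x : α} :
    x ∈ w ↔ x ∈ A := (mem_words_iff.1 h).2 x

lemma length_of_mem_words {A : Finset α} {w : List α} (h : w ∈ words A) : w.length = A.card := by
  rw [mem_words] at h
  rw [Finset.card, h, Multiset.coe_card]

lemma perm_mem_words {A : Finset α} {w w' : List α} (h : w.Perm w') :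
    w ∈ words A ↔ w' ∈ words A := by
  rw [mem_words, mem_words, Multiset.coe_eq_coe.2 h]

lemma cons_mem_words [DecidableEq α] {A : Finset α} {c : α} {w : List α} :
    c :: w ∈ words A ↔ c ∈ A ∧ w ∈ words (A.erase c) := by
  rw [mem_words_iff, mem_words_iff]
  simp only [List.nodup_cons, List.mem_cons, Finset.mem_erase]
  constructor
  · rintro ⟨⟨h1, h2⟩, h3⟩
    refine ⟨(h3 c).1 (Or.inl rfl), h2, fun x => ?_⟩
    rw [← h3]
    constructor
    · intro hx
      exact ⟨fun h => h1 (h ▸ hx), Or.inr hx⟩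
    · rintro ⟨h, h' | h'⟩
      exacts [absurd h' h, h']
  · rintro ⟨h1, h2, h3⟩
    refine ⟨⟨fun h => ((h3 c).1 h).1 rfl, h2⟩, fun x => ?_⟩
    rw [h3]
    constructor
    · rintro (rfl | h)
      exacts [h1, h.2]
    · intro h
      by_cases hx : x = c
      exacts [Or.inl hx, Or.inr ⟨hx, h⟩]

lemma words_empty : words (∅ : Finset α) = {[]} := by
  ext w
  rw [mem_words]
  simp [eq_comm]

lemma sum_words_cons [DecidableEq α] {A : Finset α} (f : List α → M) (h : A.Nonempty) :
    ∑ w ∈ words A, f w = ∑ c ∈ A, ∑ w ∈ words (A.erase c), f (c :: w) := by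
  rw [Finset.sum_sigma']
  symm
  refine Finset.sum_bij (fun (s : Σ _ : α, List α) _ => s.1 :: s.2) ?_ ?_ ?_ ?_
  · rintro ⟨c, w⟩ hs
    rw [Finset.mem_sigma] at hs
    exact cons_mem_words.2 hs
  · rintro ⟨c, w⟩ _ ⟨c', w'⟩ _ h
    simp only [List.cons.injEq] at h
    obtain ⟨rfl, rfl⟩ := h
    rfl
  · intro w hw
    match w with
    | [] =>
      obtain ⟨x, hx⟩ := h
      exact absurd ((mem_of_mem_words hw).2 hx) (by simp)
    | c :: w => exact ⟨⟨c, w⟩, Finset.mem_sigma.2 (cons_mem_words.1 hw), rfl⟩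
  · intros; rfl

/-- The pairs of words in which, taken together, every element of a finite set occurs exactly
once. -/
def wordPairs (A : Finset α) : Finset (List α × List α) := by
  classical
  exact (words A ×ˢ Finset.range (A.card + 1)).image fun s => (s.1.take s.2, s.1.drop s.2)

lemma mem_wordPairs {A : Finset α} {s : List α × List α} :
    s ∈ wordPairs A ↔ s.1 ++ s.2 ∈ words A := by
  classical
  rw [wordPairs, Finset.mem_image]
  constructor
  · rintro ⟨⟨w, k⟩, h, rfl⟩
    rw [Finset.mem_product] at h
    simpa using h.1
  · intro h
    refine ⟨(s.1 ++ s.2, s.1.length), ?_, by simp⟩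
    have := length_of_mem_words h
    rw [List.length_append] at this
    exact Finset.mem_product.2 ⟨h, Finset.mem_range.2 (by dsimp only; omega)⟩

/-- The sum of the values of `G` on all pairs of complementary subwords of a word. -/
def unshuffleSum (G : List α → List α → M) : List α → M
  | [] => G [] []
  | c :: z => unshuffleSum (fun r t => G (c :: r) t) z + unshuffleSum (fun r t => G r (c :: t)) z

lemma unshuffleSum_congr {G G' : List α → List α → M} (z : List α)
    (h : ∀ r t, (r ++ t).Perm z → G r t = G' r t) : unshuffleSum G z = unshuffleSum G' z := by
  induction z generalizing G G' with
  | nil => exact h [] [] (by simp)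
  | cons c z ih =>
    rw [unshuffleSum, unshuffleSum]
    congr 1
    · exact ih fun r t hr => h _ _ (by simpa using hr)
    · exact ih fun r t hr => h _ _ (List.perm_middle.trans (hr.cons c))

lemma unshuffleSum_add (G G' : List α → List α → M) (z : List α) :
    unshuffleSum (fun r t => G r t + G' r t) z = unshuffleSum G z + unshuffleSum G' z := by
  induction z generalizing G G' with
  | nil => rfl
  | cons c z ih =>
    simp only [unshuffleSum, ih]
    abel

/-- Only the splitting whose left part is empty survives, so the sum has a single term. -/
lemma unshuffleSum_of_left {G : List α → List α → M} (z : List α)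
    (h : ∀ r t, (r ++ t).Perm z → r ≠ [] → G r t = 0) : unshuffleSum G z = G [] z := by
  induction z generalizing G with
  | nil => rfl
  | cons c z ih =>
    rw [unshuffleSum, ih (G := fun r t => G r (c :: t))
      fun r t hr h' => h _ _ (List.perm_middle.trans (hr.cons c)) h']
    have : unshuffleSum (fun r t => G (c :: r) t) z = unshuffleSum (fun _ _ => 0) z :=
      unshuffleSum_congr z fun r t hr => h _ _ (by simpa using hr) (by simp)
    have h0 : ∀ z : List α, unshuffleSum (fun _ _ => (0 : M)) z = 0 := by
      intro z
      induction z with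
      | nil => rfl
      | cons c z ih => rw [unshuffleSum, ih, add_zero]
    rw [this, h0, zero_add]

lemma sum_wordPairs_left [DecidableEq α] {A : Finset α} (f : List α → List α → M) :
    ∑ s ∈ wordPairs A with s.1 ≠ [], f s.1 s.2 =
      ∑ c ∈ A, ∑ s ∈ wordPairs (A.erase c), f (c :: s.1) s.2 := by
  rw [Finset.sum_sigma']
  symm
  refine Finset.sum_bij (fun (s : Σ _ : α, List α × List α) _ => (s.1 :: s.2.1, s.2.2)) ?_ ?_ ?_ ?_
  · rintro ⟨c, r, t⟩ hs
    rw [Finset.mem_sigma, mem_wordPairs] at hs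
    rw [Finset.mem_filter, mem_wordPairs]
    exact ⟨cons_mem_words.2 hs, by simp⟩
  · rintro ⟨c, r, t⟩ _ ⟨c', r', t'⟩ _ h
    simp only [Prod.mk.injEq, List.cons.injEq] at h
    obtain ⟨⟨rfl, rfl⟩, rfl⟩ := h
    rfl
  · rintro ⟨r, t⟩ hw
    rw [Finset.mem_filter, mem_wordPairs] at hw
    match r, hw with
    | [], hw => exact absurd rfl hw.2
    | c :: r, hw =>
      have := cons_mem_words.1 hw.1
      exact ⟨⟨c, r, t⟩, Finset.mem_sigma.2 ⟨this.1, mem_wordPairs.2 this.2⟩, rfl⟩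
  · intros; rfl

lemma sum_wordPairs_right [DecidableEq α] {A : Finset α} (f : List α → List α → M) :
    ∑ s ∈ wordPairs A with s.2 ≠ [], f s.1 s.2 =
      ∑ c ∈ A, ∑ s ∈ wordPairs (A.erase c), f s.1 (c :: s.2) := by
  rw [Finset.sum_sigma']
  symm
  refine Finset.sum_bij (fun (s : Σ _ : α, List α × List α) _ => (s.2.1, s.1 :: s.2.2)) ?_ ?_ ?_ ?_
  · rintro ⟨c, r, t⟩ hs
    rw [Finset.mem_sigma, mem_wordPairs] at hs
    rw [Finset.mem_filter, mem_wordPairs]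
    exact ⟨(perm_mem_words List.perm_middle).2 (cons_mem_words.2 hs), by simp⟩
  · rintro ⟨c, r, t⟩ _ ⟨c', r', t'⟩ _ h
    simp only [Prod.mk.injEq, List.cons.injEq] at h
    obtain ⟨rfl, rfl, rfl⟩ := h
    rfl
  · rintro ⟨r, t⟩ hw
    rw [Finset.mem_filter, mem_wordPairs] at hw
    match t, hw with
    | [], hw => exact absurd rfl hw.2
    | c :: t, hw =>
      have := cons_mem_words.1 ((perm_mem_words List.perm_middle).1 hw.1)
      exact ⟨⟨c, r, t⟩, Finset.mem_sigma.2 ⟨this.1, mem_wordPairs.2 this.2⟩, rfl⟩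
  · intros; rfl

/-- Shuffling and unshuffling are adjoint to each other. -/
lemma sum_unshuffle {A : Type*} [AddCommGroup A] [Module 𝕜 A] (S : Finset α) (g : List α → 𝕜)
    (G : List α → List α → A) :
    ∑ z ∈ words S, g z • unshuffleSum G z =
      ∑ s ∈ wordPairs S, shuffleSum g s.1 s.2 • G s.1 s.2 := by
  classical
  induction S using Finset.strongInduction generalizing g G with
  | H S ih =>
  by_cases hS : S.Nonempty
  · rw [sum_words_cons _ hS]
    -- A shuffle takes its first letter from one word or from the other. The default in `headD` is
    -- never read, since each summand is restricted to the case of a nonempty word.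
    have h1 : ∀ s ∈ wordPairs S, shuffleSum g s.1 s.2 • G s.1 s.2 =
        (if s.1 ≠ [] then shuffleSum (fun w => g (s.1.headD hS.choose :: w)) s.1.tail s.2 •
          G s.1 s.2 else 0) +
        (if s.2 ≠ [] then shuffleSum (fun w => g (s.2.headD hS.choose :: w)) s.1 s.2.tail •
          G s.1 s.2 else 0) := by
      rintro ⟨r, t⟩ hs
      rw [mem_wordPairs] at hs
      match r, t, hs with
      | [], [], hs => exact absurd ((mem_of_mem_words hs).2 hS.choose_spec) (by simp)
      | [], y :: t, hs => simp [shuffleSum_nil_left]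
      | x :: r, [], hs => simp [shuffleSum_nil_right]
      | x :: r, y :: t, hs => simp [shuffleSum_cons, add_smul]
    rw [Finset.sum_congr rfl h1, Finset.sum_add_distrib, ← Finset.sum_filter,
      ← Finset.sum_filter,
      sum_wordPairs_left (fun r t => shuffleSum (fun w => g (r.headD hS.choose :: w)) r.tail t •
        G r t),
      sum_wordPairs_right (fun r t => shuffleSum (fun w => g (t.headD hS.choose :: w)) r t.tail •
        G r t), ← Finset.sum_add_distrib]
    refine Finset.sum_congr rfl fun c hc => ?_
    simp only [unshuffleSum, smul_add, Finset.sum_add_distrib]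
    rw [ih _ (Finset.erase_ssubset hc) (fun w => g (c :: w)),
      ih _ (Finset.erase_ssubset hc) (fun w => g (c :: w))]
    rfl
  · obtain rfl := Finset.not_nonempty_iff_eq_empty.1 hS
    have : wordPairs (∅ : Finset α) = {([], [])} := by
      ext ⟨r, t⟩
      rw [mem_wordPairs, words_empty]
      simp
    rw [this, words_empty]
    simp [unshuffleSum, shuffleSum_nil_left]

/-- Words are cut at a letter. -/
lemma sum_words_cut [DecidableEq α] {A : Finset α} {q : α} (hq : q ∈ A) (f : List α → M) :
    ∑ s ∈ wordPairs (A.erase q), f (s.1.reverse ++ q :: s.2) = ∑ w ∈ words A, f w := by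
  refine Finset.sum_bij (fun (s : List α × List α) _ => s.1.reverse ++ q :: s.2) ?_ ?_ ?_ ?_
  · rintro ⟨r, t⟩ h
    rw [mem_wordPairs] at h
    have : (q :: (r ++ t)).Perm (r.reverse ++ q :: t) :=
      (((List.reverse_perm r).symm.append_right t).cons q).trans List.perm_middle.symm
    exact (perm_mem_words this).1 (cons_mem_words.2 ⟨hq, h⟩)
  · rintro ⟨r, t⟩ h ⟨r', t'⟩ h' e
    rw [mem_wordPairs] at h h'
    have n1 : q ∉ r ++ t := fun hm => by simpa using (mem_of_mem_words h).1 hm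
    have n2 : q ∉ r' ++ t' := fun hm => by simpa using (mem_of_mem_words h').1 hm
    simp only [List.mem_append, not_or] at n1 n2
    dsimp only at e
    rw [List.append_cons_inj_of_notMem (by simpa using n1.1) n1.2] at e
    simp_all
  · intro w hw
    obtain ⟨r, t, rfl⟩ := List.append_of_mem ((mem_of_mem_words hw).2 hq)
    refine ⟨(r.reverse, t), ?_, by simp⟩
    rw [mem_wordPairs]
    have : (q :: (r.reverse ++ t)).Perm (r ++ q :: t) :=
      (((List.reverse_perm r).append_right t).cons q).trans List.perm_middle.symm
    exact (cons_mem_words.1 ((perm_mem_words this).2 hw)).2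
  · intros; rfl

end Words

/-! ### Gluing combs: brackets of adjacent letters, and the change of the first letter -/

/-- Exchanging two adjacent letters of a comb. -/
lemma gl_combWord_bracket (m R : BSpace 𝕜 Y) {x a b : Y} (s : List Y) {t : List Y} (ht : t ≠ [])
    (hx : x ∉ s ++ [a, b]) (hab : a ≠ b) (ha : a ∉ s) (hb : b ∉ s) :
    gl 𝕜 Y m (R * combWord 𝕜 (x :: (s ++ a :: b :: t))) -
      gl 𝕜 Y m (R * combWord 𝕜 (x :: (s ++ b :: a :: t))) =
        gl 𝕜 Y (joinOp 𝕜 a b m) (R * combWord 𝕜 (x :: (s ++ a :: t))) := by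
  induction s generalizing m with
  | nil =>
    simp only [List.nil_append, List.mem_cons, List.not_mem_nil, or_false, not_or] at hx
    simp only [List.nil_append]
    -- With `a` and `b` right behind `x`, both combs turn into double joins on the other side, in
    -- opposite orders, and the Jacobi identity gives their difference.
    rw [gl_combWord_cons _ _ hx.1 (by simp), gl_combWord_cons _ _ hx.2 ht,
      gl_combWord_cons _ _ hx.2 (by simp), gl_combWord_cons _ _ hx.1 ht,
      gl_combWord_cons _ _ hx.1 ht, joinOp_jacobi hx.1 hx.2 hab, map_add, LinearMap.add_apply,
      add_sub_cancel_left]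
  | cons c s ih =>
    simp only [List.cons_append, List.mem_cons, not_or, List.mem_append, List.not_mem_nil,
      or_false] at hx ha hb
    simp only [List.cons_append]
    -- A letter between `x` and the bracket is first joined to `x`; this commutes with joining `a`
    -- and `b`, as the four marks are distinct.
    rw [gl_combWord_cons _ _ hx.1 (by simp), gl_combWord_cons _ _ hx.1 (by simp),
      gl_combWord_cons _ _ hx.1 (by simp), ih _ (by simp [hx.2]) ha.2 hb.2,
      joinOp_comm hx.1 hx.2.2.1 hx.2.2.2 (Ne.symm ha.1) (Ne.symm hb.1) hab]

/-- A comb is expanded into combs with another first letter. -/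
lemma gl_combWord_expand (m R : BSpace 𝕜 Y) {p q y : Y} (hpq : p ≠ q) (z : List Y)
    (hz : z.Nodup) (hp : p ∈ z) (hq : q ∉ z) :
    gl 𝕜 Y m (R * combWord 𝕜 (q :: z ++ [y])) =
      unshuffleSum (fun r t => open scoped Classical in if r.getLast? = some p then
        (-1) ^ r.length • gl 𝕜 Y m (R * combWord 𝕜 (r.reverse ++ q :: t ++ [y])) else 0) z := by
  classical
  induction z generalizing m with
  | nil => simp at hp
  | cons c z ih =>
    rw [List.nodup_cons] at hz
    simp only [List.mem_cons, not_or] at hq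
    rw [unshuffleSum]
    by_cases hc : p = c
    · subst hc
      have hl : ∀ (u v : List Y), (u ++ v).Perm z → u.getLast? ≠ some p := fun u v h h' =>
        hz.1 (h.subset (List.mem_append_left _ (List.mem_of_getLast? h')))
      -- The word begins with `p`. Since the left part must end in `p`, it is `[p]`; all later
      -- letters go to the right part, and the claim is $[q,p]=-[p,q]$.
      have h2 : unshuffleSum (fun r t => if r.getLast? = some p then
          (-1 : ℤ) ^ r.length • gl 𝕜 Y m (R * combWord 𝕜 (r.reverse ++ q :: p :: t ++ [y]))
            else 0) z = 0 := by
        rw [unshuffleSum_of_left z fun r t h _ => if_neg (hl r t h)]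
        simp
      rw [h2, add_zero, unshuffleSum_of_left]
      · simp only [List.getLast?_singleton, if_true, List.length_singleton, pow_one,
          List.reverse_singleton, List.cons_append, List.nil_append]
        rw [combWord_swap q p (by simp), mul_neg, map_neg, neg_one_zsmul]
      · intro r t h hr
        refine if_neg ?_
        rw [List.getLast?_cons_of_ne_nil hr]
        exact hl r t h
    · have hpz : p ∈ z := by simpa [hc] using hp
      rw [List.cons_append, List.cons_append, gl_combWord_cons _ _ hq.1 (by simp),
        ← List.cons_append, ih _ hz.2 hpz hq.2, ← unshuffleSum_add]
      refine unshuffleSum_congr z fun r t h => ?_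
      have hn : (r ++ t).Nodup := h.nodup_iff.2 hz.2
      by_cases hr : r.getLast? = some p
      · have hr0 : r ≠ [] := by rintro rfl; simp at hr
        obtain ⟨r', rfl⟩ : ∃ r', r = r' ++ [p] :=
          ⟨r.dropLast, by rw [List.dropLast_append_getLast? p hr]⟩
        have hsub : ∀ x, x ∈ r' → x ∈ z := fun x hx => h.subset (by simp [hx])
        have hpr : p ∉ r' := by
          intro hx
          have := (List.nodup_append.1 (List.nodup_append.1 hn).1).2.2 p hx p (by simp)
          exact this rfl
        rw [if_pos hr, List.getLast?_cons_of_ne_nil hr0, if_pos hr, if_pos hr]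
        -- The letter `c` has been joined to `q`. The bracket is undone by placing `c` behind `q`,
        -- in the right part, or in front of it, in the left part, the latter with a minus sign.
        have key := gl_combWord_bracket m R (x := p) (a := q) (b := c) r'.reverse
          (t := t ++ [y]) (by simp)
          (by simp [hpr, hpq, hc])
          hq.1 (by simpa using fun hx => hq.2 (hsub _ hx))
          (by simpa using fun hx => hz.1 (hsub _ hx))
        simp only [List.reverse_append, List.reverse_nil, List.reverse_cons,
          List.append_assoc, List.cons_append, List.nil_append, List.length_cons] at key ⊢
        rw [← key, pow_succ, smul_sub, mul_neg_one, neg_smul]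
        abel
      · have hr' : (c :: r).getLast? ≠ some p := by
          by_cases hr0 : r = []
          · subst hr0; simpa using Ne.symm hc
          · rwa [List.getLast?_cons_of_ne_nil hr0]
        rw [if_neg hr, if_neg hr', if_neg hr, add_zero]

/-- A sum of combs, whose coefficients vanish on shuffles, does not depend on the choice of the
first letter. -/
lemma sum_gl_combWord_head [DecidableEq Y] (m R : BSpace 𝕜 Y) (A : Finset Y) {p q y : Y}
    (hpq : p ≠ q) (hp : p ∈ A) (hq : q ∈ A) (c : List Y → 𝕜)
    (hc : ∀ u v, u ≠ [] → v ≠ [] → u ++ v ∈ words A → shuffleSum c u v = 0) :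
    ∑ w ∈ words (A.erase q), c (q :: w) • gl 𝕜 Y m (R * combWord 𝕜 (q :: w ++ [y])) =
      ∑ w ∈ words (A.erase p), c (p :: w) • gl 𝕜 Y m (R * combWord 𝕜 (p :: w ++ [y])) := by
  let K : List Y → CSpace 𝕜 := fun w =>
    if w.head? = some p then c w • gl 𝕜 Y m (R * combWord 𝕜 (w ++ [y])) else 0
  have hR : ∑ w ∈ words A, K w =
      ∑ w ∈ words (A.erase p), c (p :: w) • gl 𝕜 Y m (R * combWord 𝕜 (p :: w ++ [y])) := by
    rw [sum_words_cons _ ⟨p, hp⟩, Finset.sum_eq_single p]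
    · simp [K]
    · intro b _ hb
      exact Finset.sum_eq_zero fun w _ => if_neg (by simpa using hb)
    · exact fun h => absurd hp h
  -- Every word is cut at `q`. On the other side each comb with first letter `q` is expanded into
  -- combs with first letter `p`, and unshuffling is moved to the coefficients as shuffling.
  rw [← hR, ← sum_words_cut hq]
  have h1 : ∀ w ∈ words (A.erase q),
      c (q :: w) • gl 𝕜 Y m (R * combWord 𝕜 (q :: w ++ [y])) = (fun w => c (q :: w)) w • _ :=
    fun w hw => congrArg _ (gl_combWord_expand m R hpq w (nodup_of_mem_words hw)
      ((mem_of_mem_words hw).2 (by simp [hpq, hp])) fun h => by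
        simpa using (mem_of_mem_words hw).1 h)
  rw [Finset.sum_congr rfl h1, sum_unshuffle]
  refine Finset.sum_congr rfl ?_
  rintro ⟨r, t⟩ hs
  rw [mem_wordPairs] at hs
  dsimp only at hs ⊢
  have hhead : (r.reverse ++ q :: t).head? = some p ↔ r.getLast? = some p := by
    rcases List.eq_nil_or_concat r with rfl | ⟨r', b, rfl⟩
    · simpa using Ne.symm hpq
    · simp
  by_cases hr : r.getLast? = some p
  · simp only [K]
    rw [if_pos hr, if_pos (hhead.2 hr)]
    obtain ⟨e, r', her⟩ : ∃ e r', e :: r' = r.reverse ++ q :: t :=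
      ⟨_, _, List.cons_head_tail (by simp)⟩
    -- As the coefficients vanish on shuffles, their sum over the shuffles of `r` and `t` behind `q`
    -- is, up to the sign $(-1)^{|r|}$, the coefficient of the single word `r.reverse ++ q :: t`.
    -- The sign cancels the one in the expansion.
    have hr := shuffleSum_reverse c r.reverse [] t q (fun u v hu hv h => hc u v hu hv ?_) her
    · rw [List.reverse_reverse, List.append_nil, shuffleSum_nil_left, her,
        List.length_reverse] at hr
      rw [hr, smul_assoc, smul_comm (c _), smul_smul, ← mul_pow]
      simp
    · refine (perm_mem_words (h.trans ?_)).2 (cons_mem_words.2 ⟨hq, hs⟩)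
      rw [List.append_nil]
      exact List.perm_middle.trans (((List.reverse_perm r).append_right t).cons q)
  · simp only [K]
    rw [if_neg hr, if_neg (fun h => hr (hhead.1 h)), smul_zero]

end

end Jacobi

namespace Jacobi

noncomputable section

variable {𝕜 : Type*} [Field 𝕜] {X Y Z : Type}

/-! ### Descents -/

lemma descentsOf_append (s : List ℤ) (x : ℤ) (t : List ℤ) :
    descentsOf (s ++ x :: t) = descentsOf (s ++ [x]) + descentsOf (x :: t) := by
  induction s with
  | nil => simp [descentsOf]
  | cons a s ih =>
    cases s with
    | nil => simp [descentsOf]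
    | cons b s =>
      simp only [List.cons_append, descentsOf] at ih ⊢
      rw [ih, add_assoc]

lemma descentsOf_concat {s : List ℤ} {b : ℤ} (h : ∀ x ∈ s, x ≤ b) :
    descentsOf (s ++ [b]) = descentsOf s := by
  rcases List.eq_nil_or_concat' s with rfl | ⟨s, y, rfl⟩
  · rfl
  · have hy : ¬ b < y := not_lt.2 (h y (by simp))
    rw [List.append_assoc, List.singleton_append, descentsOf_append]
    simp [descentsOf, hy]

lemma descentsOf_cons_le (a : ℤ) (s : List ℤ) : descentsOf (a :: s) ≤ s.length := by
  induction s generalizing a with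
  | nil => simp [descentsOf]
  | cons b s ih =>
    have := ih b
    rw [descentsOf, List.length_cons]
    split_ifs <;> omega

lemma descentsOf_neg_reverse (s : List ℤ) :
    descentsOf (s.map Neg.neg).reverse = descentsOf s := by
  match s with
  | [] => rfl
  | [_] => rfl
  | x :: y :: s =>
    have ih := descentsOf_neg_reverse (y :: s)
    simp only [List.map_cons, List.reverse_cons, List.append_assoc, List.singleton_append] at ih ⊢
    rw [descentsOf_append, ih]
    simp [descentsOf, add_comm]

lemma descentsOf_map_congr {α : Type*} {f g : α → ℤ} (w : List α)
    (h : ∀ s x y t, w = s ++ x :: y :: t → (f y < f x ↔ g y < g x)) :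
    descentsOf (w.map f) = descentsOf (w.map g) := by
  match w with
  | [] => rfl
  | [_] => rfl
  | x :: y :: w =>
    have ih := descentsOf_map_congr (f := f) (g := g) (y :: w)
      fun s a b t e => h (x :: s) a b t (by rw [e]; rfl)
    simp only [List.map_cons, descentsOf] at ih ⊢
    rw [ih]
    simp only [h [] x y w rfl]

/-! ### Descents and letters of neighbouring heights -/

section Adjacent

variable {pos : Y → ℤ} {p q : Y}

/-- No other letter has a height between those of `p` and `q`, so towards the rest of the word the
pair behaves like the single letter `p`; only its inner order can add a descent. -/
lemma descentsOf_adjacent (s t : List Y) (hpq : pos p < pos q)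
    (h : ∀ x ∈ s ++ t, pos x < pos p ∨ pos q < pos x) :
    descentsOf ((s ++ p :: q :: t).map pos) = descentsOf ((s ++ p :: t).map pos) ∧
      descentsOf ((s ++ q :: p :: t).map pos) = descentsOf ((s ++ p :: t).map pos) + 1 := by
  have h1 : descentsOf (pos q :: t.map pos) = descentsOf (pos p :: t.map pos) := by
    cases t with
    | nil => rfl
    | cons y t =>
      have := h y (by simp)
      have e : pos y < pos q ↔ pos y < pos p := by omega
      simp only [List.map_cons, descentsOf, e]
  have h2 : descentsOf (s.map pos ++ [pos q]) = descentsOf (s.map pos ++ [pos p]) := by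
    rcases List.eq_nil_or_concat' s with rfl | ⟨s, y, rfl⟩
    · rfl
    · have := h y (by simp)
      have e : pos q < pos y ↔ pos p < pos y := by omega
      simp only [List.map_append, List.map_cons, List.map_nil, List.append_assoc,
        List.cons_append, List.nil_append]
      rw [descentsOf_append, descentsOf_append _ _ [pos p]]
      simp only [descentsOf, e]
  have h3 : ¬ pos q < pos p := not_lt.2 hpq.le
  simp only [List.map_append, List.map_cons]
  rw [descentsOf_append, descentsOf_append _ (pos q), descentsOf_append _ (pos p) (t.map pos)]
  simp only [descentsOf, h1, h2, hpq, h3, if_true, if_false]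
  omega

variable [DecidableEq Y]

lemma map_comp_swap (s t : List Y) (hp : p ∉ s ++ t) (hq : q ∉ s ++ t) :
    (s ++ p :: q :: t).map (pos ∘ Equiv.swap p q) = (s ++ q :: p :: t).map pos ∧
      (s ++ q :: p :: t).map (pos ∘ Equiv.swap p q) = (s ++ p :: q :: t).map pos := by
  have h : ∀ u : List Y, (∀ x ∈ u, x ∈ s ++ t) → u.map (pos ∘ Equiv.swap p q) = u.map pos := by
    intro u hu
    refine List.map_congr_left fun x hx => ?_
    have := hu x hx
    rw [Function.comp_apply, Equiv.swap_apply_of_ne_of_ne] <;> (rintro rfl; contradiction)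
  have hs := h s (fun x hx => List.mem_append_left _ hx)
  have ht := h t (fun x hx => List.mem_append_right _ hx)
  simp only [List.map_append, List.map_cons, hs, ht]
  simp

/-- The exchange of neighbouring heights alters only the comparison of `p` with `q`, which is never
made if they are not adjacent in the word. -/
lemma descentsOf_comp_swap (hpos : Function.Injective pos) {w : List Y} (hpq : pos p < pos q)
    (h : ∀ x ∈ w, ¬ (pos p < pos x ∧ pos x < pos q))
    (h1 : ∀ s t, w ≠ s ++ p :: q :: t) (h2 : ∀ s t, w ≠ s ++ q :: p :: t) :
    descentsOf (w.map pos) = descentsOf (w.map (pos ∘ Equiv.swap p q)) := by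
  refine descentsOf_map_congr w ?_
  rintro s x y t rfl
  have hx := h x (by simp)
  have hy := h y (by simp)
  have e : ∀ x, pos (Equiv.swap p q x) =
      if x = p then pos q else if x = q then pos p else pos x := by
    intro x; rw [Equiv.swap_apply_def]; split_ifs <;> rfl
  simp only [Function.comp_apply, e]
  have g1 := h1 s t
  have g2 := h2 s t
  have i1 := fun h : pos x = pos p => hpos h
  have i2 := fun h : pos x = pos q => hpos h
  have i3 := fun h : pos y = pos p => hpos h
  have i4 := fun h : pos y = pos q => hpos h
  grind

end Adjacent

/-! ### The combination of trees on a block -/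

open scoped Classical in
/-- The coefficient of a comb in the combination of trees on an ordered block. -/
def treeWeight (𝕜 : Type*) [Field 𝕜] (pos : Y → ℤ) (w : List Y) : 𝕜 :=
  if 2 ≤ w.length ∧ ∀ x ∈ w, (∀ a ∈ w.head?, pos a ≤ pos x) ∧ ∀ b ∈ w.getLast?, pos x ≤ pos b then
    treeCoeff 𝕜 (w.length - 2) (descentsOf (w.map pos))
  else 0

lemma treeWeight_congr {pos pos' : Y → ℤ} {w : List Y}
    (h : ∀ x ∈ w, ∀ y ∈ w, (pos x < pos y ↔ pos' x < pos' y)) :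
    treeWeight 𝕜 pos w = treeWeight 𝕜 pos' w := by
  have hd : descentsOf (w.map pos) = descentsOf (w.map pos') :=
    descentsOf_map_congr w fun s x y t e => h y (by simp [e]) x (by simp [e])
  have hc : (∀ x ∈ w, (∀ a ∈ w.head?, pos a ≤ pos x) ∧ ∀ b ∈ w.getLast?, pos x ≤ pos b) ↔
      ∀ x ∈ w, (∀ a ∈ w.head?, pos' a ≤ pos' x) ∧ ∀ b ∈ w.getLast?, pos' x ≤ pos' b := by
    refine forall₂_congr fun x hx => and_congr (forall₂_congr fun a ha => ?_)
      (forall₂_congr fun b hb => ?_)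
    · rw [← not_lt, ← not_lt, h x hx a (List.mem_of_head? ha)]
    · rw [← not_lt, ← not_lt, h b (List.mem_of_getLast? hb) x hx]
  rw [treeWeight, treeWeight, hd]
  simp only [hc]

lemma treeWeight_map (f : Z → Y) (pos : Y → ℤ) (w : List Z) :
    treeWeight 𝕜 pos (w.map f) = treeWeight 𝕜 (pos ∘ f) w := by
  rw [treeWeight, treeWeight]
  simp

lemma treeWeight_reverse (pos : Y → ℤ) (w : List Y) :
    treeWeight 𝕜 (fun y => - pos y) w.reverse = treeWeight 𝕜 pos w := by
  have hd : descentsOf (w.reverse.map fun y => - pos y) = descentsOf (w.map pos) := by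
    rw [← descentsOf_neg_reverse (w.map pos), List.map_map, List.map_reverse]
    rfl
  rw [treeWeight, treeWeight, hd]
  simp only [List.length_reverse, List.mem_reverse, List.head?_reverse, List.getLast?_reverse,
    neg_le_neg_iff]
  simp only [and_comm]

/-- The combination of trees on an ordered block of legs. -/
def blockTree (𝕜 : Type*) [Field 𝕜] (pos : Y → ℤ) (B : Finset Y) : BSpace 𝕜 Y :=
  ∑ w ∈ words B, treeWeight 𝕜 pos w • combWord 𝕜 w

lemma blockTree_congr {pos pos' : Y → ℤ} {B : Finset Y}
    (h : ∀ x ∈ B, ∀ y ∈ B, (pos x < pos y ↔ pos' x < pos' y)) :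
    blockTree 𝕜 pos B = blockTree 𝕜 pos' B := by
  refine Finset.sum_congr rfl fun w hw => ?_
  rw [treeWeight_congr fun x hx y hy => h x ((mem_of_mem_words hw).1 hx) y
    ((mem_of_mem_words hw).1 hy)]

lemma sum_words_map {M : Type*} [AddCommMonoid M] (f : Z ↪ Y) (B : Finset Z) (F : List Y → M) :
    ∑ w ∈ words (B.map f), F w = ∑ w ∈ words B, F (w.map f) := by
  symm
  refine Finset.sum_bij (fun w _ => w.map f) ?_ ?_ ?_ ?_
  · intro w hw
    rw [mem_words] at hw ⊢
    rw [Finset.map_val, hw, Multiset.map_coe]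
  · intro w _ w' _ h
    exact List.map_injective_iff.2 f.injective h
  · intro w hw
    have hr : ∀ x ∈ w, ∃ z, f z = x := fun x hx => by
      obtain ⟨z, _, hz⟩ := Finset.mem_map.1 ((mem_of_mem_words hw).1 hx)
      exact ⟨z, hz⟩
    obtain ⟨v, rfl⟩ : ∃ v : List Z, w = v.map f := by
      clear hw
      induction w with
      | nil => exact ⟨[], rfl⟩
      | cons x w ih =>
        obtain ⟨v, rfl⟩ := ih fun y hy => hr y (by simp [hy])
        obtain ⟨z, rfl⟩ := hr x (by simp)
        exact ⟨z :: v, rfl⟩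
    refine ⟨v, ?_, rfl⟩
    rw [mem_words, Finset.map_val, ← Multiset.map_coe] at hw
    exact mem_words.2 (Multiset.map_injective f.injective hw)
  · intros; rfl

lemma map_blockTree (f : Z ↪ Y) (pos : Y → ℤ) (B : Finset Z) :
    BSpace.map 𝕜 f (blockTree 𝕜 (pos ∘ f) B) = blockTree 𝕜 pos (B.map f) := by
  rw [blockTree, blockTree, sum_words_map, map_sum]
  refine Finset.sum_congr rfl fun w _ => ?_
  rw [map_smul, combWord_map, treeWeight_map]

lemma blockTree_of_card_le {pos : Y → ℤ} {B : Finset Y} (h : B.card ≤ 1) :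
    blockTree 𝕜 pos B = 0 := by
  refine Finset.sum_eq_zero fun w hw => ?_
  have := length_of_mem_words hw
  rw [treeWeight, if_neg (by omega), zero_smul]

/-- Reading all words backwards preserves the coefficients and multiplies each comb by the
reflection sign. This reduces statements about the last leg of a block to statements about the
first. -/
lemma blockTree_neg (pos : Y → ℤ) (B : Finset Y) :
    blockTree 𝕜 (fun y => - pos y) B = (-1) ^ B.card • blockTree 𝕜 pos B := by
  by_cases hB : B.card ≤ 1
  · rw [blockTree_of_card_le hB, blockTree_of_card_le hB, smul_zero]
  rw [blockTree, blockTree, Finset.smul_sum]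
  refine Finset.sum_bij (fun w _ => w.reverse) ?_ ?_ ?_ ?_
  · exact fun w hw => (perm_mem_words (List.reverse_perm w)).2 hw
  · exact fun w _ w' _ h => List.reverse_injective h
  · exact fun w hw => ⟨w.reverse, (perm_mem_words (List.reverse_perm w)).2 hw, by simp⟩
  · intro w hw
    have hl := length_of_mem_words hw
    have h1 := treeWeight_reverse (𝕜 := 𝕜) (fun y => - pos y) w
    simp only [neg_neg] at h1
    rw [h1, combWord_rev (by omega), hl, smul_comm (_ : 𝕜), smul_smul, ← mul_pow]
    simp

/-- A word with nonzero weight must start with the lowest and end with the highest leg; only the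
letters in between are summed over. -/
lemma blockTree_eq [DecidableEq Y] {pos : Y → ℤ} (hpos : Function.Injective pos) {B : Finset Y}
    {a b : Y} (ha : a ∈ B) (hb : b ∈ B) (hab : a ≠ b) (hmin : ∀ x ∈ B, pos a ≤ pos x)
    (hmax : ∀ x ∈ B, pos x ≤ pos b) :
    blockTree 𝕜 pos B = ∑ v ∈ words ((B.erase b).erase a),
      treeCoeff 𝕜 v.length (descentsOf ((a :: v ++ [b]).map pos)) •
        combWord 𝕜 (a :: v ++ [b]) := by
  have hmem : ∀ v, a :: v ++ [b] ∈ words B ↔ v ∈ words ((B.erase b).erase a) := by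
    intro v
    have h : (b :: a :: v).Perm (a :: v ++ [b]) :=
      (List.perm_append_singleton b (a :: v)).symm
    rw [← perm_mem_words h, cons_mem_words, cons_mem_words]
    simp [ha, hb, hab]
  symm
  refine Finset.sum_of_injOn (fun v => a :: v ++ [b]) ?_ (fun v hv => (hmem v).2 hv) ?_ ?_
  · intro v _ v' _ h
    simpa using h
  · intro w hw hw'
    rw [treeWeight, if_neg, zero_smul]
    rintro ⟨h1, h2⟩
    obtain ⟨c, w, rfl⟩ := List.exists_cons_of_ne_nil (l := w) (by rintro rfl; simp at h1)
    obtain ⟨v, d, rfl⟩ : ∃ v d, w = v ++ [d] := by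
      rcases List.eq_nil_or_concat' w with rfl | ⟨v, d, h⟩
      · simp at h1
      · exact ⟨v, d, h⟩
    have e1 : c = a := by
      refine hpos (le_antisymm ((h2 a ((mem_of_mem_words hw).2 ha)).1 c rfl)
        (hmin c ((mem_of_mem_words hw).1 (by simp))))
    have e2 : d = b := by
      refine hpos (le_antisymm (hmax d ((mem_of_mem_words hw).1 (by simp)))
        ((h2 b ((mem_of_mem_words hw).2 hb)).2 d ?_))
      rw [← List.cons_append, List.getLast?_append]
      rfl
    subst e1 e2
    exact hw' ⟨v, (hmem v).1 hw, rfl⟩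
  · intro v hv
    have hw := (hmem v).2 hv
    rw [treeWeight, if_pos]
    · simp
    · refine ⟨by simp, fun x hx => ⟨?_, ?_⟩⟩
      · intro c hc
        obtain rfl : a = c := by simpa using hc
        exact hmin x ((mem_of_mem_words hw).1 hx)
      · intro c hc
        rw [List.getLast?_append] at hc
        obtain rfl : b = c := by simpa using hc
        exact hmax x ((mem_of_mem_words hw).1 hx)

/-- A sum over words in which only those contribute that have two adjacent letters `p`, `q`. -/
lemma sum_words_adjacent {α M : Type*} [AddCommMonoid M] [DecidableEq α] {A : Finset α} {p q : α}
    (hp : p ∈ A) (hq : q ∈ A) (hpq : p ≠ q) (f : List α → M)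
    (hf : ∀ w ∈ words A, (∀ s t, w ≠ s ++ p :: q :: t) → (∀ s t, w ≠ s ++ q :: p :: t) →
      f w = 0) :
    ∑ w ∈ words A, f w = ∑ s ∈ wordPairs ((A.erase q).erase p),
      (f (s.1.reverse ++ p :: q :: s.2) + f (s.1.reverse ++ q :: p :: s.2)) := by
  classical
  have key : ∀ p q : α, p ∈ A → q ∈ A → p ≠ q →
      ∑ w ∈ words A, (if ∃ s t, w = s ++ p :: q :: t then f w else 0) =
        ∑ s ∈ wordPairs ((A.erase q).erase p), f (s.1.reverse ++ p :: q :: s.2) := by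
    intro p q hp hq hpq
    have hmem : ∀ s t, s ++ p :: q :: t ∈ words A ↔
        (s.reverse, t) ∈ wordPairs ((A.erase q).erase p) := by
      intro s t
      have h : (q :: p :: (s.reverse ++ t)).Perm (s ++ p :: q :: t) := by
        refine (List.Perm.swap p q _).trans ?_
        have h1 : (p :: q :: (s.reverse ++ t)).Perm (p :: q :: (s ++ t)) :=
          (((List.reverse_perm s).append_right t).cons q).cons p
        refine h1.trans ?_
        exact (List.perm_middle.symm.cons p).trans List.perm_middle.symm
      rw [mem_wordPairs, ← perm_mem_words h, cons_mem_words, cons_mem_words]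
      simp [hp, hq, hpq]
    symm
    refine Finset.sum_of_injOn (fun s => s.1.reverse ++ p :: q :: s.2) ?_ ?_ ?_ ?_
    · rintro ⟨r, t⟩ h ⟨r', t'⟩ h' e
      rw [Finset.mem_coe, mem_wordPairs] at h h'
      have n1 : ∀ x ∈ r ++ t, x ≠ p := fun x hx => (Finset.mem_erase.1
        ((mem_of_mem_words h).1 hx)).1
      have n2 : p ∉ r.reverse := fun hx => n1 p (by simpa using Or.inl hx) rfl
      have n3 : p ∉ q :: t := by
        simp only [List.mem_cons, not_or]
        exact ⟨hpq, fun hx => n1 p (by simp [hx]) rfl⟩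
      dsimp only at e
      rw [List.append_cons_inj_of_notMem n2 n3] at e
      simp_all
    · rintro ⟨r, t⟩ h
      have := hmem r.reverse t
      rw [List.reverse_reverse] at this
      exact this.2 h
    · intro w hw h
      refine if_neg ?_
      rintro ⟨s, t, rfl⟩
      exact h ⟨(s.reverse, t), (hmem s t).1 hw, by simp⟩
    · intro s _
      exact (if_pos ⟨_, _, rfl⟩).symm
  rw [Finset.sum_add_distrib, ← key p q hp hq hpq]
  have := key q p hq hp hpq.symm
  rw [Finset.erase_right_comm] at this
  rw [← this, ← Finset.sum_add_distrib]
  refine Finset.sum_congr rfl fun w hw => ?_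
  by_cases h1 : ∃ s t, w = s ++ p :: q :: t
  -- The two adjacency patterns exclude each other, as each letter occurs once; so no word is
  -- counted twice.
  · have h2 : ¬ ∃ s t, w = s ++ q :: p :: t := by
      rintro ⟨s', t', h'⟩
      obtain ⟨s, t, rfl⟩ := h1
      have hn := nodup_of_mem_words hw
      have n1 : p ∉ s ∧ p ∉ q :: t := by
        rw [List.nodup_middle, List.nodup_cons, List.mem_append, not_or] at hn
        exact hn.1
      rw [show s' ++ q :: p :: t' = (s' ++ [q]) ++ p :: t' by simp,
        List.append_cons_inj_of_notMem n1.1 n1.2] at h'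
      rw [h'.1] at hn
      simp [List.nodup_append] at hn
    rw [if_pos h1, if_neg h2, add_zero]
  · rw [if_neg h1, zero_add]
    split_ifs with h2
    · rfl
    · push Not at h1 h2
      exact hf w hw h1 h2

end

end Jacobi

namespace Jacobi

noncomputable section

variable {𝕜 : Type*} [Field 𝕜] {X Y Z : Type}

/-! ### The exchange of neighbouring legs of a block -/

section Exchange

variable [DecidableEq Y] {pos : Y → ℤ} {B : Finset Y} {p q : Y}

/-- Here `p` and `q` lie strictly between the first and the last leg, which are fixed by the
exchange. Words in which they are not adjacent have the same weight on both sides and cancel. The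
others come in pairs $\ldots pq\ldots$ and $\ldots qp\ldots$ with $d$ and $d+1$ descents, and these
coefficients are interchanged in the second tree. The combs combine to a bracket, the coefficients
by `treeCoeff_sub`. -/
lemma gl_blockTree_interior [CharZero 𝕜] (hpos : Function.Injective pos) (hp : p ∈ B) (hq : q ∈ B)
    (hpq : pos p < pos q) (hcons : ∀ x ∈ B, ¬ (pos p < pos x ∧ pos x < pos q)) (m R : BSpace 𝕜 Y)
    {a b : Y} (ha : a ∈ B) (hb : b ∈ B) (hap : a ≠ p) (hbq : b ≠ q)
    (hmin : ∀ x ∈ B, pos a ≤ pos x) (hmax : ∀ x ∈ B, pos x ≤ pos b) :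
    gl 𝕜 Y m (R * blockTree 𝕜 pos B) - gl 𝕜 Y m (R * blockTree 𝕜 (pos ∘ Equiv.swap p q) B) =
      gl 𝕜 Y (joinOp 𝕜 p q m) (R * blockTree 𝕜 pos (B.erase q)) := by
  have hpq' : p ≠ q := by rintro rfl; exact lt_irrefl _ hpq
  have lap : pos a < pos p := lt_of_le_of_ne (hmin p hp) fun h => hap (hpos h)
  have lqb : pos q < pos b := lt_of_le_of_ne (hmax q hq) fun h => hbq (hpos h).symm
  have haq : a ≠ q := by rintro rfl; omega
  have hbp : b ≠ p := by rintro rfl; omega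
  have hab : a ≠ b := by rintro rfl; omega
  have sa : Equiv.swap p q a = a := Equiv.swap_apply_of_ne_of_ne hap haq
  have sb : Equiv.swap p q b = b := Equiv.swap_apply_of_ne_of_ne hbp hbq
  have sB : ∀ x ∈ B, Equiv.swap p q x ∈ B := by
    intro x hx
    rw [Equiv.swap_apply_def]
    split_ifs
    exacts [hq, hp, hx]
  rw [blockTree_eq hpos ha hb hab hmin hmax,
    blockTree_eq (pos := pos ∘ Equiv.swap p q) (hpos.comp (Equiv.injective _)) ha hb hab
      (fun x hx => by simpa only [Function.comp_apply, sa] using hmin _ (sB x hx))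
      (fun x hx => by simpa only [Function.comp_apply, sb] using hmax _ (sB x hx)),
    blockTree_eq hpos (Finset.mem_erase.2 ⟨haq, ha⟩) (Finset.mem_erase.2 ⟨hbq, hb⟩) hab
      (fun x hx => hmin x (Finset.mem_of_mem_erase hx))
      (fun x hx => hmax x (Finset.mem_of_mem_erase hx))]
  simp only [Finset.mul_sum, map_sum, mul_smul_comm, map_smul]
  rw [← Finset.sum_sub_distrib]
  simp only [← sub_smul]
  have hmem : ∀ {v}, v ∈ words ((B.erase b).erase a) → ∀ x ∈ a :: v ++ [b], x ∈ B := by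
    intro v hv x hx
    simp only [List.cons_append, List.mem_cons, List.mem_append, List.not_mem_nil, or_false] at hx
    rcases hx with rfl | hx | rfl
    · exact ha
    · exact Finset.mem_of_mem_erase (Finset.mem_of_mem_erase ((mem_of_mem_words hv).1 hx))
    · exact hb
  rw [sum_words_adjacent (p := p) (q := q) (by simp [hp, hap.symm, hbp.symm])
    (by simp [hq, haq.symm, hbq.symm]) hpq']
  · have he : ((B.erase q).erase b).erase a = ((B.erase b).erase a).erase q := by
      ext x; simp only [Finset.mem_erase]; tauto
    rw [he, ← sum_words_cut (q := p) (by simp [hp, hap.symm, hbp.symm, hpq'])]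
    refine Finset.sum_congr rfl ?_
    rintro ⟨r, t⟩ hs
    rw [mem_wordPairs] at hs
    dsimp only at hs ⊢
    have hrt : ∀ x ∈ r ++ t, x ≠ p ∧ x ≠ q ∧ x ≠ a ∧ x ≠ b ∧ x ∈ B := by
      intro x hx
      have := (mem_of_mem_words hs).1 hx
      simp only [Finset.mem_erase] at this
      tauto
    have hst : ∀ x ∈ a :: r.reverse ++ (t ++ [b]), x ≠ p ∧ x ≠ q ∧ x ∈ B := by
      intro x hx
      have h := hrt x
      simp only [List.cons_append, List.mem_cons, List.mem_append, List.mem_reverse,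
        List.not_mem_nil, or_false] at hx h
      rcases hx with rfl | hx | hx | rfl
      · exact ⟨hap, haq, ha⟩
      · have := h (Or.inl hx); tauto
      · have := h (Or.inr hx); tauto
      · exact ⟨hbp, hbq, hb⟩
    have hd := descentsOf_adjacent (pos := pos) (a :: r.reverse) (t ++ [b]) hpq (fun x hx => by
      obtain ⟨h1, h2, h3⟩ := hst x hx
      have h4 := hcons x h3
      have h5 : pos x ≠ pos p := fun h => h1 (hpos h)
      have h6 : pos x ≠ pos q := fun h => h2 (hpos h)
      omega)
    have hm := map_comp_swap (pos := pos) (p := p) (q := q) (a :: r.reverse) (t ++ [b])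
      (fun h => (hst p h).1 rfl) (fun h => (hst q h).2.1 rfl)
    simp only [List.cons_append, List.append_assoc] at hd hm ⊢
    rw [hm.1, hm.2, hd.1, hd.2]
    set d := descentsOf (List.map pos (a :: (r.reverse ++ p :: (t ++ [b])))) with hdd
    have hle : d ≤ (r.reverse ++ p :: t).length := by
      rw [hdd, show a :: (r.reverse ++ p :: (t ++ [b])) = a :: (r.reverse ++ p :: t) ++ [b] by simp,
        List.map_append, List.map_singleton, descentsOf_concat]
      · rw [List.map_cons, ← List.length_map (f := pos) (as := r.reverse ++ p :: t)]
        exact descentsOf_cons_le _ _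
      · intro z hz
        obtain ⟨x, hx, rfl⟩ := List.mem_map.1 hz
        refine hmax x ?_
        by_cases hxp : x = p
        · exact hxp ▸ hp
        · refine (hst x ?_).2.2
          simp only [List.cons_append, List.mem_cons, List.mem_append, hxp, false_or] at hx ⊢
          tauto
    have hl1 : (r.reverse ++ p :: q :: t).length = (r.reverse ++ p :: t).length + 1 := by
      simp; omega
    have hl2 : (r.reverse ++ q :: p :: t).length = (r.reverse ++ p :: t).length + 1 := by
      simp; omega
    rw [hl1, hl2, ← neg_sub (treeCoeff 𝕜 _ d), treeCoeff_sub hle, neg_smul, ← sub_eq_add_neg,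
      ← smul_sub]
    have key := gl_combWord_bracket m R (x := a) (a := p) (b := q) r.reverse (t := t ++ [b])
      (by simp)
      (by
        have : a ∉ r := fun h => (hrt a (List.mem_append_left _ h)).2.2.1 rfl
        simp [this, hap, haq])
      hpq' (by simpa using fun h => (hrt p (by simp [h])).1 rfl)
      (by simpa using fun h => (hrt q (by simp [h])).2.1 rfl)
    rw [key]
  · intro v hv h1 h2
    have hv' : ∀ s u : List Y, ∀ x y : Y, x ≠ a → y ≠ b → (∀ s t, v ≠ s ++ x :: y :: t) →
        a :: v ++ [b] ≠ s ++ x :: y :: u := by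
      intro s u x y hx hy hne h
      cases s with
      | nil =>
        simp only [List.cons_append, List.nil_append, List.cons.injEq] at h
        exact hx h.1.symm
      | cons c s =>
        simp only [List.cons_append, List.cons.injEq] at h
        rcases List.eq_nil_or_concat' u with rfl | ⟨u, e, rfl⟩
        · have := congrArg List.getLast? h.2
          simp only [List.getLast?_append] at this
          simp at this
          exact hy this.symm
        · have h' := h.2
          rw [show s ++ x :: y :: (u ++ [e]) = (s ++ x :: y :: u) ++ [e] by simp] at h'
          exact hne s u (List.append_inj_left' h' rfl)
    rw [descentsOf_comp_swap hpos hpq (fun x hx => hcons x (hmem hv x hx)), sub_self, zero_smul]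
    · exact fun s t => hv' s t p q hap.symm hbq.symm h1
    · exact fun s t => hv' s t q p haq.symm hbp.symm h2

/-- Here `p` is the lowest leg, so the two trees start with different letters. The first tree is
rewritten with first letter `q`, after which both are sums over the same combs and the weights can
be compared. -/
lemma gl_blockTree_first [CharZero 𝕜] (hpos : Function.Injective pos) (hp : p ∈ B) (hq : q ∈ B)
    (hpq : pos p < pos q) (hcons : ∀ x ∈ B, ¬ (pos p < pos x ∧ pos x < pos q)) (m R : BSpace 𝕜 Y)
    {b : Y} (hb : b ∈ B) (hbq : b ≠ q)
    (hmin : ∀ x ∈ B, pos p ≤ pos x) (hmax : ∀ x ∈ B, pos x ≤ pos b) :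
    gl 𝕜 Y m (R * blockTree 𝕜 pos B) - gl 𝕜 Y m (R * blockTree 𝕜 (pos ∘ Equiv.swap p q) B) =
      gl 𝕜 Y (joinOp 𝕜 p q m) (R * blockTree 𝕜 pos (B.erase q)) := by
  have hpq' : p ≠ q := by rintro rfl; exact lt_irrefl _ hpq
  have lqb : pos q < pos b := lt_of_le_of_ne (hmax q hq) fun h => hbq (hpos h).symm
  have hbp : b ≠ p := by rintro rfl; omega
  have sb : Equiv.swap p q b = b := Equiv.swap_apply_of_ne_of_ne hbp hbq
  have sB : ∀ x ∈ B, Equiv.swap p q x ∈ B := by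
    intro x hx
    rw [Equiv.swap_apply_def]
    split_ifs
    exacts [hq, hp, hx]
  rw [blockTree_eq hpos hp hb hbp.symm hmin hmax,
    blockTree_eq (pos := pos ∘ Equiv.swap p q) (hpos.comp (Equiv.injective _)) hq hb hbq.symm
      (fun x hx => by
        simpa only [Function.comp_apply, Equiv.swap_apply_right] using hmin _ (sB x hx))
      (fun x hx => by simpa only [Function.comp_apply, sb] using hmax _ (sB x hx)),
    blockTree_eq hpos (Finset.mem_erase.2 ⟨hpq', hp⟩) (Finset.mem_erase.2 ⟨hbq, hb⟩) hbp.symm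
      (fun x hx => hmin x (Finset.mem_of_mem_erase hx))
      (fun x hx => hmax x (Finset.mem_of_mem_erase hx))]
  simp only [Finset.mul_sum, map_sum, mul_smul_comm, map_smul]
  -- The highest letter at the end creates no descent, so the weight is the Eulerian coefficient of
  -- the word without it.
  have hc : ∀ x ∈ B.erase b, ∀ v ∈ words ((B.erase b).erase x),
      treeCoeff 𝕜 v.length (descentsOf ((x :: v ++ [b]).map pos)) =
        eulerCoeff 𝕜 ((x :: v).map pos) := by
    intro x hx v hv
    rw [eulerCoeff, List.length_map, List.length_cons, Nat.add_sub_cancel, List.map_append,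
      List.map_singleton, descentsOf_concat]
    intro z hz
    obtain ⟨y, hy, rfl⟩ := List.mem_map.1 hz
    exact hmax y (Finset.mem_of_mem_erase
      ((mem_of_mem_words (cons_mem_words.2 ⟨hx, hv⟩)).1 hy))
  have hpA : p ∈ B.erase b := Finset.mem_erase.2 ⟨hbp.symm, hp⟩
  have hqA : q ∈ B.erase b := Finset.mem_erase.2 ⟨hbq.symm, hq⟩
  have e1 : ∑ v ∈ words ((B.erase b).erase p),
      treeCoeff 𝕜 v.length (descentsOf ((p :: v ++ [b]).map pos)) •
        gl 𝕜 Y m (R * combWord 𝕜 (p :: v ++ [b])) =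
      ∑ v ∈ words ((B.erase b).erase q),
      treeCoeff 𝕜 v.length (descentsOf ((q :: v ++ [b]).map pos)) •
        gl 𝕜 Y m (R * combWord 𝕜 (q :: v ++ [b])) := by
    rw [Finset.sum_congr rfl fun v hv => congrArg (· • _) (hc p hpA v hv),
      Finset.sum_congr rfl fun v hv => congrArg (· • _) (hc q hqA v hv)]
    refine (sum_gl_combWord_head m R (B.erase b) hpq' hpA hqA
      (fun w => eulerCoeff 𝕜 (w.map pos)) ?_).symm
    intro u v hu hv h
    rw [← shuffleSum_map pos (eulerCoeff 𝕜) u v]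
    refine shuffleSum_eulerCoeff _ _ ?_ (by simpa using hu) (by simpa using hv)
    rw [← List.map_append]
    exact (nodup_of_mem_words h).map hpos
  rw [e1, ← Finset.sum_sub_distrib]
  simp only [← sub_smul]
  -- Only words in which `p` follows `q` immediately notice the exchange. There the weights differ
  -- by minus the weight of the shorter word, and $[q,p]=-[p,q]$ removes the sign.
  rw [sum_words_cons _ ⟨p, Finset.mem_erase.2 ⟨hpq', hpA⟩⟩, Finset.sum_eq_single p]
  · have he : ((B.erase q).erase b).erase p = ((B.erase b).erase q).erase p := by
      rw [Finset.erase_right_comm (a := q)]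
    rw [he]
    refine Finset.sum_congr rfl fun v hv => ?_
    have hvB : ∀ x ∈ v, x ≠ p ∧ x ≠ q ∧ x ∈ B ∧ x ≠ b := by
      intro x hx
      have := (mem_of_mem_words hv).1 hx
      simp only [Finset.mem_erase] at this
      tauto
    have hvB' : ∀ x ∈ v ++ [b], x ≠ p ∧ x ≠ q ∧ x ∈ B := by
      intro x hx
      rw [List.mem_append, List.mem_singleton] at hx
      rcases hx with hx | rfl
      · have := hvB x hx; tauto
      · exact ⟨hbp, hbq, hb⟩
    have hd := descentsOf_adjacent (pos := pos) [] (v ++ [b]) hpq (fun x hx => by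
      obtain ⟨h1, h2, h3⟩ := hvB' x hx
      have h4 := hcons x h3
      have h5 : pos x ≠ pos p := fun h => h1 (hpos h)
      have h6 : pos x ≠ pos q := fun h => h2 (hpos h)
      omega)
    have hm := map_comp_swap (pos := pos) (p := p) (q := q) [] (v ++ [b])
      (fun h => (hvB' p h).1 rfl) (fun h => (hvB' q h).2.1 rfl)
    simp only [List.cons_append, List.nil_append] at hd hm ⊢
    rw [hm.2, hd.1, hd.2]
    set d := descentsOf (List.map pos (p :: (v ++ [b]))) with hdd
    have hle : d ≤ v.length := by
      rw [hdd, show p :: (v ++ [b]) = p :: v ++ [b] by simp,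
        List.map_append, List.map_singleton, descentsOf_concat]
      · rw [List.map_cons, ← List.length_map (f := pos) (as := v)]
        exact descentsOf_cons_le _ _
      · intro z hz
        obtain ⟨x, hx, rfl⟩ := List.mem_map.1 hz
        refine hmax x ?_
        rcases List.mem_cons.1 hx with rfl | hx
        exacts [hp, (hvB x hx).2.2.1]
    rw [List.length_cons, ← neg_sub (treeCoeff 𝕜 _ d), treeCoeff_sub hle,
      combWord_swap q p (by simp), mul_neg, map_neg, neg_smul_neg,
      gl_combWord_cons _ _ hpq' (by simp)]
  · intro c hc' hcp
    refine Finset.sum_eq_zero fun v hv => ?_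
    have hw : c :: v ∈ words ((B.erase b).erase q) := cons_mem_words.2 ⟨hc', hv⟩
    have hw' : q :: c :: v ∈ words (B.erase b) := cons_mem_words.2 ⟨hqA, hw⟩
    have hw'' : q :: c :: v ++ [b] ∈ words B :=
      (perm_mem_words (List.perm_append_singleton b _)).2 (cons_mem_words.2 ⟨hb, hw'⟩)
    have hn := nodup_of_mem_words hw''
    rw [descentsOf_comp_swap hpos hpq (fun x hx => hcons x ((mem_of_mem_words hw'').1 hx)),
      sub_self, zero_smul]
    · intro s t h
      cases s with
      | nil => simp [hpq'.symm] at h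
      | cons e s =>
        simp only [List.cons_append, List.cons.injEq] at h
        simp only [List.cons_append] at hn
        rw [h.2] at hn
        simp at hn
    · intro s t h
      cases s with
      | nil => simp [hcp] at h
      | cons e s =>
        simp only [List.cons_append, List.cons.injEq] at h
        simp only [List.cons_append] at hn
        rw [h.2] at hn
        simp at hn
  · exact fun h => absurd (Finset.mem_erase.2 ⟨hpq', hpA⟩) h

/-- The behaviour of the combination of trees on a block under the exchange of two neighbours. -/
theorem gl_blockTree_exchange [CharZero 𝕜] (hpos : Function.Injective pos) (hp : p ∈ B)
    (hq : q ∈ B) (hpq : pos p < pos q) (hcons : ∀ x ∈ B, ¬ (pos p < pos x ∧ pos x < pos q))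
    (m R : BSpace 𝕜 Y) (hR : BSpace.map 𝕜 (Equiv.swap p q) R = R) :
    gl 𝕜 Y m (R * blockTree 𝕜 pos B) - gl 𝕜 Y m (R * blockTree 𝕜 (pos ∘ Equiv.swap p q) B) =
      gl 𝕜 Y (joinOp 𝕜 p q m) (R * blockTree 𝕜 pos (B.erase q)) := by
  have hpq' : p ≠ q := by rintro rfl; exact lt_irrefl _ hpq
  obtain ⟨a, ha, hmin⟩ := B.exists_min_image pos ⟨p, hp⟩
  obtain ⟨b, hb, hmax⟩ := B.exists_max_image pos ⟨p, hp⟩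
  by_cases hbq : b = q
  · subst hbq
    -- If `p` is the first and `q` the last leg, the block is `{p, q}`. Its tree is a strut, which
    -- the exchange preserves, and the tree on the remaining single leg is zero.
    by_cases hap : a = p
    · subst hap
      have hB : B = {a, b} := by
        ext x
        rw [Finset.mem_insert, Finset.mem_singleton]
        constructor
        · intro hx
          by_contra! h
          have h1 : pos a ≠ pos x := fun e => h.1 (hpos e).symm
          have h2 : pos x ≠ pos b := fun e => h.2 (hpos e)
          have := hmin x hx
          have := hmax x hx
          exact hcons x hx ⟨by omega, by omega⟩
        · rintro (rfl | rfl) <;> assumption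
      have hB' : B.erase b = {a} := by
        rw [hB, Finset.erase_insert_of_ne hpq']
        simp
      rw [hB', blockTree_of_card_le (B := {a}) (by simp), mul_zero, map_zero, sub_eq_zero]
      congr 2
      rw [blockTree_eq hpos hp hq hpq' hmin hmax,
        blockTree_eq (pos := pos ∘ Equiv.swap a b) (hpos.comp (Equiv.injective _)) hq hp hpq'.symm]
      · have hB'' : B.erase a = {b} := by
          rw [hB, Finset.erase_insert (by simpa using hpq')]
        rw [hB', hB'', Finset.erase_singleton, Finset.erase_singleton, words_empty]
        simp only [Finset.sum_singleton, List.length_nil, List.cons_append, List.nil_append,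
          List.map_cons, List.map_nil, Function.comp_apply, Equiv.swap_apply_left,
          Equiv.swap_apply_right]
        congr 1
        have := combWord_rev (𝕜 := 𝕜) (w := [a, b]) (by simp)
        simpa using this.symm
      · intro x hx
        rw [Function.comp_apply, Equiv.swap_apply_right]
        rw [hB, Finset.mem_insert, Finset.mem_singleton] at hx
        rcases hx with rfl | rfl <;> simp [hpq.le]
      · intro x hx
        rw [Function.comp_apply, Function.comp_apply, Equiv.swap_apply_left]
        rw [hB, Finset.mem_insert, Finset.mem_singleton] at hx
        rcases hx with rfl | rfl <;> simp [hpq.le]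
    · have hneg : Function.Injective fun y => - pos y := neg_injective.comp hpos
      -- Only `q` is extremal. With negated heights `q` becomes the first leg and `p` its successor.
      -- The smaller block has one leg fewer, which yields one sign; joining in the opposite order
      -- yields another one together with an exchange of the marks `p` and `q`.
      have key := gl_blockTree_first (pos := fun y => - pos y) hneg hq hp (neg_lt_neg hpq)
        (fun x hx h => hcons x hx ⟨neg_lt_neg_iff.1 h.2, neg_lt_neg_iff.1 h.1⟩) m R ha hap
        (fun x hx => neg_le_neg (hmax x hx)) (fun x hx => neg_le_neg (hmin x hx))
      have e0 : (fun y => - pos y) ∘ Equiv.swap b p =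
          fun y => - (pos ∘ Equiv.swap p b) y := by
        funext y
        rw [Equiv.swap_comm]
        rfl
      rw [e0, blockTree_neg, blockTree_neg, blockTree_neg, Finset.card_erase_of_mem hp] at key
      have hcard : B.card = (B.card - 1) + 1 := by
        have := Finset.card_pos.2 ⟨p, hp⟩
        omega
      have hu : ∀ (n : ℕ) (u v : CSpace 𝕜), (-1 : ℤ) ^ n • u = (-1 : ℤ) ^ n • v → u = v := by
        intro n u v h
        have := congrArg ((-1 : ℤ) ^ n • ·) h
        simpa only [smul_smul, ← mul_pow, neg_mul_neg, one_mul, one_pow, one_smul] using this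
      simp only [mul_smul_comm, map_zsmul] at key
      rw [← smul_sub, hcard, pow_succ, Nat.add_sub_cancel, mul_smul] at key
      have key2 := hu _ _ _ key
      rw [neg_one_smul, neg_eq_iff_eq_neg] at key2
      rw [key2, joinOp_swap hpq', map_neg, LinearMap.neg_apply, neg_neg]
      -- As `p` and `q` are neighbours, replacing one by the other preserves the order of the
      -- remaining block. The exchange of marks therefore affects both arguments of the pairing,
      -- `hR` covering the other trees, and can be dropped.
      have e1 : blockTree 𝕜 pos (B.erase p) =
          BSpace.map 𝕜 (Equiv.swap p b) (blockTree 𝕜 pos (B.erase b)) := by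
        have hset : (B.erase b).map (Equiv.swap p b).toEmbedding = B.erase p := by
          ext x
          rw [Finset.mem_map_equiv, Finset.mem_erase, Finset.mem_erase, Equiv.symm_swap,
            Equiv.swap_apply_def]
          split_ifs with h1 h2
          · simp [h1]
          · simp [h2, hp, hq, hpq', hpq'.symm]
          · simp [h1, h2]
        rw [← hset, ← map_blockTree]
        refine congrArg _ (blockTree_congr fun x hx y hy => ?_)
        have hx' := Finset.mem_erase.1 hx
        have hy' := Finset.mem_erase.1 hy
        simp only [Function.comp_apply, Equiv.coe_toEmbedding, Equiv.swap_apply_def, if_neg hx'.1,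
          if_neg hy'.1]
        have h1 := hcons x hx'.2
        have h2 := hcons y hy'.2
        have h3 := hmax x hx'.2
        have h4 := hmax y hy'.2
        have h5 : pos x ≠ pos b := fun h => hx'.1 (hpos h)
        have h6 : pos y ≠ pos b := fun h => hy'.1 (hpos h)
        have h7 : x ≠ p → pos x ≠ pos p := fun h h' => h (hpos h')
        have h8 : y ≠ p → pos y ≠ pos p := fun h h' => h (hpos h')
        grind
      have hsw : ∀ i : DecidableEq Y, @Equiv.swap _ i p b = Equiv.swap p b := by
        intro i; congr!
      rw [e1]
      nth_rewrite 1 [← hR]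
      rw [← map_mul]
      convert gl_map (Equiv.injective (Equiv.swap p b)) _ _
  · by_cases hap : a = p
    · subst hap
      exact gl_blockTree_first hpos hp hq hpq hcons m R hb hbq hmin hmax
    · exact gl_blockTree_interior hpos hp hq hpq hcons m R ha hb hap hbq hmin hmax

end Exchange

end

end Jacobi

namespace Jacobi

noncomputable section

variable {𝕜 : Type*} [Field 𝕜] {X Y Z : Type}

/-! ### The map `j_m` in terms of gluing -/

/-- The class of a linear combination of graphs whose ends are marked. -/
def graphClass (𝕜 : Type*) [Field 𝕜] {E : Type} [Fintype E] (c : E → Y) :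
    (Graph E →₀ 𝕜) →ₗ[𝕜] BSpace 𝕜 Y :=
  Finsupp.linearCombination 𝕜 fun H => BSpace.mk 𝕜 ⟨E, c, H⟩

lemma graphClass_single {E : Type} [Fintype E] (c : E → Y) (H : Graph E) (r : 𝕜) :
    graphClass 𝕜 c (Finsupp.single H r) = r • BSpace.mk 𝕜 ⟨E, c, H⟩ :=
  Finsupp.linearCombination_single 𝕜 r H

lemma graphClass_relabel {E F : Type} [Fintype E] [Fintype F] (f : E ≃ F) (c : F → Y)
    (u : Graph E →₀ 𝕜) :
    graphClass 𝕜 c (u.mapDomain (Graph.relabel f)) = graphClass 𝕜 (c ∘ f) u := by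
  rw [graphClass, Finsupp.linearCombination_mapDomain, graphClass]
  congr 2
  funext H
  have h := BSpace.mk_iso 𝕜 (⟨E, c ∘ f, H⟩ : BDiag Y) ⟨F, c, H.relabel f⟩ (Graph.Iso.relabel f H)
    (fun _ => rfl)
  have hs : (Graph.Iso.relabel f H).sign = 1 := Finset.prod_eq_one fun v _ => by
    change ((Equiv.Perm.sign (1 : Equiv.Perm (Fin 3)) : ℤˣ) : ℤ) = 1
    simp
  rw [h, hs, Int.cast_one, one_smul]
  rfl

lemma graphClass_comp {E : Type} [Fintype E] (f : Y → Z) (c : E → Y) (u : Graph E →₀ 𝕜) :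
    BSpace.map 𝕜 f (graphClass 𝕜 c u) = graphClass 𝕜 (f ∘ c) u := by
  induction u using Finsupp.induction_linear with
  | zero => simp
  | add u v hu hv => simp only [map_add, hu, hv]
  | single H r => rw [graphClass_single, graphClass_single, map_smul, BSpace.map_mk]

/-- Multilinear expansion of a product of sums: the choices of one graph per index are exactly the
terms of `unionSum`. -/
lemma graphClass_unionSum {ι : Type} [Fintype ι] {F : ι → Type} [∀ i, Fintype (F i)]
    (c : (Σ i, F i) → Y) (u : ∀ i, Graph (F i) →₀ 𝕜) :
    graphClass 𝕜 c (unionSum u) = ∏ i, graphClass 𝕜 (fun e => c ⟨i, e⟩) (u i) := by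
  classical
  rw [unionSum, map_sum]
  have h : ∀ i, graphClass 𝕜 (fun e => c ⟨i, e⟩) (u i) =
      ∑ g ∈ (u i).support, u i g • BSpace.mk 𝕜 ⟨F i, fun e => c ⟨i, e⟩, g⟩ := fun i => rfl
  simp only [h]
  rw [Finset.prod_univ_sum]
  refine Finset.sum_congr (by congr!) fun g _ => ?_
  rw [graphClass_single, Finset.prod_smul]
  exact congrArg _ (BDiag.mk_sigma (𝕜 := 𝕜) fun i => (⟨F i, fun e => c ⟨i, e⟩, g i⟩ : BDiag Y))

lemma sum_words_univ {n : ℕ} {M : Type*} [AddCommMonoid M] (F : List (Fin n) → M) :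
    ∑ w ∈ words (Finset.univ : Finset (Fin n)), F w =
      ∑ e : Equiv.Perm (Fin n), F (List.ofFn e) := by
  symm
  refine Finset.sum_bij (fun e _ => List.ofFn e) ?_ ?_ ?_ ?_
  · intro e _
    rw [mem_words_iff]
    refine ⟨List.nodup_ofFn.2 e.injective, fun x => ?_⟩
    simp only [List.mem_ofFn, Finset.mem_univ, iff_true]
    exact e.surjective x
  · intro e _ e' _ h
    exact DFunLike.coe_injective (List.ofFn_injective h)
  · intro w hw
    have hl : w.length = n := by rw [length_of_mem_words hw, Finset.card_univ, Fintype.card_fin]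
    have hinj : Function.Injective fun i : Fin n => w.get (i.cast hl.symm) :=
      (List.nodup_iff_injective_get.1 (nodup_of_mem_words hw)).comp (Fin.cast_injective _)
    refine ⟨Equiv.ofBijective _ (Finite.injective_iff_bijective.1 hinj), Finset.mem_univ _, ?_⟩
    apply List.ext_getElem
    · simp [hl]
    · intro i _ _
      simp
  · intros; rfl

lemma descentsOf_ofFn {n : ℕ} (f : Fin (n + 1) → ℤ) :
    descentsOf (List.ofFn f) = ∑ k : Fin n, if f k.succ < f k.castSucc then 1 else 0 := by
  induction n with
  | zero => rw [List.ofFn_succ]; simp [descentsOf]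
  | succ n ih =>
    have := ih (fun i => f i.succ)
    rw [List.ofFn_succ] at this
    rw [List.ofFn_succ, List.ofFn_succ, descentsOf, this, Fin.sum_univ_succ]
    rfl

/-- A permutation of the legs is a word in which each leg occurs once. Fixing the first and last
positions is the condition in `treeWeight`, and the descents agree. -/
lemma graphClass_treeSum (s : ℕ) :
    graphClass 𝕜 id (treeSum 𝕜 s) =
      blockTree 𝕜 (fun i : Fin s => (i : ℤ)) Finset.univ := by
  classical
  match s with
  | 0 => rw [blockTree_of_card_le (by simp), treeSum, map_zero]
  | 1 => rw [blockTree_of_card_le (by simp), treeSum, map_zero]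
  | n + 2 =>
    rw [treeSum, map_sum, blockTree, sum_words_univ]
    have hw : ∀ e : Equiv.Perm (Fin (n + 2)),
        treeWeight 𝕜 (fun i : Fin (n + 2) => (i : ℤ)) (List.ofFn e) =
          if e 0 = 0 ∧ e (Fin.last _) = Fin.last _ then treeCoeff 𝕜 n (descents e) else 0 := by
      intro e
      have hd : descentsOf ((List.ofFn e).map fun i : Fin (n + 2) => (i : ℤ)) = descents e := by
        rw [List.map_ofFn, descentsOf_ofFn, descents, Fintype.card_subtype,
          Finset.card_filter]
        simp
      have hc : (2 ≤ (List.ofFn e).length ∧ ∀ x ∈ List.ofFn e,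
          (∀ a ∈ (List.ofFn e).head?, ((a : ℕ) : ℤ) ≤ ((x : ℕ) : ℤ)) ∧
            ∀ b ∈ (List.ofFn e).getLast?, ((x : ℕ) : ℤ) ≤ ((b : ℕ) : ℤ)) ↔
          e 0 = 0 ∧ e (Fin.last _) = Fin.last _ := by
        have h1 : (List.ofFn e).head? = some (e 0) := by rw [List.ofFn_succ]; rfl
        have h2 : (List.ofFn e).getLast? = some (e (Fin.last _)) := by
          rw [List.ofFn_succ_last, List.getLast?_append]; rfl
        rw [h1, h2]
        simp only [List.length_ofFn, Option.mem_some_iff, forall_eq', List.mem_ofFn,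
          forall_exists_index, forall_apply_eq_imp_iff, Nat.cast_le]
        constructor
        · rintro ⟨-, h⟩
          refine ⟨?_, ?_⟩
          · have := (h (e.symm 0)).1
            rw [Equiv.apply_symm_apply] at this
            exact Fin.le_zero_iff.1 this
          · have := (h (e.symm (Fin.last _))).2
            rw [Equiv.apply_symm_apply] at this
            exact Fin.last_le_iff.1 this
        · rintro ⟨h0, h1⟩
          refine ⟨by omega, fun x => ⟨?_, ?_⟩⟩
          · rw [h0]; exact Nat.zero_le _
          · rw [h1]; exact Fin.le_last (e x)
      rw [treeWeight, hd]
      by_cases h : e 0 = 0 ∧ e (Fin.last _) = Fin.last _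
      · rw [if_pos h, if_pos (hc.2 h), List.length_ofFn, Nat.add_sub_cancel]
      · rw [if_neg h, if_neg fun h' => h (hc.1 h')]
    simp only [hw, ite_smul, zero_smul]
    rw [← Finset.sum_filter]
    rw [Finset.sum_subtype (p := fun e : Equiv.Perm (Fin (n + 2)) =>
      e 0 = 0 ∧ e (Fin.last _) = Fin.last _) (Finset.univ.filter _) (by simp)]
    refine Finset.sum_congr rfl fun e _ => ?_
    rw [combWord_ofFn]
    have := graphClass_relabel (𝕜 := 𝕜) e.1 (id : Fin (n + 2) → Fin (n + 2))
      (Finsupp.single (comb n) (treeCoeff 𝕜 n (descents e.1)))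
    rw [Finsupp.mapDomain_single, graphClass_single] at this
    exact (graphClass_single _ _ _).trans (this.trans (graphClass_single _ _ _))

/-- The product of the combinations of trees on the fibres of a map. -/
def forest (𝕜 : Type*) [Field 𝕜] {S : Type} [Fintype S] {L : Type} [Fintype L] (pos : L → ℤ)
    (g : L → S) : BSpace 𝕜 L := by
  classical
  exact ∏ s, blockTree 𝕜 pos {l | g l = s}

lemma forest_def [DecidableEq Z] [Fintype Z] [Fintype Y] (pos : Y → ℤ) (g : Y → Z) :
    forest 𝕜 pos g = ∏ s, blockTree 𝕜 pos {l | g l = s} := by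
  rw [forest]
  congr!

lemma enumerate_lt (B : Type) [Fintype B] (pos : B → ℕ) (h : Function.Injective pos)
    (i j : Fin (Fintype.card B)) :
    pos (enumerate B pos h i) < pos (enumerate B pos h j) ↔ i < j := by
  let _ := LinearOrder.lift' pos h
  exact (Fintype.orderIsoFinOfCardEq B rfl).lt_iff_lt

lemma graphClass_enumerate {B : Type} [Fintype B] (pos : B → ℕ) (h : Function.Injective pos)
    (c : B ↪ Y) (pos' : Y → ℤ) (hc : ∀ b, pos' (c b) = pos b) :
    graphClass 𝕜 c ((treeSum 𝕜 (Fintype.card B)).mapDomain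
      (Graph.relabel (enumerate B pos h))) = blockTree 𝕜 pos' (Finset.univ.map c) := by
  let f : Fin (Fintype.card B) ↪ Y := (enumerate B pos h).toEmbedding.trans c
  rw [graphClass_relabel]
  have h1 : graphClass 𝕜 (c ∘ enumerate B pos h) (treeSum 𝕜 (Fintype.card B)) =
      BSpace.map 𝕜 f (graphClass 𝕜 id (treeSum 𝕜 (Fintype.card B))) :=
    (graphClass_comp (𝕜 := 𝕜) f id _).symm
  rw [h1, graphClass_treeSum, blockTree_congr (pos' := pos' ∘ f), map_blockTree]
  · congr 1
    rw [← Finset.map_map, Finset.map_univ_equiv]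
  · intro i _ j _
    change _ ↔ pos' (c _) < pos' (c _)
    rw [hc, hc, Nat.cast_lt, Nat.cast_lt]
    exact (enumerate_lt B pos h i j).symm

lemma graphClass_forestSum {B : Type} [Fintype B] [DecidableEq B] (m : ℕ) (pos : B → ℕ)
    (h : Function.Injective pos) (c : B ↪ Y) (pos' : Y → ℤ) (hc : ∀ b, pos' (c b) = pos b) :
    graphClass 𝕜 c (forestSum 𝕜 m B pos h) = (m.factorial : 𝕜)⁻¹ • ∑ f : B → Fin m,
      ∏ b, blockTree 𝕜 pos' (({l | f l = b} : Finset B).map c) := by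
  classical
  rw [forestSum, map_smul, map_sum]
  refine congrArg _ (Finset.sum_congr (by congr!) fun f _ => ?_)
  rw [graphClass_relabel, graphClass_unionSum]
  refine Finset.prod_congr rfl fun b _ => ?_
  let c' : {l // f l = b} ↪ Y := (Function.Embedding.subtype _).trans c
  have h1 := graphClass_enumerate (𝕜 := 𝕜) (fun l : {l // f l = b} => pos l.1)
    (h.comp Subtype.val_injective) c' pos' (fun l => hc l.1)
  have h2 : (Finset.univ.map c') = ({l | f l = b} : Finset B).map c := by
    rw [← Finset.map_map]
    congr 1
    ext l
    simp
  rw [h2] at h1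
  rw [← h1]
  congr!

/-- The combination of forests to which the legs on all strands are glued. -/
def strandForest (𝕜 : Type*) [Field 𝕜] [Fintype X] (m : ℕ) {L : Type} [Fintype L] (color : L → X)
    (pos : L → ℤ) : BSpace 𝕜 L := by
  classical
  exact ((m.factorial : 𝕜)⁻¹) ^ Fintype.card X •
    ∑ F : L → Fin m, forest 𝕜 pos fun l => (color l, F l)

/-- The diagram whose legs have different marks. -/
abbrev freeDiag {L : Type} [Fintype L] (G : Graph L) : BDiag L := ⟨L, id, G⟩

lemma mk_glueGraphs {L : Type} [Fintype L] (G H : Graph L) :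
    CSpace.mk 𝕜 (glueGraphs G H) =
      gl 𝕜 L (BSpace.mk 𝕜 (freeDiag G)) (BSpace.mk 𝕜 (freeDiag H)) := by
  rw [gl_mk, glDiag_eq (D := freeDiag G) Function.injective_id ⟨Equiv.refl L, fun _ => rfl⟩]
  refine congrArg _ ?_
  unfold glueGraphs
  congr 1

/-- All properties of $j_m$ are derived from this form, in which the diagram enters through the
class of its graph, and the colours and heights enter through a fixed element of the algebra. -/
lemma jDiag_eq [Fintype X] (m : ℕ) (D : ADiag X) :
    jDiag 𝕜 m D = gl 𝕜 D.L (BSpace.mk 𝕜 (freeDiag D.G))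
      (strandForest 𝕜 m D.color fun l => (D.pos l : ℤ)) := by
  classical
  have h0 : ∀ u : Graph D.L →₀ 𝕜, Finsupp.linearCombination 𝕜
      (fun H : Graph D.L => CSpace.mk 𝕜 (glueGraphs D.G H)) u =
        gl 𝕜 D.L (BSpace.mk 𝕜 (freeDiag D.G)) (graphClass 𝕜 id u) := by
    intro u
    induction u using Finsupp.induction_linear with
    | zero => simp
    | add u v hu hv => simp only [map_add, hu, hv]
    | single H r =>
      rw [Finsupp.linearCombination_single, graphClass_single, map_smul, mk_glueGraphs]
  rw [jDiag, h0, graphClass_relabel, graphClass_unionSum]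
  refine congrArg _ ?_
  have h1 : ∀ x : X, graphClass 𝕜 (fun e : {l // D.color l = x} =>
      (id ∘ Equiv.sigmaFiberEquiv D.color) ⟨x, e⟩)
        (forestSum 𝕜 m {l // D.color l = x} (fun l => D.pos l.1)
          (D.pos_inj.comp Subtype.val_injective)) =
      (m.factorial : 𝕜)⁻¹ • ∑ f : {l // D.color l = x} → Fin m,
        ∏ b, blockTree 𝕜 (fun l => (D.pos l : ℤ)) (({l | f l = b} : Finset _).map
          (Function.Embedding.subtype _)) := fun x =>
    graphClass_forestSum (𝕜 := 𝕜) m (fun l : {l // D.color l = x} => D.pos l.1)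
      (D.pos_inj.comp Subtype.val_injective) (Function.Embedding.subtype _)
      (fun l => (D.pos l : ℤ)) (fun _ => rfl)
  have h2 : (∏ x, graphClass 𝕜 (fun e : {l // D.color l = x} =>
      (id ∘ Equiv.sigmaFiberEquiv D.color) ⟨x, e⟩)
        (forestSum 𝕜 m {l // D.color l = x} (fun l => D.pos l.1)
          (D.pos_inj.comp Subtype.val_injective))) =
      strandForest 𝕜 m D.color fun l => (D.pos l : ℤ) := by
    rw [Finset.prod_congr rfl fun x _ => h1 x, Finset.prod_smul, Finset.prod_const,
      Finset.card_univ, strandForest, Finset.prod_univ_sum]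
    refine congrArg _ ?_
    symm
    -- A choice of blocks on each strand separately is the same as one map on the set of all legs;
    -- the factors are then indexed by pairs of a strand and a block.
    refine Finset.sum_bij (fun F _ => fun x l => F l.1) (by simp) ?_ ?_ ?_
    · intro F _ F' _ h
      funext l
      exact congrFun (congrFun h (D.color l)) ⟨l, rfl⟩
    · intro f _
      refine ⟨fun l => f (D.color l) ⟨l, rfl⟩, Finset.mem_univ _, ?_⟩
      funext x l
      obtain ⟨l, rfl⟩ := l
      rfl
    · intro F _
      rw [forest_def, Fintype.prod_prod_type]
      refine Finset.prod_congr rfl fun x _ => Finset.prod_congr rfl fun b _ => ?_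
      congr 1
      ext l
      simp [Prod.ext_iff, and_comm]
  rw [← h2]

end

end Jacobi

namespace Jacobi

noncomputable section

variable {𝕜 : Type*} [Field 𝕜] {X Y Z : Type}

/-! ### The map `j_m` is well defined -/

section Forest

variable {S L L' : Type} [Fintype S] [Fintype L] [Fintype L']

lemma forest_congr {pos pos' : L → ℤ} {g : L → S}
    (h : ∀ x y, g x = g y → (pos x < pos y ↔ pos' x < pos' y)) :
    forest 𝕜 pos g = forest 𝕜 pos' g := by
  classical
  rw [forest_def, forest_def]
  refine Finset.prod_congr rfl fun s _ => blockTree_congr fun x hx y hy => h x y ?_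
  rw [(Finset.mem_filter.1 hx).2, (Finset.mem_filter.1 hy).2]

lemma map_forest (f : L ≃ L') (pos : L → ℤ) (g : L → S) :
    BSpace.map 𝕜 f (forest 𝕜 pos g) = forest 𝕜 (pos ∘ f.symm) (g ∘ f.symm) := by
  classical
  rw [forest_def, forest_def, map_prod]
  refine Finset.prod_congr rfl fun s _ => ?_
  have h := map_blockTree (𝕜 := 𝕜) f.toEmbedding (pos ∘ f.symm) {l | g l = s}
  have e : (pos ∘ f.symm) ∘ f.toEmbedding = pos := by funext l; simp
  rw [e] at h
  refine h.trans (congrArg _ ?_)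
  ext l
  simp [Finset.mem_map_equiv]

variable [Fintype X]

lemma strandForest_def [DecidableEq L] (m : ℕ) (color : L → X) (pos : L → ℤ) :
    strandForest 𝕜 m color pos = ((m.factorial : 𝕜)⁻¹) ^ Fintype.card X •
      ∑ F : L → Fin m, forest 𝕜 pos fun l => (color l, F l) := by
  rw [strandForest]
  congr!

lemma strandForest_congr {m : ℕ} {color : L → X} {pos pos' : L → ℤ}
    (h : ∀ x y, color x = color y → (pos x < pos y ↔ pos' x < pos' y)) :
    strandForest 𝕜 m color pos = strandForest 𝕜 m color pos' := by
  classical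
  rw [strandForest_def, strandForest_def]
  refine congrArg _ (Finset.sum_congr rfl fun F _ => forest_congr fun x y hxy => h x y ?_)
  exact congrArg Prod.fst hxy

lemma map_strandForest (f : L ≃ L') (m : ℕ) (color : L → X) (pos : L → ℤ) :
    BSpace.map 𝕜 f (strandForest 𝕜 m color pos) =
      strandForest 𝕜 m (color ∘ f.symm) (pos ∘ f.symm) := by
  classical
  rw [strandForest_def, strandForest_def, map_smul, map_sum]
  refine congrArg _ (Fintype.sum_equiv (f.arrowCongr (Equiv.refl _)) _ _ fun F => ?_)
  rw [map_forest]
  rfl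

end Forest

lemma jDiag_iso [Fintype X] (m : ℕ) (D D' : ADiag X) (φ : Graph.Iso D.G D'.G)
    (hc : ∀ l, D'.color (φ.ext l) = D.color l)
    (hp : ∀ l l', D.color l = D.color l' →
        (D'.pos (φ.ext l) < D'.pos (φ.ext l') ↔ D.pos l < D.pos l')) :
    jDiag 𝕜 m D = (φ.sign : 𝕜) • jDiag 𝕜 m D' := by
  rw [jDiag_eq, jDiag_eq, ← gl_map φ.ext.injective, BSpace.map_mk, map_strandForest]
  have h1 := BSpace.mk_iso 𝕜 ((freeDiag D.G).recolor φ.ext) (freeDiag D'.G) φ (fun _ => rfl)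
  have h2 : D.color ∘ φ.ext.symm = D'.color := by
    funext l
    rw [Function.comp_apply, ← hc, Equiv.apply_symm_apply]
  rw [h1, h2, map_smul, LinearMap.smul_apply, strandForest_congr]
  intro x y hxy
  have := hp (φ.ext.symm x) (φ.ext.symm y) (by
    rw [← hc, ← hc, Equiv.apply_symm_apply, Equiv.apply_symm_apply, hxy])
  rw [Equiv.apply_symm_apply, Equiv.apply_symm_apply] at this
  simp only [Function.comp_apply, Nat.cast_lt]
  exact this.symm

/-- The three diagrams are paired with the same forests, so the relation is inherited from marked
diagrams. -/
lemma jDiag_ihx [Fintype X] (m : ℕ) (D : ADiag X) (u v : D.G.V) (h : D.G.IsIHX u v) :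
    jDiag 𝕜 m D + jDiag 𝕜 m { D with G := D.G.conj (Graph.ihxPerm D.L u v) }
      + jDiag 𝕜 m { D with G := D.G.conj (Graph.ihxPerm D.L u v ^ 2) } = 0 := by
  rw [jDiag_eq, jDiag_eq, jDiag_eq, ← LinearMap.add_apply, ← LinearMap.add_apply, ← map_add,
    ← map_add]
  have := BSpace.mk_ihx 𝕜 (freeDiag D.G) u v h
  exact (congrArg (fun M => gl 𝕜 D.L M
    (strandForest 𝕜 m D.color fun l => (D.pos l : ℤ))) this).trans (by simp)

/-! ### The STU relation -/

section Exchange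

variable {S L : Type} [DecidableEq L] {pos : L → ℤ} {p q : L}

/-- A block that does not contain both legs cannot compare them, and if it contains one of them it
has no leg of intermediate height. -/
lemma blockTree_comp_swap (hpos : Function.Injective pos) {B : Finset L}
    (hpq : pos p < pos q) (hB : ¬ (p ∈ B ∧ q ∈ B))
    (hcons : (p ∈ B ∨ q ∈ B) → ∀ x ∈ B, ¬ (pos p < pos x ∧ pos x < pos q)) :
    blockTree 𝕜 (pos ∘ Equiv.swap p q) B = blockTree 𝕜 pos B := by
  refine blockTree_congr fun x hx y hy => ?_
  simp only [Function.comp_apply, Equiv.swap_apply_def]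
  have i1 := fun h : pos x = pos p => hpos h
  have i2 := fun h : pos x = pos q => hpos h
  have i3 := fun h : pos y = pos p => hpos h
  have i4 := fun h : pos y = pos q => hpos h
  have h1 := fun h => hcons h x hx
  have h2 := fun h => hcons h y hy
  grind

lemma map_swap_blockTree (pos : L → ℤ) {B : Finset L} (hp : p ∉ B) (hq : q ∉ B) :
    BSpace.map 𝕜 (Equiv.swap p q) (blockTree 𝕜 pos B) = blockTree 𝕜 pos B := by
  have hB : ∀ x ∈ B, Equiv.swap p q x = x := fun x hx =>
    Equiv.swap_apply_of_ne_of_ne (by rintro rfl; exact hp hx) (by rintro rfl; exact hq hx)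
  have e : B.map (Equiv.swap p q).toEmbedding = B := by
    ext x
    rw [Finset.mem_map_equiv, Equiv.symm_swap, Equiv.swap_apply_def]
    split_ifs with h1 h2
    · subst h1; exact iff_of_false hq hp
    · subst h2; exact iff_of_false hp hq
    · rfl
  have h := map_blockTree (𝕜 := 𝕜) (Equiv.swap p q).toEmbedding pos B
  rw [e] at h
  refine (congrArg (BSpace.map 𝕜 (Equiv.swap p q)) ?_).trans h
  refine blockTree_congr fun x hx y hy => ?_
  simp [hB x hx, hB y hy]

/-- The exchange affects at most one factor, the block that contains both legs. The other factors do
not involve the marks `p` and `q` in that case, so their product is a legitimate `R` in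
`gl_blockTree_exchange`. -/
lemma gl_forest_exchange [CharZero 𝕜] [Fintype S] [Fintype L] [DecidableEq S] (hpos : Function.Injective pos) (g : L → S)
    (hpq : pos p < pos q)
    (hcons : ∀ x, g x = g p ∨ g x = g q → ¬ (pos p < pos x ∧ pos x < pos q)) (m : BSpace 𝕜 L) :
    gl 𝕜 L m (forest 𝕜 pos g) - gl 𝕜 L m (forest 𝕜 (pos ∘ Equiv.swap p q) g) =
      if g p = g q then gl 𝕜 L (joinOp 𝕜 p q m)
        (∏ s, blockTree 𝕜 pos (Finset.univ.filter (fun l => g l = s) \ {q})) else 0 := by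
  classical
  have hpq' : p ≠ q := by rintro rfl; exact lt_irrefl _ hpq
  have hne : ∀ s, ¬ (g p = s ∧ g q = s) →
      blockTree 𝕜 (pos ∘ Equiv.swap p q) {l | g l = s} = blockTree 𝕜 pos {l | g l = s} := by
    intro s hs
    refine blockTree_comp_swap hpos hpq (by simpa using hs) ?_
    intro h x hx
    simp only [Finset.mem_filter, Finset.mem_univ, true_and] at h hx
    exact hcons x (by rw [hx]; tauto)
  rw [forest_def, forest_def]
  split_ifs with hg
  · have e0 : ∀ f : S → BSpace 𝕜 L, ∏ s, f s = (∏ s ∈ Finset.univ.erase (g p), f s) * f (g p) :=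
      fun f => (Finset.prod_erase_mul _ _ (Finset.mem_univ _)).symm
    rw [e0, e0 fun s => blockTree 𝕜 (pos ∘ Equiv.swap p q) {l | g l = s},
      e0 fun s => blockTree 𝕜 pos (Finset.univ.filter (fun l => g l = s) \ {q})]
    have e1 : ∏ s ∈ Finset.univ.erase (g p),
        blockTree 𝕜 (pos ∘ Equiv.swap p q) {l | g l = s} =
          ∏ s ∈ Finset.univ.erase (g p), blockTree 𝕜 pos {l | g l = s} :=
      Finset.prod_congr rfl fun s hs => hne s fun h => (Finset.mem_erase.1 hs).1 h.1.symm
    have e2 : ∏ s ∈ Finset.univ.erase (g p), blockTree 𝕜 pos (Finset.univ.filter (fun l => g l = s) \ {q}) =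
          ∏ s ∈ Finset.univ.erase (g p), blockTree 𝕜 pos {l | g l = s} := by
      refine Finset.prod_congr rfl fun s hs => ?_
      rw [Finset.sdiff_singleton_eq_erase, Finset.erase_eq_of_notMem]
      simpa [← hg] using (Finset.mem_erase.1 hs).1.symm
    rw [e1, e2, Finset.sdiff_singleton_eq_erase]
    refine gl_blockTree_exchange hpos (by simp) (by simp [hg]) hpq
      (fun x hx => hcons x (Or.inl (by simpa using hx))) m _ ?_
    rw [map_prod]
    refine Finset.prod_congr rfl fun s hs => map_swap_blockTree pos ?_ ?_
    · simpa using (Finset.mem_erase.1 hs).1.symm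
    · simpa [← hg] using (Finset.mem_erase.1 hs).1.symm
  · rw [sub_eq_zero]
    refine congrArg _ (Finset.prod_congr rfl fun s _ => (hne s ?_).symm)
    rintro ⟨h1, h2⟩
    exact hg (h1.trans h2.symm)

end Exchange

/-- The difference is taken separately for each distribution of the legs to blocks. It vanishes if
`p` and `q` are separated, and is otherwise the contribution of the induced distribution to the
joined diagram. -/
lemma jDiag_stu [CharZero 𝕜] [Fintype X] (m : ℕ) (T : ADiag X) (p q : T.L) (hpq : p ≠ q)
    (h : T.Consecutive p q) (i : DecidableEq (Flag T.G.V T.L)) :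
    jDiag 𝕜 m (T.stu p q hpq) = jDiag 𝕜 m T -
      jDiag 𝕜 m { T with G := T.G.conj (Equiv.swap (Sum.inr p) (Sum.inr q)) } := by
  classical
  obtain ⟨hcol, hlt, hcons⟩ := h
  set pos : T.L → ℤ := fun l => (T.pos l : ℤ) with hpos
  have hinj : Function.Injective pos := Nat.cast_injective.comp T.pos_inj
  have hlt' : pos p < pos q := Nat.cast_lt.2 hlt
  set M := BSpace.mk 𝕜 (freeDiag T.G) with hM
  let _ : Fintype {l : T.L // l ≠ q} := (T.stu p q hpq).fintypeL
  have e1 : jDiag 𝕜 m T = gl 𝕜 T.L M (strandForest 𝕜 m T.color pos) := jDiag_eq m T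
  -- Reattaching the graph at exchanged legs amounts to exchanging the heights of these legs in the
  -- forest; the colours do not change since both legs lie on one strand.
  have e2 : jDiag 𝕜 m { T with G := T.G.conj (Equiv.swap (Sum.inr p) (Sum.inr q)) } =
      gl 𝕜 T.L M (strandForest 𝕜 m T.color (pos ∘ Equiv.swap p q)) := by
    rw [← gl_map (Equiv.injective (Equiv.swap p q)), map_strandForest]
    have c1 : T.color ∘ (Equiv.swap p q).symm = T.color := by
      funext l
      rw [Function.comp_apply, Equiv.symm_swap, Equiv.swap_apply_def]
      split_ifs with h1 h2
      exacts [h1 ▸ hcol.symm, h2 ▸ hcol, rfl]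
    have c2 : (pos ∘ Equiv.swap p q) ∘ (Equiv.swap p q).symm = pos := by
      funext l; simp
    rw [c1, c2, jDiag_eq]
    refine congrArg (fun x => gl 𝕜 T.L x (strandForest 𝕜 m T.color pos)) ?_
    rw [hM, BSpace.map_mk]
    symm
    refine BSpace.mk_equiv 𝕜 ((freeDiag T.G).recolor (Equiv.swap p q))
      (freeDiag (T.G.conj (Equiv.swap (Sum.inr p) (Sum.inr q)))) (Equiv.swap p q)
      (Equiv.refl _) ?_ (fun _ => rfl)
    have hs : ∀ a : Flag T.G.V T.L, Sum.map (Prod.map (Equiv.refl T.G.V) id) (Equiv.swap p q) a =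
        @Equiv.swap _ i (Sum.inr p) (Sum.inr q) a := by
      rintro (⟨v, k⟩ | l)
      · exact (Graph.swap_apply_of_ne i (by simp) (by simp)).symm
      · exact (Graph.swap_map _ i Sum.inr_injective p q l).symm
    intro a
    change @Equiv.swap _ i (Sum.inr p) (Sum.inr q) (T.G.edge
      ((@Equiv.swap _ i (Sum.inr p) (Sum.inr q)).symm
        (Sum.map (Prod.map (Equiv.refl T.G.V) id) (Equiv.swap p q) a))) =
      Sum.map (Prod.map (Equiv.refl T.G.V) id) (Equiv.swap p q) (T.G.edge a)
    rw [hs, hs, Equiv.symm_apply_apply]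
  -- The legs of the joined diagram keep their marks in `T.L`. Its graph is then the result of
  -- `joinOp`, and its blocks are sets of legs without `q`.
  have e3 : jDiag 𝕜 m (T.stu p q hpq) = ((m.factorial : 𝕜)⁻¹) ^ Fintype.card X •
      ∑ F : {l : T.L // l ≠ q} → Fin m, gl 𝕜 T.L (joinOp 𝕜 p q M)
        (∏ s : X × Fin m, blockTree 𝕜 pos (({l | (T.color l.1, F l) = s} :
          Finset {l : T.L // l ≠ q}).map (Function.Embedding.subtype _))) := by
    have e4 : jDiag 𝕜 m (T.stu p q hpq) =
        gl 𝕜 {l : T.L // l ≠ q} (BSpace.mk 𝕜 (freeDiag (T.G.join p q hpq)))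
          (strandForest 𝕜 m (fun l => T.color l.1) (fun l => pos l.1)) := jDiag_eq m _
    rw [e4, ← gl_map (Subtype.val_injective (p := fun l => l ≠ q)), BSpace.map_mk,
      strandForest_def, map_smul, map_smul, map_sum, map_sum]
    refine congrArg _ (Finset.sum_congr (by congr!) fun F _ => ?_)
    have j1 : joinOp 𝕜 p q M = BSpace.mk 𝕜 ((freeDiag T.G).join p q hpq) := by
      rw [hM, joinOp_mk]
      exact joinDiag_eq (D := freeDiag T.G) Function.injective_id p q hpq rfl rfl
    rw [j1]
    refine congrArg (gl 𝕜 T.L (BSpace.mk 𝕜 ((freeDiag T.G).join p q hpq))) ?_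
    rw [forest_def, map_prod]
    refine Finset.prod_congr rfl fun s _ => ?_
    exact map_blockTree (𝕜 := 𝕜) (Function.Embedding.subtype (fun l => l ≠ q)) pos _
  rw [e1, e2, e3, strandForest_def, strandForest_def, map_smul, map_smul, ← smul_sub, map_sum,
    map_sum, ← Finset.sum_sub_distrib]
  refine congrArg _ ?_
  rw [Finset.sum_congr rfl fun (F : T.L → Fin m) _ => gl_forest_exchange hinj (fun l => (T.color l, F l)) hlt'
    (fun x hx h' => hcons x (by
      rcases hx with hx | hx
      exacts [congrArg Prod.fst hx, (congrArg Prod.fst hx).trans hcol.symm])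
      ⟨Nat.cast_lt.1 h'.1, Nat.cast_lt.1 h'.2⟩) M]
  symm
  rw [← Finset.sum_filter]
  -- A distribution with `p` and `q` in one block is determined by its restriction to the legs other
  -- than `q`, and every distribution of these legs extends.
  refine Finset.sum_bij (fun F _ (l : {l : T.L // l ≠ q}) => F l.1)
    (fun _ _ => Finset.mem_univ _) ?_ ?_ ?_
  · intro F hF F' hF' he
    have h1 := (Finset.mem_filter.1 hF).2
    have h2 := (Finset.mem_filter.1 hF').2
    simp only [Prod.mk.injEq, hcol, true_and] at h1 h2
    funext l
    by_cases hl : l = q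
    · rw [hl, ← h1, ← h2]; exact congrFun he ⟨p, hpq⟩
    · exact congrFun he ⟨l, hl⟩
  · intro F _
    refine ⟨fun l => if hl : l = q then F ⟨p, hpq⟩ else F ⟨l, hl⟩, ?_, ?_⟩
    · simp [hcol, hpq]
    · funext l
      simp [l.2]
  · intro F _
    refine congrArg _ (Finset.prod_congr rfl fun s _ => congrArg _ ?_)
    ext l
    simp [and_comm]

lemma jDiag_rel [CharZero 𝕜] (X : Type) [Fintype X] (m : ℕ) (z : ADiag X →₀ 𝕜)
    (hz : ARel 𝕜 X z) : Finsupp.linearCombination 𝕜 (jDiag 𝕜 m) z = 0 := by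
  cases hz with
  | iso D D' φ hc hp =>
    rw [map_sub, Finsupp.linearCombination_single, Finsupp.linearCombination_single, one_smul,
      sub_eq_zero]
    exact jDiag_iso m D D' φ hc hp
  | ihx D u v h =>
    simp only [map_add, Finsupp.linearCombination_single, one_smul]
    exact jDiag_ihx m D u v h
  | stu T p q hpq h =>
    simp only [map_sub, Finsupp.linearCombination_single, one_smul]
    rw [sub_eq_zero]
    exact jDiag_stu m T p q hpq h _

/-- The Le–Murakami–Ohtsuki map `j_m : 𝓐(↑_X) → 𝓐°(∅)`, before completion. -/
def jMap (𝕜 : Type*) [Field 𝕜] [CharZero 𝕜] (X : Type) [Fintype X] (m : ℕ) :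
    ASpace 𝕜 X →ₗ[𝕜] CSpace 𝕜 :=
  Submodule.liftQ _ (Finsupp.linearCombination 𝕜 (jDiag 𝕜 m))
    (Submodule.span_le.2 (fun z hz => jDiag_rel X m z hz))

lemma jMap_mk [CharZero 𝕜] [Fintype X] (m : ℕ) (D : ADiag X) :
    jMap 𝕜 X m (ASpace.mk 𝕜 D) = jDiag 𝕜 m D := by
  simp [jMap, ASpace.mk]

end

end Jacobi

namespace Jacobi

noncomputable section

variable {𝕜 : Type*} [Field 𝕜] {X Y Z : Type}

/-! ### Degrees -/

/-- The span of the diagrams with `2k` more legs than trivalent vertices. -/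
def legSpan (𝕜 : Type*) [Field 𝕜] (Y : Type) (k : ℕ) : Submodule 𝕜 (BSpace 𝕜 Y) :=
  Submodule.span 𝕜 {z | ∃ H : BDiag Y,
    Fintype.card H.G.V + 2 * k = Fintype.card H.L ∧ BSpace.mk 𝕜 H = z}

lemma mk_mem_legSpan {k : ℕ} (H : BDiag Y)
    (h : Fintype.card H.G.V + 2 * k = Fintype.card H.L) : BSpace.mk 𝕜 H ∈ legSpan 𝕜 Y k :=
  Submodule.subset_span ⟨H, h, rfl⟩

lemma one_mem_legSpan : (1 : BSpace 𝕜 Y) ∈ legSpan 𝕜 Y 0 := by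
  rw [BSpace.one_def]
  refine mk_mem_legSpan _ ?_
  change Fintype.card Empty + 2 * 0 = Fintype.card Empty
  rfl

lemma mul_mem_legSpan {k l : ℕ} {a b : BSpace 𝕜 Y} (ha : a ∈ legSpan 𝕜 Y k)
    (hb : b ∈ legSpan 𝕜 Y l) : a * b ∈ legSpan 𝕜 Y (k + l) := by
  have h : ∀ H : BDiag Y, Fintype.card H.G.V + 2 * k = Fintype.card H.L →
      ∀ b ∈ legSpan 𝕜 Y l, BSpace.mk 𝕜 H * b ∈ legSpan 𝕜 Y (k + l) := by
    intro H hH b hb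
    induction hb using Submodule.span_induction with
    | mem x hx =>
      obtain ⟨H', hH', rfl⟩ := hx
      rw [BSpace.mk_mul_mk]
      refine mk_mem_legSpan _ ?_
      change Fintype.card (H.G.V ⊕ H'.G.V) + 2 * (k + l) = Fintype.card (H.L ⊕ H'.L)
      rw [Fintype.card_sum, Fintype.card_sum]
      omega
    | zero => rw [mul_zero]; exact Submodule.zero_mem _
    | add x y _ _ hx hy => rw [mul_add]; exact Submodule.add_mem _ hx hy
    | smul c x _ hx => rw [mul_smul_comm]; exact Submodule.smul_mem _ _ hx
  induction ha using Submodule.span_induction with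
  | mem x hx =>
    obtain ⟨H, hH, rfl⟩ := hx
    exact h H hH b hb
  | zero => rw [zero_mul]; exact Submodule.zero_mem _
  | add x y _ _ hx hy => rw [add_mul]; exact Submodule.add_mem _ hx hy
  | smul c x _ hx => rw [smul_mul_assoc]; exact Submodule.smul_mem _ _ hx

lemma prod_mem_legSpan {ι : Type} (s : Finset ι) (f : ι → BSpace 𝕜 Y)
    (h : ∀ i ∈ s, f i ∈ legSpan 𝕜 Y 1) : ∏ i ∈ s, f i ∈ legSpan 𝕜 Y s.card := by
  classical
  induction s using Finset.induction_on with
  | empty => exact one_mem_legSpan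
  | insert a s ha ih =>
    rw [Finset.prod_insert ha, Finset.card_insert_of_notMem ha, add_comm]
    exact mul_mem_legSpan (h a (Finset.mem_insert_self a s))
      (ih fun i hi => h i (Finset.mem_insert_of_mem hi))

lemma combWord_mem_legSpan (w : List Y) : combWord 𝕜 w ∈ legSpan 𝕜 Y 1 := by
  match w with
  | [] => exact Submodule.zero_mem _
  | [_] => exact Submodule.zero_mem _
  | a :: b :: w =>
    refine mk_mem_legSpan _ ?_
    change Fintype.card (Fin w.length) + 2 * 1 = Fintype.card (Fin (w.length + 2))
    rw [Fintype.card_fin, Fintype.card_fin]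

lemma blockTree_mem_legSpan (pos : Y → ℤ) (B : Finset Y) :
    blockTree 𝕜 pos B ∈ legSpan 𝕜 Y 1 :=
  Submodule.sum_mem _ fun w _ => Submodule.smul_mem _ _ (combWord_mem_legSpan w)

lemma forest_mem_legSpan {S L : Type} [Fintype S] [Fintype L] (pos : L → ℤ) (g : L → S) :
    forest 𝕜 pos g ∈ legSpan 𝕜 L (Fintype.card S) := by
  classical
  rw [forest_def]
  exact prod_mem_legSpan _ _ fun s _ => blockTree_mem_legSpan _ _

/-- By the pigeonhole principle some block has at most one leg, and $T_0=T_1=0$. -/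
lemma forest_eq_zero {S L : Type} [Fintype S] [Fintype L] (pos : L → ℤ) (g : L → S)
    (h : Fintype.card L < Fintype.card S * 2) : forest 𝕜 pos g = 0 := by
  classical
  obtain ⟨s, hs⟩ := Fintype.exists_card_fiber_lt_of_card_lt_mul g h
  rw [forest_def]
  exact Finset.prod_eq_zero (Finset.mem_univ s) (blockTree_of_card_le (by omega))

/-- The glued legs, equally many on both sides, cease to be vertices, and the second factor has $2k$
fewer trivalent vertices than legs; hence the number of vertices drops by $2k$. -/
lemma gl_mem_deg {k d : ℕ} (D : BDiag Y) {b : BSpace 𝕜 Y} (hb : b ∈ legSpan 𝕜 Y k)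
    (h : Fintype.card D.G.V + Fintype.card D.L = 2 * (d + k)) :
    gl 𝕜 Y (BSpace.mk 𝕜 D) b ∈ CDeg 𝕜 d := by
  classical
  induction hb using Submodule.span_induction with
  | mem x hx =>
    obtain ⟨H, hH, rfl⟩ := hx
    rw [gl_mk, glDiag]
    split_ifs
    · refine Submodule.sum_mem _ fun f _ => Submodule.subset_span ⟨_, ?_, rfl⟩
      change Fintype.card (D.G.V ⊕ H.G.V) = 2 * d
      have := Fintype.card_congr f.1
      rw [Fintype.card_sum]
      omega
    · exact Submodule.zero_mem _
  | zero => rw [map_zero]; exact Submodule.zero_mem _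
  | add x y _ _ hx hy => rw [map_add]; exact Submodule.add_mem _ hx hy
  | smul c x _ hx => rw [map_smul]; exact Submodule.smul_mem _ _ hx

lemma jMap_mem_deg [CharZero 𝕜] [Fintype X] (m d : ℕ) :
    ∀ a ∈ ADeg 𝕜 X (d + m * Fintype.card X), jMap 𝕜 X m a ∈ CDeg 𝕜 d := by
  classical
  have : ADeg 𝕜 X (d + m * Fintype.card X) ≤ (CDeg 𝕜 d).comap (jMap 𝕜 X m) := by
    refine Submodule.span_le.2 ?_
    rintro _ ⟨D, hD, rfl⟩
    change jMap 𝕜 X m (ASpace.mk 𝕜 D) ∈ CDeg 𝕜 d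
    rw [jMap_mk, jDiag_eq, strandForest_def, map_smul, map_sum]
    refine Submodule.smul_mem _ _ (Submodule.sum_mem _ fun F _ =>
      gl_mem_deg _ (forest_mem_legSpan _ _) ?_)
    rw [Fintype.card_prod, Fintype.card_fin, mul_comm (Fintype.card X)]
    exact hD
  exact this

lemma jMap_eq_zero [CharZero 𝕜] [Fintype X] {m d : ℕ} (hd : d < m * Fintype.card X) :
    ∀ a ∈ ADeg 𝕜 X d, jMap 𝕜 X m a = 0 := by
  classical
  have : ADeg 𝕜 X d ≤ LinearMap.ker (jMap 𝕜 X m) := by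
    refine Submodule.span_le.2 ?_
    rintro _ ⟨D, hD, rfl⟩
    change jMap 𝕜 X m (ASpace.mk 𝕜 D) = 0
    rw [jMap_mk, jDiag_eq, strandForest_def, Finset.sum_eq_zero, smul_zero, map_zero]
    intro F _
    refine forest_eq_zero _ _ ?_
    rw [Fintype.card_prod, Fintype.card_fin, mul_comm (Fintype.card X)]
    omega
  exact this

end

end Jacobi

namespace Jacobi

noncomputable section

variable {𝕜 : Type*} [Field 𝕜] {X Y Z : Type}

/-! ### The composition of `j_m` with the symmetrization map -/

/-- The order of the heights is irrelevant because a strut equals its reflection. -/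
lemma blockTree_pair {L : Type} [DecidableEq L] {pos : L → ℤ} (hpos : Function.Injective pos) {p q : L}
    (hpq : p ≠ q) : blockTree 𝕜 pos {p, q} = combWord 𝕜 [p, q] := by
  have key : ∀ p q : L, p ≠ q → pos p ≤ pos q → blockTree 𝕜 pos {p, q} = combWord 𝕜 [p, q] := by
    intro p q hpq hle
    rw [blockTree_eq hpos (a := p) (b := q) (by simp) (by simp) hpq (by simpa using hle)
      (by simpa using hle)]
    have : (({p, q} : Finset L).erase q).erase p = ∅ := by
      ext x; simp only [Finset.mem_erase, Finset.mem_insert, Finset.mem_singleton]; tauto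
    rw [this, words_empty]
    simp [descentsOf, not_lt.2 hle, treeCoeff]
  rcases le_total (pos p) (pos q) with h | h
  · exact key p q hpq h
  · rw [Finset.pair_comm, key q p hpq.symm h]
    have := combWord_rev (𝕜 := 𝕜) (w := [p, q]) (by simp)
    simpa using this

/-! ### Averages over all orders of the legs -/

section Average

variable {S L : Type} [Fintype L] [DecidableEq S] [DecidableEq L]

/-- After summation over all orders the coefficient of a comb on the large block is symmetric in the
letters of that block, but the comb changes its sign when its first two letters are exchanged. The
sum equals its own negative. -/
lemma sum_forest_eq_zero [CharZero 𝕜] [Fintype S] (g : L → S) {n : ℕ} (s : S)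
    (hs : 3 ≤ (Finset.univ.filter fun l => g l = s).card) :
    ∑ e : L ≃ Fin n, forest 𝕜 (fun l => ((e l : ℕ) : ℤ)) g = 0 := by
  set B := Finset.univ.filter fun l => g l = s with hB
  let P : (L ≃ Fin n) → L → ℤ := fun e l => ((e l : ℕ) : ℤ)
  let R : (L ≃ Fin n) → BSpace 𝕜 L := fun e =>
    ∏ t ∈ Finset.univ.erase s, blockTree 𝕜 (P e) {l | g l = t}
  let Φ : List L → BSpace 𝕜 L := fun w => ∑ e, treeWeight 𝕜 (P e) w • R e
  have h1 : ∑ e : L ≃ Fin n, forest 𝕜 (P e) g = ∑ w ∈ words B, Φ w * combWord 𝕜 w := by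
    have h : ∀ e, forest 𝕜 (P e) g = ∑ w ∈ words B, treeWeight 𝕜 (P e) w • R e * combWord 𝕜 w := by
      intro e
      rw [forest_def, ← Finset.prod_erase_mul _ _ (Finset.mem_univ s), blockTree, Finset.mul_sum]
      refine Finset.sum_congr rfl fun w _ => ?_
      rw [mul_smul_comm, smul_mul_assoc]
    simp only [h, Φ, Finset.sum_mul]
    exact Finset.sum_comm
  -- A transposition inside the block is absorbed by reindexing the orders; it fixes the legs of all
  -- other blocks, so their trees stay the same.
  have hΦ : ∀ a ∈ B, ∀ b ∈ B, ∀ w, Φ (w.map (Equiv.swap a b)) = Φ w := by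
    intro a ha b hb w
    have ha' := (Finset.mem_filter.1 ha).2
    have hb' := (Finset.mem_filter.1 hb).2
    refine Fintype.sum_equiv (Equiv.equivCongr (Equiv.swap a b) (Equiv.refl _)) _ _ fun e => ?_
    have e1 : P (Equiv.equivCongr (Equiv.swap a b) (Equiv.refl _) e) = P e ∘ Equiv.swap a b := by
      funext l
      simp [P, Equiv.equivCongr]
    rw [treeWeight_map, ← e1]
    refine congrArg _ (Finset.prod_congr rfl fun t ht => blockTree_congr fun x hx y hy => ?_)
    have hne : ∀ x, g x = t → Equiv.swap a b x = x := by
      rintro x rfl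
      have := (Finset.mem_erase.1 ht).1
      refine Equiv.swap_apply_of_ne_of_ne ?_ ?_ <;> rintro rfl
      exacts [this ha', this hb']
    rw [e1, Function.comp_apply, Function.comp_apply, hne x (Finset.mem_filter.1 hx).2,
      hne y (Finset.mem_filter.1 hy).2]
  have hw : ∀ w ∈ words B, ∃ a b c u, w = a :: b :: c :: u := by
    intro w hw
    have hl := length_of_mem_words hw
    match w with
    | [] | [_] | [_, _] => simp at hl; omega
    | a :: b :: c :: u => exact ⟨a, b, c, u, rfl⟩
  have h2 : ∑ w ∈ words B, Φ w * combWord 𝕜 w = - ∑ w ∈ words B, Φ w * combWord 𝕜 w := by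
    rw [← Finset.sum_neg_distrib]
    let tw : List L → List L := fun w =>
      match w with
      | a :: b :: u => b :: a :: u
      | u => u
    have htw : ∀ w ∈ words B, tw w ∈ words B := by
      intro w h
      obtain ⟨a, b, c, u, rfl⟩ := hw w h
      exact (perm_mem_words (List.Perm.swap b a _)).1 h
    have htt : ∀ w ∈ words B, tw (tw w) = w := by
      intro w h
      obtain ⟨a, b, c, u, rfl⟩ := hw w h
      rfl
    refine Finset.sum_bij' (fun w _ => tw w) (fun w _ => tw w) htw htw htt htt ?_
    intro w h
    obtain ⟨a, b, c, u, rfl⟩ := hw w h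
    have hn := nodup_of_mem_words h
    have hmap : (a :: b :: c :: u).map (Equiv.swap a b) = b :: a :: c :: u := by
      rw [List.map_cons, List.map_cons, Equiv.swap_apply_left, Equiv.swap_apply_right]
      congr 2
      refine (List.map_congr_left fun x hx => ?_).trans (List.map_id _)
      refine Equiv.swap_apply_of_ne_of_ne ?_ ?_ <;> rintro rfl <;> simp_all
    rw [combWord_swap a b (by simp), mul_neg]
    change - (Φ (a :: b :: c :: u) * _) = - (Φ (b :: a :: c :: u) * _)
    rw [← hmap, hΦ a ((mem_of_mem_words h).1 (by simp)) b ((mem_of_mem_words h).1 (by simp)), hmap]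
  rw [h1]
  have h3 : (2 : 𝕜) • ∑ w ∈ words B, Φ w * combWord 𝕜 w = 0 := by
    rw [two_smul]
    nth_rewrite 1 [h2]
    exact neg_add_cancel _
  exact (smul_eq_zero.1 h3).resolve_left two_ne_zero

lemma exists_pairing (g : L → S) (hg : ∀ s, (Finset.univ.filter fun l => g l = s).card = 2) :
    ∃ p : Pairing L, (∀ l, g (p.1 l) = g l) ∧
      ∀ l l', g l' = g l → l' = l ∨ l' = p.1 l := by
  have h : ∀ l, ∃ a, (Finset.univ.filter fun l' => g l' = g l).erase l = {a} := by
    intro l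
    rw [← Finset.card_eq_one, Finset.card_erase_of_mem (by simp), hg]
  choose p hp using h
  have h1 : ∀ l, p l ≠ l ∧ g (p l) = g l := by
    intro l
    have : p l ∈ (Finset.univ.filter fun l' => g l' = g l).erase l := by rw [hp]; simp
    simpa using this
  have h2 : ∀ l l', g l' = g l → l' = l ∨ l' = p l := by
    intro l l' h
    by_cases hl : l' = l
    · exact Or.inl hl
    · right
      have : l' ∈ (Finset.univ.filter fun l' => g l' = g l).erase l := by simp [hl, h]
      rwa [hp, Finset.mem_singleton] at this
  refine ⟨⟨p, fun l => ?_, fun l => (h1 l).1⟩, fun l => (h1 l).2, h2⟩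
  exact ((h2 (p l) l (h1 l).2.symm).resolve_left (h1 l).1.symm).symm

lemma fiber_eq_pair {g : L → S} (hg : ∀ s, (Finset.univ.filter fun l => g l = s).card = 2)
    (p : Pairing L) (hp : ∀ l, g (p.1 l) = g l) (l : L) :
    (Finset.univ.filter fun l' => g l' = g l) = {l, p.1 l} := by
  symm
  refine Finset.eq_of_subset_of_card_le ?_ ?_
  · intro x hx
    rw [Finset.mem_insert, Finset.mem_singleton] at hx
    rcases hx with rfl | rfl <;> simp [hp]
  · rw [hg, Finset.card_pair (p.2.2 l).symm]

/-- With two legs in every block the forest is a union of struts. The result does not depend on the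
heights. -/
lemma gl_forest_pairs [CharZero 𝕜] [Fintype S] (G : Graph L) {pos : L → ℤ} (hpos : Function.Injective pos)
    {g : L → S} (hg : ∀ s, (Finset.univ.filter fun l => g l = s).card = 2)
    (p : Pairing L) (hp : ∀ l, g (p.1 l) = g l) :
    gl 𝕜 L (BSpace.mk 𝕜 (freeDiag G)) (forest 𝕜 pos g) = CSpace.mk 𝕜 ⟨L, p, G⟩ := by
  have hr : ∀ s, ∃ l, g l = s := by
    intro s
    obtain ⟨l, hl⟩ := Finset.card_pos.1 (by rw [hg s]; omega :
      0 < (Finset.univ.filter fun l => g l = s).card)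
    exact ⟨l, (Finset.mem_filter.1 hl).2⟩
  choose r hr using hr
  let s0 : (Σ _ : S, Fin 2) → L := fun b => if b.2 = 0 then r b.1 else p.1 (r b.1)
  have hs0 : ∀ b, g (s0 b) = b.1 := by
    rintro ⟨b, i⟩
    dsimp only [s0]
    split_ifs
    exacts [hr b, (hp _).trans (hr b)]
  have hbij : Function.Bijective s0 := by
    constructor
    · rintro ⟨b, i⟩ ⟨b', i'⟩ h
      have hb : b = b' := by have := congrArg g h; rwa [hs0, hs0] at this
      subst hb
      have hn := p.2.2 (r b)
      dsimp only [s0] at h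
      have hi : i = i' := by
        split_ifs at h with h1 h2 h2
        exacts [h1.trans h2.symm, absurd h.symm hn, absurd h hn, by omega]
      rw [hi]
    · intro l
      have : l ∈ (Finset.univ.filter fun l' => g l' = g (r (g l))) := by simp [hr]
      rw [fiber_eq_pair hg p hp, Finset.mem_insert, Finset.mem_singleton] at this
      rcases this with h | h
      · exact ⟨⟨g l, 0⟩, by simp only [s0, if_true]; exact h.symm⟩
      · exact ⟨⟨g l, 1⟩, by simp only [s0, one_ne_zero, if_false]; exact h.symm⟩
  have key := gl_struts (𝕜 := 𝕜) (freeDiag G) Function.injective_id p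
    (Equiv.ofBijective s0 hbij) (fun b => by
      change p.1 (s0 ⟨b, 0⟩) = s0 ⟨b, 1⟩
      simp only [s0, if_true, one_ne_zero, if_false])
  refine Eq.trans ?_ key
  rw [forest_def]
  refine congrArg _ (Finset.prod_congr rfl fun b _ => ?_)
  have hf := fiber_eq_pair hg p hp (r b)
  rw [hr] at hf
  rw [hf, blockTree_pair hpos (p.2.2 _).symm]
  have := combWord_ofFn (𝕜 := 𝕜) (n := 0) (fun i : Fin 2 => s0 ⟨b, i⟩)
  simp only [List.ofFn_succ, List.ofFn_zero] at this
  exact this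

end Average

/-! ### Counting the distributions that belong to a pairing -/

/-- `F` numbers the pairs of `p` of every colour. -/
def IsNumbering {L : Type} (color : L → X) (p : Pairing L) {m : ℕ} (F : L → Fin m) : Prop :=
  (∀ x b, ∃ l, color l = x ∧ F l = b) ∧
    ∀ l l', color l = color l' → (F l = F l' ↔ l' = l ∨ l' = p.1 l)

/-- Two numberings of the same pairs differ by one permutation of `Fin m` for each colour, and this
permutation is unique because all numbers occur. -/
lemma card_numberings {L : Type} [Fintype X] {color : L → X} {m : ℕ} (p : Pairing L) (F₀ : L → Fin m)
    (h₀ : IsNumbering color p F₀) :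
    Nat.card {F : L → Fin m // IsNumbering color p F} = m.factorial ^ Fintype.card X := by
  classical
  let f : (X → Equiv.Perm (Fin m)) → {F : L → Fin m // IsNumbering color p F} := fun σ =>
    ⟨fun l => σ (color l) (F₀ l), by
      refine ⟨fun x b => ?_, fun l l' h => ?_⟩
      · obtain ⟨l, rfl, hl⟩ := h₀.1 x ((σ x).symm b)
        exact ⟨l, rfl, (congrArg _ hl).trans (Equiv.apply_symm_apply _ _)⟩
      · change σ (color l) (F₀ l) = σ (color l') (F₀ l') ↔ _
        rw [← h₀.2 l l' h, ← h, (σ _).apply_eq_iff_eq]⟩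
  have hf : Function.Bijective f := by
    constructor
    · intro σ τ h
      funext x
      ext b
      obtain ⟨l, rfl, rfl⟩ := h₀.1 x b
      exact congrArg Fin.val (congrFun (congrArg Subtype.val h) l)
    · rintro ⟨F, hF⟩
      choose r hr hr' using h₀.1
      have hinj : ∀ x, Function.Injective fun b => F (r x b) := by
        intro x b b' h
        have := (hF.2 (r x b) (r x b') ((hr x b).trans (hr x b').symm)).1 h
        have := (h₀.2 (r x b) (r x b') ((hr x b).trans (hr x b').symm)).2 this
        rwa [hr', hr'] at this
      refine ⟨fun x => Equiv.ofBijective _ (Finite.injective_iff_bijective.1 (hinj x)), ?_⟩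
      apply Subtype.ext
      funext l
      change F (r (color l) (F₀ l)) = F l
      have hcl := hr (color l) (F₀ l)
      exact (hF.2 _ _ hcl).2 ((h₀.2 _ _ hcl).1 (hr' _ _))
  rw [← Nat.card_congr (Equiv.ofBijective f hf), Nat.card_eq_fintype_card, Fintype.card_fun,
    Fintype.card_perm, Fintype.card_fin]

section Count

variable {L : Type} [Fintype L] [DecidableEq L] [DecidableEq X] {color : L → X}

/-- The sets `{l, p l}` divide the $2m$ legs of a colour into $m$ classes, which are enumerated
arbitrarily. -/
lemma exists_matching {m : ℕ} (hc : ∀ x, (Finset.univ.filter fun l => color l = x).card = 2 * m)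
    (p : Pairing L) (hp : ∀ l, color (p.1 l) = color l) :
    ∃ F : L → Fin m, (∀ x b, ∃ l, color l = x ∧ F l = b) ∧
      ∀ l l', color l = color l' → (F l = F l' ↔ l' = l ∨ l' = p.1 l) := by
  let u : L → Finset L := fun l => {l, p.1 l}
  have hu : ∀ l l', u l = u l' ↔ l' = l ∨ l' = p.1 l := by
    intro l l'
    constructor
    · intro h
      have : l' ∈ u l := by rw [h]; simp [u]
      simpa [u] using this
    · rintro (rfl | rfl)
      · rfl
      · simp only [u, p.2.1]; exact Finset.pair_comm _ _
  let I : X → Finset (Finset L) := fun x => (Finset.univ.filter fun l => color l = x).image u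
  have hI : ∀ x, (I x).card = m := by
    intro x
    have h1 := Finset.card_eq_sum_card_image u (Finset.univ.filter fun l => color l = x)
    rw [hc x, Finset.sum_const_nat (m := 2)] at h1
    · change _ = (I x).card * 2 at h1
      omega
    · intro y hy
      obtain ⟨l, hl, rfl⟩ := Finset.mem_image.1 hy
      have hl' := (Finset.mem_filter.1 hl).2
      have : ((Finset.univ.filter fun l => color l = x).filter fun l' => u l' = u l) =
          {l, p.1 l} := by
        ext l'
        simp only [Finset.mem_filter, Finset.mem_univ, true_and, Finset.mem_insert,
          Finset.mem_singleton]
        rw [eq_comm (a := u l'), hu]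
        constructor
        · exact fun h => h.2
        · intro h
          refine ⟨?_, h⟩
          rcases h with rfl | rfl
          exacts [hl', (hp l).trans hl']
      rw [this, Finset.card_pair (p.2.2 l).symm]
  let E : ∀ x, I x ≃ Fin m := fun x => Finset.equivFinOfCardEq (hI x)
  have hmem : ∀ l, u l ∈ I (color l) := fun l => Finset.mem_image_of_mem u (by simp)
  refine ⟨fun l => E (color l) ⟨u l, hmem l⟩, ?_, ?_⟩
  · intro x b
    obtain ⟨l, hl, hul⟩ := Finset.mem_image.1 ((E x).symm b).2
    obtain rfl := (Finset.mem_filter.1 hl).2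
    refine ⟨l, rfl, ?_⟩
    rw [← Equiv.eq_symm_apply]
    exact Subtype.ext hul
  · intro l l' h
    rw [← hu]
    have : ∀ x x' (hx : x = x') (hl : u l ∈ I x) (hl' : u l' ∈ I x'),
        E x ⟨u l, hl⟩ = E x' ⟨u l', hl'⟩ ↔ u l = u l' := by
      rintro x _ rfl hl hl'
      rw [(E x).apply_eq_iff_eq, Subtype.mk.injEq]
    exact this _ _ h _ _

lemma isNumbering_iff {m : ℕ} (p : Pairing L) (hp : ∀ l, color (p.1 l) = color l) (F : L → Fin m) :
    IsNumbering color p F ↔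
      (∀ s : X × Fin m, (Finset.univ.filter fun l => (color l, F l) = s).card = 2) ∧
        ∀ l, F (p.1 l) = F l := by
  constructor
  · rintro ⟨h1, h2⟩
    have h3 : ∀ l, F (p.1 l) = F l := fun l => ((h2 l (p.1 l) (hp l).symm).2 (Or.inr rfl)).symm
    refine ⟨?_, h3⟩
    rintro ⟨x, b⟩
    obtain ⟨l, rfl, rfl⟩ := h1 x b
    have : (Finset.univ.filter fun l' => (color l', F l') = (color l, F l)) = {l, p.1 l} := by
      ext l'
      simp only [Finset.mem_filter, Finset.mem_univ, true_and, Finset.mem_insert,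
        Finset.mem_singleton, Prod.mk.injEq]
      constructor
      · exact fun h => (h2 l l' h.1.symm).1 h.2.symm
      · rintro (rfl | rfl)
        exacts [⟨rfl, rfl⟩, ⟨hp l, h3 l⟩]
    rw [this, Finset.card_pair (p.2.2 l).symm]
  · rintro ⟨h1, h2⟩
    have hg : ∀ l, (fun l => (color l, F l)) (p.1 l) = (fun l => (color l, F l)) l := fun l =>
      Prod.ext (hp l) (h2 l)
    refine ⟨fun x b => ?_, fun l l' h => ?_⟩
    · obtain ⟨l, hl⟩ := Finset.card_pos.1 (by rw [h1 (x, b)]; omega :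
        0 < (Finset.univ.filter fun l => (color l, F l) = (x, b)).card)
      have := (Finset.mem_filter.1 hl).2
      exact ⟨l, congrArg Prod.fst this, congrArg Prod.snd this⟩
    · have hf := fiber_eq_pair (g := fun l => (color l, F l)) h1 p hg l
      have : l' ∈ (Finset.univ.filter fun l' => (color l', F l') = (color l, F l)) ↔
          l' ∈ ({l, p.1 l} : Finset L) := by rw [← hf]
      simp only [Finset.mem_filter, Finset.mem_univ, true_and, Finset.mem_insert,
        Finset.mem_singleton, Prod.mk.injEq, h, eq_comm (a := F l')] at this
      exact this

end Count

/-- If every block has two legs, all orders give the same closed diagram and exactly one pairing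
respects the blocks. Otherwise some block is too small, so that each term vanishes, or has at least
three legs, so that the sum vanishes. -/
lemma sum_gl_forest [CharZero 𝕜] {S L : Type} [Fintype S] [Fintype L] [DecidableEq S]
    [DecidableEq L] (G : Graph L) (g : L → S) {n : ℕ} (hn : Fintype.card L = n)
    [DecidablePred fun p : Pairing L => ∀ l, g (p.1 l) = g l] [Fintype (Pairing L)] :
    ∑ e : L ≃ Fin n, gl 𝕜 L (BSpace.mk 𝕜 (freeDiag G)) (forest 𝕜 (fun l => ((e l : ℕ) : ℤ)) g) =
      (n.factorial : 𝕜) • if ∀ s, (Finset.univ.filter fun l => g l = s).card = 2 then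
        ∑ p : Pairing L, if ∀ l, g (p.1 l) = g l then CSpace.mk 𝕜 ⟨L, p, G⟩ else 0 else 0 := by
  split_ifs with hg
  · obtain ⟨p, hp, hu⟩ := exists_pairing g hg
    have h1 : ∀ e : L ≃ Fin n, Function.Injective fun l => ((e l : ℕ) : ℤ) := fun e =>
      Nat.cast_injective.comp (Fin.val_injective.comp e.injective)
    rw [Finset.sum_congr rfl fun e _ => gl_forest_pairs G (h1 e) hg p hp, Finset.sum_const,
      Finset.card_univ, Fintype.card_equiv (Fintype.equivFinOfCardEq hn), hn,
      ← Nat.cast_smul_eq_nsmul 𝕜]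
    refine congrArg _ ?_
    rw [Finset.sum_eq_single p, if_pos hp]
    · intro p' _ hne
      refine if_neg fun hp' => hne ?_
      apply Subtype.ext
      funext l
      exact (hu l _ (hp' l)).resolve_left (p'.2.2 l)
    · exact fun h => absurd (Finset.mem_univ p) h
  · rw [smul_zero, ← map_sum]
    push Not at hg
    obtain ⟨s, hs⟩ := hg
    by_cases h : 3 ≤ (Finset.univ.filter fun l => g l = s).card
    · rw [sum_forest_eq_zero g s h, map_zero]
    · rw [Finset.sum_eq_zero, map_zero]
      intro e _
      rw [forest_def]
      exact Finset.prod_eq_zero (Finset.mem_univ s) (blockTree_of_card_le (by omega))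

/-- The map `j_m` takes the symmetrization of a diagram to the sum over all gluings of its legs
in pairs. -/
theorem jMap_chiDiag [CharZero 𝕜] [Fintype X] (m : ℕ) (D : BDiag X) :
    jMap 𝕜 X m (chiDiag 𝕜 D) = intDiag 𝕜 m D := by
  classical
  have hm : (m.factorial : 𝕜) ≠ 0 := Nat.cast_ne_zero.2 m.factorial_ne_zero
  have hn : ((Fintype.card D.L).factorial : 𝕜) ≠ 0 := Nat.cast_ne_zero.2 (Nat.factorial_ne_zero _)
  have h1 : ∀ e : D.L ≃ Fin (Fintype.card D.L), jMap 𝕜 X m (ASpace.mk 𝕜 (D.place e)) =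
      ((m.factorial : 𝕜)⁻¹) ^ Fintype.card X • ∑ F : D.L → Fin m,
        gl 𝕜 D.L (BSpace.mk 𝕜 (freeDiag D.G))
          (forest 𝕜 (fun l => ((e l : ℕ) : ℤ)) fun l => (D.color l, F l)) := by
    intro e
    rw [jMap_mk, jDiag_eq, strandForest_def, map_smul, map_sum]
    rfl
  rw [chiDiag, map_smul, map_sum, Finset.sum_congr (by congr!) fun e _ => h1 e, ← Finset.smul_sum,
    Finset.sum_comm, Finset.sum_congr rfl fun F _ =>
      sum_gl_forest D.G (fun l => (D.color l, F l)) rfl, ← Finset.smul_sum, smul_comm, inv_smul_smul₀ hn]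
  -- A distribution into blocks of two is reinterpreted as a pairing together with a numbering of
  -- its pairs, in order to sum over the pairings first.
  have h2 : ∀ F : D.L → Fin m, (if ∀ s : X × Fin m,
      (Finset.univ.filter fun l => (D.color l, F l) = s).card = 2 then
        ∑ p : Pairing D.L, if ∀ l, (fun l => (D.color l, F l)) (p.1 l) =
          (fun l => (D.color l, F l)) l then CSpace.mk 𝕜 ⟨D.L, p, D.G⟩ else 0 else 0) =
      ∑ p : {p : Pairing D.L // ∀ l, D.color (p.1 l) = D.color l},
        if IsNumbering D.color p.1 F then CSpace.mk 𝕜 (D.close p.1) else 0 := by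
    intro F
    have h3 : ∑ p : {p : Pairing D.L // ∀ l, D.color (p.1 l) = D.color l},
        (if IsNumbering D.color p.1 F then CSpace.mk 𝕜 (D.close p.1) else 0) =
        ∑ p : Pairing D.L, if ∀ l, D.color (p.1 l) = D.color l then
          if IsNumbering D.color p F then CSpace.mk 𝕜 (D.close p) else 0 else 0 := by
      refine Eq.trans ?_ (Finset.sum_filter _ _)
      exact (Finset.sum_subtype (p := fun p : Pairing D.L => ∀ l, D.color (p.1 l) = D.color l)
        (Finset.univ.filter fun p : Pairing D.L => ∀ l, D.color (p.1 l) = D.color l)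
        (fun p => by rw [Finset.mem_filter]; simp only [Finset.mem_univ, true_and])
        fun p => if IsNumbering D.color p F then CSpace.mk 𝕜 (D.close p) else 0).symm
    rw [h3]
    split_ifs with hg
    · refine Finset.sum_congr rfl fun p _ => ?_
      by_cases hp : ∀ l, D.color (p.1 l) = D.color l
      · rw [if_pos hp]
        refine if_congr ?_ rfl rfl
        rw [isNumbering_iff p hp]
        simp only [Prod.mk.injEq, hp, true_and]
        exact ⟨fun h => ⟨hg, h⟩, fun h => h.2⟩
      · rw [if_neg hp, if_neg fun h => hp fun l => congrArg Prod.fst (h l)]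
    · symm
      refine Finset.sum_eq_zero fun p _ => ?_
      by_cases hp : ∀ l, D.color (p.1 l) = D.color l
      · rw [if_pos hp, if_neg fun h => hg ((isNumbering_iff p hp F).1 h).1]
      · rw [if_neg hp]
  rw [Finset.sum_congr rfl fun F _ => h2 F, Finset.sum_comm]
  by_cases hc : ∀ x, (Finset.univ.filter fun l => D.color l = x).card = 2 * m
  · rw [intDiag, if_pos (fun x => by rw [← hc x, Fintype.card_subtype]), Finset.smul_sum]
    refine Finset.sum_congr (by congr!) fun p _ => ?_
    obtain ⟨F₀, h₀⟩ := exists_matching hc p.1 p.2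
    -- Each pairing is counted $(m!)^{|X|}$ times, which is exactly the normalization of the
    -- unordered blocks.
    have hcard := card_numberings p.1 F₀ h₀
    rw [Nat.card_eq_fintype_card, Fintype.card_subtype] at hcard
    rw [← Finset.sum_filter, Finset.sum_const, hcard, ← Nat.cast_smul_eq_nsmul 𝕜, smul_smul,
      Nat.cast_pow, ← mul_pow, inv_mul_cancel₀ hm, one_pow, one_smul]
  · rw [intDiag, if_neg (fun h => hc fun x => by rw [← h x, Fintype.card_subtype])]
    rw [Finset.sum_eq_zero, smul_zero]
    -- A numbering splits the legs of each colour into $m$ pairs, so there is none if some colour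
    -- does not have $2m$ legs.
    intro p _
    refine Finset.sum_eq_zero fun F _ => if_neg fun h => hc fun x => ?_
    have hF := ((isNumbering_iff p.1 p.2 F).1 h).1
    rw [Finset.card_eq_sum_card_fiberwise (f := F) (t := Finset.univ) (by simp),
      Finset.sum_const_nat (m := 2)]
    · simp [mul_comm]
    · intro b _
      rw [← hF (x, b), Finset.filter_filter]
      simp only [Prod.mk.injEq]

end

end Jacobi

namespace Jacobi

noncomputable section

variable {𝕜 : Type*} [Field 𝕜] {X Y Z : Type}

/-! ### The symmetrization map is surjective -/

lemma ASpace.mk_stu (𝕜 : Type*) [Field 𝕜] {X : Type} (T : ADiag X) (p q : T.L) (hpq : p ≠ q)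
    (h : T.Consecutive p q) (i : DecidableEq (Flag T.G.V T.L)) :
    ASpace.mk 𝕜 (T.stu p q hpq) = ASpace.mk 𝕜 T -
      ASpace.mk 𝕜 { T with G := T.G.conj (Equiv.swap (Sum.inr p) (Sum.inr q)) } := by
  have h := (Submodule.Quotient.mk_eq_zero (Submodule.span 𝕜 {z | ARel 𝕜 X z})).2
    (Submodule.subset_span (ARel.stu (𝕜 := 𝕜) T p q hpq h))
  rw [Submodule.Quotient.mk_sub, sub_eq_zero, Submodule.Quotient.mk_sub] at h
  exact h.trans (congrArg (fun j : DecidableEq (Flag T.G.V T.L) => ASpace.mk 𝕜 T -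
    ASpace.mk 𝕜 { T with G := T.G.conj (@Equiv.swap _ j (Sum.inr p) (Sum.inr q)) })
    (Subsingleton.elim _ i))

lemma ASpace.mk_equiv (𝕜 : Type*) [Field 𝕜] {X : Type} (D D' : ADiag X)
    (ext : D.L ≃ D'.L) (vtx : D.G.V ≃ D'.G.V)
    (h : ∀ a, D'.G.edge (Sum.map (Prod.map vtx id) ext a) =
      Sum.map (Prod.map vtx id) ext (D.G.edge a))
    (hc : ∀ l, D'.color (ext l) = D.color l)
    (hp : ∀ l l', D.color l = D.color l' →
        (D'.pos (ext l) < D'.pos (ext l') ↔ D.pos l < D.pos l')) :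
    ASpace.mk 𝕜 D = ASpace.mk 𝕜 D' := by
  rw [ASpace.mk_iso 𝕜 D D' (Graph.Iso.ofEquiv ext vtx h) hc hp]
  have hs : (Graph.Iso.ofEquiv ext vtx h).sign = 1 := Finset.prod_eq_one fun v _ => by
    change ((Equiv.Perm.sign (1 : Equiv.Perm (Fin 3)) : ℤˣ) : ℤ) = 1
    simp
  rw [hs, Int.cast_one, one_smul]

lemma BDiag.mk_place_of_lt_iff (D : BDiag X) {n : ℕ} (e : D.L ≃ Fin n) (T : ADiag X)
    (ext : D.L ≃ T.L) (vtx : D.G.V ≃ T.G.V)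
    (h : ∀ a, T.G.edge (Sum.map (Prod.map vtx id) ext a) =
      Sum.map (Prod.map vtx id) ext (D.G.edge a))
    (hc : ∀ l, T.color (ext l) = D.color l)
    (hp : ∀ l l', D.color l = D.color l' →
        (T.pos (ext l) < T.pos (ext l') ↔ e l < e l')) :
    ASpace.mk 𝕜 (D.place e) = ASpace.mk 𝕜 T :=
  ASpace.mk_equiv 𝕜 (D.place e) T ext vtx h hc hp

/-- Modulo diagrams with fewer legs, the order of the legs on the strands does not matter. -/
lemma mk_place_sub_mem (N : Submodule 𝕜 (ASpace 𝕜 X)) (D : BDiag X) {n : ℕ}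
    (hN : ∀ (e : D.L ≃ Fin n) (p q : D.L) (hpq : p ≠ q),
      ASpace.mk 𝕜 ((D.place e).stu p q hpq) ∈ N) (e e' : D.L ≃ Fin n) :
    ASpace.mk 𝕜 (D.place e) - ASpace.mk 𝕜 (D.place e') ∈ N := by
  classical
  obtain ⟨σ, rfl⟩ : ∃ σ : Equiv.Perm (Fin n), e' = e.trans σ :=
    ⟨e.symm.trans e', by ext; simp⟩
  match n with
  | 0 =>
    have : σ = 1 := Subsingleton.elim _ _
    rw [this]
    change ASpace.mk 𝕜 (D.place e) - ASpace.mk 𝕜 (D.place e) ∈ N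
    rw [sub_self]
    exact N.zero_mem
  | n + 1 =>
  -- Adjacent transpositions generate, so it is enough to exchange two legs of consecutive numbers.
  have hσ : σ ∈ Submonoid.closure (Set.range fun i : Fin n => Equiv.swap i.castSucc i.succ) := by
    rw [Equiv.Perm.mclosure_swap_castSucc_succ]
    exact Submonoid.mem_top σ
  induction hσ using Submonoid.closure_induction generalizing e with
  | one =>
    change ASpace.mk 𝕜 (D.place e) - ASpace.mk 𝕜 (D.place e) ∈ N
    rw [sub_self]
    exact N.zero_mem
  | mul x y _ _ hx hy =>
    have h := N.add_mem (hy e) (hx (e.trans y))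
    rwa [sub_add_sub_cancel] at h
  | mem x hx =>
    obtain ⟨i, rfl⟩ := hx
    set p := e.symm i.castSucc with hp
    set q := e.symm i.succ with hq
    have ep : e p = i.castSucc := Equiv.apply_symm_apply _ _
    have eq : e q = i.succ := Equiv.apply_symm_apply _ _
    have hpq : p ≠ q := fun h => by
      have := congrArg e h
      rw [ep, eq] at this
      exact absurd this (Fin.castSucc_lt_succ (i := i)).ne
    have hval : ∀ l, e l ≠ i.castSucc → e l ≠ i.succ →
        Equiv.swap i.castSucc i.succ (e l) = e l := fun l h h' =>
      Equiv.swap_apply_of_ne_of_ne h h'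
    -- On a common strand the two legs are consecutive, and by STU the two placements differ by a
    -- joined diagram, which lies in `N`.
    by_cases hcol : D.color p = D.color q
    · have hcons : (D.place e).Consecutive p q := by
        refine ⟨hcol, ?_, ?_⟩
        · change (e p : ℕ) < (e q : ℕ)
          rw [ep, eq]
          simp
        · rintro r - ⟨h1, h2⟩
          change (e p : ℕ) < (e r : ℕ) at h1
          change (e r : ℕ) < (e q : ℕ) at h2
          rw [ep] at h1
          rw [eq] at h2
          simp only [Fin.val_castSucc, Fin.val_succ] at h1 h2
          omega
      have h := ASpace.mk_stu 𝕜 (D.place e) p q hpq hcons (Classical.decEq _)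
      have h2 := hN e p q hpq
      rw [h] at h2
      convert h2 using 2
      refine BDiag.mk_place_of_lt_iff D _ _ (Equiv.swap p q) (Equiv.refl _) ?_ ?_ ?_
      · have hs : ∀ a : Flag D.G.V D.L,
            Sum.map (Prod.map (Equiv.refl D.G.V) id) (Equiv.swap p q) a =
            @Equiv.swap _ (Classical.decEq _) (Sum.inr p) (Sum.inr q) a := by
          rintro (⟨v, k⟩ | l)
          · exact (Graph.swap_apply_of_ne _ (by simp) (by simp)).symm
          · exact (Graph.swap_map _ _ Sum.inr_injective p q l).symm
        intro a
        change @Equiv.swap _ (Classical.decEq _) (Sum.inr p) (Sum.inr q) (D.G.edge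
          ((@Equiv.swap _ (Classical.decEq _) (Sum.inr p) (Sum.inr q)).symm
            (Sum.map (Prod.map (Equiv.refl D.G.V) id) (Equiv.swap p q) a))) =
          Sum.map (Prod.map (Equiv.refl D.G.V) id) (Equiv.swap p q) (D.G.edge a)
        rw [hs, hs, Equiv.symm_apply_apply]
      · intro l
        change D.color (Equiv.swap p q l) = D.color l
        rw [Equiv.swap_apply_def]
        split_ifs with h1 h2
        exacts [h1 ▸ hcol.symm, h2 ▸ hcol, rfl]
      · have hs : ∀ l, e (Equiv.swap p q l) = Equiv.swap i.castSucc i.succ (e l) := by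
          intro l
          rw [← ep, ← eq]
          exact (Graph.swap_map _ _ e.injective p q l).symm
        intro l l' _
        change (e (Equiv.swap p q l) : ℕ) < (e (Equiv.swap p q l') : ℕ) ↔ _
        rw [hs, hs]
        rfl
    -- On different strands the relative order of the two legs is not part of the diagram, so both
    -- placements represent the same class.
    · have h : ASpace.mk 𝕜 (D.place (e.trans (Equiv.swap i.castSucc i.succ))) =
          ASpace.mk 𝕜 (D.place e) := by
        refine BDiag.mk_place_of_lt_iff D _ (D.place e) (Equiv.refl _) (Equiv.refl _) ?_
          (fun _ => rfl) ?_
        · intro a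
          exact (congrArg D.G.edge (flag_map_id a)).trans (flag_map_id _).symm
        · intro l l' hll
          change (e l : ℕ) < (e l' : ℕ) ↔
            Equiv.swap i.castSucc i.succ (e l) < Equiv.swap i.castSucc i.succ (e l')
          have hne : ¬ (e l = i.castSucc ∧ e l' = i.succ) := by
            rintro ⟨h1, h2⟩
            rw [← ep] at h1
            rw [← eq] at h2
            rw [e.injective h1, e.injective h2] at hll
            exact hcol hll
          have hne' : ¬ (e l = i.succ ∧ e l' = i.castSucc) := by
            rintro ⟨h1, h2⟩
            rw [← eq] at h1
            rw [← ep] at h2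
            rw [e.injective h1, e.injective h2] at hll
            exact hcol hll.symm
          generalize e l = a at *
          generalize e l' = b at *
          rw [Equiv.swap_apply_def, Equiv.swap_apply_def]
          simp only [Fin.ext_iff, Fin.val_castSucc, Fin.val_succ] at hne hne' ⊢
          rw [Fin.lt_def]
          split_ifs <;> simp only [Fin.val_castSucc, Fin.val_succ] <;> omega
      rw [h, sub_self]
      exact N.zero_mem

/-- The symmetrization map is surjective in every degree. -/
theorem chi_surjective [CharZero 𝕜] (d : ℕ) : ADeg 𝕜 X d ≤ (BDeg 𝕜 X d).map (chi 𝕜 X) := by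
  classical
  refine Submodule.span_le.2 ?_
  rintro _ ⟨T, hT, rfl⟩
  generalize hk : Fintype.card T.L = k
  -- Induction on the number of legs: a join removes one leg and adds one trivalent vertex, so it
  -- keeps the degree and falls under the induction hypothesis.
  induction k using Nat.strong_induction_on generalizing T with
  | _ k ih =>
  let D : BDiag X := ⟨T.L, T.color, T.G⟩
  have hN : ∀ (e : D.L ≃ Fin (Fintype.card D.L)) (p q : D.L) (hpq : p ≠ q),
      ASpace.mk 𝕜 ((D.place e).stu p q hpq) ∈ (BDeg 𝕜 X d).map (chi 𝕜 X) := by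
    intro e p q hpq
    have hL : Fintype.card ((D.place e).stu p q hpq).L + 1 = Fintype.card T.L := by
      change @Fintype.card {l : T.L // l ≠ q} _ + 1 = _
      have h1 := Fintype.card_subtype_compl (fun l : T.L => l = q)
      have h2 : Fintype.card {l : T.L // l = q} = 1 := Fintype.card_subtype_eq q
      have h3 : 0 < Fintype.card T.L := Fintype.card_pos_iff.2 ⟨q⟩
      rw [h2] at h1
      have h4 : @Fintype.card {l : T.L // l ≠ q} ((D.place e).stu p q hpq).fintypeL =
          Fintype.card {l : T.L // ¬ l = q} := Fintype.card_congr (Equiv.refl _)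
      exact (congrArg (· + 1) (h4.trans h1)).trans (by omega)
    have hV : Fintype.card ((D.place e).stu p q hpq).G.V = Fintype.card T.G.V + 1 :=
      Fintype.card_option
    exact ih _ (by omega) ((D.place e).stu p q hpq) (by omega) rfl
  let e₀ := enumerate T.L T.pos T.pos_inj
  have h0 : ASpace.mk 𝕜 (D.place e₀.symm) = ASpace.mk 𝕜 T := by
    refine BDiag.mk_place_of_lt_iff D _ T (Equiv.refl _) (Equiv.refl _) ?_ (fun _ => rfl) ?_
    · intro a
      exact (congrArg T.G.edge (flag_map_id a)).trans (flag_map_id _).symm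
    · intro l l' _
      have := enumerate_lt T.L T.pos T.pos_inj (e₀.symm l) (e₀.symm l')
      change T.pos (e₀ (e₀.symm l)) < T.pos (e₀ (e₀.symm l')) ↔ _ at this
      rw [Equiv.apply_symm_apply, Equiv.apply_symm_apply] at this
      exact this
  have hn : ((Fintype.card D.L).factorial : 𝕜) ≠ 0 := Nat.cast_ne_zero.2 (Nat.factorial_ne_zero _)
  have h1 : chi 𝕜 X (BSpace.mk 𝕜 D) ∈ (BDeg 𝕜 X d).map (chi 𝕜 X) :=
    Submodule.mem_map_of_mem (Submodule.subset_span ⟨D, hT, rfl⟩)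
  -- The difference of a diagram and its symmetrization is an average of differences of two
  -- placements, and each of these is in the image.
  have h2 : ASpace.mk 𝕜 T - chi 𝕜 X (BSpace.mk 𝕜 D) =
      ((Fintype.card D.L).factorial : 𝕜)⁻¹ • ∑ e : D.L ≃ Fin (Fintype.card D.L),
        (ASpace.mk 𝕜 (D.place e₀.symm) - ASpace.mk 𝕜 (D.place e)) := by
    rw [Finset.sum_sub_distrib, smul_sub, chi_mk, chiDiag, Finset.sum_const, Finset.card_univ,
      Fintype.card_equiv e₀.symm, ← Nat.cast_smul_eq_nsmul 𝕜, inv_smul_smul₀ hn, h0]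
  have h3 := Submodule.add_mem _ (Submodule.smul_mem _ ((Fintype.card D.L).factorial : 𝕜)⁻¹
    (Submodule.sum_mem _ fun e (_ : e ∈ Finset.univ) =>
      mk_place_sub_mem ((BDeg 𝕜 X d).map (chi 𝕜 X)) D hN e₀.symm e)) h1
  rw [← h2, sub_add_cancel] at h3
  exact h3

lemma chiHat_surjective [CharZero 𝕜] : Function.Surjective (chiHat 𝕜 X) := by
  intro a
  have h : ∀ d, ∃ b : BDeg 𝕜 X d, chi 𝕜 X b = a d := fun d => by
    obtain ⟨b, hb, hba⟩ := chi_surjective d (a d).2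
    exact ⟨⟨b, hb⟩, hba⟩
  choose b hb using h
  refine ⟨b, ?_⟩
  funext d
  exact Subtype.ext (hb d)

/-- For a surjection `Function.invFun` is a right inverse. No other property of $\sigma$ enters the
comparison of the two maps. -/
lemma chiHat_sigma [CharZero 𝕜] (a : AHat 𝕜 X) : chiHat 𝕜 X (sigma 𝕜 X a) = a :=
  Function.rightInverse_invFun chiHat_surjective a

/-- Formal integration is the composition of `j_m` with the symmetrization map. -/
lemma proj_jMap_chi [CharZero 𝕜] [Fintype X] (m : ℕ) (b : BSpace 𝕜 X) :
    proj 𝕜 m (jMap 𝕜 X m (chi 𝕜 X b)) = integral 𝕜 X m b := by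
  suffices h : (proj 𝕜 m).comp ((jMap 𝕜 X m).comp (chi 𝕜 X)) = integral 𝕜 X m from
    congrArg (fun f => f b) h
  apply BSpace.hom_ext
  intro D
  rw [LinearMap.comp_apply, LinearMap.comp_apply, chi_mk, jMap_chiDiag, integral_mk]

end

end Jacobi

/-! ### The theorem -/

theorem lemma1 (𝕜 : Type*) [Field 𝕜] [CharZero 𝕜] (X : Type) [Fintype X] (m : ℕ) :
    -- the map `j_m` is well defined on diagrams modulo the relations,
    ∃ j : Jacobi.ASpace 𝕜 X →ₗ[𝕜] Jacobi.CSpace 𝕜,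
      (∀ D : Jacobi.ADiag X, j (Jacobi.ASpace.mk 𝕜 D) = Jacobi.jDiag 𝕜 m D) ∧
      -- it lowers degrees by `m |X|`, so it extends to the completed spaces,
      (∀ d < m * Fintype.card X, ∀ a ∈ Jacobi.ADeg 𝕜 X d, j a = 0) ∧
      ∃ jHat : Jacobi.AHat 𝕜 X →ₗ[𝕜] Jacobi.CHat 𝕜,
        (∀ (a : Jacobi.AHat 𝕜 X) (d : ℕ),
          (jHat a d : Jacobi.CSpace 𝕜) = j (a (d + m * Fintype.card X))) ∧
        -- and it agrees with `∫^{(m)} ∘ σ` modulo `(O_m, P_{m+1})`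
        ∀ a : Jacobi.AHat 𝕜 X,
          Jacobi.integralHat 𝕜 X m (Jacobi.sigma 𝕜 X a) = Jacobi.projHat 𝕜 m (jHat a) := by
  refine ⟨Jacobi.jMap 𝕜 X m, Jacobi.jMap_mk m, fun d hd => Jacobi.jMap_eq_zero hd,
    LinearMap.pi fun d => ((Jacobi.jMap 𝕜 X m).restrict (Jacobi.jMap_mem_deg m d)).comp
      (LinearMap.proj (d + m * Fintype.card X)), fun _ _ => rfl, fun a => ?_⟩
  funext d
  apply Subtype.ext
  -- Degree $d$ of the result depends only on degree $d+m|X|$ of the argument, where $a$ is replaced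
  -- by $\chi(\sigma a)$.
  have h := congrFun (Jacobi.chiHat_sigma a) (d + m * Fintype.card X)
  have h' : Jacobi.chi 𝕜 X (Jacobi.sigma 𝕜 X a (d + m * Fintype.card X)) =
      a (d + m * Fintype.card X) := congrArg Subtype.val h
  change Jacobi.integral 𝕜 X m (Jacobi.sigma 𝕜 X a (d + m * Fintype.card X)) =
    Jacobi.proj 𝕜 m (Jacobi.jMap 𝕜 X m (a (d + m * Fintype.card X)))
  rw [← h', Jacobi.proj_jMap_chi]
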